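/- Let $\mathbb T^2=\mathbb R^2/\mathbb Z^2$, let $\mathcal M$ be the space of finite signed measures on $\mathbb T^2$ (with the weak topology given by continuous test functions and the $\sigma$-algebra generated by the evaluations $\mu\mapsto\mu(A)$), and write $\langle f,\mu\rangle=\int f\,d\mu$. Let $G$ be the zero-average Green function of $\Delta$ on $\mathbb T^2$, $K=\nabla^\perp G$ with $\nabla^\perp=(\partial_2,-\partial_1)$ acting on the first variable, and for $f\in C^\infty(\mathbb T^2)$ let $H_f(x,y)=\frac12K(x,y)\cdot(\nabla f(x)-\nabla f(y))$. For $\mu\in\mathcal M$ put $:\!\langle h,\mu\otimes\mu\rangle\!:\;=\int_{x\ne y}h(x,y)\,\mu(dx)\mu(dy)$. Let $H^s=H^s(\mathbb T^2)$ be the real $L^2$-based Sobolev spaces; $\mathcal M\subset H^{-1-\delta}$ for all $\delta>0$. Fix $\theta,\lambda>0$ and $0\le M<\infty$. A sequence $(t_m,\sigma_m,x_m)_{m\ge1}$ is sampled under the Poisson point process $\pi^\lambda$ if $t_1<t_2<\dots$ are the jump times of a Poisson process of rate $\lambda$, the $\sigma_m$ are i.i.d. uniform on $\{\pm1\}$,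 the $x_m$ are i.i.d. uniform on $\mathbb T^2$, and these three families are independent. Put $\Sigma^\lambda_t=\sum_{t_m\le t}\sigma_m\delta_{x_m}$, and let $\Xi^{\theta,\lambda}_M$ be the law on $\mathcal M$ of $\sum_{t_m\le M}\sigma_m e^{-\theta t_m}\delta_{x_m}$. Let $(\Omega,\mathcal F,\mathbb P)$ be a complete probability space carrying: a random finite family $(\xi_{i,0},x_{i,0})_{1\le i\le n}$ of vortices, with a.s. non-zero intensities and distinct positions, such that $\omega_0=\sum_{i\le n}\xi_{i,0}\delta_{x_{i,0}}$ has law $\Xi^{\theta,\lambda}_M$; and, independent of $\omega_0$, a sequence $(t_{n+m},\xi_{n+m,0},x_{n+m,0})_{m\ge1}$ sampled under $\pi^\lambda$, with associated noise $\Sigma^\lambda$. Put $t_1=\dots=t_n=0$, and consider $$x_{i,t}=x_{i,0}+\mathbf 1_{t_i\le t}\int_{t_i}^t\sum_{j\ne i:\,t_j\le s}\xi_{j,s}K(x_{i,s},x_{j,s})\,ds,\qquad \xi_{i,t}=\begin{cases}\xi_{i,0}&t<t_i,\\ e^{-\theta(t-t_i)}\xi_{i,0}&t\ge t_i,\end{cases}\tag{1}$$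 where a solution is required to have no collisions: $x_{i,t}\neq x_{j,t}$ whenever $i\ne j$ and $t_i,t_j\le t$. Then, almost surely, (1) has a solution defined for all $t\ge0$. For any such (almost sure) solution, the process $\omega_{M,t}=\sum_{i:\,t_i\le t}\xi_{i,t}\delta_{x_{i,t}}$, $t\ge 0$, starts a.s. from $\omega_0$, has a.s. càdlàg trajectories in $\mathcal M$, is a Markov process with respect to the filtration $\mathcal G_t$ generated by $\omega_0$ and $\Sigma^\lambda$ (completed and made right-continuous), and has marginals $\omega_{M,t}\sim\Xi^{\theta,\lambda}_{M+t}$ for all $t\ge0$. Moreover it is a strong solution of the damped Euler equation driven by $\Sigma^\lambda$, in the following sense. Let $T,\delta>0$. The filtration $\mathcal G_t$ satisfies the usual hypotheses and $\Sigma^\lambda$ is an $H^{-1-\delta}$-valued $\mathcal G_t$-martingale. For $\mathcal F_t=\mathcal G_t$, and for every filtration $\mathcal F_t$ satisfying the usual hypotheses for which $\omega_0$ is $\mathcal F_0$-measurable and $\Sigma^\lambda$ is an $H^{-1-\delta}$-valued martingale, the process $(\omega_{M,t})_{t\in[0,T]}$ is an $H^{-1-\delta}$-valued $\mathcal F_t$-adapted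 process with an $\mathcal F_t$-predictable modification, its trajectories are a.s. in $L^2([0,T],H^{-1-\delta})\cap\mathbb D([0,T],H^{-3-\delta})$, and for every $f\in C^\infty(\mathbb T^2)$, $\mathbb P$-almost surely, for all $t\in[0,T]$, $$\langle f,\omega_{M,t}\rangle=e^{-\theta t}\langle f,\omega_{M,0}\rangle+\int_0^te^{-\theta(t-s)}:\!\langle H_f,\omega_{M,s}\otimes\omega_{M,s}\rangle\!:\,ds+\int_0^te^{-\theta(t-s)}\langle f,d\Sigma^\lambda_s\rangle ,$$ where the first integrand is integrable and the last integral is a Lebesgue–Stieltjes integral against a path of bounded variation. -/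

import Mathlib

open MeasureTheory ProbabilityTheory Filter Topology
open scoped NNReal ENNReal

noncomputable section

namespace PointVortex

/-! ### The torus, smooth functions, the Biot-Savart kernel -/

/-- The two-dimensional torus `ℝ² / ℤ²`; `volume` is its Lebesgue (Haar) probability measure. -/
abbrev Torus : Type := UnitAddCircle × UnitAddCircle

/-- The projection `ℝ² → ℝ² / ℤ²`. -/
def toTorus (v : ℝ × ℝ) : Torus := ((v.1 : UnitAddCircle), (v.2 : UnitAddCircle))

/-- The partial derivative `∂₁ g` on the torus. -/
def partial₁ (g : Torus → ℝ) (x : Torus) : ℝ := deriv (fun h : ℝ => g (x + toTorus (h, 0))) 0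

/-- The partial derivative `∂₂ g` on the torus. -/
def partial₂ (g : Torus → ℝ) (x : Torus) : ℝ := deriv (fun h : ℝ => g (x + toTorus (0, h))) 0

/-- `f ∈ C^∞(𝕋²)`. -/
def SmoothOnTorus (f : Torus → ℝ) : Prop := ContDiff ℝ ((⊤ : ℕ∞) : WithTop ℕ∞) (fun v : ℝ × ℝ => f (toTorus v))

/-- The zero-average Green function of the Laplacian on the torus, as a function of `z = x - y`:
`Δ g = δ₀ - 1`, `g = - ∫₀^∞ (e^{tΔ} δ₀ - 1) dt`. Here
`cosKernel a s = ∑ₙ e^{2πi n a} e^{-π n² s}`, so that the heat kernel of the torus at time `t` is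
`cosKernel z₁ (4πt) * cosKernel z₂ (4πt)`, and the variable of integration is `s = 4πt`.
The integral converges absolutely for `z ≠ 0`, where `g` is smooth; the value at `z = 0` is
meaningless. -/
def green (z : Torus) : ℝ :=
  -(1 / (4 * Real.pi)) *
    ∫ s in Set.Ioi (0 : ℝ), (HurwitzZeta.cosKernel z.1 s * HurwitzZeta.cosKernel z.2 s - 1)

/-- The Biot-Savart kernel `K(x, y) = ∇^⊥ G(x, y)`, with `G(x, y) = g(x - y)` and
`∇^⊥ = (∂₂, -∂₁)` acting on `x`. Only its values for `x ≠ y` are meaningful. -/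
def biotSavart (x y : Torus) : ℝ × ℝ := (partial₂ green (x - y), -partial₁ green (x - y))

/-- `H_f(x, y) = ½ K(x, y) · (∇f(x) - ∇f(y))`. -/
def symKernel (f : Torus → ℝ) (x y : Torus) : ℝ :=
  (1 / 2) * ((biotSavart x y).1 * (partial₁ f x - partial₁ f y)
    + (biotSavart x y).2 * (partial₂ f x - partial₂ f y))

/-! ### Finite signed measures on the torus -/

/-- The space of finite signed measures on the torus. -/
abbrev SMeas : Type := SignedMeasure Torus

/-- The σ-algebra on signed measures generated by the evaluations `μ ↦ μ A`. -/
instance instMeasurableSpaceSMeas : MeasurableSpace SMeas :=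
  ⨆ A : Set Torus, MeasurableSpace.comap (fun μ : SMeas => μ A) inferInstance

/-- The coupling `⟨f, μ⟩ = ∫ f dμ`. -/
def pairing (f : Torus → ℝ) (μ : SMeas) : ℝ :=
  VectorMeasure.integral μ f (ContinuousLinearMap.lsmul ℝ ℝ)

/-- The weak topology on signed measures: the coarsest one for which `μ ↦ ⟨f, μ⟩` is continuous
for all continuous `f`. -/
instance instTopologicalSpaceSMeas : TopologicalSpace SMeas :=
  TopologicalSpace.induced (fun (μ : SMeas) (f : C(Torus, ℝ)) => pairing f μ) inferInstance

/-- The double integral without diagonal contribution,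
`:⟨h, μ ⊗ μ⟩: = ∫_{x ≠ y} h(x, y) (μ ⊗ μ)(dx, dy)`. If `μ = ∑ ξᵢ δ_{xᵢ}` is a finite sum with
distinct `xᵢ`, this is `∑_{i ≠ j} ξᵢ ξⱼ h(xᵢ, xⱼ)`. -/
def offDiagonal (h : Torus → Torus → ℝ) (μ : SMeas) : ℝ :=
  VectorMeasure.integral
    ((VectorMeasure.prod μ μ (ContinuousLinearMap.lsmul ℝ ℝ)).restrict (Set.diagonal Torus)ᶜ)
    (fun p => h p.1 p.2) (ContinuousLinearMap.lsmul ℝ ℝ)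

/-! ### Sobolev spaces -/

/-- The Fourier mode `e_k(x) = e^{2πi k·x}`. -/
def mode (k : ℤ × ℤ) (x : Torus) : ℂ := fourier k.1 x.1 * fourier k.2 x.2

/-- The real Sobolev space `H^s(𝕋²)`. A distribution `u` with Fourier coefficients `û_k` is
represented by the sequence `a_k = (1 + |k|²)^{s/2} û_k`, so that
`‖u‖² = ∑_k (1 + |k|²)^s |û_k|²` is the squared `ℓ²` norm of `a`; reality of `u` is
`a_{-k} = conj a_k`. -/
def Sobolev (_s : ℝ) : Submodule ℝ (lp (fun _ : ℤ × ℤ => ℂ) 2) where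
  carrier := {a | ∀ k, a (-k) = (starRingEnd ℂ) (a k)}
  add_mem' := by
    intro a b ha hb k
    simp only [lp.coeFn_add, Pi.add_apply, ha k, hb k, map_add]
  zero_mem' := by
    intro k
    simp
  smul_mem' := by
    intro c a ha k
    simp only [lp.coeFn_smul, Pi.smul_apply, ha k, Complex.real_smul, map_mul, Complex.conj_ofReal]

theorem isClosed_sobolev (s : ℝ) : IsClosed (Sobolev s : Set (lp (fun _ : ℤ × ℤ => ℂ) 2)) := by
  have hc : ∀ k : ℤ × ℤ, Continuous (fun a : lp (fun _ : ℤ × ℤ => ℂ) 2 => a k) := fun k =>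
    (continuous_apply k).comp (lp.uniformContinuous_coe (p := 2)).continuous
  have h : (Sobolev s : Set (lp (fun _ : ℤ × ℤ => ℂ) 2)) =
      ⋂ k, {a | a (-k) = (starRingEnd ℂ) (a k)} := by
    ext a
    simp [Sobolev]
  rw [h]
  exact isClosed_iInter fun k => isClosed_eq (hc _) (Complex.continuous_conj.comp (hc _))

instance instCompleteSpaceSobolev (s : ℝ) : CompleteSpace (Sobolev s) :=
  (isClosed_sobolev s).completeSpace_coe

/-- The Fourier coefficient `μ̂_k = ∫ e_{-k} dμ` of a signed measure. -/
def fourierCoeffSM (μ : SMeas) (k : ℤ × ℤ) : ℂ :=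
  VectorMeasure.integral μ (mode (-k)) (ContinuousLinearMap.lsmul ℝ ℝ).flip

/-- The normalized Fourier coefficients `(1 + |k|²)^{s/2} μ̂_k` of a signed measure. -/
def sobolevCoeff (s : ℝ) (μ : SMeas) (k : ℤ × ℤ) : ℂ :=
  (((1 + (k.1 : ℝ) ^ 2 + (k.2 : ℝ) ^ 2) ^ (s / 2) : ℝ) : ℂ) * fourierCoeffSM μ k

open Classical in
/-- A signed measure as an element of `H^s`. All of them belong to `H^s` when `s < -1`, the
only range in which this is used. -/
def toSobolev (s : ℝ) (μ : SMeas) : Sobolev s :=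
  if h : ∃ a : Sobolev s, ∀ k, (a : lp (fun _ : ℤ × ℤ => ℂ) 2) k = sobolevCoeff s μ k
  then h.choose else 0

/-! ### Poissonian random measures -/

/-- The uniform law on `{1, -1}`. -/
def signLaw : Measure ℝ :=
  (2⁻¹ : ℝ≥0∞) • (Measure.dirac (1 : ℝ) + Measure.dirac (-1 : ℝ))

/-- The law of (waiting time, sign, position): the three components are independent, exponential
of rate `lam`, uniform on `{1, -1}`, and uniform on the torus. -/
def markLaw (lam : ℝ) : Measure (ℝ≥0 × ℝ × Torus) :=
  ((expMeasure lam).map Real.toNNReal).prod (signLaw.prod volume)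

/-- The law of the sequence `(t_m, σ_m, x_m)` of points of the Poisson point process `π^λ`, listed
by increasing times: `t_m` are the jump times of a Poisson process of rate `lam`, `σ_m` i.i.d.
uniform signs, `x_m` i.i.d. uniform on the torus. -/
def poissonLaw (lam : ℝ) : Measure (ℕ → ℝ≥0 × ℝ × Torus) :=
  (Measure.infinitePi fun _ : ℕ => markLaw lam).map
    (fun g m => (∑ i ∈ Finset.range (m + 1), (g i).1, (g m).2))

/-- The compound Poisson process `Σ_t = ∑_{t_m ≤ t} σ_m δ_{x_m}`. -/
def compoundPoisson (p : ℕ → ℝ≥0 × ℝ × Torus) (t : ℝ≥0) : SMeas :=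
  ∑ᶠ (m : ℕ) (_ : (p m).1 ≤ t), VectorMeasure.dirac (p m).2.2 (p m).2.1

/-- The random measure `∑_{t_m ≤ M} σ_m e^{-θ t_m} δ_{x_m}`. -/
def xiSum (θ : ℝ) (M : ℝ≥0) (p : ℕ → ℝ≥0 × ℝ × Torus) : SMeas :=
  ∑ᶠ (m : ℕ) (_ : (p m).1 ≤ M),
    VectorMeasure.dirac (p m).2.2 ((p m).2.1 * Real.exp (-θ * (p m).1))

/-- The law of `Ξ_M^{θ,λ}` on the space of signed measures. -/
def xiLaw (θ lam : ℝ) (M : ℝ≥0) : Measure SMeas := (poissonLaw lam).map (xiSum θ M)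

/-! ### The system of vortices -/

/-- Birth times, positions at birth and intensities at birth of a sequence of vortices. -/
structure VortexData where
  birth : ℕ → ℝ≥0
  pos : ℕ → Torus
  int : ℕ → ℝ

/-- The `n` initial vortices `z 0, …, z (n - 1)` (intensity, position), born at time `0`, followed
by the vortices `p 0, p 1, …` (birth time, intensity, position). -/
def vortexData (n : ℕ) (z : ℕ → ℝ × Torus) (p : ℕ → ℝ≥0 × ℝ × Torus) : VortexData where
  birth i := if i < n then 0 else (p (i - n)).1
  pos i := if i < n then (z i).2 else (p (i - n)).2.2
  int i := if i < n then (z i).1 else (p (i - n)).2.1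

/-- The initial vorticity `∑_{i < n} ξ_i δ_{x_i}`. -/
def initialVorticity (n : ℕ) (z : ℕ → ℝ × Torus) : SMeas :=
  ∑ i ∈ Finset.range n, VectorMeasure.dirac (z i).2 (z i).1

/-- The intensity `ξ_{i,t}`: constant before birth, damped at rate `θ` afterwards. -/
def intensity (θ : ℝ) (V : VortexData) (i : ℕ) (t : ℝ≥0) : ℝ :=
  if t < V.birth i then V.int i else Real.exp (-θ * ((t : ℝ) - V.birth i)) * V.int i

/-- The velocity `∑_{j ≠ i, t_j ≤ s} ξ_{j,s} K(x_{i,s}, x_{j,s})` of the `i`-th vortex. -/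
def velocity (θ : ℝ) (V : VortexData) (X : ℕ → ℝ≥0 → Torus) (i : ℕ) (s : ℝ≥0) : ℝ × ℝ :=
  ∑ᶠ (j : ℕ) (_ : j ≠ i ∧ V.birth j ≤ s), intensity θ V j s • biotSavart (X i s) (X j s)

/-- The trajectories `X i t = x_{i,t}` solve, for all times `t ≥ 0`,
`x_{i,t} = x_{i,t_i} + 1_{t_i ≤ t} ∫_{t_i}^t ∑_{j ≠ i, t_j ≤ s} ξ_{j,s} K(x_{i,s}, x_{j,s}) ds`,
and present vortices never collide (the kernel is not defined on the diagonal). -/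
structure IsVortexFlow (θ : ℝ) (V : VortexData) (X : ℕ → ℝ≥0 → Torus) : Prop where
  before_birth : ∀ i t, t ≤ V.birth i → X i t = V.pos i
  integrable : ∀ i t, V.birth i ≤ t →
    IntervalIntegrable (fun s : ℝ => velocity θ V X i s.toNNReal) volume (V.birth i) t
  after_birth : ∀ i t, V.birth i ≤ t →
    X i t = V.pos i + toTorus (∫ s in (V.birth i : ℝ)..t, velocity θ V X i s.toNNReal)
  no_collision : ∀ i j t, i ≠ j → V.birth i ≤ t → V.birth j ≤ t → X i t ≠ X j t

/-- The vorticity `ω_t = ∑_{t_i ≤ t} ξ_{i,t} δ_{x_{i,t}}`. -/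
def vorticity (θ : ℝ) (V : VortexData) (X : ℕ → ℝ≥0 → Torus) (t : ℝ≥0) : SMeas :=
  ∑ᶠ (i : ℕ) (_ : V.birth i ≤ t), VectorMeasure.dirac (X i t) (intensity θ V i t)

/-! ### Stochastic processes -/

/-- `u` is càdlàg on the time set `I`. -/
def IsCadlagOn {E : Type*} [TopologicalSpace E] (u : ℝ≥0 → E) (I : Set ℝ≥0) : Prop :=
  ∀ t ∈ I, ContinuousWithinAt u (I ∩ Set.Ici t) t ∧
    ∃ l : E, Tendsto u (𝓝[I ∩ Set.Iio t] t) (𝓝 l)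

/-- The usual hypotheses: all `P`-null sets belong to `𝓕 0` (in particular `P` is complete), and
the filtration is right-continuous. -/
def UsualHypotheses {Ω : Type*} {m : MeasurableSpace Ω} (𝓕 : Filtration ℝ≥0 m) (P : Measure Ω) :
    Prop :=
  (∀ A : Set Ω, P A = 0 → MeasurableSet[𝓕 0] A) ∧ ∀ t : ℝ≥0, (⨅ s > t, 𝓕 s) ≤ 𝓕 t

/-- The filtration generated by a random variable `X₀` at time `0` and a process `N`, completed by
the `P`-null sets and made right-continuous. (The intersection with the ambient σ-algebra `m`
changes nothing when `X₀` and `N` are measurable and `P` is complete.) -/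
def generatedFiltration {Ω S : Type*} {m : MeasurableSpace Ω} [MeasurableSpace S] (P : Measure Ω)
    (X₀ : Ω → S) (N : ℝ≥0 → Ω → S) : Filtration ℝ≥0 m :=
  Filtration.rightCont
    { seq := fun t =>
        (MeasurableSpace.comap X₀ inferInstance ⊔
          (⨆ r : ℝ≥0, ⨆ _ : r ≤ t, MeasurableSpace.comap (N r) inferInstance) ⊔
          MeasurableSpace.generateFrom {A | P A = 0}) ⊓ m
      mono' := by
        intro s t hst
        refine inf_le_inf_right m (sup_le_sup_right (sup_le_sup_left ?_ _) _)
        exact iSup_mono fun r => iSup_mono' fun hr => ⟨hr.trans hst, le_rfl⟩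
      le' := fun _ => inf_le_right }

/-- `X` is an `𝓕`-Markov process: it is adapted and, for `s ≤ t`, the conditional law of `X t`
given `𝓕 s` depends on `X s` only. (The Markov property with respect to the natural filtration
of `X` follows by conditioning.) -/
def IsMarkov {Ω S : Type*} {m : MeasurableSpace Ω} [MeasurableSpace S] (X : ℝ≥0 → Ω → S)
    (𝓕 : Filtration ℝ≥0 m) (P : Measure Ω) : Prop :=
  (∀ t, Measurable[𝓕 t] (X t)) ∧
  ∀ s t : ℝ≥0, s ≤ t → ∀ B : Set S, MeasurableSet B →
    P[(X t ⁻¹' B).indicator (fun _ => (1 : ℝ)) | 𝓕 s]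
      =ᵐ[P] P[(X t ⁻¹' B).indicator (fun _ => (1 : ℝ)) | MeasurableSpace.comap (X s) inferInstance]

open Classical in
/-- The Lebesgue-Stieltjes integral `∫_0^t φ(s) dg(s)` against a function `g` of bounded variation
on `[0, t]` (with the jumps of `g` in `(0, t]` included). -/
def stieltjesIntegral (φ g : ℝ≥0 → ℝ) (t : ℝ≥0) : ℝ :=
  if h : BoundedVariationOn (fun s => g (min s t)) Set.univ then
    VectorMeasure.integral h.vectorMeasure φ (ContinuousLinearMap.lsmul ℝ ℝ)
  else 0

/-! ### Solutions of the damped and driven Euler equation -/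

/-- The measure-valued process `ω` is a solution on `[0, T]`, in the filtered probability space
`(Ω, P, 𝓕)`, of `dω = -θ ω dt + (K * ω) · ∇ω dt + dN`, the noise `N` being a compound Poisson
process `Σ^λ`, with marginals `Ξ_{M+t}^{θ,λ}`. A càdlàg process which jumps at the times of a Poisson
process cannot itself be predictable: predictability holds up to modification. -/
structure IsSolution {Ω : Type*} {m : MeasurableSpace Ω} (P : Measure Ω) (𝓕 : Filtration ℝ≥0 m)
    (θ lam : ℝ) (M T : ℝ≥0) (δ : ℝ) (N ω : ℝ≥0 → Ω → SMeas) : Prop where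
  usual : UsualHypotheses 𝓕 P
  noise_martingale : Martingale (fun t w => toSobolev (-1 - δ) (N t w)) 𝓕 P
  noise_law : P.map (fun w t => N t w) = (poissonLaw lam).map compoundPoisson
  adapted : ∀ t ≤ T, StronglyMeasurable[𝓕 t] (fun w => toSobolev (-1 - δ) (ω t w))
  predictable_modification : ∃ Y : ℝ≥0 → Ω → Sobolev (-1 - δ), IsStronglyPredictable 𝓕 Y ∧
    ∀ t ≤ T, ∀ᵐ w ∂P, Y t w = toSobolev (-1 - δ) (ω t w)
  square_integrable : ∀ᵐ w ∂P, MemLp (fun s : ℝ => toSobolev (-1 - δ) (ω s.toNNReal w)) 2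
    (volume.restrict (Set.Icc (0 : ℝ) T))
  cadlag : ∀ᵐ w ∂P, IsCadlagOn (fun t => toSobolev (-3 - δ) (ω t w)) (Set.Icc 0 T)
  marginal : ∀ t ≤ T, P.map (ω t) = xiLaw θ lam (M + t)
  equation : ∀ f : Torus → ℝ, SmoothOnTorus f → ∀ᵐ w ∂P, ∀ t ≤ T,
    IntervalIntegrable (fun s : ℝ => Real.exp (-θ * ((t : ℝ) - s)) *
      offDiagonal (symKernel f) (ω s.toNNReal w)) volume 0 t ∧
    BoundedVariationOn (fun s => pairing f (N (min s t) w)) Set.univ ∧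
    pairing f (ω t w) = Real.exp (-θ * t) * pairing f (ω 0 w)
      + (∫ s in (0 : ℝ)..t, Real.exp (-θ * ((t : ℝ) - s)) *
          offDiagonal (symKernel f) (ω s.toNNReal w))
      + stieltjesIntegral (fun s => Real.exp (-θ * ((t : ℝ) - s))) (fun s => pairing f (N s w)) t

end PointVortex

end

noncomputable section

open Real (exp exp_add pi_pos sqrt rpow_natCast rpow_mul exp_le_one_iff exp_pos rpow_add log
  norm_eq_abs smoothTransition coe_toNNReal)
open Finset (mem_univ sum_le_sum sum_sub_distrib sum_congr sum_nonneg measurable_sum mul_sum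
  abs_sum_le_sum_abs range sum_range sum_eq_zero mem_range sum_range_add)
open Set (Ioi Ioc uIcc_of_le indicator_of_mem indicator_of_notMem uIoc_of_le univ uIoc Icc Ici
  mem_preimage indicator mem_inter_iff mem_iUnion mem_ofPred_eq)
open ENNReal (ofReal ofReal_mul ofReal_ne_top ofReal_lt_top mul_lt_top)
open NNReal (coe_le_coe coe_add coe_sub coe_zero)
open VectorMeasure (dirac integral_finsetSum_vectorMeasure prod dirac_zero)
open Complex (I abs_re_le_norm)
open Function (comp_def comp_apply update update_of_ne update_self Injective)
open MeasureTheory.Measure (quasiMeasurePreserving_fst quasiMeasurePreserving_snd volume_eq_prod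
  map_apply prod_prod isProbabilityMeasure_map infinitePi map_prod_map restrict_apply)
open ContinuousLinearMap (fst snd proj proj_apply lsmul)
open intervalIntegral (integral_of_le intervalIntegrable_rpow' integral_congr
  integral_add_adjacent_intervals integral_comp_add_left)
open MeasurableSpace (CountablySeparated generateFrom)
open Nat (sInf_mem succ_ne_zero)
open scoped Real

local notation "Poi" => PointVortex.poissonLaw

namespace PointVortex

/-! Cutting the Green function `g` off near its logarithmic singularity (`greenReg`) leaves a smooth
kernel `∇^⊥ g_k` without divergence. With birth times and intensities frozen, the truncated system
of `N` vortices is a Lipschitz equation. Its flow `regFlow` exists for all times, depends measurably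
on all data, and preserves Lebesgue measure on `(𝕋²)^N` (`measurePreserving_flow`). The coefficients
jump at births, so Liouville's theorem is obtained by approximating the flow by compositions of
shears, each of which preserves volume up to an error quadratic in the step.

Collisions are excluded by the function `E = ∑ g(x_i - x_j)` with unit weights; the Hamiltonian,
weighted by intensities of both signs, would not separate the vortices. In `dE/dt` the products
`∇g(x_i - x_j) · ∇^⊥g(x_i - x_j)` vanish, and only products of gradients at two different pairs of
three distinct vortices remain. These are integrable because `∇g` is, and by invariance of the
volume the mean of `∫ |dE/dt|` is bounded uniformly in `k`. By Fatou, for almost every initial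
configuration `E` stays above `-k` by the needed margin for some `k`, so the truncation is never
felt and the truncated flow solves (1) (`ae_exists_lt_greenReg`, `IsGood.isFlowUpTo`). Conversely a
solution without collisions keeps its vortices apart on compact time intervals, hence is a truncated
flow for all large `k` (`IsFlowUpTo.exists_isGood`); this gives uniqueness and reduces every
pathwise claim to the smooth flow.

Given the number, times and signs of the points, the positions are independent and uniform, so
statements for almost every position become almost sure statements for the canonical configuration
built from two Poisson processes (`lintegral_canonLaw_loc`). The hypotheses prescribe only the law
of the measure `ω₀`, not that of the labelled family. Transfer to the given space therefore goes
through the observation (initial measure and noise): it determines the vortices up to relabelling,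
the system is equivariant under relabelling, and a Borel event saturated for the observation is a
Borel event of it (`exists_measurableSet_reaches_iff`). The same fact yields adaptedness.

For the marginal at time `T`, invariance of the volume shows that the moved positions may be
replaced by those at birth (`canonLaw_reaches`). What remains is a sum of initial atoms damped by
`e^{-θ(T+t)}` and births damped by `e^{-θ(T-t)}`. Reversing time on `[0, T]`, which preserves the
characteristic functional of a weighted Poisson sum, and gluing the two independent processes gives
`Ξ_{M+T}` (`map_weighted_reverse`, `map_static_eq_xiLaw`).

The Markov property holds because the vorticity at `s + u` is a function of the one at `s` and of
the births shifted by `s` (`exists_observeFun_mem_iff`), and these births are independent of `𝓖_s`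
(`measure_inter_shift`). The noise is a martingale since its increments are independent of the past
and symmetric under a change of all signs. The equation is Duhamel's formula for each vortex,
combined with the symmetrization that turns `∇f · K` into `H_f` (`sum_curInt_mul_transport`). For a
general filtration only the Sobolev-valued noise is known to be adapted; finite sums of point masses
are recovered from their Fourier coefficients (`measurable_noise_of_toSobolev`). -/

/-- Birth times and intensities of `N` vortices. -/
abbrev Marks (N : ℕ) : Type := Fin N → ℝ≥0 × ℝ

/-- Positions of `N` vortices. -/
abbrev Pos (N : ℕ) : Type := Fin N → Torus

/-- Trajectories of a sequence of vortices. -/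
abbrev Paths : Type := ℕ → ℝ≥0 → Torus

/-- Velocities of `N` vortices. -/
abbrev Vel (N : ℕ) : Type := Fin N → ℝ × ℝ

/-- Time, intensity and position of a point. -/
abbrev Mark : Type := ℝ≥0 × ℝ × Torus

variable {θ s t : ℝ} {N k : ℕ} {V : VortexData} {X : Paths} {B : Set SMeas} {z : Torus}

/-! ### Estimates for the theta function -/

/-- The entire function `z ↦ ∑ₙ e^{2πi n z} e^{-π n² s}`. -/
def theta (s : ℝ) (z : ℂ) : ℂ := jacobiTheta₂ z (I * s)

lemma differentiable_theta (hs : 0 < s) : Differentiable ℂ (theta s) := fun z =>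
  differentiableAt_jacobiTheta₂_fst z (by simpa using hs)

lemma summable_exp_neg_mul_sq {c : ℝ} (hc : 0 < c) : Summable (fun n : ℤ => exp (-c * (n : ℝ) ^ 2)) := by
  have h := summable_pow_mul_jacobiTheta₂_term_bound 0 (T := c / π) (by positivity) 0
  refine h.congr fun n => ?_
  have : π ≠ 0 := Real.pi_ne_zero
  simp only [pow_zero, one_mul, mul_zero, zero_mul, sub_zero]
  congr 1
  field_simp

/-- On the strip `|Im z| ≤ 1/4` the factor `e^{-2πn Im z}` is absorbed by half of the Gaussian
decay, as `s ≥ 1`. A complex strip rather than the real line is needed in order to apply Cauchy's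
estimates to all derivatives. -/
lemma norm_theta_sub_one_le : ∃ C : ℝ, 0 ≤ C ∧ ∀ (s : ℝ) (z : ℂ), 1 ≤ s → |z.im| ≤ 1 / 4 →
    ‖theta s z - 1‖ ≤ C * exp (-(π / 4) * s) := by
  have hsum := summable_exp_neg_mul_sq (c := π / 4) (by positivity)
  refine ⟨∑' n : ℤ, exp (-(π / 4) * (n : ℝ) ^ 2), tsum_nonneg fun _ => by positivity, ?_⟩
  intro s z hs hz
  have h1 : HasSum (fun n : ℤ => if n = 0 then 0 else jacobiTheta₂_term n z (I * s)) (theta s z - 1) := by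
    have := hasSum_ite_sub_hasSum (hasSum_jacobiTheta₂_term z (τ := I * s)
      (by simpa using lt_of_lt_of_le one_pos hs)) 0
    simpa [jacobiTheta₂_term, theta] using this
  have hb : ∀ n : ℤ, ‖if n = 0 then 0 else jacobiTheta₂_term n z (I * s)‖
      ≤ exp (-(π / 4) * (n : ℝ) ^ 2) * exp (-(π / 4) * s) := by
    intro n
    split_ifs with hn
    · rw [norm_zero]; positivity
    rw [norm_jacobiTheta₂_term, ← exp_add, Real.exp_le_exp]
    have him : (I * (s : ℂ)).im = s := by simp
    rw [him]
    have hn1 : (1 : ℝ) ≤ |(n : ℝ)| := by rw [← Int.cast_abs]; exact_mod_cast Int.one_le_abs hn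
    have hn2 : |(n : ℝ)| ≤ (n : ℝ) ^ 2 := by rw [← sq_abs]; nlinarith
    have h3 : -(n : ℝ) * z.im ≤ (n : ℝ) ^ 2 / 4 := by
      calc -(n : ℝ) * z.im ≤ |-(n : ℝ) * z.im| := le_abs_self _
        _ = |(n : ℝ)| * |z.im| := by rw [abs_mul, abs_neg]
        _ ≤ (n : ℝ) ^ 2 * (1 / 4) := by gcongr
        _ = _ := by ring
    have hpi := pi_pos
    have h4 : (n : ℝ) ^ 2 ≤ n ^ 2 * s := le_mul_of_one_le_right (sq_nonneg _) hs
    have h5 : s ≤ n ^ 2 * s := le_mul_of_one_le_left (by linarith) (by linarith)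
    nlinarith
  have h2 := hsum.mul_right (exp (-(π / 4) * s))
  rw [← h1.tsum_eq, ← tsum_mul_right]
  exact tsum_of_norm_bounded h2.hasSum hb

/-- The functional equation of the theta function (Poisson summation) gives the series suited to
small `s`: Gaussians of variance of order `s` centred at the integers. -/
lemma theta_eq_gauss (hs : 0 < s) (z : ℂ) :
    HasSum (fun n : ℤ => ((s ^ (-(1 / 2) : ℝ) : ℝ) : ℂ) * Complex.exp (-π * (n - z) ^ 2 / s)) (theta s z) := by
  have hs' : (s : ℂ) ≠ 0 := mod_cast hs.ne'
  have hsI : I * (s : ℂ) ≠ 0 := mul_ne_zero Complex.I_ne_zero hs'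
  have h := hasSum_jacobiTheta₂_term (z / (I * s)) (τ := -1 / (I * s)) (by
    rw [← div_div, Complex.div_I]
    have : (-(-1 * I) / (s : ℂ)) = ((1 / s : ℝ) : ℂ) * I := by push_cast; ring
    rw [this, Complex.im_ofReal_mul]
    simpa using hs)
  rw [theta, jacobiTheta₂_functional_equation]
  refine (h.mul_left (1 / (-I * (I * s)) ^ (1 / 2 : ℂ) *
    Complex.exp (-π * I * z ^ 2 / (I * s)))).congr_fun fun n => ?_
  have h3 : 1 / (-I * (I * s)) ^ (1 / 2 : ℂ) = ((s ^ (-(1 / 2) : ℝ) : ℝ) : ℂ) := by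
    rw [neg_mul, ← mul_assoc, Complex.I_mul_I, neg_one_mul, neg_neg, Complex.ofReal_cpow hs.le,
      one_div, ← Complex.cpow_neg]
    push_cast; rfl
  rw [h3, mul_assoc, jacobiTheta₂_term, ← Complex.exp_add]
  congr 2
  have hI : I ≠ 0 := Complex.I_ne_zero
  field_simp
  ring_nf

lemma norm_theta_le : ∃ C : ℝ, 0 ≤ C ∧ ∀ (s : ℝ) (z : ℂ), 0 < s → s ≤ 1 → |z.re| ≤ 3 / 4 →
    ‖theta s z‖ ≤ C * s ^ (-(1 / 2) : ℝ) * exp (π * z.im ^ 2 / s - π / 18 * z.re ^ 2 / s) := by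
  have hsum := summable_exp_neg_mul_sq (c := π / 32) (by positivity)
  refine ⟨∑' n : ℤ, exp (-(π / 32) * (n : ℝ) ^ 2), tsum_nonneg fun _ => by positivity, ?_⟩
  intro s z hs hs1 hz
  have hpi := pi_pos
  have hb : ∀ n : ℤ, ‖((s ^ (-(1 / 2) : ℝ) : ℝ) : ℂ) *
      Complex.exp (-π * (n - z) ^ 2 / s)‖ ≤ exp (-(π / 32) * (n : ℝ) ^ 2) *
       (s ^ (-(1 / 2) : ℝ) * exp (π * z.im ^ 2 / s - π / 18 * z.re ^ 2 / s)) := by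
    intro n
    rw [norm_mul, Complex.norm_real, Real.norm_of_nonneg (by positivity), Complex.norm_exp,
      mul_left_comm, ← exp_add]
    gcongr
    have e1 : (-(π : ℂ) * ((n : ℂ) - z) ^ 2 / s).re = (-π * ((n - z.re) ^ 2 - z.im ^ 2)) / s := by
      have : (-(π : ℂ) * ((n : ℂ) - z) ^ 2 / s) = ((1 / s * -π : ℝ) : ℂ) * ((n : ℂ) - z) ^ 2 := by push_cast; ring
      rw [this, Complex.re_ofReal_mul]
      simp [pow_two]; ring
    rw [e1]
    -- Equality holds for `n = 1`, `Re z = 3/4`, where each of the two terms is half of `1/16`.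
    have key : z.re ^ 2 / 18 + (n : ℝ) ^ 2 / 32 ≤ (n - z.re) ^ 2 := by
      have hz2 := abs_le.mp hz
      rcases lt_trichotomy n 0 with hn | hn | hn
      · have : (n : ℝ) ≤ -1 := mod_cast Int.le_sub_one_of_lt hn
        nlinarith
      · subst hn; simp; nlinarith [sq_nonneg z.re]
      · have : (1 : ℝ) ≤ n := mod_cast hn
        nlinarith
    have h6 : -(π / 32) * (n : ℝ) ^ 2 ≥ -(π / 32) * (n : ℝ) ^ 2 / s := by
      rw [ge_iff_le, div_le_iff₀ hs]
      have : 0 ≤ (π / 32) * (n : ℝ) ^ 2 := by positivity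
      nlinarith
    calc -π * ((n - z.re) ^ 2 - z.im ^ 2) / s
        ≤ (-(π / 32) * (n : ℝ) ^ 2 + (π * z.im ^ 2 - π / 18 * z.re ^ 2)) / s := by
          gcongr; nlinarith
      _ = -(π / 32) * (n : ℝ) ^ 2 / s + (π * z.im ^ 2 / s - π / 18 * z.re ^ 2 / s) := by
          ring
      _ ≤ _ := by linarith
  rw [← (theta_eq_gauss hs z).tsum_eq, mul_assoc, ← tsum_mul_right]
  exact tsum_of_norm_bounded (hsum.mul_right _).hasSum hb

/-- The real derivatives in `a` of the heat kernel on the circle. -/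
def thetaD (j : ℕ) (a s : ℝ) : ℝ := (iteratedDeriv j (theta s) (a : ℂ)).re

lemma thetaD_zero (a s : ℝ) : thetaD 0 a s = HurwitzZeta.cosKernel (a : UnitAddCircle) s := by
  rw [thetaD, iteratedDeriv_zero, theta, ← HurwitzZeta.cosKernel_def, Complex.ofReal_re]

lemma hasDerivAt_thetaD (j : ℕ) (a : ℝ) (hs : 0 < s) :
    HasDerivAt (fun a => thetaD j a s) (thetaD (j + 1) a s) a := by
  have h : HasDerivAt (iteratedDeriv j (theta s)) (iteratedDeriv (j + 1) (theta s) (a : ℂ)) (a : ℂ) := by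
    rw [iteratedDeriv_succ]
    exact (((differentiable_theta hs).contDiff (n := (⊤ : ℕ∞))).differentiable_iteratedDeriv j
      (mod_cast ENat.natCast_lt_top j) _).hasDerivAt
  exact h.real_of_complex

lemma abs_thetaD_le_of_one_le (j : ℕ) : ∃ C : ℝ, 0 ≤ C ∧ ∀ a s : ℝ, 1 ≤ s →
    |thetaD j a s - if j = 0 then 1 else 0| ≤ C * exp (-(π / 4) * s) := by
  obtain ⟨C, hC, h⟩ := norm_theta_sub_one_le
  refine ⟨j.factorial * C / (1 / 4) ^ j, by positivity, fun a s hs => ?_⟩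
  have hd : Differentiable ℂ (fun z => theta s z - 1) := (differentiable_theta (by linarith)).sub_const 1
  have h1 := Complex.norm_iteratedDeriv_le_of_forall_mem_sphere_norm_le (c := (a : ℂ)) (R := 1 / 4)
    (C := C * exp (-(π / 4) * s)) j (by norm_num) hd.diffContOnCl (by
      intro z hz
      apply h s z hs
      have : |(z - a).im| ≤ ‖z - a‖ := Complex.abs_im_le_norm _
      rw [mem_sphere_iff_norm.mp hz] at this
      simpa using this)
  have h2 : thetaD j a s - (if j = 0 then 1 else 0) = (iteratedDeriv j (fun z => theta s z - 1) (a : ℂ)).re := by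
    cases j with
    | zero => simp [thetaD]
    | succ k =>
      rw [iteratedDeriv_succ', thetaD, iteratedDeriv_succ']
      simp [deriv_sub_const_fun]
  rw [h2]
  refine (abs_re_le_norm _).trans (h1.trans (le_of_eq ?_))
  ring

/-- Cauchy's estimate on the circle of radius `√s / 8`, the length scale of the heat kernel: there
the imaginary part costs only a bounded factor, and every derivative costs `s^{-1/2}`. The
restriction `|a| ≤ 5/8` keeps the circle inside `|Re z| ≤ 3/4`. -/
lemma abs_thetaD_le_of_le_one (j : ℕ) : ∃ C : ℝ, 0 ≤ C ∧ ∀ a s : ℝ, 0 < s → s ≤ 1 →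
    |a| ≤ 5 / 8 →
    |thetaD j a s| ≤ C * s ^ (-((j : ℝ) + 1) / 2) * exp (-(π / 36) * a ^ 2 / s) := by
  obtain ⟨C, hC, h⟩ := norm_theta_le
  have hpi := pi_pos
  refine ⟨j.factorial * (C * exp π) * 8 ^ j, by positivity, fun a s hs hs1 ha => ?_⟩
  set R := sqrt s / 8 with hR
  have hsq : sqrt s ^ 2 = s := Real.sq_sqrt hs.le
  have hsq1 : sqrt s ≤ 1 := Real.sqrt_le_one.mpr hs1
  have hsq0 : 0 < sqrt s := Real.sqrt_pos.mpr hs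
  have h1 := Complex.norm_iteratedDeriv_le_of_forall_mem_sphere_norm_le (c := (a : ℂ)) (R := R)
    (C := C * s ^ (-(1 / 2) : ℝ) * (exp π * exp (-(π / 36) * a ^ 2 / s))) j
    (by positivity) (differentiable_theta hs).diffContOnCl (by
      intro z hz
      have hz' := mem_sphere_iff_norm.mp hz
      have him : |z.im| ≤ R := by
        have : |(z - a).im| ≤ ‖z - a‖ := Complex.abs_im_le_norm _
        rw [hz'] at this; simpa using this
      have hre : |z.re - a| ≤ R := by
        have : |(z - a).re| ≤ ‖z - a‖ := abs_re_le_norm _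
        rw [hz'] at this; simpa using this
      have hR8 : R ≤ 1 / 8 := by rw [hR]; linarith
      refine (h s z hs hs1 ?_).trans ?_
      · have := abs_le.mp hre; have := abs_le.mp ha
        rw [abs_le]; constructor <;> linarith
      rw [← exp_add]
      gcongr
      have hR2 : R ^ 2 = s / 64 := by rw [hR, div_pow, hsq]; norm_num
      have him2 : z.im ^ 2 ≤ s / 64 := by rw [← hR2, ← sq_abs z.im]; gcongr
      have hre2 : (z.re - a) ^ 2 ≤ s / 64 := by rw [← hR2, ← sq_abs (z.re - a)]; gcongr
      have h5 : a ^ 2 / 2 - s / 64 ≤ z.re ^ 2 := by nlinarith [sq_nonneg (z.re + (z.re - a))]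
      have e : π + -(π / 36) * a ^ 2 / s = (π * s - π / 36 * a ^ 2) / s := by field_simp; ring
      rw [e, ← sub_div]
      refine div_le_div_of_nonneg_right ?_ hs.le
      nlinarith)
  refine (abs_re_le_norm _).trans (h1.trans (le_of_eq ?_))
  have e1 : s ^ (-((j : ℝ) + 1) / 2) = s ^ (-(1 / 2) : ℝ) / sqrt s ^ j := by
    rw [Real.sqrt_eq_rpow, ← rpow_natCast, ← rpow_mul hs.le, ← Real.rpow_sub hs]
    congr 1; ring
  rw [e1, hR, div_pow]
  field_simp

/-! ### Smoothness of the Green function -/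

lemma exists_rpow_neg_mul_exp_le (q : ℝ) {b : ℝ} (hb : 0 < b) :
    ∃ B : ℝ, 0 ≤ B ∧ ∀ s : ℝ, 0 < s → s ≤ 1 → s ^ (-q) * exp (-b / s) ≤ B := by
  obtain ⟨m, hm⟩ := exists_nat_ge q
  refine ⟨m.factorial / b ^ m, by positivity, fun s hs hs1 => ?_⟩
  have h1 : s ^ (-q) ≤ s ^ (-(m : ℝ)) := Real.rpow_le_rpow_of_exponent_ge hs hs1 (by linarith)
  have h2 : (b / s) ^ m / m.factorial ≤ exp (b / s) := Real.pow_div_factorial_le_exp _ (by positivity) m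
  rw [neg_div, Real.exp_neg]
  calc s ^ (-q) * (exp (b / s))⁻¹ ≤ s ^ (-(m : ℝ)) * ((b / s) ^ m / m.factorial)⁻¹ := by
        gcongr
    _ = m.factorial / b ^ m := by
        rw [Real.rpow_neg hs.le, rpow_natCast, div_pow]
        field_simp

/-- The limit as `s → ∞` of the derivatives of the heat kernel on the circle. -/
def thetaLimit (j : ℕ) : ℝ := if j = 0 then 1 else 0

/-- At distance at least `√ρ` from the origin the Gaussian factors beat every negative power of `s`
near `0`, and for `s ≥ 1` the convergence is exponential. The resulting majorant is integrable and
independent of `v`, as needed to differentiate the Green function under the integral. -/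
lemma abs_thetaD_mul_sub_le (i j : ℕ) {ρ : ℝ} (hρ : 0 < ρ) :
    ∃ C : ℝ, ∀ (v : ℝ × ℝ) (s : ℝ), |v.1| ≤ 5 / 8 → |v.2| ≤ 5 / 8 → ρ ≤ v.1 ^ 2 + v.2 ^ 2 → 0 < s →
      |thetaD i v.1 s * thetaD j v.2 s - thetaLimit i * thetaLimit j| ≤ C * exp (-(π / 4) * s) := by
  obtain ⟨Ci, hCi, hi⟩ := abs_thetaD_le_of_one_le i
  obtain ⟨Cj, hCj, hj⟩ := abs_thetaD_le_of_one_le j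
  obtain ⟨Di, hDi, hi'⟩ := abs_thetaD_le_of_le_one i
  obtain ⟨Dj, hDj, hj'⟩ := abs_thetaD_le_of_le_one j
  have hpi := pi_pos
  obtain ⟨B, hB, hBs⟩ := exists_rpow_neg_mul_exp_le (((i : ℝ) + 1) / 2 + ((j : ℝ) + 1) / 2)
    (b := π / 36 * ρ) (by positivity)
  have hl : ∀ k, |thetaLimit k| ≤ 1 := fun k => by unfold thetaLimit; split_ifs <;> simp
  refine ⟨(Ci + Cj + Ci * Cj) + (Di * Dj * B + 1) * exp (π / 4), fun v s h1 h2 h3 hs => ?_⟩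
  rcases le_total 1 s with hs1 | hs1
  · set E := exp (-(π / 4) * s)
    have hE : E ≤ 1 := exp_le_one_iff.mpr (by nlinarith)
    have hE0 : 0 < E := exp_pos _
    have hA := hi v.1 s hs1
    have hA' := hj v.2 s hs1
    rw [← thetaLimit] at hA hA'
    set A := thetaD i v.1 s - thetaLimit i
    set A' := thetaD j v.2 s - thetaLimit j
    have e : thetaD i v.1 s * thetaD j v.2 s - thetaLimit i * thetaLimit j
        = A * thetaLimit j + thetaLimit i * A' + A * A' := by
      simp only [A, A']; ring
    rw [e]
    calc _ ≤ |A * thetaLimit j| + |thetaLimit i * A'| + |A * A'| := by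
          exact (abs_add_le _ _).trans (by gcongr; exact abs_add_le _ _)
      _ ≤ Ci * E * 1 + 1 * (Cj * E) + (Ci * E) * (Cj * 1) := by
          simp only [abs_mul]
          have := hl i
          have := hl j
          have h8 : |A'| ≤ Cj * 1 := hA'.trans (by gcongr)
          gcongr
      _ = (Ci + Cj + Ci * Cj) * E := by ring
      _ ≤ _ := mul_le_mul_of_nonneg_right (le_add_of_nonneg_right (by positivity)) hE0.le
  · have hA := hi' v.1 s hs hs1 h1
    have hA' := hj' v.2 s hs hs1 h2
    have h5 : |thetaD i v.1 s * thetaD j v.2 s| ≤ Di * Dj * B := by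
      rw [abs_mul]
      calc _ ≤ _ := mul_le_mul hA hA' (abs_nonneg _) (by positivity)
        _ = Di * Dj * (s ^ (-(((i : ℝ) + 1) / 2 + ((j : ℝ) + 1) / 2)) *
              exp (-(π / 36) * (v.1 ^ 2 + v.2 ^ 2) / s)) := by
            rw [neg_add (((i : ℝ) + 1) / 2), rpow_add hs, mul_add, add_div (-(π / 36) * v.1 ^ 2), exp_add, neg_div,
              neg_div ((2 : ℝ)) ((j : ℝ) + 1)]; ring
        _ ≤ Di * Dj * (s ^ (-(((i : ℝ) + 1) / 2 + ((j : ℝ) + 1) / 2)) * exp (-(π / 36 * ρ) / s)) := by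
            gcongr ?_ * (?_ * exp (?_ / s))
            nlinarith
        _ ≤ _ := by gcongr; exact hBs s hs hs1
    have h6 : |thetaLimit i * thetaLimit j| ≤ 1 := by rw [abs_mul]; exact mul_le_one₀ (hl i) (abs_nonneg _) (hl j)
    have h7 : 1 ≤ exp (π / 4) * exp (-(π / 4) * s) := by rw [← exp_add]; exact Real.one_le_exp (by nlinarith)
    calc _ ≤ |thetaD i v.1 s * thetaD j v.2 s| + |thetaLimit i * thetaLimit j| := abs_sub _ _
      _ ≤ (Di * Dj * B + 1) * 1 := by linarith
      _ ≤ (Di * Dj * B + 1) * (exp (π / 4) * exp (-(π / 4) * s)) := by gcongr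
      _ ≤ _ := by rw [← mul_assoc]; gcongr; exact le_add_of_nonneg_left (by positivity)

/-- The cosine kernel is continuous in `s`; each further derivative in `a` is a pointwise limit of
difference quotients. -/
lemma aestronglyMeasurable_thetaD (j : ℕ) (a : ℝ) :
    AEStronglyMeasurable (fun s => thetaD j a s) (volume.restrict (Ioi 0)) := by
  induction j generalizing a with
  | zero =>
    simp only [thetaD_zero]
    exact (HurwitzZeta.continuousOn_cosKernel a).aestronglyMeasurable measurableSet_Ioi
  | succ j ih =>
    refine aestronglyMeasurable_of_tendsto_ae atTop (f := fun (n : ℕ) s =>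
      ((1 : ℝ) / (n + 1))⁻¹ • (thetaD j (a + 1 / (n + 1)) s - thetaD j a s)) (fun n =>
        ((ih (a + 1 / (n + 1))).sub (ih a)).const_smul ((1 : ℝ) / (n + 1))⁻¹) ?_
    filter_upwards [ae_restrict_mem measurableSet_Ioi] with s hs
    have h := (hasDerivAt_thetaD j a hs).tendsto_slope_zero
    refine h.comp (tendsto_nhdsWithin_iff.mpr ⟨tendsto_one_div_add_atTop_nhds_zero_nat, ?_⟩)
    exact .of_forall fun n => by simp only [Set.mem_compl_iff, Set.mem_singleton_iff]; positivity

/-- The derivatives of the Green function, lifted to the plane (up to a constant). -/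
def greenInt (i j : ℕ) (v : ℝ × ℝ) : ℝ :=
  ∫ s in Ioi (0 : ℝ), (thetaD i v.1 s * thetaD j v.2 s - thetaLimit i * thetaLimit j)

lemma green_toTorus (v : ℝ × ℝ) : green (toTorus v) = -(1 / (4 * π)) * greenInt 0 0 v := by
  simp [green, greenInt, thetaD_zero, thetaLimit, toTorus]

/-- A neighbourhood of a fundamental domain, without the origin. -/
def puncturedSquare : Set (ℝ × ℝ) := {v | |v.1| < 5 / 8 ∧ |v.2| < 5 / 8 ∧ v ≠ 0}

lemma isOpen_puncturedSquare : IsOpen puncturedSquare := by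
  have h1 : IsOpen {v : ℝ × ℝ | |v.1| < 5 / 8} := isOpen_lt (by fun_prop) continuous_const
  have h2 : IsOpen {v : ℝ × ℝ | |v.2| < 5 / 8} := isOpen_lt (by fun_prop) continuous_const
  exact h1.inter (h2.inter isOpen_ne)

lemma integrable_exp_quarter_pi : Integrable (fun s : ℝ => exp (-(π / 4) * s)) (volume.restrict (Ioi 0)) :=
  integrableOn_exp_mul_Ioi (by have := pi_pos; linarith) 0

lemma aestronglyMeasurable_thetaD_mul (i j : ℕ) (v : ℝ × ℝ) :
    AEStronglyMeasurable (fun s => thetaD i v.1 s * thetaD j v.2 s) (volume.restrict (Ioi 0)) :=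
  (aestronglyMeasurable_thetaD i _).mul (aestronglyMeasurable_thetaD j _)

lemma integrable_thetaD_mul_sub (i j : ℕ) {v : ℝ × ℝ} (hv : v ∈ puncturedSquare) :
    Integrable (fun s => thetaD i v.1 s * thetaD j v.2 s - thetaLimit i * thetaLimit j)
      (volume.restrict (Ioi 0)) := by
  obtain ⟨h1, h2, h3⟩ := hv
  have hρ : 0 < v.1 ^ 2 + v.2 ^ 2 := by
    by_contra h
    apply h3
    have := sq_nonneg v.1; have := sq_nonneg v.2
    ext <;> simp <;> nlinarith
  obtain ⟨C, hC⟩ := abs_thetaD_mul_sub_le i j hρ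
  refine Integrable.mono' (integrable_exp_quarter_pi.const_mul C)
    ((aestronglyMeasurable_thetaD_mul i j v).sub aestronglyMeasurable_const) ?_
  filter_upwards [ae_restrict_mem measurableSet_Ioi] with s hs
  exact hC v s h1.le h2.le le_rfl hs

lemma hasFDerivAt_greenInt (i j : ℕ) {v : ℝ × ℝ} (hv : v ∈ puncturedSquare) :
    HasFDerivAt (greenInt i j) (greenInt (i + 1) j v • fst ℝ ℝ ℝ + greenInt i (j + 1) v • snd ℝ ℝ ℝ) v := by
  have hv' := hv
  obtain ⟨h1, h2, h3⟩ := hv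
  have hρ : 0 < v.1 ^ 2 + v.2 ^ 2 := by
    by_contra h
    apply h3
    have := sq_nonneg v.1; have := sq_nonneg v.2
    ext <;> simp <;> nlinarith
  obtain ⟨C1, hC1⟩ := abs_thetaD_mul_sub_le (i + 1) j (half_pos hρ)
  obtain ⟨C2, hC2⟩ := abs_thetaD_mul_sub_le i (j + 1) (half_pos hρ)
  have hl : ∀ k, thetaLimit (k + 1) = 0 := fun k => by simp [thetaLimit]
  simp only [hl, zero_mul, mul_zero, sub_zero] at hC1 hC2
  set S : Set (ℝ × ℝ) := puncturedSquare ∩ {u | (v.1 ^ 2 + v.2 ^ 2) / 2 < u.1 ^ 2 + u.2 ^ 2} with hS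
  have hSn : S ∈ 𝓝 v := by
    refine (isOpen_puncturedSquare.inter (isOpen_lt continuous_const (by fun_prop))).mem_nhds ?_
    exact ⟨hv', by simpa using hρ⟩
  have i1 := integrable_thetaD_mul_sub (i + 1) j hv'
  have i2 := integrable_thetaD_mul_sub i (j + 1) hv'
  simp only [hl, zero_mul, mul_zero, sub_zero] at i1 i2
  have key := hasFDerivAt_integral_of_dominated_of_fderiv_le (𝕜 := ℝ)
    (μ := volume.restrict (Ioi (0 : ℝ))) (x₀ := v) (s := S)
    (F := fun u s => thetaD i u.1 s * thetaD j u.2 s - thetaLimit i * thetaLimit j)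
    (F' := fun u s => (thetaD (i + 1) u.1 s * thetaD j u.2 s) • fst ℝ ℝ ℝ +
      (thetaD i u.1 s * thetaD (j + 1) u.2 s) • snd ℝ ℝ ℝ)
    (bound := fun s => (C1 + C2) * exp (-(π / 4) * s)) hSn
    (.of_forall fun u => (aestronglyMeasurable_thetaD_mul i j u).sub aestronglyMeasurable_const)
    (integrable_thetaD_mul_sub i j hv')
    (((aestronglyMeasurable_thetaD_mul (i + 1) j v).smul_const _).add
      ((aestronglyMeasurable_thetaD_mul i (j + 1) v).smul_const _)) ?_
    (integrable_exp_quarter_pi.const_mul _) ?_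
  · rw [integral_add (i1.smul_const _) (i2.smul_const _), integral_smul_const, integral_smul_const] at key
    simpa [greenInt, hl] using! key
  · filter_upwards [ae_restrict_mem measurableSet_Ioi] with s hs u hu
    obtain ⟨⟨hu1, hu2, -⟩, hu3⟩ := hu
    have hu3' : (v.1 ^ 2 + v.2 ^ 2) / 2 ≤ u.1 ^ 2 + u.2 ^ 2 := le_of_lt hu3
    have b1 := hC1 u s hu1.le hu2.le hu3' hs
    have b2 := hC2 u s hu1.le hu2.le hu3' hs
    refine (norm_add_le _ _).trans ?_
    rw [norm_smul, norm_smul, add_mul]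
    refine add_le_add ?_ ?_
    · refine (mul_le_of_le_one_right (norm_nonneg _) (ContinuousLinearMap.norm_fst_le ℝ ℝ ℝ)).trans b1
    · refine (mul_le_of_le_one_right (norm_nonneg _) (ContinuousLinearMap.norm_snd_le ℝ ℝ ℝ)).trans b2
  · filter_upwards [ae_restrict_mem measurableSet_Ioi] with s hs u _
    have d1 : HasFDerivAt (fun u : ℝ × ℝ => thetaD i u.1 s) (thetaD (i + 1) u.1 s • fst ℝ ℝ ℝ) u :=
      (hasDerivAt_thetaD i u.1 hs).comp_hasFDerivAt u hasFDerivAt_fst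
    have d2 : HasFDerivAt (fun u : ℝ × ℝ => thetaD j u.2 s) (thetaD (j + 1) u.2 s • snd ℝ ℝ ℝ) u :=
      (hasDerivAt_thetaD j u.2 hs).comp_hasFDerivAt u hasFDerivAt_snd
    refine ((d1.mul d2).sub_const (thetaLimit i * thetaLimit j)).congr_fderiv ?_
    rw [smul_smul, smul_smul, add_comm, mul_comm (thetaD j u.2 s)]

lemma contDiffOn_greenInt (n i j : ℕ) : ContDiffOn ℝ n (greenInt i j) puncturedSquare := by
  induction n generalizing i j with
  | zero => exact contDiffOn_zero.mpr fun v hv => (hasFDerivAt_greenInt i j hv).continuousAt.continuousWithinAt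
  | succ n ih =>
    push_cast
    rw [contDiffOn_succ_iff_fderiv_of_isOpen isOpen_puncturedSquare]
    refine ⟨fun v hv => (hasFDerivAt_greenInt i j hv).differentiableAt.differentiableWithinAt, by simp, ?_⟩
    refine ContDiffOn.congr ?_ (fun v hv => (hasFDerivAt_greenInt i j hv).fderiv)
    exact ((ih (i + 1) j).smul contDiffOn_const).add ((ih i (j + 1)).smul contDiffOn_const)

lemma toTorus_add (u v : ℝ × ℝ) : toTorus (u + v) = toTorus u + toTorus v := rfl

lemma toTorus_zero : toTorus 0 = 0 := rfl

lemma toTorus_neg (u : ℝ × ℝ) : toTorus (-u) = -toTorus u := rfl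

lemma toTorus_sub (u v : ℝ × ℝ) : toTorus (u - v) = toTorus u - toTorus v := rfl

lemma continuous_toTorus : Continuous toTorus :=
  ((AddCircle.continuous_mk' 1).comp continuous_fst).prodMk ((AddCircle.continuous_mk' 1).comp continuous_snd)

lemma exists_toTorus_eq (z : Torus) : ∃ v : ℝ × ℝ, toTorus v = z ∧ |v.1| = ‖z.1‖ ∧ |v.2| = ‖z.2‖ := by
  obtain ⟨z1, z2⟩ := z
  obtain ⟨a, rfl⟩ := QuotientAddGroup.mk_surjective z1
  obtain ⟨b, rfl⟩ := QuotientAddGroup.mk_surjective z2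
  refine ⟨(a - round a, b - round b), ?_, ?_, ?_⟩
  · simp only [toTorus, AddCircle.coe_sub]
    ext
    · simp
    · simp
  · exact (UnitAddCircle.norm_eq (x := a)).symm
  · exact (UnitAddCircle.norm_eq (x := b)).symm

lemma norm_unitAddCircle_le (x : UnitAddCircle) : ‖x‖ ≤ 1 / 2 := by
  have := AddCircle.norm_le_half_period (p := (1 : ℝ)) (x := x) one_ne_zero
  simpa using this

lemma exists_mem_puncturedSquare (hz : z ≠ 0) :
    ∃ v ∈ puncturedSquare, toTorus v = z ∧ |v.1| = ‖z.1‖ ∧ |v.2| = ‖z.2‖ := by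
  obtain ⟨v, hv, h1, h2⟩ := exists_toTorus_eq z
  refine ⟨v, ⟨?_, ?_, ?_⟩, hv, h1, h2⟩
  · rw [h1]; linarith [norm_unitAddCircle_le z.1]
  · rw [h2]; linarith [norm_unitAddCircle_le z.2]
  · rintro rfl
    exact hz (by rw [← hv, toTorus_zero])

lemma contDiffAt_green (hz : z ≠ 0) (n : ℕ) : ContDiffAt ℝ n (fun v => green (z + toTorus v)) 0 := by
  obtain ⟨u, hu, rfl, -⟩ := exists_mem_puncturedSquare hz
  have h1 : ContDiffAt ℝ n (greenInt 0 0) (u + 0) := by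
    rw [add_zero]
    exact (contDiffOn_greenInt n 0 0).contDiffAt (isOpen_puncturedSquare.mem_nhds hu)
  have h2 : (fun v => green (toTorus u + toTorus v)) = fun v => -(1 / (4 * π)) * greenInt 0 0 (u + v) := by
    ext v; rw [← toTorus_add, green_toTorus]
  rw [h2]
  exact contDiffAt_const.mul (h1.comp (0 : ℝ × ℝ) (by fun_prop))

lemma green_neg (z : Torus) : green (-z) = green z := by simp [green]

lemma partial₁_green_toTorus {v : ℝ × ℝ} (hv : v ∈ puncturedSquare) :
    partial₁ green (toTorus v) = -(1 / (4 * π)) * greenInt 1 0 v := by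
  have h : HasDerivAt (fun h : ℝ => v + (h, (0 : ℝ))) (1, 0) 0 := by
    simpa using ((hasDerivAt_id (0 : ℝ)).prodMk (hasDerivAt_const (0 : ℝ) (0 : ℝ))).const_add v
  have h0 : v + ((0 : ℝ), (0 : ℝ)) = v := by simp
  have h2 := (h0.symm ▸ hasFDerivAt_greenInt 0 0 hv :
    HasFDerivAt (greenInt 0 0) _ (v + ((0 : ℝ), (0 : ℝ)))).comp_hasDerivAt (0 : ℝ) h
  have h3 := (h2.const_mul (-(1 / (4 * π)))).deriv
  simp only [comp_def, ← green_toTorus, toTorus_add] at h3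
  rw [partial₁, h3, h0]
  simp

lemma partial₂_green_toTorus {v : ℝ × ℝ} (hv : v ∈ puncturedSquare) :
    partial₂ green (toTorus v) = -(1 / (4 * π)) * greenInt 0 1 v := by
  have h : HasDerivAt (fun h : ℝ => v + ((0 : ℝ), h)) (0, 1) 0 := by
    simpa using ((hasDerivAt_const (0 : ℝ) (0 : ℝ)).prodMk (hasDerivAt_id (0 : ℝ))).const_add v
  have h0 : v + ((0 : ℝ), (0 : ℝ)) = v := by simp
  have h2 := (h0.symm ▸ hasFDerivAt_greenInt 0 0 hv :
    HasFDerivAt (greenInt 0 0) _ (v + ((0 : ℝ), (0 : ℝ)))).comp_hasDerivAt (0 : ℝ) h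
  have h3 := (h2.const_mul (-(1 / (4 * π)))).deriv
  simp only [comp_def, ← green_toTorus, toTorus_add] at h3
  rw [partial₂, h3, h0]
  simp

/-! ### Singularity of the Green function -/

lemma hasSum_thetaD_zero (a : ℝ) (hs : 0 < s) :
    HasSum (fun n : ℤ => s ^ (-(1 / 2) : ℝ) * exp (-π * (n - a) ^ 2 / s)) (thetaD 0 a s) := by
  have h := Complex.hasSum_re (theta_eq_gauss hs (a : ℂ))
  rw [thetaD, iteratedDeriv_zero]
  refine h.congr_fun fun n => ?_
  rw [Complex.re_ofReal_mul]
  congr 1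
  have : (-(π : ℂ) * ((n : ℂ) - a) ^ 2 / s) = ((-π * (n - a) ^ 2 / s : ℝ) : ℂ) := by push_cast; ring
  rw [this, ← Complex.ofReal_exp, Complex.ofReal_re]

lemma le_thetaD_zero (a : ℝ) (hs : 0 < s) : s ^ (-(1 / 2) : ℝ) * exp (-π * a ^ 2 / s) ≤ thetaD 0 a s := by
  have h := le_hasSum (hasSum_thetaD_zero a hs) 0 (fun n _ => by positivity)
  simpa using h

/-- Keeping one Gaussian in each factor bounds the heat kernel below by `e^{-πr/s} / s`, with `r =
|v|²`. For `r < s ≤ 1` this is at least `e^{-π} / s`, whose integral is the logarithm. On the other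
times the kernel is nonnegative or exponentially close to its limit, which costs a constant. -/
lemma le_greenInt : ∃ C : ℝ, ∀ v ∈ puncturedSquare, v.1 ^ 2 + v.2 ^ 2 < 1 →
    -exp (-π) * log (v.1 ^ 2 + v.2 ^ 2) - C ≤ greenInt 0 0 v := by
  obtain ⟨C0, hC0, h0⟩ := abs_thetaD_le_of_one_le 0
  have hpi := pi_pos
  set C := 2 * C0 + C0 * C0 + exp (π / 4) with hC
  have hCpos : 0 < C := by positivity
  refine ⟨C * ∫ s in Ioi (0 : ℝ), exp (-(π / 4) * s), fun v hv hr1 => ?_⟩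
  set r := v.1 ^ 2 + v.2 ^ 2 with hr
  have hr0 : 0 < r := by
    by_contra h
    apply hv.2.2
    have := sq_nonneg v.1; have := sq_nonneg v.2
    ext <;> simp <;> nlinarith
  have hi : IntegrableOn (fun s : ℝ => exp (-π) * s⁻¹) (Ioc r 1) := by
    have : IntervalIntegrable (fun s : ℝ => s⁻¹) volume r 1 := intervalIntegral.intervalIntegrable_inv (by
        intro x hx; rw [uIcc_of_le hr1.le] at hx
        have := hx.1
        linarith) continuousOn_id
    exact ((intervalIntegrable_iff_integrableOn_Ioc_of_le hr1.le).mp this).const_mul _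
  have hi' : Integrable ((Ioc r 1).indicator (fun s : ℝ => exp (-π) * s⁻¹)) (volume.restrict (Ioi 0)) := by
    rw [integrable_indicator_iff measurableSet_Ioc, IntegrableOn,
      Measure.restrict_restrict measurableSet_Ioc, Set.inter_eq_left.mpr]
    · exact hi
    · intro x hx; exact hr0.trans hx.1
  have hsub : Ioc r 1 ∩ Ioi 0 = Ioc r 1 := Set.inter_eq_left.mpr fun x hx => hr0.trans hx.1
  have hlow : ∫ s in Ioi (0 : ℝ), ((Ioc r 1).indicator (fun s : ℝ => exp (-π) * s⁻¹) s - C * exp (-(π / 4) * s))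
      = -exp (-π) * log r - C * ∫ s in Ioi (0 : ℝ), exp (-(π / 4) * s) := by
    rw [integral_sub hi' (integrable_exp_quarter_pi.const_mul C), integral_const_mul,
      integral_indicator measurableSet_Ioc, Measure.restrict_restrict measurableSet_Ioc,
      hsub, integral_const_mul, ← integral_of_le hr1.le, integral_inv_of_pos hr0 one_pos]
    rw [one_div, Real.log_inv]; ring
  rw [← hlow]
  refine setIntegral_mono_on (hi'.sub (integrable_exp_quarter_pi.const_mul C))
    (integrable_thetaD_mul_sub 0 0 hv) measurableSet_Ioi fun s hs => ?_
  have hs : 0 < s := hs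
  have t1 := le_thetaD_zero v.1 hs
  have t2 := le_thetaD_zero v.2 hs
  have hprod : s⁻¹ * exp (-π * r / s) ≤ thetaD 0 v.1 s * thetaD 0 v.2 s := by
    refine le_trans (le_of_eq ?_) (mul_le_mul t1 t2 (by positivity) (le_trans (by positivity) t1))
    have e1 : s⁻¹ = s ^ (-(1 / 2) : ℝ) * s ^ (-(1 / 2) : ℝ) := by rw [← rpow_add hs, ← Real.rpow_neg_one]; norm_num
    have e2 : -π * r / s = -π * v.1 ^ 2 / s + -π * v.2 ^ 2 / s := by rw [hr]; ring
    rw [e2, exp_add, e1]; ring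
  simp only [thetaLimit, if_true, mul_one]
  rcases le_or_gt s 1 with hs1 | hs1
  · have hb : 1 ≤ C * exp (-(π / 4) * s) := by
      have : 1 ≤ exp (π / 4) * exp (-(π / 4) * s) := by rw [← exp_add]; exact Real.one_le_exp (by nlinarith)
      refine this.trans ?_
      gcongr
      rw [hC]
      exact le_add_of_nonneg_left (by positivity)
    by_cases hsr : s ∈ Ioc r 1
    · rw [indicator_of_mem hsr]
      have : exp (-π) * s⁻¹ ≤ s⁻¹ * exp (-π * r / s) := by
        rw [mul_comm]
        gcongr
        rw [le_div_iff₀ hs]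
        nlinarith [hsr.1]
      linarith
    · rw [indicator_of_notMem hsr]
      have : 0 ≤ s⁻¹ * exp (-π * r / s) := by positivity
      linarith
  · rw [indicator_of_notMem (fun h => absurd h.2 (not_le.mpr hs1))]
    have a1 := abs_le.mp (h0 v.1 s hs1.le)
    have a2 := abs_le.mp (h0 v.2 s hs1.le)
    simp only [if_true] at a1 a2
    set E := exp (-(π / 4) * s)
    have hE : 0 < E := exp_pos _
    have hE1 : E ≤ 1 := exp_le_one_iff.mpr (by nlinarith)
    set x := thetaD 0 v.1 s - 1
    set y := thetaD 0 v.2 s - 1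
    have e : thetaD 0 v.1 s * thetaD 0 v.2 s - 1 = x + y + x * y := by simp only [x, y]; ring
    rw [e]
    have hxy : -(C0 * C0 * E) ≤ x * y := by
      have : |x * y| ≤ (C0 * E) * (C0 * 1) := by
        rw [abs_mul]
        have : C0 * E ≤ C0 * 1 := by gcongr
        exact mul_le_mul (abs_le.mpr a1) ((abs_le.mpr a2).trans this) (abs_nonneg _) (by positivity)
      have := (abs_le.mp this).1
      linarith
    have : 0 ≤ exp (π / 4) * E := by positivity
    rw [hC]
    nlinarith

lemma tendsto_green_atBot : Tendsto green (𝓝[≠] 0) atBot := by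
  obtain ⟨C, hC⟩ := le_greenInt
  have hpi := pi_pos
  have hb : ∀ z : Torus, z ≠ 0 → green z ≤ (1 / (4 * π)) * exp (-π) * log (‖z.1‖ ^ 2 + ‖z.2‖ ^ 2)
      + C / (4 * π) := by
    intro z hz
    obtain ⟨v, hv, rfl, h1, h2⟩ := exists_mem_puncturedSquare hz
    have h3 : v.1 ^ 2 + v.2 ^ 2 = ‖(toTorus v).1‖ ^ 2 + ‖(toTorus v).2‖ ^ 2 := by rw [← h1, ← h2, sq_abs, sq_abs]
    have n1 := norm_unitAddCircle_le (toTorus v).1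
    have n2 := norm_unitAddCircle_le (toTorus v).2
    have h4 := hC v hv (by rw [h3]; nlinarith [norm_nonneg (toTorus v).1, norm_nonneg (toTorus v).2])
    rw [green_toTorus, ← h3]
    have : 0 < 1 / (4 * π) := by positivity
    have h5 := mul_le_mul_of_nonneg_left h4 this.le
    have e : C / (4 * π) = 1 / (4 * π) * C := by ring
    rw [e]
    nlinarith
  have hr : Tendsto (fun z : Torus => ‖z.1‖ ^ 2 + ‖z.2‖ ^ 2) (𝓝[≠] 0) (𝓝[>] 0) := by
    refine tendsto_nhdsWithin_iff.mpr ⟨?_, ?_⟩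
    · have : Continuous (fun z : Torus => ‖z.1‖ ^ 2 + ‖z.2‖ ^ 2) := by fun_prop
      have h := this.tendsto 0
      simp only [Prod.fst_zero, Prod.snd_zero, norm_zero] at h
      norm_num at h
      exact h.mono_left nhdsWithin_le_nhds
    · filter_upwards [self_mem_nhdsWithin] with z hz
      have hz : z ≠ 0 := hz
      by_contra h
      apply hz
      have := sq_nonneg ‖z.1‖; have := sq_nonneg ‖z.2‖
      simp only [Set.mem_Ioi, not_lt] at h
      ext
      · exact norm_eq_zero.mp (pow_eq_zero_iff two_ne_zero |>.mp (by linarith))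
      · exact norm_eq_zero.mp (pow_eq_zero_iff two_ne_zero |>.mp (by linarith))
  have hlog := Real.tendsto_log_nhdsGT_zero.comp hr
  refine tendsto_atBot_mono' _ ?_ (tendsto_atBot_add_const_right _ (C / (4 * π))
    (hlog.const_mul_atBot (show 0 < (1 / (4 * π)) * exp (-π) by positivity)))
  filter_upwards [self_mem_nhdsWithin] with z hz
  exact hb z hz

/-! ### Integrability of the gradient of the Green function -/

/-- The exponent `3/8` is used once per coordinate: together they improve the singularity `s^{-3/2}`
of a first derivative of the heat kernel to the integrable `s^{-3/4}`, at the price of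
`|v_i|^{-3/4}` in each coordinate, which is integrable on the circle as well. -/
lemma exp_neg_le_rpow {x : ℝ} (hx : 0 < x) : exp (-x) ≤ x ^ (-(3 / 8) : ℝ) := by
  rw [Real.exp_neg, Real.rpow_neg hx.le]
  refine inv_anti₀ (by positivity) ?_
  rcases le_total x 1 with h | h
  · exact (Real.rpow_le_one hx.le h (by norm_num)).trans (Real.one_le_exp hx.le)
  · calc x ^ (3 / 8 : ℝ) ≤ x ^ (1 : ℝ) := Real.rpow_le_rpow_of_exponent_le h (by norm_num)
      _ = x := Real.rpow_one x
      _ ≤ exp x := by linarith [Real.add_one_le_exp x]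

/-- A majorant in product form, weaker than `1 / |v|`, is enough: integrability of the gradient then
follows from Fubini and a power of one variable. -/
lemma abs_greenInt_le (i j : ℕ) (hij : i + j = 1) : ∃ C : ℝ, 0 ≤ C ∧ ∀ v ∈ puncturedSquare, v.1 ≠ 0 → v.2 ≠ 0 →
    |greenInt i j v| ≤ C * (1 + |v.1| ^ (-(3 / 4) : ℝ) * |v.2| ^ (-(3 / 4) : ℝ)) := by
  obtain ⟨Ci, hCi, hi⟩ := abs_thetaD_le_of_one_le i
  obtain ⟨Cj, hCj, hj⟩ := abs_thetaD_le_of_one_le j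
  obtain ⟨Di, hDi, hi'⟩ := abs_thetaD_le_of_le_one i
  obtain ⟨Dj, hDj, hj'⟩ := abs_thetaD_le_of_le_one j
  have hpi := pi_pos
  set I1 := ∫ s in Ioi (0 : ℝ), exp (-(π / 4) * s)
  set I2 := ∫ s in Ioc (0 : ℝ) 1, s ^ (-(3 / 4) : ℝ)
  have hI1 : 0 ≤ I1 := integral_nonneg fun _ => by positivity
  have hI2 : 0 ≤ I2 := setIntegral_nonneg measurableSet_Ioc fun s hs => Real.rpow_nonneg hs.1.le _
  set A := Di * Dj * ((π / 36) ^ (-(3 / 8) : ℝ) * (π / 36) ^ (-(3 / 8) : ℝ)) with hA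
  have hA0 : 0 ≤ A := by positivity
  set B := Ci + Cj + Ci * Cj with hB
  have hB0 : 0 ≤ B := by positivity
  refine ⟨B * I1 + A * I2, by positivity, fun v hv hv1 hv2 => ?_⟩
  set Q := |v.1| ^ (-(3 / 4) : ℝ) * |v.2| ^ (-(3 / 4) : ℝ) with hQ
  have hQ0 : 0 ≤ Q := by positivity
  have hi2 : IntegrableOn (fun s : ℝ => s ^ (-(3 / 4) : ℝ)) (Ioc 0 1) :=
    (intervalIntegrable_iff_integrableOn_Ioc_of_le zero_le_one).mp (intervalIntegrable_rpow' (by norm_num))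
  have hind : Integrable ((Ioc (0 : ℝ) 1).indicator (fun s : ℝ => s ^ (-(3 / 4) : ℝ)))
      (volume.restrict (Ioi 0)) := by
    rw [integrable_indicator_iff measurableSet_Ioc, IntegrableOn,
      Measure.restrict_restrict measurableSet_Ioc, Set.inter_eq_left.mpr]
    · exact hi2
    · intro x hx; exact hx.1
  have hInt : ∫ s in Ioi (0 : ℝ), (B * exp (-(π / 4) * s) +
      A * Q * (Ioc (0 : ℝ) 1).indicator (fun s : ℝ => s ^ (-(3 / 4) : ℝ)) s)
      = B * I1 + A * Q * I2 := by
    rw [integral_add (integrable_exp_quarter_pi.const_mul B) (hind.const_mul _), integral_const_mul,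
      integral_const_mul, integral_indicator measurableSet_Ioc,
      Measure.restrict_restrict measurableSet_Ioc,
      Set.inter_eq_left.mpr (show Ioc (0 : ℝ) 1 ⊆ Ioi 0 from fun x hx => hx.1)]
  have hb : |greenInt i j v| ≤ B * I1 + A * Q * I2 := by
    rw [← hInt, greenInt, ← norm_eq_abs]
    refine norm_integral_le_of_norm_le ((integrable_exp_quarter_pi.const_mul B).add (hind.const_mul _)) ?_
    filter_upwards [ae_restrict_mem measurableSet_Ioi] with s hs
    have hs : 0 < s := hs
    have hl : thetaLimit i * thetaLimit j = 0 := by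
      unfold thetaLimit
      rcases Nat.eq_zero_or_pos i with h | h
      · have : j ≠ 0 := by omega
        simp [this]
      · have : i ≠ 0 := by omega
        simp [this]
    rw [hl, sub_zero, norm_eq_abs]
    rcases le_or_gt s 1 with hs1 | hs1
    · rw [indicator_of_mem (show s ∈ Ioc (0 : ℝ) 1 from ⟨hs, hs1⟩)]
      have hA := hi' v.1 s hs hs1 hv.1.le
      have hA' := hj' v.2 s hs hs1 hv.2.1.le
      have hexp : ∀ a : ℝ, a ≠ 0 → exp (-(π / 36) * a ^ 2 / s)
          ≤ (π / 36) ^ (-(3 / 8) : ℝ) * |a| ^ (-(3 / 4) : ℝ) * s ^ (3 / 8 : ℝ) := by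
        intro a ha
        have ha' : 0 < |a| := abs_pos.mpr ha
        have := exp_neg_le_rpow (x := π / 36 * |a| ^ 2 / s) (by positivity)
        rw [sq_abs] at this
        refine le_trans (le_of_eq (by congr 1; ring)) (this.trans (le_of_eq ?_))
        rw [← sq_abs, Real.div_rpow (by positivity) hs.le, Real.mul_rpow (by positivity) (by positivity),
          ← rpow_natCast |a| 2, ← rpow_mul ha'.le, Real.rpow_neg hs.le, div_inv_eq_mul]
        norm_num
      have h5 : |thetaD i v.1 s * thetaD j v.2 s| ≤ A * Q * s ^ (-(3 / 4) : ℝ) := by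
        rw [abs_mul]
        calc _ ≤ _ := mul_le_mul hA hA' (abs_nonneg _) (by positivity)
          _ ≤ (Di * s ^ (-((i : ℝ) + 1) / 2) *
                ((π / 36) ^ (-(3 / 8) : ℝ) * |v.1| ^ (-(3 / 4) : ℝ) * s ^ (3 / 8 : ℝ))) *
              (Dj * s ^ (-((j : ℝ) + 1) / 2) *
                ((π / 36) ^ (-(3 / 8) : ℝ) * |v.2| ^ (-(3 / 4) : ℝ) * s ^ (3 / 8 : ℝ))) := by
              gcongr
              · exact hexp _ hv1
              · exact hexp _ hv2
          _ = A * Q * (s ^ (-((i : ℝ) + 1) / 2) * s ^ (3 / 8 : ℝ) *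
                (s ^ (-((j : ℝ) + 1) / 2) * s ^ (3 / 8 : ℝ))) := by
              simp only [A, Q]; ring
          _ = _ := by
              rw [← rpow_add hs, ← rpow_add hs, ← rpow_add hs]
              congr 2
              have : (i : ℝ) + j = 1 := mod_cast hij
              linarith
      have : 0 ≤ B * exp (-(π / 4) * s) := by positivity
      linarith
    · rw [indicator_of_notMem (fun h => absurd h.2 (not_le.mpr hs1)), mul_zero, add_zero]
      have a1 := hi v.1 s hs1.le
      have a2 := hj v.2 s hs1.le
      rw [← thetaLimit] at a1 a2
      set E := exp (-(π / 4) * s)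
      have hE : 0 < E := exp_pos _
      have hE1 : E ≤ 1 := exp_le_one_iff.mpr (by nlinarith)
      set x := thetaD i v.1 s - thetaLimit i
      set y := thetaD j v.2 s - thetaLimit j
      have hlk : ∀ k, |thetaLimit k| ≤ 1 := fun k => by unfold thetaLimit; split_ifs <;> simp
      have e : thetaD i v.1 s * thetaD j v.2 s = x * thetaLimit j + thetaLimit i * y + x * y := by
        have : x * thetaLimit j + thetaLimit i * y + x * y =
          thetaD i v.1 s * thetaD j v.2 s - thetaLimit i * thetaLimit j := by
          simp only [x, y]; ring
        rw [this, hl, sub_zero]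
      rw [e]
      calc _ ≤ |x * thetaLimit j| + |thetaLimit i * y| + |x * y| := by
            exact (abs_add_le _ _).trans (by gcongr; exact abs_add_le _ _)
        _ ≤ Ci * E * 1 + 1 * (Cj * E) + (Ci * E) * (Cj * 1) := by
            simp only [abs_mul]
            have := hlk i
            have := hlk j
            have h8 : |y| ≤ Cj * 1 := a2.trans (by gcongr)
            gcongr
        _ = B * E := by rw [hB]; ring
  refine hb.trans ?_
  have : 0 ≤ B * I1 * Q := by positivity
  have : 0 ≤ A * I2 := by positivity
  nlinarith

lemma integrable_norm_rpow_unitAddCircle : Integrable (fun x : UnitAddCircle => ‖x‖ ^ (-(3 / 4) : ℝ)) := by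
  have hmp := UnitAddCircle.measurePreserving_mk (-(1 / 2))
  have hm : Measurable (fun x : UnitAddCircle => ‖x‖ ^ (-(3 / 4) : ℝ)) := measurable_norm.pow_const _
  rw [← hmp.integrable_comp hm.aestronglyMeasurable]
  have e : (-(1 / 2) : ℝ) + 1 = 1 / 2 := by norm_num
  rw [e]
  have hpos : IntervalIntegrable (fun x : ℝ => |x| ^ (-(3 / 4) : ℝ)) volume 0 (1 / 2) := by
    refine (intervalIntegrable_rpow' (r := -(3 / 4)) (by norm_num)).congr ?_
    intro x hx
    rw [uIoc_of_le (by norm_num)] at hx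
    simp only [abs_of_pos hx.1]
  have hneg : IntervalIntegrable (fun x : ℝ => |x| ^ (-(3 / 4) : ℝ)) volume (-(1 / 2)) 0 := by
    rw [IntervalIntegrable.iff_comp_neg]
    simpa using hpos.symm
  have h := (intervalIntegrable_iff_integrableOn_Ioc_of_le (by norm_num)).mp (hneg.trans hpos)
  refine Integrable.congr h ?_
  filter_upwards [ae_restrict_mem measurableSet_Ioc] with x hx
  have hx' : ‖(x : UnitAddCircle)‖ = |x| := (AddCircle.norm_coe_eq_abs_iff (1 : ℝ) one_ne_zero).mpr (by
      rw [abs_le]; constructor <;> simp <;> linarith [hx.1, hx.2])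
  simp only [comp_apply, hx']

lemma isOpenQuotientMap_toTorus : IsOpenQuotientMap toTorus := by
  have h : IsOpenQuotientMap (fun x : ℝ => (x : UnitAddCircle)) := QuotientAddGroup.isOpenQuotientMap_mk
  exact h.prodMap h

lemma continuousAt_iff_toTorus {E : Type*} [TopologicalSpace E] (f : Torus → E) (z : Torus) :
    ContinuousAt f z ↔ ContinuousAt (fun v => f (z + toTorus v)) 0 := by
  obtain ⟨v, rfl⟩ := isOpenQuotientMap_toTorus.surjective z
  rw [← isOpenQuotientMap_toTorus.continuousAt_comp_iff]
  have e : (fun u => f (toTorus v + toTorus u)) = (f ∘ toTorus) ∘ (fun u => v + u) := rfl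
  rw [e]
  have h := (Homeomorph.addLeft v).isOpenQuotientMap.continuousAt_comp_iff (f := ⇑(Homeomorph.addLeft v)) (g := f ∘ toTorus) (x := 0)
  simp only [Homeomorph.coe_addLeft, add_zero] at h
  exact h.symm

lemma continuousAt_partial₁_green (hz : z ≠ 0) : ContinuousAt (partial₁ green) z := by
  obtain ⟨v, hv, rfl, -⟩ := exists_mem_puncturedSquare hz
  rw [← isOpenQuotientMap_toTorus.continuousAt_comp_iff]
  refine ContinuousAt.congr (f := fun u => -(1 / (4 * π)) * greenInt 1 0 u)
    (continuousAt_const.mul (hasFDerivAt_greenInt 1 0 hv).continuousAt) ?_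
  filter_upwards [isOpen_puncturedSquare.mem_nhds hv] with u hu
  exact (partial₁_green_toTorus hu).symm

lemma continuousAt_partial₂_green (hz : z ≠ 0) : ContinuousAt (partial₂ green) z := by
  obtain ⟨v, hv, rfl, -⟩ := exists_mem_puncturedSquare hz
  rw [← isOpenQuotientMap_toTorus.continuousAt_comp_iff]
  refine ContinuousAt.congr (f := fun u => -(1 / (4 * π)) * greenInt 0 1 u)
    (continuousAt_const.mul (hasFDerivAt_greenInt 0 1 hv).continuousAt) ?_
  filter_upwards [isOpen_puncturedSquare.mem_nhds hv] with u hu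
  exact (partial₂_green_toTorus hu).symm

instance instNullSingletonClassUnitAddCircle : NullSingletonClass (volume : Measure UnitAddCircle) where
  measure_singleton x := by
    have h := AddCircle.volume_closedBall (1 : ℝ) (x := x) 0
    simpa using h

lemma ae_coord_ne_zero : ∀ᵐ z : Torus, z.1 ≠ 0 ∧ z.2 ≠ 0 := by
  have h : ∀ᵐ x : UnitAddCircle, x ≠ 0 := by rw [ae_iff]; simp
  have h1 : ∀ᵐ z : Torus, z.1 ≠ 0 := quasiMeasurePreserving_fst.ae h
  have h2 : ∀ᵐ z : Torus, z.2 ≠ 0 := quasiMeasurePreserving_snd.ae h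
  filter_upwards [h1, h2] with z a b using ⟨a, b⟩

lemma integrable_of_le_green {F : Torus → ℝ} (hF : ∀ z : Torus, z ≠ 0 → ContinuousAt F z) {C : ℝ}
    (hC : ∀ z : Torus, z.1 ≠ 0 → z.2 ≠ 0 →
      |F z| ≤ C * (1 + ‖z.1‖ ^ (-(3 / 4) : ℝ) * ‖z.2‖ ^ (-(3 / 4) : ℝ))) : Integrable F := by
  have hm : AEStronglyMeasurable F volume := by
    have h1 : ContinuousOn F {(0 : Torus)}ᶜ := fun z hz => (hF z hz).continuousWithinAt
    have h2 := h1.aestronglyMeasurable (μ := (volume : Measure Torus)) (measurableSet_singleton _).compl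
    rwa [Measure.restrict_eq_self_of_ae_mem] at h2
    filter_upwards [ae_coord_ne_zero] with z hz
    rintro rfl
    exact hz.1 rfl
  have hi := (integrable_norm_rpow_unitAddCircle.mul_prod integrable_norm_rpow_unitAddCircle)
  refine Integrable.mono' (((integrable_const (1 : ℝ)).add hi).const_mul C) hm ?_
  filter_upwards [ae_coord_ne_zero] with z hz
  exact hC z hz.1 hz.2

lemma integrable_partial₁_green : Integrable (partial₁ green) := by
  obtain ⟨C, hC0, hC⟩ := abs_greenInt_le 1 0 rfl
  refine integrable_of_le_green (fun z hz => continuousAt_partial₁_green hz) (C := 1 / (4 * π) * C) ?_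
  intro z h1 h2
  obtain ⟨v, hv, rfl, n1, n2⟩ := exists_mem_puncturedSquare (z := z) (fun h => h1 (by rw [h]; rfl))
  have hpi := pi_pos
  rw [partial₁_green_toTorus hv, abs_mul, abs_neg, abs_of_pos (by positivity), ← n1, ← n2, mul_assoc]
  gcongr
  refine hC v hv ?_ ?_
  · rw [← abs_pos, n1]; exact norm_pos_iff.mpr h1
  · rw [← abs_pos, n2]; exact norm_pos_iff.mpr h2

lemma integrable_partial₂_green : Integrable (partial₂ green) := by
  obtain ⟨C, hC0, hC⟩ := abs_greenInt_le 0 1 rfl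
  refine integrable_of_le_green (fun z hz => continuousAt_partial₂_green hz) (C := 1 / (4 * π) * C) ?_
  intro z h1 h2
  obtain ⟨v, hv, rfl, n1, n2⟩ := exists_mem_puncturedSquare (z := z) (fun h => h1 (by rw [h]; rfl))
  have hpi := pi_pos
  rw [partial₂_green_toTorus hv, abs_mul, abs_neg, abs_of_pos (by positivity), ← n1, ← n2, mul_assoc]
  gcongr
  refine hC v hv ?_ ?_
  · rw [← abs_pos, n1]; exact norm_pos_iff.mpr h1
  · rw [← abs_pos, n2]; exact norm_pos_iff.mpr h2

/-! ### Smooth functions on the torus -/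

namespace SmoothOnTorus

variable {f : Torus → ℝ}

lemma hasFDerivAt_add (hf : SmoothOnTorus f) (x : Torus) (v : ℝ × ℝ) :
    HasFDerivAt (fun u => f (x + toTorus u))
      (partial₁ f (x + toTorus v) • fst ℝ ℝ ℝ + partial₂ f (x + toTorus v) • snd ℝ ℝ ℝ) v := by
  obtain ⟨w, rfl⟩ := isOpenQuotientMap_toTorus.surjective x
  have hd : HasFDerivAt (fun u => f (toTorus w + toTorus u))
      (fderiv ℝ (fun u => f (toTorus w + toTorus u)) v) v := by
    refine DifferentiableAt.hasFDerivAt ?_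
    have : (fun u => f (toTorus w + toTorus u)) = (fun v => f (toTorus v)) ∘ fun u => w + u := rfl
    rw [this]
    exact (hf.differentiable (by simp) _).comp v (by fun_prop)
  convert hd using 1
  set D := fderiv ℝ (fun u => f (toTorus w + toTorus u)) v with hD
  have h1 : partial₁ f (toTorus w + toTorus v) = D (1, 0) := by
    have h : HasDerivAt (fun h : ℝ => v + (h, (0 : ℝ))) (1, 0) 0 := by
      simpa using ((hasDerivAt_id (0 : ℝ)).prodMk (hasDerivAt_const (0 : ℝ) (0 : ℝ))).const_add v
    have hd' : HasFDerivAt (fun u => f (toTorus w + toTorus u)) D (v + ((0 : ℝ), (0 : ℝ))) := by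
      rw [show v + ((0 : ℝ), (0 : ℝ)) = v by simp]; exact hd
    have := (hd'.comp_hasDerivAt (0 : ℝ) h).deriv
    rw [← this, partial₁]
    congr 1; ext h; simp only [comp_apply, toTorus_add, add_assoc]
  have h2 : partial₂ f (toTorus w + toTorus v) = D (0, 1) := by
    have h : HasDerivAt (fun h : ℝ => v + ((0 : ℝ), h)) (0, 1) 0 := by
      simpa using ((hasDerivAt_const (0 : ℝ) (0 : ℝ)).prodMk (hasDerivAt_id (0 : ℝ))).const_add v
    have hd' : HasFDerivAt (fun u => f (toTorus w + toTorus u)) D (v + ((0 : ℝ), (0 : ℝ))) := by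
      rw [show v + ((0 : ℝ), (0 : ℝ)) = v by simp]; exact hd
    have := (hd'.comp_hasDerivAt (0 : ℝ) h).deriv
    rw [← this, partial₂]
    congr 1; ext h; simp only [comp_apply, toTorus_add, add_assoc]
  rw [h1, h2]
  ext <;> simp

lemma hasFDerivAt (hf : SmoothOnTorus f) (v : ℝ × ℝ) :
    HasFDerivAt (fun u => f (toTorus u))
      (partial₁ f (toTorus v) • fst ℝ ℝ ℝ + partial₂ f (toTorus v) • snd ℝ ℝ ℝ) v := by
  simpa using hf.hasFDerivAt_add 0 v

lemma partial₁ (hf : SmoothOnTorus f) : SmoothOnTorus (partial₁ f) := by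
  have h : (fun v => PointVortex.partial₁ f (toTorus v))
      = fun v => fderiv ℝ (fun u => f (toTorus u)) v (1, 0) := by
    ext v; rw [(hf.hasFDerivAt v).fderiv]; simp
  rw [SmoothOnTorus, h]
  exact (hf.fderiv_right (m := ((⊤ : ℕ∞) : WithTop ℕ∞)) (by simp)).clm_apply contDiff_const

lemma partial₂ (hf : SmoothOnTorus f) : SmoothOnTorus (partial₂ f) := by
  have h : (fun v => PointVortex.partial₂ f (toTorus v))
      = fun v => fderiv ℝ (fun u => f (toTorus u)) v (0, 1) := by
    ext v; rw [(hf.hasFDerivAt v).fderiv]; simp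
  rw [SmoothOnTorus, h]
  exact (hf.fderiv_right (m := ((⊤ : ℕ∞) : WithTop ℕ∞)) (by simp)).clm_apply contDiff_const

lemma neg (hf : SmoothOnTorus f) : SmoothOnTorus (fun x => -f x) := ContDiff.neg hf

lemma partial_comm (hf : SmoothOnTorus f) (x : Torus) :
    PointVortex.partial₁ (PointVortex.partial₂ f) x = PointVortex.partial₂ (PointVortex.partial₁ f) x := by
  obtain ⟨v, rfl⟩ := isOpenQuotientMap_toTorus.surjective x
  have hs : IsSymmSndFDerivAt ℝ (fun u => f (toTorus u)) v := (ContDiff.contDiffAt hf).isSymmSndFDerivAt (by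
      simpa using (WithTop.coe_le_coe.mpr le_top : ((2 : ℕ∞) : WithTop ℕ∞) ≤ ((⊤ : ℕ∞) : WithTop ℕ∞)))
  have hdd : HasFDerivAt (fderiv ℝ (fun u => f (toTorus u))) (fderiv ℝ (fderiv ℝ (fun u => f (toTorus u))) v) v :=
    ((hf.fderiv_right (m := ((⊤ : ℕ∞) : WithTop ℕ∞)) (by simp)).differentiable (by simp) v).hasFDerivAt
  have e1 : (fun u => PointVortex.partial₁ f (toTorus u))
      = fun u => fderiv ℝ (fun u => f (toTorus u)) u (1, 0) := by
    ext v; rw [(hf.hasFDerivAt v).fderiv]; simp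
  have e2 : (fun u => PointVortex.partial₂ f (toTorus u))
      = fun u => fderiv ℝ (fun u => f (toTorus u)) u (0, 1) := by
    ext v; rw [(hf.hasFDerivAt v).fderiv]; simp
  have h1 := hf.partial₁.hasFDerivAt v
  have h2 := hf.partial₂.hasFDerivAt v
  rw [e1] at h1; rw [e2] at h2
  have h1' := h1.unique (hdd.clm_apply (hasFDerivAt_const (((1 : ℝ), (0 : ℝ))) v))
  have h2' := h2.unique (hdd.clm_apply (hasFDerivAt_const (((0 : ℝ), (1 : ℝ))) v))
  have k1 := congrArg (fun L => L ((0 : ℝ), (1 : ℝ))) h1'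
  have k2 := congrArg (fun L => L ((1 : ℝ), (0 : ℝ))) h2'
  simp at k1 k2
  rw [k1, k2]
  exact hs (1, 0) (0, 1)

lemma continuous (hf : SmoothOnTorus f) : Continuous f :=
  isOpenQuotientMap_toTorus.continuous_comp_iff.mp (ContDiff.continuous hf)

lemma exists_bound (hf : SmoothOnTorus f) : ∃ C : ℝ, 0 ≤ C ∧ ∀ x, |f x| ≤ C := by
  obtain ⟨C, hC⟩ := isCompact_univ.exists_bound_of_continuousOn hf.continuous.continuousOn
  exact ⟨C, (norm_nonneg _).trans (hC 0 trivial), fun x => hC x trivial⟩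

lemma exists_lipschitz (hf : SmoothOnTorus f) :
    ∃ L : ℝ, 0 ≤ L ∧ ∀ x u v, |f (x + toTorus u) - f (x + toTorus v)| ≤ L * ‖u - v‖ := by
  obtain ⟨C1, h1, hC1⟩ := hf.partial₁.exists_bound
  obtain ⟨C2, h2, hC2⟩ := hf.partial₂.exists_bound
  refine ⟨C1 + C2, by positivity, fun x u v => ?_⟩
  refine Convex.norm_image_sub_le_of_norm_hasFDerivWithin_le (s := univ)
    (fun w _ => (hf.hasFDerivAt_add x w).hasFDerivWithinAt) (fun w _ => ?_) convex_univ trivial trivial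
  refine (norm_add_le _ _).trans ?_
  rw [norm_smul, norm_smul]
  refine add_le_add ?_ ?_
  · exact (mul_le_of_le_one_right (norm_nonneg _) (ContinuousLinearMap.norm_fst_le ℝ ℝ ℝ)).trans (hC1 _)
  · exact (mul_le_of_le_one_right (norm_nonneg _) (ContinuousLinearMap.norm_snd_le ℝ ℝ ℝ)).trans (hC2 _)

end SmoothOnTorus

lemma tendsto_add_toTorus (x : Torus) {g : ℝ → ℝ × ℝ} (hg : Continuous g) (h0 : g 0 = 0) :
    Tendsto (fun h : ℝ => x + toTorus (g h)) (𝓝 0) (𝓝 x) := by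
  have : Continuous (fun h : ℝ => x + toTorus (g h)) := continuous_const.add (continuous_toTorus.comp hg)
  simpa [h0, toTorus_zero] using this.tendsto 0

lemma partial₁_congr {f g : Torus → ℝ} {x : Torus} (h : f =ᶠ[𝓝 x] g) : partial₁ f x = partial₁ g x :=
  EventuallyEq.deriv_eq ((tendsto_add_toTorus x (g := fun h => (h, 0)) (by fun_prop) rfl).eventually h)

lemma partial₂_congr {f g : Torus → ℝ} {x : Torus} (h : f =ᶠ[𝓝 x] g) : partial₂ f x = partial₂ g x :=
  EventuallyEq.deriv_eq ((tendsto_add_toTorus x (g := fun h => (0, h)) (by fun_prop) rfl).eventually h)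

/-! ### Truncation of the Green function -/

/-- A smooth nondecreasing function, equal to the identity on `[-k, ∞)` and constant on
`(-∞, -k - 1]`. -/
def cutoff (k : ℕ) (u : ℝ) : ℝ := ∫ r in (0 : ℝ)..u, smoothTransition (r + k + 1)

lemma continuous_cutoff_deriv (k : ℕ) : Continuous (fun r : ℝ => smoothTransition (r + k + 1)) :=
  smoothTransition.continuous.comp (by fun_prop)

lemma hasDerivAt_cutoff (k : ℕ) (u : ℝ) : HasDerivAt (cutoff k) (smoothTransition (u + k + 1)) u :=
  (continuous_cutoff_deriv k).integral_hasStrictDerivAt 0 u |>.hasDerivAt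

lemma contDiff_cutoff (k : ℕ) : ContDiff ℝ ((⊤ : ℕ∞) : WithTop ℕ∞) (cutoff k) := by
  rw [contDiff_infty_iff_deriv]
  refine ⟨fun u => (hasDerivAt_cutoff k u).differentiableAt, ?_⟩
  have : deriv (cutoff k) = fun u => smoothTransition (u + k + 1) := funext fun u => (hasDerivAt_cutoff k u).deriv
  rw [this]
  exact smoothTransition.contDiff.comp (by fun_prop)

lemma monotone_cutoff (k : ℕ) : Monotone (cutoff k) :=
  monotone_of_hasDerivAt_nonneg (hasDerivAt_cutoff k) fun _ => smoothTransition.nonneg _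

lemma cutoff_of_le {u : ℝ} (hu : -(k : ℝ) ≤ u) : cutoff k u = u := by
  have h : ∫ r in (0 : ℝ)..u, smoothTransition (r + k + 1) = ∫ _ in (0 : ℝ)..u, (1 : ℝ) := by
    refine integral_congr fun r hr => smoothTransition.one_of_one_le ?_
    have := hr.1
    have h0 : -(k : ℝ) ≤ min 0 u := le_min (by simp) hu
    linarith
  rw [cutoff, h]; simp

lemma cutoff_of_le_neg {u : ℝ} (hu : u ≤ -(k : ℝ) - 1) : cutoff k u = cutoff k (-(k : ℝ) - 1) := by
  have hd := intervalIntegral.integral_eq_sub_of_hasDerivAt (a := u) (b := -(k : ℝ) - 1)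
    (fun x _ => hasDerivAt_cutoff k x) ((continuous_cutoff_deriv k).intervalIntegrable _ _)
  have h : ∫ r in u..(-(k : ℝ) - 1), smoothTransition (r + k + 1) = ∫ _ in u..(-(k : ℝ) - 1), (0 : ℝ) := by
    refine integral_congr fun r hr => smoothTransition.zero_of_nonpos ?_
    rw [uIcc_of_le hu] at hr
    linarith [hr.2]
  rw [h] at hd
  simp at hd
  linarith

lemma cutoff_le_neg {u : ℝ} (hu : u ≤ -(k : ℝ)) : cutoff k u ≤ -(k : ℝ) :=
  (monotone_cutoff k hu).trans (cutoff_of_le le_rfl).le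

/-- The slope of the cutoff is at most one, so `u - cutoff k u` is nondecreasing, and it vanishes at
`-k`. Truncation thus only raises the energy, so the untruncated initial energy is a lower bound
valid for all `k`. -/
lemma le_cutoff (k : ℕ) (u : ℝ) : u ≤ cutoff k u := by
  rcases le_total (-(k : ℝ)) u with h | h
  · exact (cutoff_of_le h).ge
  · have hm : Monotone (fun u => u - cutoff k u) :=
      monotone_of_hasDerivAt_nonneg (fun u => (hasDerivAt_id u).sub (hasDerivAt_cutoff k u))
        fun u => sub_nonneg.mpr (smoothTransition.le_one _)
    have := hm h
    simp only [cutoff_of_le (le_refl (-(k : ℝ))), sub_self] at this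
    linarith

lemma cutoff_le_max (k : ℕ) (u : ℝ) : cutoff k u ≤ max u 0 := by
  rcases le_total 0 u with h | h
  · rw [cutoff_of_le (le_trans (by simp) h)]; exact le_max_left _ _
  · refine (monotone_cutoff k h).trans ?_
    rw [cutoff_of_le (by simp)]; exact le_max_right _ _

/-- The truncated Green function. -/
def greenReg (k : ℕ) (z : Torus) : ℝ := if z = 0 then cutoff k (-(k : ℝ) - 1) else cutoff k (green z)

/-- The divergence of the Green function to `-∞` puts a whole neighbourhood of the origin into the
flat part of the cutoff; this is what makes the truncated function smooth. -/
lemma greenReg_eventually_const (k : ℕ) : ∀ᶠ z in 𝓝 (0 : Torus), greenReg k z = greenReg k 0 := by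
  have h := tendsto_green_atBot.eventually (eventually_le_atBot (-(k : ℝ) - 1))
  rw [eventually_nhdsWithin_iff] at h
  filter_upwards [h] with z hz
  by_cases h0 : z = 0
  · rw [h0]
  · rw [greenReg, if_neg h0, greenReg, if_pos rfl, cutoff_of_le_neg (hz h0)]

lemma greenReg_eventually_eq (k : ℕ) (hz : z ≠ 0) : greenReg k =ᶠ[𝓝 z] fun z => cutoff k (green z) := by
  filter_upwards [isOpen_ne.mem_nhds hz] with y hy
  rw [greenReg, if_neg hy]

lemma smoothOnTorus_greenReg (k : ℕ) : SmoothOnTorus (greenReg k) := by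
  refine contDiff_iff_contDiffAt.mpr fun v => ?_
  by_cases hv : toTorus v = 0
  · have h : (fun u => greenReg k (toTorus u)) =ᶠ[𝓝 v] fun _ => greenReg k 0 := by
      have ht : Tendsto toTorus (𝓝 v) (𝓝 0) := hv ▸ continuous_toTorus.tendsto v
      exact ht.eventually (greenReg_eventually_const k)
    exact contDiffAt_const.congr_of_eventuallyEq h
  · have h : (fun u => greenReg k (toTorus u)) =ᶠ[𝓝 v] fun u => cutoff k (green (toTorus u)) :=
      (continuous_toTorus.tendsto v).eventually (greenReg_eventually_eq k hv)
    refine ContDiffAt.congr_of_eventuallyEq ?_ h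
    refine (contDiff_cutoff k).contDiffAt.comp v (contDiffAt_infty.mpr fun n => ?_)
    have h1 := contDiffAt_green hv n
    have e : (fun u => green (toTorus u)) = (fun w => green (toTorus v + toTorus w)) ∘ fun u => u - v := by
      ext u; simp [← toTorus_add]
    rw [e]
    refine ContDiffAt.comp v ?_ (by fun_prop)
    simpa using h1

lemma differentiableAt_green (hz : z ≠ 0) (g : ℝ → ℝ × ℝ) (hg : DifferentiableAt ℝ g 0)
    (h0 : g 0 = 0) : DifferentiableAt ℝ (fun h => green (z + toTorus (g h))) 0 := by
  have h1 : DifferentiableAt ℝ (fun v => green (z + toTorus v)) (g 0) := by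
    rw [h0]; exact (contDiffAt_green hz 1).differentiableAt (by simp)
  exact h1.comp (0 : ℝ) hg

lemma partial₁_greenReg (k : ℕ) (hz : z ≠ 0) :
    partial₁ (greenReg k) z = smoothTransition (green z + k + 1) * partial₁ green z := by
  rw [partial₁_congr (greenReg_eventually_eq k hz), partial₁, partial₁]
  have hd := (differentiableAt_green hz (fun h => (h, 0)) (by fun_prop) rfl).hasDerivAt
  have h0 : green z = green (z + toTorus ((0 : ℝ), (0 : ℝ))) := by
    rw [show toTorus ((0 : ℝ), (0 : ℝ)) = 0 from rfl, add_zero]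
  rw [h0]
  exact ((hasDerivAt_cutoff k _).comp (0 : ℝ) hd).deriv

lemma partial₂_greenReg (k : ℕ) (hz : z ≠ 0) :
    partial₂ (greenReg k) z = smoothTransition (green z + k + 1) * partial₂ green z := by
  rw [partial₂_congr (greenReg_eventually_eq k hz), partial₂, partial₂]
  have hd := (differentiableAt_green hz (fun h => (0, h)) (by fun_prop) rfl).hasDerivAt
  have h0 : green z = green (z + toTorus ((0 : ℝ), (0 : ℝ))) := by
    rw [show toTorus ((0 : ℝ), (0 : ℝ)) = 0 from rfl, add_zero]
  rw [h0]
  exact ((hasDerivAt_cutoff k _).comp (0 : ℝ) hd).deriv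

lemma partial₁_greenReg_zero (k : ℕ) : partial₁ (greenReg k) 0 = 0 := by
  rw [partial₁_congr (g := fun _ => greenReg k 0) (greenReg_eventually_const k)]
  simp [partial₁]

lemma partial₂_greenReg_zero (k : ℕ) : partial₂ (greenReg k) 0 = 0 := by
  rw [partial₂_congr (g := fun _ => greenReg k 0) (greenReg_eventually_const k)]
  simp [partial₂]

/-- The slope of the cutoff lies in `[0, 1]`; hence bounds by the true gradient are uniform in `k`.
-/
lemma abs_partial₁_greenReg_le (k : ℕ) (z : Torus) : |partial₁ (greenReg k) z| ≤ |partial₁ green z| := by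
  by_cases hz : z = 0
  · rw [hz, partial₁_greenReg_zero, abs_zero]; positivity
  · rw [partial₁_greenReg k hz, abs_mul, abs_of_nonneg (smoothTransition.nonneg _)]
    exact mul_le_of_le_one_left (abs_nonneg _) (smoothTransition.le_one _)

lemma abs_partial₂_greenReg_le (k : ℕ) (z : Torus) : |partial₂ (greenReg k) z| ≤ |partial₂ green z| := by
  by_cases hz : z = 0
  · rw [hz, partial₂_greenReg_zero, abs_zero]; positivity
  · rw [partial₂_greenReg k hz, abs_mul, abs_of_nonneg (smoothTransition.nonneg _)]
    exact mul_le_of_le_one_left (abs_nonneg _) (smoothTransition.le_one _)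

/-- The truncated Biot-Savart kernel, as a function of `x - y`. -/
def kernelReg (k : ℕ) (z : Torus) : ℝ × ℝ := (partial₂ (greenReg k) z, -partial₁ (greenReg k) z)

/-- A truncated value above `-k` is attained only where the cutoff is the identity. The hypothesis
concerns the truncated function, so it can be checked along the truncated flow alone. -/
lemma kernelReg_eq_biotSavart {x y : Torus} (h : -(k : ℝ) < greenReg k (x - y)) :
    kernelReg k (x - y) = biotSavart x y := by
  have hz : x - y ≠ 0 := by
    intro h0
    rw [h0, greenReg, if_pos rfl] at h
    exact absurd (cutoff_le_neg (by linarith)) (not_le.mpr h)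
  have hg : -(k : ℝ) ≤ green (x - y) := by
    by_contra h'
    rw [greenReg, if_neg hz] at h
    exact absurd (cutoff_le_neg (not_le.mp h').le) (not_le.mpr h)
  rw [kernelReg, biotSavart, partial₁_greenReg k hz, partial₂_greenReg k hz,
    smoothTransition.one_of_one_le (by linarith), one_mul, one_mul]

lemma greenReg_neg (k : ℕ) (z : Torus) : greenReg k (-z) = greenReg k z := by simp [greenReg, green_neg]

lemma partial₁_neg_of_even {f : Torus → ℝ} (hf : ∀ z, f (-z) = f z) (z : Torus) :
    partial₁ f (-z) = -partial₁ f z := by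
  have e : (fun h : ℝ => f (-z + toTorus (h, 0))) = (fun h : ℝ => f (z + toTorus (h, 0))) ∘ Neg.neg := by
    ext h
    rw [comp_apply, ← hf]
    congr 1
    rw [neg_add, neg_neg, ← toTorus_neg]
    simp
  rw [partial₁, partial₁, e]
  have := deriv_comp_neg (fun h : ℝ => f (z + toTorus (h, 0))) 0
  rw [neg_zero] at this
  exact this

lemma partial₂_neg_of_even {f : Torus → ℝ} (hf : ∀ z, f (-z) = f z) (z : Torus) :
    partial₂ f (-z) = -partial₂ f z := by
  have e : (fun h : ℝ => f (-z + toTorus (0, h))) = (fun h : ℝ => f (z + toTorus (0, h))) ∘ Neg.neg := by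
    ext h
    rw [comp_apply, ← hf]
    congr 1
    rw [neg_add, neg_neg, ← toTorus_neg]
    simp
  rw [partial₂, partial₂, e]
  have := deriv_comp_neg (fun h : ℝ => f (z + toTorus (0, h))) 0
  rw [neg_zero] at this
  exact this

lemma kernelReg_neg (k : ℕ) (z : Torus) : kernelReg k (-z) = -kernelReg k z := by
  rw [kernelReg, kernelReg, partial₁_neg_of_even (greenReg_neg k), partial₂_neg_of_even (greenReg_neg k)]
  simp

/-- Near the origin the Green function is negative, elsewhere it is continuous on a compact set. An
upper bound for single terms lets a lower bound on the total energy control every pair. -/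
lemma exists_greenReg_le : ∃ C : ℝ, 0 ≤ C ∧ ∀ k z, greenReg k z ≤ C := by
  have h := tendsto_green_atBot.eventually (eventually_le_atBot (0 : ℝ))
  rw [eventually_nhdsWithin_iff] at h
  obtain ⟨U, hU, hUo, h0⟩ := mem_nhds_iff.mp h
  have hc : IsCompact Uᶜ := hUo.isClosed_compl.isCompact
  have hcont : ContinuousOn green Uᶜ := by
    intro z hz
    have hz0 : z ≠ 0 := fun h => hz (h ▸ h0)
    refine ContinuousAt.continuousWithinAt ?_
    rw [continuousAt_iff_toTorus]
    exact (contDiffAt_green hz0 0).continuousAt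
  obtain ⟨C, hC⟩ := hc.exists_bound_of_continuousOn hcont
  refine ⟨max C 0, le_max_right _ _, fun k z => ?_⟩
  by_cases hz : z = 0
  · rw [greenReg, if_pos hz]
    refine (cutoff_le_neg (by linarith)).trans (le_trans ?_ (le_max_right _ _))
    simp
  · rw [greenReg, if_neg hz]
    refine (cutoff_le_max k _).trans (max_le ?_ (le_max_right _ _))
    by_cases hzU : z ∈ U
    · exact (hU hzU hz).trans (le_max_right _ _)
    · exact ((le_abs_self _).trans (hC z hzU)).trans (le_max_left _ _)

/-! ### Picard iteration with parameters -/

section Picard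

variable {Q E : Type*} [MeasurableSpace Q] [NormedAddCommGroup E] [NormedSpace ℝ E]
  [MeasurableSpace E] [BorelSpace E] [SecondCountableTopology E]

/-- A jointly measurable time-dependent vector field with parameters, bounded and Lipschitz for
each value of the parameter. -/
structure IsLipField (v : Q → ℝ → E → E) (B L : Q → ℝ) : Prop where
  measurable : Measurable (fun p : Q × ℝ × E => v p.1 p.2.1 p.2.2)
  bound : ∀ ρ s y, ‖v ρ s y‖ ≤ B ρ
  lip : ∀ ρ s y y', ‖v ρ s y - v ρ s y'‖ ≤ L ρ * ‖y - y'‖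
  lip_nonneg : ∀ ρ, 0 ≤ L ρ

/-- The Picard iterates for the equation `y' = v(s, y)`, `y(0) = 0`. -/
def picard (v : Q → ℝ → E → E) : ℕ → Q → ℝ → E
  | 0, _, _ => 0
  | m + 1, ρ, t => ∫ s in (0 : ℝ)..t, v ρ s (picard v m ρ s)

/-- The solution of `y' = v(s, y)`, `y(0) = 0`. -/
def flow (v : Q → ℝ → E → E) (ρ : Q) (t : ℝ) : E := limUnder atTop (fun m => picard v m ρ (max t 0))

/-- The variable endpoint is absorbed into the indicator of a planar set, which leaves a parametric
integral over the whole line. -/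
lemma measurable_intervalIntegral {f : Q × ℝ → E} (hf : Measurable f) :
    Measurable (fun q : Q × ℝ => ∫ s in (0 : ℝ)..q.2, f (q.1, s)) := by
  have key : ∀ S : Set (ℝ × ℝ), MeasurableSet S → Measurable (fun q : Q × ℝ =>
      ∫ s, S.indicator (fun p => f (q.1, p.2)) (q.2, s)) := by
    intro S hS
    refine (StronglyMeasurable.integral_prod_right (f := fun (q : Q × ℝ) (s : ℝ) =>
      S.indicator (fun p => f (q.1, p.2)) (q.2, s)) ?_).measurable
    have : (Function.uncurry fun (q : Q × ℝ) (s : ℝ) => S.indicator (fun p => f (q.1, p.2)) (q.2, s))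
        = ((fun p : (Q × ℝ) × ℝ => (p.1.2, p.2)) ⁻¹' S).indicator (fun p => f (p.1.1, p.2)) := by
      ext p
      rfl
    rw [this]
    exact ((hf.comp (by fun_prop)).indicator (hS.preimage (by fun_prop))).stronglyMeasurable
  have h1 := key {p | p.2 ∈ Ioc 0 p.1}
    ((measurableSet_lt measurable_const measurable_snd).inter (measurableSet_le measurable_snd measurable_fst))
  have h2 := key {p | p.2 ∈ Ioc p.1 0}
    ((measurableSet_lt measurable_fst measurable_snd).inter (measurableSet_le measurable_snd measurable_const))
  convert h1.sub h2 using 2 with q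
  rw [intervalIntegral, ← integral_indicator measurableSet_Ioc, ← integral_indicator measurableSet_Ioc]
  rfl

namespace IsLipField

variable {v : Q → ℝ → E → E} {B L : Q → ℝ}

lemma bound_nonneg (hv : IsLipField v B L) (ρ : Q) : 0 ≤ B ρ := (norm_nonneg _).trans (hv.bound ρ 0 0)

lemma measurable_picard (hv : IsLipField v B L) (m : ℕ) : Measurable (fun q : Q × ℝ => picard v m q.1 q.2) := by
  induction m with
  | zero => exact measurable_const
  | succ m ih =>
    exact measurable_intervalIntegral (f := fun q => v q.1 q.2 (picard v m q.1 q.2))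
      (hv.measurable.comp (measurable_fst.prodMk (measurable_snd.prodMk ih)))

lemma intervalIntegrable (hv : IsLipField v B L) (ρ : Q) {y : ℝ → E} {a b : ℝ}
    (hy : AEStronglyMeasurable y (volume.restrict (uIoc a b))) :
    IntervalIntegrable (fun s => v ρ s (y s)) volume a b := by
  rw [intervalIntegrable_iff]
  refine Integrable.mono' (g := fun _ => B ρ) (integrableOn_const (by simp)) ?_
    (.of_forall fun s => hv.bound ρ s _)
  exact (hv.measurable.comp_aemeasurable (aemeasurable_const.prodMk
    (aemeasurable_id.prodMk hy.aemeasurable))).aestronglyMeasurable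

/-- One Picard step in the form that reproduces itself: integrating `s^m / m!` gives the next term
of the exponential series. -/
lemma norm_integral_sub_le (hv : IsLipField v B L) (ρ : Q) {y z : ℝ → E} {C t : ℝ} (m : ℕ) (ht : 0 ≤ t)
    (hy : AEStronglyMeasurable y (volume.restrict (uIoc 0 t)))
    (hz : AEStronglyMeasurable z (volume.restrict (uIoc 0 t)))
    (h : ∀ s ∈ Icc 0 t, ‖y s - z s‖ ≤ C * s ^ m / m.factorial) :
    ‖(∫ s in (0 : ℝ)..t, v ρ s (y s)) - ∫ s in (0 : ℝ)..t, v ρ s (z s)‖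
      ≤ L ρ * C * t ^ (m + 1) / (m + 1).factorial := by
  rw [← intervalIntegral.integral_sub (hv.intervalIntegrable ρ hy) (hv.intervalIntegrable ρ hz)]
  have hb : ∀ s ∈ Ioc 0 t, ‖v ρ s (y s) - v ρ s (z s)‖ ≤ L ρ * (C * s ^ m / m.factorial) :=
    fun s hs => (hv.lip ρ s _ _).trans (mul_le_mul_of_nonneg_left (h s ⟨hs.1.le, hs.2⟩) (hv.lip_nonneg ρ))
  refine (intervalIntegral.norm_integral_le_of_norm_le ht (.of_forall hb)
    (Continuous.intervalIntegrable (by fun_prop) _ _)).trans (le_of_eq ?_)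
  have : (fun s : ℝ => L ρ * (C * s ^ m / m.factorial)) = fun s => (L ρ * C / m.factorial) * s ^ m := by
    ext s; ring
  rw [this, intervalIntegral.integral_const_mul, integral_pow, Nat.factorial_succ]
  push_cast
  field_simp
  simp

lemma aestronglyMeasurable_picard (hv : IsLipField v B L) (ρ : Q) (m : ℕ) (S : Set ℝ) :
    AEStronglyMeasurable (picard v m ρ) (volume.restrict S) :=
  ((hv.measurable_picard m).comp (measurable_const.prodMk measurable_id)).aestronglyMeasurable

/-- An arbitrary solution is compared with the iterates rather than with another solution. Since the
bound tends to zero, every solution is their limit, which is uniqueness. -/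
lemma norm_sub_picard_le (hv : IsLipField v B L) (ρ : Q) {y : ℝ → E} {T : ℝ}
    (hy : AEStronglyMeasurable y (volume.restrict (Icc 0 T)))
    (h : ∀ t ∈ Icc 0 T, y t = ∫ s in (0 : ℝ)..t, v ρ s (y s)) (m : ℕ) :
    ∀ t ∈ Icc 0 T, ‖y t - picard v m ρ t‖ ≤ B ρ * L ρ ^ m * t ^ (m + 1) / (m + 1).factorial := by
  have hsub : ∀ t ∈ Icc 0 T, uIoc 0 t ⊆ Icc 0 T := by
    intro t ht s hs
    rw [uIoc_of_le ht.1] at hs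
    exact ⟨hs.1.le, hs.2.trans ht.2⟩
  induction m with
  | zero =>
    intro t ht
    rw [h t ht, picard, sub_zero]
    refine (intervalIntegral.norm_integral_le_of_norm_le_const fun s _ => hv.bound ρ s _).trans ?_
    simp [abs_of_nonneg ht.1]
  | succ m ih =>
    intro t ht
    have hyt := hy.mono_measure (Measure.restrict_mono_set volume (hsub t ht))
    have h1 := hv.norm_integral_sub_le ρ (C := B ρ * L ρ ^ m) (m + 1) ht.1 hyt
      (hv.aestronglyMeasurable_picard ρ m _) (fun s hs => ih s ⟨hs.1, hs.2.trans ht.2⟩)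
    rw [← h t ht] at h1
    refine (le_of_eq ?_).trans (h1.trans (le_of_eq ?_))
    · rfl
    · ring

lemma tendsto_bound (B L t : ℝ) :
    Tendsto (fun m : ℕ => B * L ^ m * t ^ (m + 1) / (m + 1).factorial) atTop (𝓝 0) := by
  have hs : Summable (fun m : ℕ => B * L ^ m * t ^ (m + 1) / (m + 1).factorial) := by
    have h := (Real.summable_pow_div_factorial (|L * t|)).mul_left (|B| * |t|)
    refine Summable.of_norm_bounded h fun m => ?_
    rw [norm_eq_abs, abs_div, abs_mul, abs_mul, abs_pow, abs_pow, abs_mul, mul_pow,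
      abs_of_nonneg (by positivity : (0 : ℝ) ≤ ((m + 1).factorial : ℝ)), pow_succ]
    have h2 : (m.factorial : ℝ) ≤ (m + 1).factorial := mod_cast Nat.factorial_le (Nat.le_succ m)
    calc |B| * |L| ^ m * (|t| ^ m * |t|) / (m + 1).factorial
        ≤ |B| * |L| ^ m * (|t| ^ m * |t|) / m.factorial := by gcongr
      _ = _ := by ring
  exact hs.tendsto_atTop_zero

lemma tendsto_picard_of_solution (hv : IsLipField v B L) (ρ : Q) {y : ℝ → E} {T : ℝ}
    (hy : AEStronglyMeasurable y (volume.restrict (Icc 0 T)))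
    (h : ∀ t ∈ Icc 0 T, y t = ∫ s in (0 : ℝ)..t, v ρ s (y s)) (ht : t ∈ Icc 0 T) :
    Tendsto (fun m => picard v m ρ t) atTop (𝓝 (y t)) := by
  rw [tendsto_iff_norm_sub_tendsto_zero]
  refine squeeze_zero (fun _ => norm_nonneg _) (fun m => ?_) (tendsto_bound (B ρ) (L ρ) t)
  rw [norm_sub_rev]
  exact hv.norm_sub_picard_le ρ hy h m t ht

/-- Uniqueness of solutions. -/
lemma eq_flow (hv : IsLipField v B L) (ρ : Q) {y : ℝ → E} {T : ℝ}
    (hy : AEStronglyMeasurable y (volume.restrict (Icc 0 T)))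
    (h : ∀ t ∈ Icc 0 T, y t = ∫ s in (0 : ℝ)..t, v ρ s (y s)) (ht : t ∈ Icc 0 T) :
    y t = flow v ρ t := by
  have := (hv.tendsto_picard_of_solution ρ hy h ht).limUnder_eq
  rw [flow, max_eq_left ht.1, this]

lemma norm_picard_succ_sub_le (hv : IsLipField v B L) (ρ : Q) (m : ℕ) (ht : 0 ≤ t) :
    ‖picard v (m + 1) ρ t - picard v m ρ t‖ ≤ B ρ * L ρ ^ m * t ^ (m + 1) / (m + 1).factorial := by
  induction m generalizing t with
  | zero =>
    rw [picard, picard, sub_zero]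
    refine (intervalIntegral.norm_integral_le_of_norm_le_const fun s _ => hv.bound ρ s _).trans ?_
    simp [abs_of_nonneg ht]
  | succ m ih =>
    have h1 := hv.norm_integral_sub_le ρ (C := B ρ * L ρ ^ m) (m + 1) ht
      (hv.aestronglyMeasurable_picard ρ (m + 1) _) (hv.aestronglyMeasurable_picard ρ m _)
      (fun s hs => ih hs.1)
    refine (le_of_eq ?_).trans (h1.trans (le_of_eq ?_))
    · rfl
    · ring

variable [CompleteSpace E]

lemma tendsto_picard (hv : IsLipField v B L) (ρ : Q) (t : ℝ) :
    Tendsto (fun m => picard v m ρ (max t 0)) atTop (𝓝 (flow v ρ t)) := by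
  have hs : Summable (fun m : ℕ => B ρ * L ρ ^ m * (max t 0) ^ (m + 1) / (m + 1).factorial) := by
    have h := (Real.summable_pow_div_factorial (|L ρ * max t 0|)).mul_left (|B ρ| * |max t 0|)
    refine Summable.of_norm_bounded h fun m => ?_
    rw [norm_eq_abs, abs_div, abs_mul, abs_mul, abs_pow, abs_pow, abs_mul, mul_pow,
      abs_of_nonneg (by positivity : (0 : ℝ) ≤ ((m + 1).factorial : ℝ)), pow_succ]
    have h2 : (m.factorial : ℝ) ≤ (m + 1).factorial := mod_cast Nat.factorial_le (Nat.le_succ m)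
    calc |B ρ| * |L ρ| ^ m * (|max t 0| ^ m * |max t 0|) / (m + 1).factorial
        ≤ |B ρ| * |L ρ| ^ m * (|max t 0| ^ m * |max t 0|) / m.factorial := by gcongr
      _ = _ := by ring
  have hc : CauchySeq (fun m => picard v m ρ (max t 0)) := by
    refine cauchySeq_of_dist_le_of_summable _ (fun m => ?_) hs
    rw [dist_eq_norm, norm_sub_rev]
    exact hv.norm_picard_succ_sub_le ρ m (le_max_right _ _)
  exact hc.tendsto_limUnder

/-- The iterates are jointly measurable in parameter and time, and measurability passes to their
limit. Replacing `t` by `max t 0` in `flow` makes the iterates converge at every real time. -/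
lemma measurable_flow (hv : IsLipField v B L) : Measurable (fun q : Q × ℝ => flow v q.1 q.2) := by
  refine measurable_of_tendsto_metrizable (f := fun m (q : Q × ℝ) => picard v m q.1 (max q.2 0))
    (fun m => (hv.measurable_picard m).comp (measurable_fst.prodMk (measurable_snd.max measurable_const))) ?_
  exact tendsto_pi_nhds.mpr fun q => hv.tendsto_picard q.1 q.2

lemma flow_eq (hv : IsLipField v B L) (ρ : Q) (ht : 0 ≤ t) :
    flow v ρ t = ∫ s in (0 : ℝ)..t, v ρ s (flow v ρ s) := by
  have h1 : Tendsto (fun m => picard v (m + 1) ρ t) atTop (𝓝 (flow v ρ t)) := by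
    have := (hv.tendsto_picard ρ t).comp (tendsto_add_atTop_nat 1)
    simpa only [max_eq_left ht, comp_def] using this
  refine tendsto_nhds_unique h1 ?_
  refine intervalIntegral.tendsto_integral_filter_of_dominated_convergence (fun _ => B ρ)
    (.of_forall fun m => ?_) (.of_forall fun m => ?_) (by simp) ?_
  · exact (hv.intervalIntegrable ρ (hv.aestronglyMeasurable_picard ρ m _)).aestronglyMeasurable_restrict_uIoc
  · exact .of_forall fun s _ => hv.bound ρ s _
  · refine .of_forall fun s hs => ?_
    rw [uIoc_of_le ht] at hs
    have hp : Tendsto (fun m => picard v m ρ s) atTop (𝓝 (flow v ρ s)) := by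
      simpa only [max_eq_left hs.1.le] using hv.tendsto_picard ρ s
    have hlip : Continuous (v ρ s) := by
      refine (LipschitzWith.of_dist_le_mul (K := ⟨L ρ, hv.lip_nonneg ρ⟩) fun y y' => ?_).continuous
      rw [dist_eq_norm, dist_eq_norm]; exact hv.lip ρ s y y'
    exact (hlip.tendsto _).comp hp

lemma aestronglyMeasurable_flow (hv : IsLipField v B L) (ρ : Q) (S : Set ℝ) :
    AEStronglyMeasurable (flow v ρ) (volume.restrict S) :=
  (hv.measurable_flow.comp (measurable_const.prodMk measurable_id)).aestronglyMeasurable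

lemma norm_flow_sub_le (hv : IsLipField v B L) (ρ : Q) (hs : 0 ≤ s) (hst : s ≤ t) :
    ‖flow v ρ t - flow v ρ s‖ ≤ B ρ * (t - s) := by
  rw [hv.flow_eq ρ hs, hv.flow_eq ρ (hs.trans hst), intervalIntegral.integral_interval_sub_left
    (hv.intervalIntegrable ρ (hv.aestronglyMeasurable_flow ρ _))
    (hv.intervalIntegrable ρ (hv.aestronglyMeasurable_flow ρ _))]
  refine (intervalIntegral.norm_integral_le_of_norm_le_const fun r _ => hv.bound ρ r _).trans ?_
  rw [abs_of_nonneg (by linarith)]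

lemma continuousOn_flow (hv : IsLipField v B L) (ρ : Q) : ContinuousOn (flow v ρ) (Ici 0) := by
  have : LipschitzOnWith ⟨B ρ, hv.bound_nonneg ρ⟩ (flow v ρ) (Ici 0) := by
    refine LipschitzOnWith.of_dist_le_mul fun s hs t ht => ?_
    rw [dist_eq_norm, Real.dist_eq]
    rcases le_total s t with h | h
    · rw [norm_sub_rev, abs_sub_comm, abs_of_nonneg (sub_nonneg.mpr h)]
      exact hv.norm_flow_sub_le ρ hs h
    · rw [abs_of_nonneg (sub_nonneg.mpr h)]
      exact hv.norm_flow_sub_le ρ ht h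
  exact this.continuousOn

end IsLipField

end Picard

/-! ### Instances -/

instance instIsProbabilityMeasureUnitAddCircle : IsProbabilityMeasure (volume : Measure UnitAddCircle) :=
  ⟨by rw [UnitAddCircle.measure_univ]⟩

instance instIsProbabilityMeasureTorus : IsProbabilityMeasure (volume : Measure Torus) :=
  inferInstanceAs (IsProbabilityMeasure ((volume : Measure UnitAddCircle).prod (volume : Measure UnitAddCircle)))

instance instIsAddHaarMeasureTorus : (volume : Measure Torus).IsAddHaarMeasure :=
  inferInstanceAs ((volume : Measure UnitAddCircle).prod (volume : Measure UnitAddCircle)).IsAddHaarMeasure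

instance instIsProbabilityMeasurePiTorus {ι : Type*} [Fintype ι] :
    IsProbabilityMeasure (volume : Measure (ι → Torus)) :=
  inferInstanceAs (IsProbabilityMeasure (Measure.pi fun _ : ι => (volume : Measure Torus)))

instance instBorelSpacePiTorusProd (N : ℕ) : BorelSpace (Pos N × Torus) :=
  haveI : BorelSpace (Pos N) := Pi.borelSpace
  Prod.borelSpace

/-! ### Shears of the torus -/

/-- Lifted to the line, `t ↦ t + w(t)` carries the period `[0, 1]` to the period `[w(0), w(0) + 1]`,
by periodicity of `w`. Substitution needs no injectivity, so the displacement need not be small. -/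
lemma UnitAddCircle.integral_comp_add_mul {ψ : UnitAddCircle → ℝ} (hψ : Continuous ψ)
    {w w' : UnitAddCircle → ℝ} (hw' : Continuous w')
    (hw : ∀ t : ℝ, HasDerivAt (fun t : ℝ => w t) (w' t) t) :
    ∫ x, ψ (x + (w x : ℝ)) * (1 + w' x) = ∫ x, ψ x := by
  have hmk : Continuous (fun t : ℝ => (t : UnitAddCircle)) := AddCircle.continuous_mk' 1
  rw [← UnitAddCircle.intervalIntegral_preimage 0, ← UnitAddCircle.intervalIntegral_preimage (w 0)]
  have h := intervalIntegral.integral_comp_mul_deriv (a := 0) (b := 0 + 1)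
    (f := fun t : ℝ => t + w t) (f' := fun t : ℝ => 1 + w' t)
    (g := fun t : ℝ => ψ (t : UnitAddCircle))
    (fun t _ => (hasDerivAt_id t).add (hw t)) (by fun_prop) (by fun_prop)
  have e1 : (0 : ℝ) + 1 + w ((0 + 1 : ℝ) : UnitAddCircle) = w 0 + 1 := by
    have : ((0 + 1 : ℝ) : UnitAddCircle) = 0 := by simp
    rw [this]; ring
  have e0 : (0 : ℝ) + w ((0 : ℝ) : UnitAddCircle) = w 0 := by simp
  rw [e1, e0] at h
  rw [← h]
  simp

lemma continuous_smul_toTorus {E : Type*} [TopologicalSpace E] {f g : E → ℝ} (hf : Continuous f)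
    (hg : Continuous g) : Continuous (fun x => toTorus (f x, g x)) :=
  continuous_toTorus.comp (hf.prodMk hg)

lemma integrable_of_continuous {E : Type*} [TopologicalSpace E] [CompactSpace E] [MeasurableSpace E]
    [OpensMeasurableSpace E] (μ : Measure E) [IsFiniteMeasure μ] {g : E → ℝ} (hg : Continuous g) :
    Integrable g μ := by
  obtain ⟨C, hC⟩ := isCompact_univ.exists_bound_of_continuousOn hg.continuousOn
  exact Integrable.of_bound hg.measurable.aestronglyMeasurable C (.of_forall fun x => hC x trivial)

lemma integral_shear₁ {g h : Torus → ℝ} (hg : Continuous g) (hh : SmoothOnTorus h) (c : ℝ) :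
    ∫ z, g (z + toTorus (c * h z, 0)) * (1 + c * partial₁ h z) = ∫ z, g z := by
  have hc : Continuous (fun z => g (z + toTorus (c * h z, 0)) * (1 + c * partial₁ h z)) := by
    have h1 := hh.continuous
    have h2 := hh.partial₁.continuous
    have h3 : Continuous (fun z : Torus => toTorus (c * h z, 0)) :=
      continuous_smul_toTorus (by fun_prop) continuous_const
    fun_prop
  rw [volume_eq_prod, integral_prod_symm _ (integrable_of_continuous _ hc),
    integral_prod_symm _ (integrable_of_continuous _ hg)]
  refine integral_congr_ae (.of_forall fun b => ?_)
  have := UnitAddCircle.integral_comp_add_mul (ψ := fun x => g (x, b)) (by fun_prop)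
    (w := fun x => c * h (x, b)) (w' := fun x => c * partial₁ h (x, b))
    (by have := hh.partial₁.continuous; fun_prop) (fun t => by
      obtain ⟨b, rfl⟩ := QuotientAddGroup.mk_surjective b
      have h1 := (hh.hasFDerivAt (t, b)).comp_hasDerivAt t ((hasDerivAt_id t).prodMk (hasDerivAt_const t b))
      have h2 := h1.const_mul c
      refine h2.congr_deriv ?_
      simp [toTorus])
  refine Eq.trans ?_ this
  refine integral_congr_ae (.of_forall fun x => ?_)
  have e : (x, b) + toTorus (c * h (x, b), 0) = (x + ((c * h (x, b) : ℝ) : UnitAddCircle), b) := by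
    ext <;> simp [toTorus]
  simp only [e]

lemma integral_shear₂ {g h : Torus → ℝ} (hg : Continuous g) (hh : SmoothOnTorus h) (c : ℝ) :
    ∫ z, g (z + toTorus (0, c * h z)) * (1 + c * partial₂ h z) = ∫ z, g z := by
  have hc : Continuous (fun z => g (z + toTorus (0, c * h z)) * (1 + c * partial₂ h z)) := by
    have h1 := hh.continuous
    have h2 := hh.partial₂.continuous
    have h3 : Continuous (fun z : Torus => toTorus (0, c * h z)) :=
      continuous_smul_toTorus continuous_const (by fun_prop)
    fun_prop
  rw [volume_eq_prod, integral_prod _ (integrable_of_continuous _ hc),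
    integral_prod _ (integrable_of_continuous _ hg)]
  refine integral_congr_ae (.of_forall fun b => ?_)
  have := UnitAddCircle.integral_comp_add_mul (ψ := fun x => g (b, x)) (by fun_prop)
    (w := fun x => c * h (b, x)) (w' := fun x => c * partial₂ h (b, x))
    (by have := hh.partial₂.continuous; fun_prop) (fun t => by
      obtain ⟨b, rfl⟩ := QuotientAddGroup.mk_surjective b
      have h1 := (hh.hasFDerivAt (b, t)).comp_hasDerivAt t ((hasDerivAt_const t b).prodMk (hasDerivAt_id t))
      have h2 := h1.const_mul c
      refine h2.congr_deriv ?_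
      simp [toTorus])
  refine Eq.trans ?_ this
  refine integral_congr_ae (.of_forall fun x => ?_)
  have e : (b, x) + toTorus (0, c * h (b, x)) = (b, x + ((c * h (b, x) : ℝ) : UnitAddCircle)) := by
    ext <;> simp [toTorus]
  simp only [e]

/-! ### Kernels without divergence -/

/-- A smooth divergence-free vector field on the torus, with bounds. -/
structure IsDivFree (K : Torus → ℝ × ℝ) : Prop where
  smooth₁ : SmoothOnTorus fun z => (K z).1
  smooth₂ : SmoothOnTorus fun z => (K z).2
  div : ∀ z, partial₁ (fun z => (K z).1) z + partial₂ (fun z => (K z).2) z = 0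

lemma isDivFree_kernelReg (k : ℕ) : IsDivFree (kernelReg k) where
  smooth₁ := (smoothOnTorus_greenReg k).partial₂
  smooth₂ := (smoothOnTorus_greenReg k).partial₁.neg
  div z := by
    have h1 : partial₂ (fun z => (kernelReg k z).2) z = -partial₂ (partial₁ (greenReg k)) z := by
      simp only [kernelReg, partial₂]
      exact deriv.fun_neg
    rw [h1]
    simp only [kernelReg]
    have := (smoothOnTorus_greenReg k).partial_comm z
    rw [← this]
    exact add_neg_cancel _

namespace IsDivFree

variable {K : Torus → ℝ × ℝ}

lemma continuous (hK : IsDivFree K) : Continuous K := hK.smooth₁.continuous.prodMk hK.smooth₂.continuous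

lemma exists_bound (hK : IsDivFree K) : ∃ C : ℝ, 0 ≤ C ∧ (∀ z, ‖K z‖ ≤ C) ∧
    ∀ x u v, ‖K (x + toTorus u) - K (x + toTorus v)‖ ≤ C * ‖u - v‖ := by
  obtain ⟨C1, h1, hC1⟩ := hK.smooth₁.exists_bound
  obtain ⟨C2, h2, hC2⟩ := hK.smooth₂.exists_bound
  obtain ⟨L1, k1, hL1⟩ := hK.smooth₁.exists_lipschitz
  obtain ⟨L2, k2, hL2⟩ := hK.smooth₂.exists_lipschitz
  refine ⟨C1 + C2 + L1 + L2, by positivity, fun z => ?_, fun x u v => ?_⟩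
  · refine max_le ((hC1 z).trans ?_) ((hC2 z).trans ?_) <;> linarith
  · refine max_le ((hL1 x u v).trans ?_) ((hL2 x u v).trans ?_) <;> gcongr <;> linarith

/-- An approximation of the flow of `c K` at time `1`, composed of two shears. -/
def _root_.PointVortex.pairDisp (K : Torus → ℝ × ℝ) (c : ℝ) (z : Torus) : ℝ × ℝ :=
  (c * (K z).1, c * (K (z + toTorus (c * (K z).1, 0))).2)

lemma continuous_pairDisp (hK : IsDivFree K) (c : ℝ) : Continuous (pairDisp K c) := by
  have h := hK.continuous
  have h1 : Continuous (fun z : Torus => toTorus (c * (K z).1, 0)) :=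
    continuous_smul_toTorus (by fun_prop) continuous_const
  unfold pairDisp
  fun_prop

/-- The two shears have Jacobians `1 + c ∂₁K₁` and `1 + c ∂₂K₂`. Their first order terms cancel
because the divergence vanishes, up to the Lipschitz cost of evaluating the second one at the
displaced point. The error is thus of order `c²`, which survives summation over many small steps. -/
lemma exists_integral_pairDisp_le (hK : IsDivFree K) : ∃ C : ℝ, 0 ≤ C ∧
    ∀ (g : Torus → ℝ) (M c : ℝ), Continuous g → (∀ z, |g z| ≤ M) → |c| ≤ 1 →
      |(∫ z, g (z + toTorus (pairDisp K c z))) - ∫ z, g z| ≤ C * c ^ 2 * M := by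
  obtain ⟨C1, h1, hC1⟩ := hK.smooth₁.partial₁.exists_bound
  obtain ⟨C2, h2, hC2⟩ := hK.smooth₂.partial₂.exists_bound
  obtain ⟨C0, h0, hC0⟩ := hK.smooth₁.exists_bound
  obtain ⟨L, hL0, hL⟩ := hK.smooth₂.partial₂.exists_lipschitz
  refine ⟨L * C0 + C1 * C2, by positivity, fun g M c hg hM hc => ?_⟩
  have hKc := hK.continuous
  have hp1 := hK.smooth₁.partial₁.continuous
  have hp2 := hK.smooth₂.partial₂.continuous
  have ht1 : Continuous (fun z : Torus => toTorus (c * (K z).1, 0)) :=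
    continuous_smul_toTorus (by fun_prop) continuous_const
  have ht2 : Continuous (fun z : Torus => toTorus (0, c * (K z).2)) :=
    continuous_smul_toTorus continuous_const (by fun_prop)
  have e2 := integral_shear₂ hg hK.smooth₂ c
  have hG : Continuous (fun z => g (z + toTorus (0, c * (K z).2)) *
    (1 + c * partial₂ (fun z => (K z).2) z)) := by fun_prop
  have e1 := integral_shear₁ hG hK.smooth₁ c
  have hG1 : Continuous (fun z => g (z + toTorus (c * (K z).1, 0) +
      toTorus (0, c * (K (z + toTorus (c * (K z).1, 0))).2)) *
        (1 + c * partial₂ (fun z => (K z).2) (z + toTorus (c * (K z).1, 0))) *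
        (1 + c * partial₁ (fun z => (K z).1) z)) :=
    (hG.comp (continuous_id.add ht1)).mul (by fun_prop)
  rw [e2] at e1
  have hd := hK.continuous_pairDisp c
  have ht3 : Continuous (fun z : Torus => g (z + toTorus (pairDisp K c z))) :=
    hg.comp (continuous_id.add (continuous_toTorus.comp hd))
  rw [← e1, ← integral_sub (integrable_of_continuous _ ht3) (integrable_of_continuous _ hG1)]
  have hM0 : 0 ≤ M := (abs_nonneg _).trans (hM 0)
  have hb : ∀ z, ‖g (z + toTorus (pairDisp K c z)) -
      g (z + toTorus (c * (K z).1, 0) + toTorus (0, c * (K (z + toTorus (c * (K z).1, 0))).2)) *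
        (1 + c * partial₂ (fun z => (K z).2) (z + toTorus (c * (K z).1, 0))) *
        (1 + c * partial₁ (fun z => (K z).1) z)‖ ≤ (L * C0 + C1 * C2) * c ^ 2 * M := by
    intro z
    have e : z + toTorus (c * (K z).1, 0) + toTorus (0, c * (K (z + toTorus (c * (K z).1, 0))).2)
        = z + toTorus (pairDisp K c z) := by
      rw [add_assoc, ← toTorus_add]; simp [pairDisp]
    rw [e]
    set p1 := partial₁ (fun z => (K z).1) z with hp1'
    set q := partial₂ (fun z => (K z).2) (z + toTorus (c * (K z).1, 0)) with hq
    set p2 := partial₂ (fun z => (K z).2) z with hp2'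
    have hdiv : p1 + p2 = 0 := hK.div z
    have hq1 : |q - p2| ≤ L * (|c| * C0) := by
      have := hL z (c * (K z).1, 0) 0
      rw [toTorus_zero, add_zero, sub_zero] at this
      refine this.trans ?_
      gcongr
      rw [Prod.norm_def]
      simp only [norm_zero, norm_eq_abs, abs_mul]
      refine max_le ?_ (by positivity)
      gcongr
      exact hC0 z
    have e3 : g (z + toTorus (pairDisp K c z)) - g (z + toTorus (pairDisp K c z)) * (1 + c * q) * (1 + c * p1)
        = -(g (z + toTorus (pairDisp K c z)) * (c * (q - p2) + c ^ 2 * (q * p1))) := by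
      have : p2 = -p1 := by linarith
      rw [this]; ring
    rw [e3, norm_neg, norm_eq_abs, abs_mul, mul_comm]
    refine mul_le_mul ?_ (hM _) (abs_nonneg _) (by positivity)
    refine (abs_add_le _ _).trans ?_
    rw [abs_mul, abs_mul, abs_mul, abs_pow, sq_abs]
    calc |c| * |q - p2| + c ^ 2 * (|q| * |p1|) ≤ |c| * (L * (|c| * C0)) + c ^ 2 * (C2 * C1) := by
          gcongr
          · exact hC2 _
          · exact hC1 _
      _ = (L * C0 + C1 * C2) * (|c| ^ 2) := by rw [sq_abs]; rw [← sq_abs c]; ring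
      _ = _ := by rw [sq_abs]
  have := norm_integral_le_of_norm_le_const (μ := (volume : Measure Torus)) (.of_forall hb)
  simpa using this

end IsDivFree

/-! ### Particles -/

section Particles

/-- Resampling one coordinate preserves the product measure. -/
lemma measurePreserving_update (i : Fin N) :
    MeasurePreserving (fun p : Pos N × Torus => update p.1 i p.2) (volume.prod volume) volume := by
  have hm : Measurable (fun p : Pos N × Torus => update p.1 i p.2) := by
    refine measurable_pi_iff.mpr fun j => ?_
    by_cases h : j = i
    · subst h; simpa using measurable_snd
    · simp only [update_of_ne h]; fun_prop
  refine ⟨hm, ?_⟩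
  rw [volume_pi]
  refine (Measure.pi_eq fun s hs => ?_).symm
  rw [map_apply hm (MeasurableSet.univ_pi hs)]
  have e : (fun p : Pos N × Torus => update p.1 i p.2) ⁻¹' univ.pi s = (univ.pi (update s i univ)) ×ˢ s i := by
    ext p
    simp only [mem_preimage, Set.mem_pi, Set.mem_univ, true_implies, Set.mem_prod]
    constructor
    · intro h
      refine ⟨fun j => ?_, by simpa using h i⟩
      by_cases hj : j = i
      · subst hj; simp
      · simpa [hj] using h j
    · rintro ⟨h1, h2⟩ j
      by_cases hj : j = i
      · subst hj; simpa using h2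
      · simpa [hj] using h1 j
  rw [e, prod_prod, Measure.pi_pi, ← Finset.mul_prod_erase _ (fun j => volume (update s i univ j)) (mem_univ i),
    ← Finset.mul_prod_erase _ (fun j => volume (s j)) (mem_univ i), mul_comm]
  simp only [update_self, measure_univ, one_mul]
  congr 1
  refine Finset.prod_congr rfl fun j hj => ?_
  rw [update_of_ne (Finset.ne_of_mem_erase hj)]

lemma integral_eq_integral_update (i : Fin N) {u : (Pos N) → ℝ} (hu : Continuous u) :
    ∫ x, u x = ∫ x, ∫ z, u (update x i z) := by
  have h := measurePreserving_update i
  have hc : Continuous (fun p : Pos N × Torus => u (update p.1 i p.2)) :=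
    hu.comp (continuous_fst.update i continuous_snd)
  conv_lhs => rw [← h.map_eq]
  rw [integral_map h.measurable.aemeasurable hu.measurable.aestronglyMeasurable,
    integral_prod _ (integrable_of_continuous _ hc)]

/-- The displacement of a configuration. -/
def move (x : Pos N) (y : Vel N) : Pos N := fun i => x i + toTorus (y i)

lemma move_move (x : Pos N) (y y' : Vel N) : move (move x y) y' = move x (y + y') := by
  ext1 i; simp [move, toTorus_add, add_assoc]

lemma move_zero (x : Pos N) : move x 0 = x := by ext1 i; simp [move, toTorus_zero]

/-- The velocities `∑ⱼ aᵢⱼ K(xᵢ - xⱼ)`. -/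
def force (K : Torus → ℝ × ℝ) (a : Fin N → Fin N → ℝ) (x : Pos N) : Vel N := fun i => ∑ j, a i j • K (x i - x j)

/-- The displacement of particle `i` under an approximate flow of the force with `j`. -/
def pairStep (K : Torus → ℝ × ℝ) (c : ℝ) (i j : Fin N) (x : Pos N) : Pos N :=
  move x (Pi.single i (pairDisp K c (x i - x j)))

lemma pairStep_update (K : Torus → ℝ × ℝ) (c : ℝ) {i j : Fin N} (hij : i ≠ j) (x : Pos N)
    (z : Torus) : pairStep K c i j (update x i z) = update x i (z + toTorus (pairDisp K c (z - x j))) := by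
  ext1 l
  by_cases h : l = i
  · subst h; simp [pairStep, move, update_of_ne hij.symm]
  · simp [pairStep, move, h, toTorus_zero]

lemma continuous_pairStep {K : Torus → ℝ × ℝ} (hK : IsDivFree K) (c : ℝ) (i j : Fin N) :
    Continuous (pairStep K c i j) := by
  refine continuous_pi fun l => ?_
  have h : Continuous fun x : Pos N => pairDisp K c (x i - x j) := (hK.continuous_pairDisp c).comp (by fun_prop)
  by_cases hl : l = i
  · subst hl
    simp only [pairStep, move, Pi.single_eq_same]
    exact (continuous_apply l).add (continuous_toTorus.comp h)
  · simp only [pairStep, move, Pi.single_eq_of_ne hl, toTorus_zero]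
    fun_prop

/-- The composition of pair interactions along a list. -/
def stepList (K : Torus → ℝ × ℝ) (c : Fin N → Fin N → ℝ) : List (Fin N × Fin N) → (Pos N) → Fin N → Torus
  | [], x => x
  | p :: l, x => stepList K c l (pairStep K (c p.1 p.2) p.1 p.2 x)

lemma continuous_stepList {K : Torus → ℝ × ℝ} (hK : IsDivFree K) (c : Fin N → Fin N → ℝ)
    (l : List (Fin N × Fin N)) : Continuous (stepList K c l) := by
  induction l with
  | nil => exact continuous_id
  | cons p l ih => exact ih.comp (continuous_pairStep hK _ _ _)

/-- Only `x_i` moves while `x_j` stays fixed, so integrating first in `x_i` and translating by `x_j`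
reduces the claim to the estimate for a single point. -/
lemma abs_integral_pairStep_le {K : Torus → ℝ × ℝ} {C : ℝ}
    (hK : IsDivFree K) (hC : ∀ (g : Torus → ℝ) (M c : ℝ), Continuous g → (∀ z, |g z| ≤ M) → |c| ≤ 1 →
      |(∫ z, g (z + toTorus (pairDisp K c z))) - ∫ z, g z| ≤ C * c ^ 2 * M)
    {u : (Pos N) → ℝ} (hu : Continuous u) {M : ℝ} (hM : ∀ x, |u x| ≤ M) {c : ℝ} (hc : |c| ≤ 1)
    {i j : Fin N} (hij : i ≠ j) :
    |(∫ x, u (pairStep K c i j x)) - ∫ x, u x| ≤ C * c ^ 2 * M := by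
  have hu' : Continuous fun x => u (pairStep K c i j x) := hu.comp (continuous_pairStep hK c i j)
  rw [integral_eq_integral_update i hu, integral_eq_integral_update i hu']
  have hcu : ∀ w : (Pos N) → ℝ, Continuous w → Continuous (fun x => ∫ z, w (update x i z)) := by
    intro w hw
    obtain ⟨D, hD⟩ := isCompact_univ.exists_bound_of_continuousOn hw.continuousOn
    refine continuous_of_dominated (bound := fun _ => D) (fun x => ?_) (fun x => ?_) (integrable_const D) ?_
    · exact (hw.comp (continuous_const.update i continuous_id)).measurable.aestronglyMeasurable
    · exact .of_forall fun z => hD _ trivial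
    · exact .of_forall fun z => hw.comp (continuous_id.update i continuous_const)
  rw [← integral_sub (integrable_of_continuous _ (hcu _ hu')) (integrable_of_continuous _ (hcu _ hu))]
  have hb : ∀ x, ‖(∫ z, u (pairStep K c i j (update x i z))) - ∫ z, u (update x i z)‖ ≤ C * c ^ 2 * M := by
    intro x
    have h := hC (fun z => u (update x i (z + x j))) M c
      (hu.comp (continuous_const.update i (by fun_prop))) (fun z => hM _) hc
    rw [integral_add_right_eq_self (fun z => u (update x i z)) (x j)] at h
    rw [← integral_add_right_eq_self (fun z => u (pairStep K c i j (update x i z))) (x j)]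
    simp only [pairStep_update K c hij, add_sub_cancel_right]
    simp only [add_right_comm _ (x j)]
    exact h
  have := norm_integral_le_of_norm_le_const (μ := (volume : Measure (Pos N))) (.of_forall hb)
  simpa using this

lemma abs_integral_stepList_le {K : Torus → ℝ × ℝ} {C : ℝ} (hC0 : 0 ≤ C)
    (hK : IsDivFree K) (hC : ∀ (g : Torus → ℝ) (M c : ℝ), Continuous g → (∀ z, |g z| ≤ M) → |c| ≤ 1 →
      |(∫ z, g (z + toTorus (pairDisp K c z))) - ∫ z, g z| ≤ C * c ^ 2 * M)
    {u : (Pos N) → ℝ} (hu : Continuous u) {M : ℝ} (hM : ∀ x, |u x| ≤ M)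
    {c : Fin N → Fin N → ℝ} {η : ℝ} (hη : η ≤ 1) (hc : ∀ i j, |c i j| ≤ η)
    (l : List (Fin N × Fin N)) (hl : ∀ p ∈ l, p.1 ≠ p.2) :
    |(∫ x, u (stepList K c l x)) - ∫ x, u x| ≤ l.length * (C * η ^ 2 * M) := by
  induction l with
  | nil => simp [stepList]
  | cons p l ih =>
    have ih' := ih fun q hq => hl q (List.mem_cons_of_mem _ hq)
    have hM0 : 0 ≤ M := (abs_nonneg _).trans (hM 0)
    have hη0 : 0 ≤ η := (abs_nonneg _).trans (hc p.1 p.2)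
    have h1 := abs_integral_pairStep_le hK hC (hu.comp (continuous_stepList hK c l))
      (fun x => hM _) ((hc p.1 p.2).trans hη) (hl p List.mem_cons_self)
    have h2 : C * c p.1 p.2 ^ 2 * M ≤ C * η ^ 2 * M := by
      have : c p.1 p.2 ^ 2 ≤ η ^ 2 := by rw [← sq_abs]; gcongr; exact hc _ _
      gcongr
    have h3 := abs_sub_le (∫ x, u (stepList K c (p :: l) x)) (∫ x, u (stepList K c l x)) (∫ x, u x)
    simp only [comp_apply] at h1
    simp only [stepList, List.length_cons] at h3 ⊢
    push_cast
    linarith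

/-- The sum of the pair interactions along a list. -/
def sumList (K : Torus → ℝ × ℝ) (c : Fin N → Fin N → ℝ) (l : List (Fin N × Fin N)) (x : Pos N) : Vel N :=
  (l.map fun p => Pi.single p.1 (c p.1 p.2 • K (x p.1 - x p.2))).sum

lemma move_sub_move (x : Pos N) (y : Vel N) (i j : Fin N) :
    move x y i - move x y j = (x i - x j) + toTorus (y i - y j) := by
  simp only [move, toTorus_sub]; abel

lemma norm_single_le (i : Fin N) (v : ℝ × ℝ) : ‖(Pi.single i v : Vel N)‖ ≤ ‖v‖ := by
  refine (pi_norm_le_iff_of_nonneg (norm_nonneg _)).mpr fun l => ?_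
  by_cases h : l = i
  · subst h; simp
  · simp [h]

lemma norm_kernel_move_sub_le {K : Torus → ℝ × ℝ} {C : ℝ} (hC0 : 0 ≤ C)
    (hlip : ∀ x u v, ‖K (x + toTorus u) - K (x + toTorus v)‖ ≤ C * ‖u - v‖)
    (x : Pos N) (y y' : Vel N) (i j : Fin N) :
    ‖K (move x y i - move x y j) - K (move x y' i - move x y' j)‖ ≤ 2 * C * ‖y - y'‖ := by
  rw [move_sub_move, move_sub_move]
  refine (hlip _ _ _).trans ?_
  have h1 : ‖y i - y j - (y' i - y' j)‖ ≤ ‖y - y'‖ + ‖y - y'‖ := by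
    have : y i - y j - (y' i - y' j) = (y - y') i - (y - y') j := by simp; abel
    rw [this]
    exact (norm_sub_le _ _).trans (add_le_add (norm_le_pi_norm _ i) (norm_le_pi_norm _ j))
  calc C * _ ≤ C * (‖y - y'‖ + ‖y - y'‖) := by gcongr
    _ = _ := by ring

lemma norm_sumList_move_sub_le {K : Torus → ℝ × ℝ} {C : ℝ} (hC0 : 0 ≤ C)
    (hlip : ∀ x u v, ‖K (x + toTorus u) - K (x + toTorus v)‖ ≤ C * ‖u - v‖)
    {c : Fin N → Fin N → ℝ} {η : ℝ} (hc : ∀ i j, |c i j| ≤ η)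
    (l : List (Fin N × Fin N)) (x : Pos N) (d : Vel N) :
    ‖sumList K c l (move x d) - sumList K c l x‖ ≤ l.length * (η * (2 * C * ‖d‖)) := by
  induction l with
  | nil => simp [sumList]
  | cons p l ih =>
    have h1 : ‖(Pi.single p.1 (c p.1 p.2 • K (move x d p.1 - move x d p.2)) : Vel N) -
        Pi.single p.1 (c p.1 p.2 • K (x p.1 - x p.2))‖ ≤ η * (2 * C * ‖d‖) := by
      rw [← Pi.single_sub, ← smul_sub]
      refine (norm_single_le _ _).trans ?_
      rw [norm_smul]
      have hη0 : 0 ≤ η := (abs_nonneg _).trans (hc p.1 p.2)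
      have := norm_kernel_move_sub_le hC0 hlip x d 0 p.1 p.2
      rw [move_zero, sub_zero] at this
      exact mul_le_mul (hc _ _) this (norm_nonneg _) hη0
    simp only [sumList, List.map_cons, List.sum_cons, List.length_cons] at ih ⊢
    rw [add_sub_add_comm]
    refine (norm_add_le _ _).trans ?_
    push_cast
    linarith

/-- The composition differs from the simultaneous sum of the pair forces in two ways: each pair uses
two shears instead of a straight displacement, and later pairs see a configuration already moved.
Both effects are of second order in `η`. -/
lemma stepList_eq_move {K : Torus → ℝ × ℝ} {C : ℝ} (hC0 : 0 ≤ C) (hbd : ∀ z, ‖K z‖ ≤ C)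
    (hlip : ∀ x u v, ‖K (x + toTorus u) - K (x + toTorus v)‖ ≤ C * ‖u - v‖)
    {c : Fin N → Fin N → ℝ} {η : ℝ} (hc : ∀ i j, |c i j| ≤ η)
    (l : List (Fin N × Fin N)) (x : Pos N) :
    ∃ D : Vel N, stepList K c l x = move x D ∧
      ‖D - sumList K c l x‖ ≤ (l.length : ℝ) ^ 2 * (2 * C ^ 2 * η ^ 2) := by
  induction l generalizing x with
  | nil => exact ⟨0, by simp [stepList, move_zero], by simp [sumList]⟩
  | cons p l ih =>
    set d : Vel N := Pi.single p.1 (pairDisp K (c p.1 p.2) (x p.1 - x p.2)) with hd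
    obtain ⟨D, hD, hD2⟩ := ih (move x d)
    have hη0 : 0 ≤ η := (abs_nonneg _).trans (hc p.1 p.2)
    set cc := c p.1 p.2
    set z := x p.1 - x p.2
    have hdn : ‖d‖ ≤ η * C := by
      refine (norm_single_le _ _).trans ?_
      rw [pairDisp, Prod.norm_def]
      simp only [norm_mul]
      refine max_le ?_ ?_
      · exact mul_le_mul (hc _ _) ((norm_fst_le _).trans (hbd _)) (norm_nonneg _) hη0
      · exact mul_le_mul (hc _ _) ((norm_snd_le _).trans (hbd _)) (norm_nonneg _) hη0
    have hdd : ‖d - Pi.single p.1 (cc • K z)‖ ≤ C ^ 2 * η ^ 2 := by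
      rw [hd, ← Pi.single_sub]
      refine (norm_single_le _ _).trans ?_
      have e : pairDisp K cc z - cc • K z = (0, cc * ((K (z + toTorus (cc * (K z).1, 0))).2 - (K z).2)) := by
        ext
        · simp [pairDisp]
        · simp [pairDisp]; ring
      rw [e, Prod.norm_def]
      simp only [norm_zero, norm_mul]
      refine max_le (by positivity) ?_
      have h1 := hlip z (cc * (K z).1, 0) 0
      rw [toTorus_zero, add_zero, sub_zero] at h1
      have h2 : ‖((cc * (K z).1, 0) : ℝ × ℝ)‖ ≤ η * C := by
        rw [Prod.norm_def]
        simp only [norm_zero, norm_mul]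
        exact max_le (mul_le_mul (hc _ _) ((norm_fst_le _).trans (hbd _)) (norm_nonneg _) hη0) (by positivity)
      calc ‖cc‖ * ‖(K (z + toTorus (cc * (K z).1, 0))).2 - (K z).2‖
          ≤ η * (C * (η * C)) := by
            refine mul_le_mul (hc _ _) ?_ (norm_nonneg _) hη0
            exact (norm_snd_le (K (z + toTorus (cc * (K z).1, 0)) - K z)).trans (h1.trans (by gcongr))
        _ = _ := by ring
    refine ⟨d + D, ?_, ?_⟩
    · rw [stepList, pairStep, hD, move_move]
    · have h3 := norm_sumList_move_sub_le hC0 hlip hc l x d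
      have e : d + D - sumList K c (p :: l) x = (d - Pi.single p.1 (cc • K z)) +
          ((D - sumList K c l (move x d)) + (sumList K c l (move x d) - sumList K c l x)) := by
        simp only [sumList, List.map_cons, List.sum_cons]; abel
      rw [e]
      refine (norm_add_le _ _).trans ?_
      have h4 := norm_add_le (D - sumList K c l (move x d)) (sumList K c l (move x d) - sumList K c l x)
      have h5 : (l.length : ℝ) * (η * (2 * C * ‖d‖)) ≤ l.length * (η * (2 * C * (η * C))) := by gcongr
      have h6 : (0 : ℝ) ≤ C ^ 2 * η ^ 2 := by positivity
      have h7 : (0 : ℝ) ≤ (l.length : ℝ) * (C ^ 2 * η ^ 2) := by positivity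
      simp only [List.length_cons]
      push_cast
      nlinarith

end Particles

/-! ### The flow of particles with a smooth force preserves the volume -/

section ParticleFlow

variable {Q : Type*} [MeasurableSpace Q] {K : Torus → ℝ × ℝ} {C : ℝ}

/-- The vector field of the displacements of particles started at `ρ.2`. -/
def drift (K : Torus → ℝ × ℝ) (a : Q → ℝ → Fin N → Fin N → ℝ) : Q × (Pos N) → ℝ → (Vel N) → Vel N :=
  fun ρ s y => force K (a ρ.1 s) (move ρ.2 y)

lemma norm_force_le (hC0 : 0 ≤ C) (hbd : ∀ z, ‖K z‖ ≤ C) {a : Fin N → Fin N → ℝ} {A : ℝ}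
    (hA0 : 0 ≤ A) (ha : ∀ i j, |a i j| ≤ A) (x : Pos N) :
    ‖force K a x‖ ≤ N * A * C := by
  refine (pi_norm_le_iff_of_nonneg (by positivity)).mpr fun i => ?_
  refine (norm_sum_le _ _).trans ?_
  calc ∑ j, ‖a i j • K (x i - x j)‖ ≤ ∑ _j : Fin N, A * C := by
        refine sum_le_sum fun j _ => ?_
        rw [norm_smul]
        exact mul_le_mul (ha i j) (hbd _) (norm_nonneg _) hA0
    _ = _ := by simp; ring

lemma norm_force_move_sub_le (hC0 : 0 ≤ C) (hlip : ∀ x u v, ‖K (x + toTorus u) - K (x + toTorus v)‖ ≤ C * ‖u - v‖)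
    {a : Fin N → Fin N → ℝ} {A : ℝ} (hA0 : 0 ≤ A) (ha : ∀ i j, |a i j| ≤ A)
    (x : Pos N) (y y' : Vel N) :
    ‖force K a (move x y) - force K a (move x y')‖ ≤ N * A * (2 * C) * ‖y - y'‖ := by
  refine (pi_norm_le_iff_of_nonneg (by positivity)).mpr fun i => ?_
  simp only [Pi.sub_apply, force]
  rw [← sum_sub_distrib]
  refine (norm_sum_le _ _).trans ?_
  calc ∑ j, ‖a i j • K (move x y i - move x y j) - a i j • K (move x y' i - move x y' j)‖
      ≤ ∑ _j : Fin N, A * (2 * C * ‖y - y'‖) := by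
        refine sum_le_sum fun j _ => ?_
        rw [← smul_sub, norm_smul]
        exact mul_le_mul (ha i j) (norm_kernel_move_sub_le hC0 hlip _ _ _ _ _) (norm_nonneg _) hA0
    _ = _ := by simp; ring

lemma continuous_move : Continuous (fun p : Pos N × (Vel N) => move p.1 p.2) := by
  refine continuous_pi fun i => ?_
  have h : Continuous fun p : Pos N × (Vel N) => toTorus (p.2 i) := continuous_toTorus.comp (by fun_prop)
  simp only [move]
  fun_prop

lemma measurable_force (hK : Continuous K) :
    Measurable (fun p : (Fin N → Fin N → ℝ) × (Pos N) => force K p.1 p.2) := by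
  have hc : Continuous (fun p : (Fin N → Fin N → ℝ) × (Pos N) => force K p.1 p.2) := by
    unfold force
    refine continuous_pi fun i => continuous_finsetSum _ fun j _ => ?_
    fun_prop
  have : BorelSpace (Pos N) := Pi.borelSpace
  exact hc.measurable

lemma isLipField_drift (hK : IsDivFree K) (hC0 : 0 ≤ C) (hbd : ∀ z, ‖K z‖ ≤ C)
    (hlip : ∀ x u v, ‖K (x + toTorus u) - K (x + toTorus v)‖ ≤ C * ‖u - v‖)
    {a : Q → ℝ → Fin N → Fin N → ℝ} {A : Q → ℝ}
    (hm : Measurable (fun p : Q × ℝ => a p.1 p.2)) (hA0 : ∀ q, 0 ≤ A q)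
    (ha : ∀ q s i j, |a q s i j| ≤ A q) :
    IsLipField (drift K a) (fun ρ => N * A ρ.1 * C) (fun ρ => N * A ρ.1 * (2 * C)) where
  measurable := by
    have : BorelSpace (Pos N) := Pi.borelSpace
    have h1 : Measurable (fun p : Pos N × (Vel N) => move p.1 p.2) := continuous_move.measurable
    exact (measurable_force hK.continuous).comp
      ((hm.comp (by fun_prop : Measurable fun p : (Q × (Pos N)) × ℝ × (Vel N) =>
        (p.1.1, p.2.1))).prodMk (h1.comp (by fun_prop : Measurable
          fun p : (Q × (Pos N)) × ℝ × (Vel N) => (p.1.2, p.2.2))))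
  bound ρ s y := norm_force_le hC0 hbd (hA0 _) (ha _ _) _
  lip ρ s y y' := norm_force_move_sub_le hC0 hlip (hA0 _) (ha _ _) _ _ _
  lip_nonneg ρ := by have := hA0 ρ.1; positivity

lemma sumList_offDiag (K : Torus → ℝ × ℝ) {c : Fin N → Fin N → ℝ} (hc : ∀ i, c i i = 0) (x : Pos N) :
    sumList K c (Finset.univ.filter fun p : Fin N × Fin N => p.1 ≠ p.2).toList x = force K c x := by
  rw [sumList, Finset.sum_map_toList, Finset.sum_filter_of_ne, Fintype.sum_prod_type]
  · ext1 i
    rw [Finset.sum_apply, Finset.sum_eq_single i]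
    · simp [force, Finset.sum_apply]
    · intro j _ hj
      simp [Finset.sum_apply, Pi.single_eq_of_ne hj.symm]
    · simp
  · intro p _ hp h
    apply hp
    rw [h, hc]
    simp

/-- The approximation of the flow of particles by compositions of shears. -/
def shearScheme (K : Torus → ℝ × ℝ) (c : ℕ → Fin N → Fin N → ℝ) (l : List (Fin N × Fin N)) :
    ℕ → (Pos N) → Fin N → Torus
  | 0, x => x
  | k + 1, x => stepList K (c k) l (shearScheme K c l k x)

lemma continuous_shearScheme (hK : IsDivFree K) (c : ℕ → Fin N → Fin N → ℝ)
    (l : List (Fin N × Fin N)) (k : ℕ) : Continuous (shearScheme K c l k) := by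
  induction k with
  | zero => exact continuous_id
  | succ k ih => exact (continuous_stepList hK _ _).comp ih

lemma abs_integral_shearScheme_le (hC0 : 0 ≤ C)
    (hK : IsDivFree K) (hC : ∀ (g : Torus → ℝ) (M c : ℝ), Continuous g → (∀ z, |g z| ≤ M) → |c| ≤ 1 →
      |(∫ z, g (z + toTorus (pairDisp K c z))) - ∫ z, g z| ≤ C * c ^ 2 * M)
    {M : ℝ} {c : ℕ → Fin N → Fin N → ℝ} {η : ℝ} (hη : η ≤ 1) (hc : ∀ k i j, |c k i j| ≤ η)
    (l : List (Fin N × Fin N)) (hl : ∀ p ∈ l, p.1 ≠ p.2) (k : ℕ)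
    {u : (Pos N) → ℝ} (hu : Continuous u) (hM : ∀ x, |u x| ≤ M) :
    |(∫ x, u (shearScheme K c l k x)) - ∫ x, u x| ≤ k * (l.length * (C * η ^ 2 * M)) := by
  induction k generalizing u with
  | zero => simp [shearScheme]
  | succ k ih =>
    have h1 := ih (hu.comp (continuous_stepList hK (c k) l)) (fun x => hM _)
    have h2 := abs_integral_stepList_le hC0 hK hC hu hM hη (hc k) l hl
    have h3 := abs_sub_le (∫ x, u (shearScheme K c l (k + 1) x)) (∫ x, u (stepList K (c k) l x)) (∫ x, u x)
    simp only [comp_apply] at h1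
    simp only [shearScheme] at h3 ⊢
    push_cast
    linarith

/-- The force is linear in its coefficients: with frozen positions, a time integral of forces is the
force with integrated coefficients. In this way no continuity of the coefficients in time is ever
used, and births are allowed inside a step. -/
lemma force_integral {a : ℝ → Fin N → Fin N → ℝ} {s s' : ℝ}
    (ha : ∀ i j, IntervalIntegrable (fun r => a r i j) volume s s') (x : Pos N) :
    force K (fun i j => ∫ r in s..s', a r i j) x = ∫ r in s..s', force K (a r) x := by
  have hi : ∀ i j, IntervalIntegrable (fun r => a r i j • K (x i - x j)) volume s s' := fun i j =>
    ⟨(ha i j).1.smul_const _, (ha i j).2.smul_const _⟩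
  have hI : ∀ i, IntervalIntegrable (fun r => force K (a r) x i) volume s s' := fun i => by
    simp only [force]
    simpa only [Finset.sum_fn] using IntervalIntegrable.sum Finset.univ fun j _ => hi i j
  have hI' : IntervalIntegrable (fun r => force K (a r) x) volume s s' := by
    rw [intervalIntegrable_iff]
    exact Integrable.of_eval fun i => intervalIntegrable_iff.mp (hI i)
  ext1 i
  have e := (proj (R := ℝ) (φ := fun _ : Fin N => ℝ × ℝ) i).intervalIntegral_comp_comm hI'
  simp only [proj_apply] at e
  rw [← e]
  simp only [force]
  rw [intervalIntegral.integral_finsetSum fun j _ => hi i j]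
  exact sum_congr rfl fun j _ => (intervalIntegral.integral_smul_const _ _).symm

/-- Freezing the positions over the step costs the Lipschitz constant times the distance travelled,
integrated over the step: hence the square. -/
lemma norm_flow_sub_force_le (hK : IsDivFree K) (hC0 : 0 ≤ C) (hbd : ∀ z, ‖K z‖ ≤ C)
    (hlip : ∀ x u v, ‖K (x + toTorus u) - K (x + toTorus v)‖ ≤ C * ‖u - v‖)
    {a : Q → ℝ → Fin N → Fin N → ℝ} {A : Q → ℝ}
    (hm : Measurable (fun p : Q × ℝ => a p.1 p.2)) (hA0 : ∀ q, 0 ≤ A q)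
    (ha : ∀ q s i j, |a q s i j| ≤ A q) (q : Q) (x : Pos N) {s s' : ℝ} (hs : 0 ≤ s)
    (hss : s ≤ s') :
    ‖flow (drift K a) (q, x) s' - flow (drift K a) (q, x) s
      - force K (fun i j => ∫ r in s..s', a q r i j) (move x (flow (drift K a) (q, x) s))‖
      ≤ N * A q * (2 * C) * (N * A q * C) * (s' - s) ^ 2 := by
  have hv := isLipField_drift hK hC0 hbd hlip hm hA0 ha
  have hAq := hA0 q
  set Y := flow (drift K a) (q, x) with hY
  have hInt : ∀ u w : ℝ, IntervalIntegrable (fun r => drift K a (q, x) r (Y r)) volume u w :=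
    fun u w => hv.intervalIntegrable (q, x) (hv.aestronglyMeasurable_flow _ _)
  have hint2 : IntervalIntegrable (fun r => drift K a (q, x) r (Y s)) volume s s' :=
    hv.intervalIntegrable (q, x) aestronglyMeasurable_const
  have hai : ∀ i j, IntervalIntegrable (fun r => a q r i j) volume s s' := by
    intro i j
    rw [intervalIntegrable_iff]
    refine Integrable.mono' (g := fun _ => A q) (integrableOn_const (by simp)) ?_ (.of_forall fun r => ha q r i j)
    have : Measurable fun r => a q r := hm.comp (measurable_const.prodMk measurable_id)
    exact ((measurable_pi_apply j).comp ((measurable_pi_apply i).comp this)).aestronglyMeasurable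
  rw [force_integral hai, hY, hv.flow_eq _ hs, hv.flow_eq _ (hs.trans hss), ← hY,
    intervalIntegral.integral_interval_sub_left (hInt _ _) (hInt _ _)]
  rw [← hv.flow_eq _ hs, ← hY]
  change ‖(∫ r in s..s', drift K a (q, x) r (Y r)) - ∫ r in s..s', drift K a (q, x) r (Y s)‖ ≤ _
  rw [← intervalIntegral.integral_sub (hInt _ _) hint2]
  refine (intervalIntegral.norm_integral_le_of_norm_le_const
    (C := N * A q * (2 * C) * (N * A q * C * (s' - s))) fun r hr => ?_).trans ?_
  · rw [uIoc_of_le hss] at hr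
    refine (hv.lip _ _ _ _).trans ?_
    have h1 := hv.norm_flow_sub_le (q, x) hs hr.1.le
    simp only
    gcongr
    refine h1.trans ?_
    simp only
    gcongr
    exact hr.2
  · rw [abs_of_nonneg (sub_nonneg.mpr hss)]
    exact le_of_eq (by ring)

/-- Liouville's theorem by time discretization. With `m` steps of size `t/m` the composition of
shears is within `O(1/m)` of the flow and changes the integral of a continuous function by at most
`m · O(1/m²)`; both errors vanish as `m → ∞`. -/
lemma measurePreserving_flow (hK : IsDivFree K)
    {a : Q → ℝ → Fin N → Fin N → ℝ} {A : Q → ℝ}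
    (hm : Measurable (fun p : Q × ℝ => a p.1 p.2)) (hA0 : ∀ q, 0 ≤ A q)
    (ha : ∀ q s i j, |a q s i j| ≤ A q) (hdiag : ∀ q s i, a q s i i = 0) (q : Q) (ht : 0 ≤ t) :
    MeasurePreserving (fun x : Pos N => move x (flow (drift K a) (q, x) t)) volume volume := by
  have : BorelSpace (Pos N) := Pi.borelSpace
  obtain ⟨C, hC0, hbd, hlip⟩ := hK.exists_bound
  obtain ⟨C', hC'0, hC'⟩ := hK.exists_integral_pairDisp_le
  have hv := isLipField_drift hK hC0 hbd hlip hm hA0 ha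
  have hAq := hA0 q
  have hmeas : Measurable (fun x : Pos N => move x (flow (drift K a) (q, x) t)) :=
    continuous_move.measurable.comp (measurable_id.prodMk (hv.measurable_flow.comp
      (by fun_prop : Measurable fun x : Pos N => ((q, x), t))))
  refine ⟨hmeas, ?_⟩
  have : IsFiniteMeasure ((volume : Measure (Pos N)).map (fun x : Pos N => move x (flow (drift K a) (q, x) t))) :=
    Measure.isFiniteMeasure_map _ _
  refine ext_of_forall_integral_eq_of_IsFiniteMeasure fun φ => ?_
  rw [integral_map hmeas.aemeasurable φ.continuous.measurable.aestronglyMeasurable]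
  set l := (Finset.univ.filter fun p : Fin N × Fin N => p.1 ≠ p.2).toList with hl
  have hlne : ∀ p ∈ l, p.1 ≠ p.2 := fun p hp => by simpa [hl] using hp
  set c : ℕ → ℕ → Fin N → Fin N → ℝ := fun m k i j =>
    ∫ r in (k * (t / m))..((k + 1 : ℕ) * (t / m)), a q r i j with hc
  have hcb : ∀ m k i j, |c m k i j| ≤ A q * (t / m) := by
    intro m k i j
    rw [hc, ← norm_eq_abs]
    refine (intervalIntegral.norm_integral_le_of_norm_le_const (C := A q) fun r _ => ha q r i j).trans ?_
    push_cast
    rw [← sub_mul, add_sub_cancel_left, one_mul, abs_of_nonneg (by positivity)]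
  set W : ℝ := (l.length : ℝ) ^ 2 * (2 * C ^ 2 * A q ^ 2) + N * A q * (2 * C) * (N * A q * C) with hW
  set Λ : ℝ := N * A q * (2 * C) with hΛ
  have hΛ0 : 0 ≤ Λ := by positivity
  have hW0 : 0 ≤ W := by positivity
  have happrox : ∀ m : ℕ, m ≠ 0 → ∀ x, ∃ D : Vel N, shearScheme K (c m) l m x = move x D ∧
      ‖D - flow (drift K a) (q, x) t‖ ≤ W * t * exp (Λ * t) * (t / m) := by
    intro m hm0 x
    have hmpos : (0 : ℝ) < m := by positivity
    set h := t / m with hh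
    have hh0 : 0 ≤ h := by positivity
    -- Discrete Gronwall inequality: an old error is amplified by `1 + Λh`, and each step adds the
    -- local error `W h²` of the composition and of the frozen positions.
    have hstep : ∀ k, ∀ D : Vel N, ∃ D' : Vel N, stepList K (c m k) l (move x D) = move x D' ∧
        ‖D' - flow (drift K a) (q, x) ((k + 1 : ℕ) * h)‖ ≤
          (1 + Λ * h) * ‖D - flow (drift K a) (q, x) (k * h)‖ + W * h ^ 2 := by
      intro k D
      obtain ⟨E, hE, hE2⟩ := stepList_eq_move hC0 hbd hlip (hcb m k) l (move x D)
      refine ⟨D + E, by rw [hE, move_move], ?_⟩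
      rw [hl, sumList_offDiag K (fun i => by simp [hc, hdiag]), ← hl] at hE2
      have h1 := norm_flow_sub_force_le hK hC0 hbd hlip hm hA0 ha q x (s := k * h)
        (s' := (k + 1 : ℕ) * h) (by positivity) (by gcongr; simp)
      have h2 := norm_force_move_sub_le hC0 hlip (by positivity : 0 ≤ A q * h) (hcb m k) x D
        (flow (drift K a) (q, x) (k * h))
      have e2 : ((k + 1 : ℕ) * h - k * h) ^ 2 = h ^ 2 := by push_cast; ring
      rw [e2] at h1
      set F1 := flow (drift K a) (q, x) ((k + 1 : ℕ) * h)
      set F0 := flow (drift K a) (q, x) (k * h)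
      set I0 := force K (c m k) (move x F0)
      set ID := force K (c m k) (move x D)
      have h1' : ‖F1 - F0 - I0‖ ≤ N * A q * (2 * C) * (N * A q * C) * h ^ 2 := h1
      have e : D + E - F1 = (D - F0) + (ID - I0) + (E - ID) - (F1 - F0 - I0) := by abel
      rw [e]
      have n1 := norm_sub_le ((D - F0) + (ID - I0) + (E - ID)) (F1 - F0 - I0)
      have n2 := norm_add_le ((D - F0) + (ID - I0)) (E - ID)
      have n3 := norm_add_le (D - F0) (ID - I0)
      have e3 : (l.length : ℝ) ^ 2 * (2 * C ^ 2 * (A q * h) ^ 2) =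
        (l.length : ℝ) ^ 2 * (2 * C ^ 2 * A q ^ 2) * h ^ 2 := by ring
      have e4 : N * (A q * h) * (2 * C) * ‖D - F0‖ = Λ * h * ‖D - F0‖ := by rw [hΛ]; ring
      rw [e3] at hE2
      rw [e4] at h2
      rw [hW, add_mul, add_mul, one_mul]
      linarith
    have hex : ∀ k : ℕ, ∃ D : Vel N, shearScheme K (c m) l k x = move x D ∧
        ‖D - flow (drift K a) (q, x) (k * h)‖ ≤ k * (W * h ^ 2) * (1 + Λ * h) ^ k := by
      intro k
      induction k with
      | zero =>
        refine ⟨0, by simp [shearScheme, move_zero], ?_⟩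
        rw [Nat.cast_zero, zero_mul, hv.flow_eq _ le_rfl]
        simp
      | succ k ih =>
        obtain ⟨D, hD, hD2⟩ := ih
        obtain ⟨D', hD', hD2'⟩ := hstep k D
        refine ⟨D', by rw [shearScheme, hD, hD'], hD2'.trans ?_⟩
        have hr : 1 ≤ 1 + Λ * h := by nlinarith [mul_nonneg hΛ0 hh0]
        have hw : W * h ^ 2 ≤ W * h ^ 2 * (1 + Λ * h) ^ (k + 1) :=
          le_mul_of_one_le_right (by positivity) (one_le_pow₀ hr)
        calc _ ≤ (1 + Λ * h) * (k * (W * h ^ 2) * (1 + Λ * h) ^ k) +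
              W * h ^ 2 * (1 + Λ * h) ^ (k + 1) := by gcongr
          _ = _ := by push_cast; ring
    obtain ⟨D, hD, hD2⟩ := hex m
    have emh : m * h = t := by rw [hh]; field_simp
    rw [emh] at hD2
    refine ⟨D, hD, hD2.trans ?_⟩
    have h1 : (1 + Λ * h) ^ m ≤ exp (Λ * t) := by
      calc (1 + Λ * h) ^ m ≤ (exp (Λ * h)) ^ m := by
            gcongr
            rw [add_comm]; exact Real.add_one_le_exp _
        _ = _ := by rw [← Real.exp_nat_mul, ← emh]; congr 1; ring
    calc m * (W * h ^ 2) * (1 + Λ * h) ^ m ≤ m * (W * h ^ 2) * exp (Λ * t) := by gcongr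
      _ = W * (m * h) * exp (Λ * t) * h := by ring
      _ = _ := by rw [emh]
  have htm : Tendsto (fun m : ℕ => t / (m : ℝ)) atTop (𝓝 0) := tendsto_const_div_atTop_nhds_zero_nat t
  have hlim1 : Tendsto (fun m : ℕ => ∫ x, φ (shearScheme K (c m) l m x)) atTop
      (𝓝 (∫ x, φ (move x (flow (drift K a) (q, x) t)))) := by
    refine tendsto_integral_of_dominated_convergence (fun _ => ‖φ‖)
      (fun m => (φ.continuous.comp (continuous_shearScheme hK (c m) l m)).measurable.aestronglyMeasurable)
      (integrable_const _) (fun m => .of_forall fun x => φ.norm_coe_le_norm _) ?_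
    refine .of_forall fun x => (φ.continuous.tendsto _).comp ?_
    have hx : ∀ m : ℕ, ∃ D : Vel N, m ≠ 0 → shearScheme K (c m) l m x = move x D ∧
      ‖D - flow (drift K a) (q, x) t‖ ≤ W * t * exp (Λ * t) * (t / m) := by
      intro m
      by_cases h0 : m = 0
      · exact ⟨0, fun h => absurd h0 h⟩
      · obtain ⟨D, hD⟩ := happrox m h0 x
        exact ⟨D, fun _ => hD⟩
    choose D hD using hx
    have hDlim : Tendsto D atTop (𝓝 (flow (drift K a) (q, x) t)) := by
      rw [tendsto_iff_norm_sub_tendsto_zero]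
      refine squeeze_zero' (.of_forall fun _ => norm_nonneg _) ?_
        (by simpa using htm.const_mul (W * t * exp (Λ * t)))
      filter_upwards [eventually_ne_atTop 0] with m hm0 using (hD m hm0).2
    have hc1 : Continuous (move x) := continuous_move.comp (continuous_const.prodMk continuous_id)
    refine ((hc1.tendsto _).comp hDlim).congr' ?_
    filter_upwards [eventually_ne_atTop 0] with m hm0 using (hD m hm0).1.symm
  have hlim2 : Tendsto (fun m : ℕ => ∫ x, φ (shearScheme K (c m) l m x)) atTop (𝓝 (∫ x, φ x)) := by
    rw [tendsto_iff_norm_sub_tendsto_zero]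
    have hb : Tendsto (fun m : ℕ => t * l.length * (C' * A q ^ 2 * ‖φ‖) * (t / m)) atTop (𝓝 0) := by
      simpa using htm.const_mul (t * l.length * (C' * A q ^ 2 * ‖φ‖))
    refine squeeze_zero' (.of_forall fun _ => norm_nonneg _) ?_ hb
    have hsmall : ∀ᶠ m : ℕ in atTop, A q * (t / m) ≤ 1 := by
      have : Tendsto (fun m : ℕ => A q * (t / (m : ℝ))) atTop (𝓝 0) := by simpa using htm.const_mul (A q)
      exact (this.eventually (gt_mem_nhds one_pos)).mono fun m hm => hm.le
    filter_upwards [hsmall, eventually_ne_atTop 0] with m h1 h0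
    refine (abs_integral_shearScheme_le hC'0 hK hC' h1 (hcb m) l hlne m φ.continuous
      (fun x => φ.norm_coe_le_norm x)).trans (le_of_eq ?_)
    field_simp
  exact tendsto_nhds_unique hlim1 hlim2

end ParticleFlow

/-! ### The chain rule along a right-differentiable path -/

/-- Velocities jump at births but are right-continuous, so the path has a right derivative
everywhere; the fundamental theorem of calculus for right derivatives suffices. -/
lemma sub_eq_integral_of_right_continuous {E : Type*} [NormedAddCommGroup E] [NormedSpace ℝ E]
    [CompleteSpace E] {w y : ℝ → E} {T : ℝ}
    (hw : ∀ t, 0 ≤ t → IntervalIntegrable w volume 0 t)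
    (hr : ∀ s, 0 ≤ s → ContinuousWithinAt w (Ici s) s)
    (hy : ∀ t, 0 ≤ t → y t = ∫ s in (0 : ℝ)..t, w s) {G : E → ℝ} {G' : E → E →L[ℝ] ℝ}
    (hG : ∀ e, HasFDerivAt G (G' e) e) {s₀ : ℝ} (hs₀ : 0 ≤ s₀) (hT : s₀ ≤ T)
    (hi : IntervalIntegrable (fun s => G' (y s) (w s)) volume s₀ T) :
    G (y T) - G (y s₀) = ∫ s in s₀..T, G' (y s) (w s) := by
  have hyc : ContinuousOn y (Icc s₀ T) := by
    have h1 : ContinuousOn (fun t => ∫ s in (0 : ℝ)..t, w s) (Set.uIcc 0 T) :=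
      intervalIntegral.continuousOn_primitive_interval' (hw T (hs₀.trans hT)) Set.left_mem_uIcc
    rw [uIcc_of_le (hs₀.trans hT)] at h1
    exact (h1.mono (Set.Icc_subset_Icc_left hs₀)).congr fun t ht => hy t (hs₀.trans ht.1)
  symm
  refine intervalIntegral.integral_eq_sub_of_hasDeriv_right (f := fun s => G (y s)) ?_ ?_ hi
  · rw [uIcc_of_le hT]
    have hGc : Continuous G := continuous_iff_continuousAt.mpr fun e => (hG e).continuousAt
    exact hGc.comp_continuousOn hyc
  · intro s hs
    rw [min_eq_left hT, max_eq_right hT] at hs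
    have hs0 : 0 ≤ s := hs₀.trans hs.1.le
    have h1 : HasDerivWithinAt (fun t => ∫ r in (0 : ℝ)..t, w r) (w s) (Ici s) s := by
      refine intervalIntegral.integral_hasDerivWithinAt_right (t := Ioi s) (hw s hs0) ?_
        ((hr s hs0).mono Set.Ioi_subset_Ici_self)
      have h2 := hw (s + 1) (by linarith)
      refine ⟨Ioc s (s + 1), ?_, ?_⟩
      · exact mem_nhdsWithin.mpr ⟨Set.Iio (s + 1), isOpen_Iio, by simp, fun r hr => ⟨hr.2, (Set.mem_Iio.mp hr.1).le⟩⟩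
      · exact (h2.1.mono_set (Set.Ioc_subset_Ioc_left hs0)).aestronglyMeasurable
    have h3 : HasDerivWithinAt y (w s) (Ioi s) s :=
      (h1.mono Set.Ioi_subset_Ici_self).congr (fun t ht => hy t (hs0.trans ht.le)) (hy s hs0)
    exact (hG (y s)).comp_hasDerivWithinAt s h3

/-! ### Coefficients of the force -/

section Coef

/-- The coefficient of `K(xᵢ - xⱼ)` in the velocity of the vortex `i` at time `s`; the data are
birth times and intensities at birth. -/
def coef (θ : ℝ) (q : Marks N) (s : ℝ) (i j : Fin N) : ℝ :=
  if i ≠ j ∧ ((q i).1 : ℝ) ≤ s ∧ ((q j).1 : ℝ) ≤ s then exp (-θ * (s - (q j).1)) * (q j).2 else 0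

/-- The sum of the absolute values of the intensities. -/
def totalInt (q : Marks N) : ℝ := ∑ j, |(q j).2|

lemma totalInt_nonneg (q : Marks N) : 0 ≤ totalInt q := sum_nonneg fun _ _ => abs_nonneg _

lemma coef_self (θ : ℝ) (q : Marks N) (s : ℝ) (i : Fin N) : coef θ q s i i = 0 := by simp [coef]

lemma abs_coef_le (hθ : 0 < θ) (q : Marks N) (s : ℝ) (i j : Fin N) :
    |coef θ q s i j| ≤ totalInt q := by
  unfold coef
  split_ifs with h
  · rw [abs_mul, Real.abs_exp]
    have h1 : exp (-θ * (s - (q j).1)) ≤ 1 := by rw [exp_le_one_iff]; nlinarith [h.2.2]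
    calc _ ≤ 1 * |(q j).2| := by gcongr
      _ ≤ totalInt q := by
        rw [one_mul]
        exact Finset.single_le_sum (f := fun j => |(q j).2|) (fun _ _ => abs_nonneg _) (mem_univ j)
  · rw [abs_zero]; exact totalInt_nonneg q

lemma measurable_coef (θ : ℝ) : Measurable (fun p : Marks N × ℝ => coef θ p.1 p.2) := by
  refine measurable_pi_iff.mpr fun i => measurable_pi_iff.mpr fun j => ?_
  have hb : ∀ i : Fin N, Measurable fun p : Marks N × ℝ => ((p.1 i).1 : ℝ) := fun i => by fun_prop
  have hx : ∀ i : Fin N, Measurable fun p : Marks N × ℝ => (p.1 i).2 := fun i => by fun_prop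
  refine Measurable.ite ?_ ?_ measurable_const
  · exact (MeasurableSet.const _).inter
      ((measurableSet_le (hb i) measurable_snd).inter (measurableSet_le (hb j) measurable_snd))
  · have := hb j; have := hx j; fun_prop

lemma continuousWithinAt_coef (θ : ℝ) (q : Marks N) (s : ℝ) : ContinuousWithinAt (coef θ q) (Ici s) s := by
  refine continuousWithinAt_pi.mpr fun i => continuousWithinAt_pi.mpr fun j => ?_
  by_cases h : i ≠ j ∧ ((q i).1 : ℝ) ≤ s ∧ ((q j).1 : ℝ) ≤ s
  · have hc : ContinuousWithinAt (fun s : ℝ => exp (-θ * (s - (q j).1)) * (q j).2) (Ici s) s := by fun_prop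
    refine hc.congr (fun r hr => ?_) (by simp only [coef]; rw [if_pos h])
    rw [coef, if_pos ⟨h.1, h.2.1.trans hr, h.2.2.trans hr⟩]
  · have : (fun s => coef θ q s i j) =ᶠ[𝓝 s] fun _ => 0 := by
      by_cases hij : i = j
      · exact .of_forall fun r => by simp [hij, coef_self]
      · have h' : s < (q i).1 ∨ s < (q j).1 := by
          by_contra hcon
          push Not at hcon
          exact h ⟨hij, hcon⟩
        rcases h' with h' | h'
        · filter_upwards [gt_mem_nhds h'] with r hr
          rw [coef, if_neg fun hh => absurd hh.2.1 (not_le.mpr hr)]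
        · filter_upwards [gt_mem_nhds h'] with r hr
          rw [coef, if_neg fun hh => absurd hh.2.2 (not_le.mpr hr)]
    exact (continuousAt_const.congr this.symm).continuousWithinAt

end Coef

/-! ### The regularized flow -/

section RegFlow

/-- The displacements of vortices interacting through the regularized kernel. -/
def regDisp (θ : ℝ) (k : ℕ) (q : Marks N) (x : Pos N) (t : ℝ) : Vel N :=
  flow (drift (kernelReg k) (coef θ)) (q, x) t

/-- The loc of vortices interacting through the regularized kernel. -/
def regFlow (θ : ℝ) (k : ℕ) (q : Marks N) (x : Pos N) (t : ℝ) : Pos N := move x (regDisp θ k q x t)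

lemma exists_isLipField (hθ : 0 < θ) (k N : ℕ) : ∃ B L,
    IsLipField (drift (N := N) (kernelReg k) (coef θ)) B L := by
  obtain ⟨C, hC0, hbd, hlip⟩ := (isDivFree_kernelReg k).exists_bound
  exact ⟨_, _, isLipField_drift (isDivFree_kernelReg k) hC0 hbd hlip (measurable_coef θ)
    totalInt_nonneg (abs_coef_le hθ)⟩

lemma measurable_regDisp (hθ : 0 < θ) (k : ℕ) :
    Measurable (fun p : (Marks N × Pos N) × ℝ => regDisp θ k p.1.1 p.1.2 p.2) := by
  obtain ⟨B, L, hv⟩ := exists_isLipField hθ k N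
  exact hv.measurable_flow

lemma measurable_move : Measurable (fun p : Pos N × (Vel N) => move p.1 p.2) := by
  have : BorelSpace (Pos N) := Pi.borelSpace
  exact continuous_move.measurable

lemma measurable_regFlow (hθ : 0 < θ) (k : ℕ) :
    Measurable (fun p : (Marks N × Pos N) × ℝ => regFlow θ k p.1.1 p.1.2 p.2) :=
  measurable_move.comp ((by fun_prop : Measurable
    fun p : (Marks N × Pos N) × ℝ => p.1.2).prodMk (measurable_regDisp hθ k))

lemma continuousOn_regDisp (hθ : 0 < θ) (k : ℕ) (q : Marks N) (x : Pos N) :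
    ContinuousOn (regDisp θ k q x) (Ici 0) := by
  obtain ⟨B, L, hv⟩ := exists_isLipField hθ k N
  exact hv.continuousOn_flow _

lemma continuousOn_regFlow (hθ : 0 < θ) (k : ℕ) (q : Marks N) (x : Pos N) :
    ContinuousOn (regFlow θ k q x) (Ici 0) :=
  (continuous_move.comp (continuous_const.prodMk continuous_id)).comp_continuousOn (continuousOn_regDisp hθ k q x)

lemma regDisp_zero (hθ : 0 < θ) (k : ℕ) (q : Marks N) (x : Pos N) : regDisp θ k q x 0 = 0 := by
  obtain ⟨B, L, hv⟩ := exists_isLipField hθ k N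
  rw [regDisp, hv.flow_eq _ le_rfl]; simp

lemma regFlow_zero (hθ : 0 < θ) (k : ℕ) (q : Marks N) (x : Pos N) : regFlow θ k q x 0 = x := by
  rw [regFlow, regDisp_zero hθ, move_zero]

/-- The velocities in the regularized flow. -/
def regVel (θ : ℝ) (k : ℕ) (q : Marks N) (x : Pos N) (s : ℝ) : Vel N :=
  force (kernelReg k) (coef θ q s) (regFlow θ k q x s)

lemma regDisp_eq (hθ : 0 < θ) (k : ℕ) (q : Marks N) (x : Pos N) 
    (ht : 0 ≤ t) : regDisp θ k q x t = ∫ s in (0 : ℝ)..t, regVel θ k q x s := by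
  obtain ⟨B, L, hv⟩ := exists_isLipField hθ k N
  exact hv.flow_eq _ ht

lemma intervalIntegrable_regVel (hθ : 0 < θ) (k : ℕ) (q : Marks N)
    (x : Pos N) (a b : ℝ) : IntervalIntegrable (regVel θ k q x) volume a b := by
  obtain ⟨B, L, hv⟩ := exists_isLipField hθ k N
  exact hv.intervalIntegrable (q, x) (hv.aestronglyMeasurable_flow _ _)

lemma measurable_regVel (hθ : 0 < θ) (k : ℕ) (q : Marks N) (x : Pos N) : Measurable (regVel θ k q x) := by
  have h1 : Measurable (fun s => coef θ q s) := (measurable_coef θ).comp (measurable_prodMk_left (x := q))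
  have h2 : Measurable (fun s => regFlow θ k q x s) := by
    have hx : Measurable (fun s : ℝ => (((q, x), s) : (Marks N × Pos N) × ℝ)) :=
      measurable_const.prodMk measurable_id
    have h := (measurable_regFlow (N := N) hθ k).comp hx
    simpa only [comp_def] using h
  have h3 := (measurable_force (N := N) (isDivFree_kernelReg k).continuous).comp (h1.prodMk h2)
  exact h3

lemma exists_norm_regVel_le (hθ : 0 < θ) (k : ℕ) (q : Marks N)
    (x : Pos N) : ∃ B : ℝ, ∀ s, ‖regVel θ k q x s‖ ≤ B := by
  obtain ⟨B, L, hv⟩ := exists_isLipField hθ k N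
  exact ⟨_, fun s => hv.bound (q, x) s _⟩

lemma continuous_force {K : Torus → ℝ × ℝ} (hK : Continuous K) :
    Continuous (fun p : (Fin N → Fin N → ℝ) × (Pos N) => force K p.1 p.2) := by
  unfold force
  refine continuous_pi fun i => continuous_finsetSum _ fun j _ => ?_
  fun_prop

lemma continuousWithinAt_regVel (hθ : 0 < θ) (k : ℕ) (q : Marks N) (x : Pos N) (hs : 0 ≤ s) :
    ContinuousWithinAt (regVel θ k q x) (Ici s) s := by
  have h1 := (continuousOn_regFlow hθ k q x s hs).mono (Set.Ici_subset_Ici.mpr hs)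
  exact (continuous_force (isDivFree_kernelReg k).continuous).continuousAt.comp_continuousWithinAt
    ((continuousWithinAt_coef θ q s).prodMk h1)

lemma measurePreserving_regFlow (hθ : 0 < θ) (k : ℕ) (q : Marks N) (ht : 0 ≤ t) :
    MeasurePreserving (fun x => regFlow θ k q x t) volume volume :=
  measurePreserving_flow (isDivFree_kernelReg k) (measurable_coef θ) totalInt_nonneg
    (abs_coef_le hθ) (coef_self θ) q ht

end RegFlow

/-! ### Absence of collisions for almost every initial configuration -/

section NoCollision

/-- The size of the gradient of the Green function. -/
def gradSize (z : Torus) : ℝ := |partial₁ green z| + |partial₂ green z|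

lemma gradSize_nonneg (z : Torus) : 0 ≤ gradSize z := by unfold gradSize; positivity

lemma measurable_gradSize : Measurable gradSize := by
  refine measurable_of_continuousOn_compl_singleton 0 fun z hz => ContinuousAt.continuousWithinAt ?_
  exact (continuousAt_partial₁_green hz).abs.add (continuousAt_partial₂_green hz).abs

lemma lintegral_gradSize_lt_top : ∫⁻ z, ofReal (gradSize z) < ∞ :=
  (integrable_partial₁_green.abs.add integrable_partial₂_green.abs).lintegral_lt_top

lemma gradSize_neg (z : Torus) : gradSize (-z) = gradSize z := by
  rw [gradSize, partial₁_neg_of_even green_neg, partial₂_neg_of_even green_neg, abs_neg, abs_neg, gradSize]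

/-- A bound for the derivative of `∑ g(xᵢ - xⱼ)` along the flow. -/
def collRate (x : Pos N) : ℝ :=
  ∑ i, ∑ j, if i = j then 0 else ∑ l, if l = i ∨ l = j then 0 else
    gradSize (x i - x j) * (gradSize (x i - x l) + gradSize (x j - x l))

lemma collRate_nonneg (x : Pos N) : 0 ≤ collRate x := by
  unfold collRate
  refine sum_nonneg fun i _ => sum_nonneg fun j _ => ?_
  split_ifs
  · exact le_rfl
  · refine sum_nonneg fun l _ => ?_
    split_ifs
    · exact le_rfl
    · exact mul_nonneg (gradSize_nonneg _) (add_nonneg (gradSize_nonneg _) (gradSize_nonneg _))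

lemma measurable_collRate : Measurable (collRate (N := N)) := by
  unfold collRate
  have h : ∀ i j : Fin N, Measurable fun x : Pos N => gradSize (x i - x j) := fun i j =>
    measurable_gradSize.comp ((measurable_pi_apply i).sub (measurable_pi_apply j))
  refine measurable_sum _ fun i _ => measurable_sum _ fun j _ => ?_
  split_ifs
  · exact measurable_const
  · refine measurable_sum _ fun l _ => ?_
    split_ifs
    · exact measurable_const
    · exact (h i j).mul ((h i l).add (h j l))

lemma lintegral_eq_lintegral_update (i : Fin N) {u : (Pos N) → ℝ≥0∞} (hu : Measurable u) :
    ∫⁻ x, u x = ∫⁻ x, ∫⁻ z, u (update x i z) := by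
  have h := measurePreserving_update i
  conv_lhs => rw [← h.map_eq]
  rw [lintegral_map hu h.measurable]
  exact lintegral_prod _ (hu.comp h.measurable).aemeasurable

lemma lintegral_gradSize_pair {i j : Fin N} (hij : i ≠ j) :
    ∫⁻ x : Pos N, ofReal (gradSize (x i - x j)) = ∫⁻ z, ofReal (gradSize z) := by
  have hm : Measurable fun x : Pos N => ofReal (gradSize (x i - x j)) :=
    (measurable_gradSize.comp ((measurable_pi_apply i).sub (measurable_pi_apply j))).ennreal_ofReal
  rw [lintegral_eq_lintegral_update i hm]
  simp only [update_self, update_of_ne hij.symm]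
  simp [lintegral_sub_right_eq_self (μ := (volume : Measure Torus)) (fun z => ofReal (gradSize z))]

/-- The variable `x_l` occurs only in the second factor; integrating it out first leaves the
integral for a single pair. The index `l` has to differ from `i` and `j`: a square of `gradSize`
would require more than integrability. -/
lemma lintegral_gradSize_mul {i j l m : Fin N} (hij : i ≠ j) (hl : l ≠ i) (hl' : l ≠ j) (hm : m ≠ l) :
    ∫⁻ x : Pos N, ofReal (gradSize (x i - x j) * gradSize (x m - x l)) = (∫⁻ z, ofReal (gradSize z)) ^ 2 := by
  have h : ∀ i j : Fin N, Measurable fun x : Pos N => gradSize (x i - x j) := fun i j =>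
    measurable_gradSize.comp ((measurable_pi_apply i).sub (measurable_pi_apply j))
  have hu : Measurable fun x : Pos N => ofReal (gradSize (x i - x j) * gradSize (x m - x l)) :=
    ((h i j).mul (h m l)).ennreal_ofReal
  rw [lintegral_eq_lintegral_update l hu]
  simp only [update_self, update_of_ne hm, update_of_ne hl.symm,
    update_of_ne hl'.symm, ofReal_mul (gradSize_nonneg _)]
  have e : ∀ x : Pos N, ∫⁻ z, ofReal (gradSize (x i - x j)) * ofReal (gradSize (x m - z)) =
      ofReal (gradSize (x i - x j)) * ∫⁻ z, ofReal (gradSize z) := by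
    intro x
    rw [lintegral_const_mul' _ _ ofReal_ne_top]
    congr 1
    rw [← lintegral_sub_right_eq_self (fun z => ofReal (gradSize z)) (x m)]
    exact lintegral_congr fun z => by rw [← gradSize_neg, neg_sub]
  simp only [e]
  rw [lintegral_mul_const _ (h i j).ennreal_ofReal, lintegral_gradSize_pair hij, sq]

lemma lintegral_collRate_lt_top : ∫⁻ x : Pos N, ofReal (collRate x) < ∞ := by
  have h : ∀ i j : Fin N, Measurable fun x : Pos N => gradSize (x i - x j) := fun i j =>
    measurable_gradSize.comp ((measurable_pi_apply i).sub (measurable_pi_apply j))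
  have hInt : Integrable (collRate (N := N)) := by
    unfold collRate
    refine integrable_finsetSum _ fun i _ => integrable_finsetSum _ fun j _ => ?_
    split_ifs with hij
    · exact integrable_zero _ _ _
    refine integrable_finsetSum _ fun l _ => ?_
    split_ifs with hl
    · exact integrable_zero _ _ _
    push Not at hl
    have hI : ∀ m : Fin N, m ≠ l → Integrable (fun x : Pos N => gradSize (x i - x j) * gradSize (x m - x l)) := by
      intro m hm
      refine ⟨((h i j).mul (h m l)).aestronglyMeasurable, ?_⟩
      rw [hasFiniteIntegral_iff_ofReal (.of_forall fun x =>
        mul_nonneg (gradSize_nonneg _) (gradSize_nonneg _)), lintegral_gradSize_mul hij hl.1 hl.2 hm]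
      exact ENNReal.pow_lt_top lintegral_gradSize_lt_top
    have := (hI i hl.1.symm).add (hI j hl.2.symm)
    refine this.congr (.of_forall fun x => ?_)
    simp only [Pi.add_apply, mul_add]
  exact hInt.lintegral_lt_top

end NoCollision

/-! ### Energy along the truncated flow -/

section Energy

/-- The derivative of `greenReg k` at `z` in the direction `v`. -/
def gradReg (k : ℕ) (z : Torus) : ℝ × ℝ →L[ℝ] ℝ :=
  partial₁ (greenReg k) z • fst ℝ ℝ ℝ + partial₂ (greenReg k) z • snd ℝ ℝ ℝ

lemma gradReg_apply (k : ℕ) (z : Torus) (v : ℝ × ℝ) :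
    gradReg k z v = partial₁ (greenReg k) z * v.1 + partial₂ (greenReg k) z * v.2 := by
  simp [gradReg]

/-- The gradient is orthogonal to its own rotation: the mutual interaction of a pair does not change
that pair's contribution to the energy. This removes the square of the gradient, whose integrability
is not available. -/
lemma gradReg_kernelReg_self (k : ℕ) (z : Torus) : gradReg k z (kernelReg k z) = 0 := by
  rw [gradReg_apply, kernelReg]; ring

lemma abs_gradReg_kernelReg_le (k : ℕ) (z z' : Torus) :
    |gradReg k z (kernelReg k z')| ≤ gradSize z * gradSize z' := by
  rw [gradReg_apply, kernelReg, gradSize, gradSize]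
  have h1 := abs_partial₁_greenReg_le k z
  have h2 := abs_partial₂_greenReg_le k z
  have h3 := abs_partial₁_greenReg_le k z'
  have h4 := abs_partial₂_greenReg_le k z'
  have h5 := mul_le_mul h1 h4 (abs_nonneg _) (abs_nonneg _)
  have h6 := mul_le_mul h2 h3 (abs_nonneg _) (abs_nonneg _)
  refine (abs_add_le _ _).trans ?_
  rw [abs_mul, abs_mul, abs_neg, add_mul, mul_add, mul_add]
  have h7 := mul_nonneg (abs_nonneg (partial₁ green z)) (abs_nonneg (partial₁ green z'))
  have h8 := mul_nonneg (abs_nonneg (partial₂ green z)) (abs_nonneg (partial₂ green z'))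
  linarith

/-- For `l = i` or `l = j` one coefficient is diagonal, hence zero, and the other multiplies the
orthogonal product, the kernel being odd. Only triples of distinct vortices remain. -/
lemma abs_sum_gradReg_le (k : ℕ) {a : Fin N → Fin N → ℝ} {A : ℝ} (ha0 : ∀ i, a i i = 0)
    (ha : ∀ i j, |a i j| ≤ A) (X : Pos N) :
    |∑ i, ∑ j, if i = j then 0 else gradReg k (X i - X j)
      (force (kernelReg k) a X i - force (kernelReg k) a X j)| ≤ A * collRate X := by
  rw [collRate, mul_sum]
  refine (abs_sum_le_sum_abs _ _).trans (sum_le_sum fun i _ => ?_)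
  rw [mul_sum]
  refine (abs_sum_le_sum_abs _ _).trans (sum_le_sum fun j _ => ?_)
  split_ifs with hij
  · simp
  rw [mul_sum]
  have e : gradReg k (X i - X j) (force (kernelReg k) a X i - force (kernelReg k) a X j)
      = ∑ l, (a i l * gradReg k (X i - X j) (kernelReg k (X i - X l)) -
          a j l * gradReg k (X i - X j) (kernelReg k (X j - X l))) := by
    simp only [force]
    rw [map_sub, map_sum, map_sum, ← sum_sub_distrib]
    simp
  rw [e]
  refine (abs_sum_le_sum_abs _ _).trans (sum_le_sum fun l _ => ?_)
  split_ifs with hl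
  · rw [mul_zero, abs_nonpos_iff]
    have hneg : kernelReg k (X j - X i) = -kernelReg k (X i - X j) := by rw [← kernelReg_neg, neg_sub]
    rcases hl with rfl | rfl
    · rw [ha0, hneg, map_neg, gradReg_kernelReg_self]; simp
    · rw [ha0, gradReg_kernelReg_self]; simp
  · have h1 := abs_gradReg_kernelReg_le k (X i - X j) (X i - X l)
    have h2 := abs_gradReg_kernelReg_le k (X i - X j) (X j - X l)
    have hA : 0 ≤ A := (abs_nonneg _).trans (ha i l)
    refine (abs_sub _ _).trans ?_
    rw [abs_mul, abs_mul, mul_add, mul_add]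
    exact add_le_add (mul_le_mul (ha _ _) h1 (abs_nonneg _) hA) (mul_le_mul (ha _ _) h2 (abs_nonneg _) hA)

/-- The energy `∑ g(xᵢ - xⱼ)` of vortices with unit intensity. -/
def energyReg (k : ℕ) (X : Pos N) : ℝ := ∑ i, ∑ j, if i = j then 0 else greenReg k (X i - X j)

lemma hasFDerivAt_energyReg_move (k : ℕ) (x : Pos N) (y : Vel N) :
    HasFDerivAt (fun y => energyReg k (move x y)) (∑ i, ∑ j, if i = j then 0 else
      (gradReg k (move x y i - move x y j)).comp
        (proj (R := ℝ) (φ := fun _ : Fin N => ℝ × ℝ) i - proj (R := ℝ) (φ := fun _ : Fin N => ℝ × ℝ) j)) y := by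
  unfold energyReg
  refine HasFDerivAt.fun_sum fun i _ => HasFDerivAt.fun_sum fun j _ => ?_
  split_ifs with hij
  · exact hasFDerivAt_const _ _
  · have h1 := (smoothOnTorus_greenReg k).hasFDerivAt_add (x i - x j) (y i - y j)
    have h2 : HasFDerivAt (fun y : Vel N => y i - y j)
        (proj (R := ℝ) (φ := fun _ : Fin N => ℝ × ℝ) i - proj (R := ℝ) (φ := fun _ : Fin N => ℝ × ℝ) j) y :=
      (hasFDerivAt_apply i y).sub (hasFDerivAt_apply j y)
    simp only [move_sub_move]
    exact HasFDerivAt.comp (f := fun y : Vel N => y i - y j) y h1 h2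

/-- The intensities enter only through the velocities, bounded by `totalInt`; the energy itself has
unit weights, so that no cancellation between signs can hide a collision. -/
lemma abs_energyReg_sub_le (hθ : 0 < θ) (k : ℕ) (q : Marks N) (x : Pos N)
    {t T : ℝ} (ht : 0 ≤ t) (htT : t ≤ T) {F : ℝ}
    (hF0 : 0 ≤ F) (hF : ∫⁻ s in Ioc 0 T, ofReal (totalInt q * collRate (regFlow θ k q x s)) ≤ ofReal F) :
    |energyReg k (regFlow θ k q x t) - energyReg k x| ≤ F := by
  set G' : (Vel N) → (Vel N) →L[ℝ] ℝ := fun y => ∑ i, ∑ j, if i = j then 0 else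
      (gradReg k (move x y i - move x y j)).comp
        (proj (R := ℝ) (φ := fun _ : Fin N => ℝ × ℝ) i - proj (R := ℝ) (φ := fun _ : Fin N => ℝ × ℝ) j) with hG'
  have hval : ∀ s, G' (regDisp θ k q x s) (regVel θ k q x s) = ∑ i, ∑ j, if i = j then 0 else
      gradReg k (regFlow θ k q x s i - regFlow θ k q x s j)
        (force (kernelReg k) (coef θ q s) (regFlow θ k q x s) i -
          force (kernelReg k) (coef θ q s) (regFlow θ k q x s) j) := by
    intro s
    simp only [hG', _root_.sum_apply]
    refine sum_congr rfl fun i _ => sum_congr rfl fun j _ => ?_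
    split_ifs
    · rfl
    · rfl
  have hbound : ∀ s, |G' (regDisp θ k q x s) (regVel θ k q x s)|
      ≤ totalInt q * collRate (regFlow θ k q x s) := fun s => by
    rw [hval]
    exact abs_sum_gradReg_le k (coef_self θ q s) (abs_coef_le hθ q s) _
  have hmeasflow : Measurable (fun s => regFlow θ k q x s) := by
    have hx : Measurable (fun s : ℝ => (((q, x), s) : (Marks N × Pos N) × ℝ)) :=
      measurable_const.prodMk measurable_id
    have h := (measurable_regFlow (N := N) hθ k).comp hx
    simpa only [comp_def] using h
  have hmeas : Measurable fun s => G' (regDisp θ k q x s) (regVel θ k q x s) := by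
    have hv := measurable_regVel hθ k q x
    have hvi : ∀ i, Measurable fun s => force (kernelReg k) (coef θ q s) (regFlow θ k q x s) i :=
      fun i => (measurable_pi_apply i).comp hv
    have hd : ∀ i j : Fin N, Measurable fun s => regFlow θ k q x s i - regFlow θ k q x s j := fun i j =>
      ((measurable_pi_apply i).comp hmeasflow).sub ((measurable_pi_apply j).comp hmeasflow)
    simp only [hval]
    refine measurable_sum _ fun i _ => measurable_sum _ fun j _ => ?_
    split_ifs
    · exact measurable_const
    · simp only [gradReg_apply]
      have h1 := (smoothOnTorus_greenReg k).partial₁.continuous.measurable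
      have h2 := (smoothOnTorus_greenReg k).partial₂.continuous.measurable
      have h3 := (hvi i).sub (hvi j)
      exact ((h1.comp (hd i j)).mul (measurable_fst.comp h3)).add ((h2.comp (hd i j)).mul (measurable_snd.comp h3))
  have hmeasR : Measurable fun s => totalInt q * collRate (regFlow θ k q x s) :=
    (measurable_collRate.comp hmeasflow).const_mul _
  have hR0 : ∀ s, 0 ≤ totalInt q * collRate (regFlow θ k q x s) := fun s =>
    mul_nonneg (totalInt_nonneg q) (collRate_nonneg _)
  have hintR : IntegrableOn (fun s => totalInt q * collRate (regFlow θ k q x s)) (Ioc 0 T) := by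
    refine ⟨hmeasR.aestronglyMeasurable, ?_⟩
    rw [hasFiniteIntegral_iff_ofReal (.of_forall hR0)]
    exact hF.trans_lt ofReal_lt_top
  have hintRF : ∫ s in Ioc 0 T, totalInt q * collRate (regFlow θ k q x s) ≤ F := by
    rw [integral_eq_lintegral_of_nonneg_ae (.of_forall hR0) hmeasR.aestronglyMeasurable]
    exact ENNReal.toReal_le_of_le_ofReal hF0 hF
  have hsub : Ioc 0 t ⊆ Ioc 0 T := Set.Ioc_subset_Ioc_right htT
  have hi : IntervalIntegrable (fun s => G' (regDisp θ k q x s) (regVel θ k q x s)) volume 0 t := by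
    rw [intervalIntegrable_iff, uIoc_of_le ht]
    exact Integrable.mono' (hintR.mono_set hsub) hmeas.aestronglyMeasurable (.of_forall hbound)
  have h := sub_eq_integral_of_right_continuous (w := regVel θ k q x) (y := regDisp θ k q x)
    (fun s _ => intervalIntegrable_regVel hθ k q x 0 s)
    (fun s hs => continuousWithinAt_regVel hθ k q x hs) (fun s hs => regDisp_eq hθ k q x hs)
    (G := fun y => energyReg k (move x y)) (hasFDerivAt_energyReg_move k x) le_rfl ht hi
  have e0 : move x (regDisp θ k q x 0) = x := regFlow_zero hθ k q x
  simp only [e0] at h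
  change |energyReg k (move x (regDisp θ k q x t)) - energyReg k x| ≤ F
  rw [h]
  refine (intervalIntegral.abs_integral_le_integral_abs ht).trans ?_
  rw [integral_of_le ht]
  refine le_trans ?_ hintRF
  refine (setIntegral_mono_on (hi.abs.1) (hintR.mono_set hsub) measurableSet_Ioc fun s _ => hbound s).trans ?_
  exact setIntegral_mono_set hintR (.of_forall hR0) (.of_forall hsub)

/-- All terms of the energy other than the chosen one are at most `C`, and there are at most `N²` of
them. -/
lemma lt_greenReg_of_energy {C : ℝ} (hC : ∀ k z, greenReg k z ≤ C) (hC0 : 0 ≤ C) 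
    {X : Pos N} {b : ℝ} (h : b + N * (N * C) < energyReg k X) {i j : Fin N} (hij : i ≠ j) :
    b < greenReg k (X i - X j) := by
  classical
  have h1 : energyReg k X ≤ greenReg k (X i - X j) + N * (N * C) := by
    have e : energyReg k X = ∑ p : Fin N × Fin N, if p.1 = p.2 then 0 else greenReg k (X p.1 - X p.2) := by
      rw [energyReg, Fintype.sum_prod_type]
    rw [e, ← Finset.add_sum_erase _ _ (mem_univ (i, j))]
    simp only [if_neg hij]
    refine add_le_add le_rfl ((Finset.sum_le_card_nsmul _ _ C fun p _ => ?_).trans ?_)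
    · split_ifs
      · exact hC0
      · exact hC _ _
    · rw [nsmul_eq_mul, ← mul_assoc]
      refine mul_le_mul_of_nonneg_right ?_ hC0
      have : (Finset.univ.erase (i, j)).card ≤ N * N := (Finset.card_erase_le).trans (by simp)
      exact_mod_cast this
  linarith

lemma ae_ne_pi {i j : Fin N} (hij : i ≠ j) : ∀ᵐ x : Pos N, x i ≠ x j := by
  have h0 : (∫⁻ x : Pos N, ({x : Pos N | x i = x j}.indicator 1 x : ℝ≥0∞)) = 0 := by
    rw [lintegral_eq_lintegral_update i (measurable_one.indicator
      (measurableSet_eq_fun (measurable_pi_apply i) (measurable_pi_apply j)))]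
    have : ∀ x : Pos N, (∫⁻ z, ({x : Pos N | x i = x j}.indicator 1 (update x i z) : ℝ≥0∞)) = 0 := by
      intro x
      have e : (fun z => ({x : Pos N | x i = x j}.indicator 1 (update x i z) : ℝ≥0∞))
          = ({x j} : Set Torus).indicator 1 := by
        ext z
        simp [Set.indicator_apply, update_of_ne hij.symm]
      rw [e, lintegral_indicator_one (measurableSet_singleton _)]
      have : ({x j} : Set Torus) = {(x j).1} ×ˢ {(x j).2} := by simp
      rw [this, volume_eq_prod, prod_prod]
      simp
    simp [this]
  rw [lintegral_indicator_one (measurableSet_eq_fun (measurable_pi_apply i) (measurable_pi_apply j))] at h0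
  rw [ae_iff]
  simpa using h0

/-- Almost every initial configuration does not lead to a collision before time `T`, not even with
vortices still to be born. -/
lemma ae_exists_lt_greenReg (hθ : 0 < θ) (q : Marks N) (T : ℝ) :
    ∀ᵐ x : Pos N, ∃ k : ℕ, ∀ t ∈ Icc 0 T, ∀ i j, i ≠ j →
      -(k : ℝ) < greenReg k (regFlow θ k q x t i - regFlow θ k q x t j) := by
  obtain ⟨C, hC0, hC⟩ := exists_greenReg_le
  set F : ℕ → (Pos N) → ℝ≥0∞ := fun k x =>
    ∫⁻ s in Ioc 0 T, ofReal (totalInt q * collRate (regFlow θ k q x s)) with hF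
  have hm : ∀ k, Measurable (fun p : Pos N × ℝ => ofReal (totalInt q * collRate (regFlow θ k q p.1 p.2))) := by
    intro k
    have hx : Measurable (fun p : Pos N × ℝ => (((q, p.1), p.2) : (Marks N × Pos N) × ℝ)) :=
      (measurable_const.prodMk measurable_fst).prodMk measurable_snd
    have h := (measurable_regFlow (N := N) hθ k).comp hx
    have h' := ((measurable_collRate.comp h).const_mul (totalInt q)).ennreal_ofReal
    simpa only [comp_def] using h'
  have hFm : ∀ k, Measurable (F k) := fun k => (hm k).lintegral_prod_right'
  set c : ℝ≥0∞ := (∫⁻ x : Pos N, ofReal (totalInt q * collRate x)) with hc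
  have hc_top : c < ∞ := by
    rw [hc]
    simp only [ofReal_mul (totalInt_nonneg q)]
    rw [lintegral_const_mul' _ _ ofReal_ne_top]
    exact mul_lt_top ofReal_lt_top lintegral_collRate_lt_top
  have hInt : ∀ k, ∫⁻ x, F k x = ofReal T * c := by
    intro k
    rw [hF, lintegral_lintegral_swap (hm k).aemeasurable]
    have : ∀ s ∈ Ioc 0 T, ∫⁻ x : Pos N, ofReal (totalInt q * collRate (regFlow θ k q x s)) = c := by
      intro s hs
      exact (measurePreserving_regFlow hθ k q hs.1.le).lintegral_comp
        ((measurable_collRate.const_mul _).ennreal_ofReal)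
    rw [setLIntegral_congr_fun measurableSet_Ioc this]
    simp [mul_comm]
  -- Since the flow preserves volume, the mean of the collision rate does not depend on `k`. Fatou's
  -- lemma then makes the lower limit finite almost everywhere, so that arbitrarily large `k` share
  -- one bound `r` at a given point.
  have hfatou : ∫⁻ x, liminf (fun k => F k x) atTop ≤ ofReal T * c := by
    refine (lintegral_liminf_le hFm).trans ?_
    simp [hInt]
  have hfin : ∀ᵐ x, liminf (fun k => F k x) atTop < ∞ :=
    ae_lt_top (Measurable.liminf hFm) (hfatou.trans_lt (mul_lt_top ofReal_lt_top hc_top)).ne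
  have hne : ∀ᵐ x : Pos N, ∀ i j, i ≠ j → x i ≠ x j := by
    refine ae_all_iff.mpr fun i => ae_all_iff.mpr fun j => ?_
    by_cases hij : i = j
    · exact .of_forall fun x h => absurd hij h
    · exact (ae_ne_pi hij).mono fun x hx _ => hx
  filter_upwards [hfin, hne] with x hx hxne
  obtain ⟨r, hr⟩ := ENNReal.lt_iff_exists_nnreal_btwn.mp hx
  have hfreq : ∃ᶠ k in atTop, F k x < r := frequently_lt_of_liminf_lt (by isBoundedDefault) hr.1
  set L : ℝ := ∑ i, ∑ j, if i = j then 0 else green (x i - x j) with hL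
  -- For `k` beyond this value, the initial energy `L` minus the possible loss `r` still exceeds
  -- `-k` by the margin `N²C` required to control single pairs.
  obtain ⟨k0, hk0⟩ := exists_nat_gt (r + N * (N * C) - L)
  obtain ⟨k, hk, hkr⟩ := (frequently_atTop.mp hfreq) k0
  have hk' : r + N * (N * C) - L < (k : ℝ) := hk0.trans_le (mod_cast hk)
  refine ⟨k, fun t ht i j hij => ?_⟩
  have hE := abs_energyReg_sub_le hθ k q x ht.1 ht.2 (F := r) r.coe_nonneg
    (by rw [ENNReal.ofReal_coe_nnreal]; exact hkr.le)
  have hLe : L ≤ energyReg k x := by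
    refine sum_le_sum fun i _ => sum_le_sum fun j _ => ?_
    split_ifs with h
    · exact le_rfl
    · rw [greenReg, if_neg (sub_ne_zero.mpr (hxne i j h))]
      exact le_cutoff _ _
  refine lt_greenReg_of_energy hC hC0 ?_ hij
  have := (abs_le.mp hE).1
  linarith

end Energy

/-! ### Vortex flows on a finite time interval -/

lemma integral_congr_uIoc {E : Type*} [NormedAddCommGroup E] [NormedSpace ℝ E] {f g : ℝ → E} {a b : ℝ}
    (h : ∀ s ∈ uIoc a b, f s = g s) : ∫ s in a..b, f s = ∫ s in a..b, g s :=
  intervalIntegral.integral_congr_ae (.of_forall h)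

open Classical in
lemma finsum_cond_eq_sum_fin {M : Type*} [AddCommMonoid M] {f : ℕ → M} {p : ℕ → Prop} 
    (h : ∀ j, p j → j < N) : ∑ᶠ (j : ℕ) (_ : p j), f j = ∑ j : Fin N, if p j then f j else 0 := by
  have e : ∀ j, ∑ᶠ (_ : p j), f j = if p j then f j else 0 := fun j => finsum_eq_if
  simp only [e]
  rw [finsum_eq_sum_of_support_subset (s := range N), sum_range]
  intro j hj
  by_cases hp : p j
  · simpa using h j hp
  · simp [hp] at hj

/-- The trajectories `X` solve the system of vortices up to time `T`. -/
structure IsFlowUpTo (θ : ℝ) (V : VortexData) (X : Paths) (T : ℝ≥0) : Prop where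
  before_birth : ∀ i, ∀ t ≤ T, t ≤ V.birth i → X i t = V.pos i
  integrable : ∀ i, ∀ t ≤ T, V.birth i ≤ t →
    IntervalIntegrable (fun s : ℝ => velocity θ V X i s.toNNReal) volume (V.birth i) t
  after_birth : ∀ i, ∀ t ≤ T, V.birth i ≤ t →
    X i t = V.pos i + toTorus (∫ s in (V.birth i : ℝ)..t, velocity θ V X i s.toNNReal)
  no_collision : ∀ i j, ∀ t ≤ T, i ≠ j → V.birth i ≤ t → V.birth j ≤ t → X i t ≠ X j t

lemma IsVortexFlow.isFlowUpTo (h : IsVortexFlow θ V X) (T : ℝ≥0) : IsFlowUpTo θ V X T where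
  before_birth i t _ := h.before_birth i t
  integrable i t _ := h.integrable i t
  after_birth i t _ := h.after_birth i t
  no_collision i j t _ := h.no_collision i j t

lemma IsFlowUpTo.mono {S T : ℝ≥0} (h : IsFlowUpTo θ V X T) (hST : S ≤ T) : IsFlowUpTo θ V X S where
  before_birth i t ht := h.before_birth i t (ht.trans hST)
  integrable i t ht := h.integrable i t (ht.trans hST)
  after_birth i t ht := h.after_birth i t (ht.trans hST)
  no_collision i j t ht := h.no_collision i j t (ht.trans hST)

lemma isVortexFlow_of_forall (h : ∀ T, IsFlowUpTo θ V X T) : IsVortexFlow θ V X where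
  before_birth i t := (h t).before_birth i t le_rfl
  integrable i t := (h t).integrable i t le_rfl
  after_birth i t := (h t).after_birth i t le_rfl
  no_collision i j t := (h t).no_collision i j t le_rfl

/-- Birth times and intensities of the first `N` vortices. -/
def VortexData.marks (V : VortexData) (N : ℕ) (i : Fin N) : ℝ≥0 × ℝ := (V.birth i, V.int i)

/-- Positions at birth of the first `N` vortices. -/
def VortexData.loc (V : VortexData) (N : ℕ) (i : Fin N) : Torus := V.pos i

/-- The regularization has no effect on the regularized flow up to time `T`. -/
def IsGood (θ : ℝ) (k : ℕ) (T : ℝ) (q : Marks N) (x : Pos N) : Prop :=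
  ∀ t ∈ Icc 0 T, ∀ i j, i ≠ j → ((q i).1 : ℝ) ≤ t → ((q j).1 : ℝ) ≤ t →
    -(k : ℝ) < greenReg k (regFlow θ k q x t i - regFlow θ k q x t j)

lemma velocity_congr {X X' : Paths} {i : ℕ} {s : ℝ≥0}
    (h : ∀ j, X j s = X' j s) : velocity θ V X i s = velocity θ V X' i s := by
  unfold velocity; simp only [h]

lemma force_eq_velocity {s : ℝ≥0} (hN : ∀ j, V.birth j ≤ s → j < N) {i : Fin N} (hi : V.birth i ≤ s)
    (hg : ∀ j : Fin N, j ≠ i → V.birth j ≤ s → -(k : ℝ) < greenReg k (X i s - X j s)) :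
    force (kernelReg k) (coef θ (V.marks N) s) (fun j => X j s) i = velocity θ V X i s := by
  classical
  rw [velocity, finsum_cond_eq_sum_fin (N := N) (fun j hj => hN j hj.2), force]
  refine sum_congr rfl fun j _ => ?_
  by_cases hj : (j : ℕ) ≠ i ∧ V.birth j ≤ s
  · have hji : j ≠ i := fun h => hj.1 (by rw [h])
    rw [if_pos hj, kernelReg_eq_biotSavart (hg j hji hj.2), coef,
      if_pos ⟨hji.symm, mod_cast hi, mod_cast hj.2⟩, intensity,
      if_neg (not_lt.mpr hj.2)]
    rfl
  · rw [if_neg hj, coef, if_neg, zero_smul]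
    rintro ⟨h1, _, h3⟩
    exact hj ⟨fun h => h1 (Fin.ext h).symm, mod_cast h3⟩

lemma regVel_apply_eq_zero {q : Marks N} {x : Pos N} 
    {i : Fin N} (hi : s < (q i).1) : regVel θ k q x s i = 0 := by
  rw [regVel, force]
  refine sum_eq_zero fun j _ => ?_
  rw [coef, if_neg fun h => absurd h.2.1 (not_le.mpr hi), zero_smul]

lemma regDisp_apply (hθ : 0 < θ) (k : ℕ) (q : Marks N) (x : Pos N) (ht : 0 ≤ t) (i : Fin N) :
    regDisp θ k q x t i = ∫ s in (0 : ℝ)..t, regVel θ k q x s i := by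
  rw [regDisp_eq hθ k q x ht]
  exact ((proj (R := ℝ) (φ := fun _ : Fin N => ℝ × ℝ) i).intervalIntegral_comp_comm
    (intervalIntegrable_regVel hθ k q x 0 t)).symm

lemma intervalIntegrable_regVel_apply (hθ : 0 < θ) (k : ℕ) (q : Marks N) (x : Pos N) (i : Fin N) (a b : ℝ) :
    IntervalIntegrable (fun s => regVel θ k q x s i) volume a b := by
  have h := intervalIntegrable_regVel hθ k q x a b
  exact ⟨(proj (R := ℝ) (φ := fun _ : Fin N => ℝ × ℝ) i).integrable_comp h.1,
    (proj (R := ℝ) (φ := fun _ : Fin N => ℝ × ℝ) i).integrable_comp h.2⟩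

lemma integral_eq_zero_of_lt {f : ℝ → ℝ × ℝ} {b t : ℝ} (ht : 0 ≤ t) (htb : t ≤ b)
    (h : ∀ s < b, f s = 0) : ∫ s in (0 : ℝ)..t, f s = 0 := by
  rw [integral_of_le ht, integral_Ioc_eq_integral_Ioo]
  exact setIntegral_eq_zero_of_forall_eq_zero fun s hs => h s (hs.2.trans_le htb)

lemma regFlow_eq_of_le (hθ : 0 < θ) (k : ℕ) (q : Marks N) (x : Pos N)
    (ht : 0 ≤ t) {i : Fin N} (hi : t ≤ (q i).1) : regFlow θ k q x t i = x i := by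
  have : regDisp θ k q x t i = 0 := by
    rw [regDisp_apply hθ k q x ht, integral_eq_zero_of_lt ht hi fun s hs => regVel_apply_eq_zero hs]
  rw [regFlow, move, this, toTorus_zero, add_zero]

lemma regDisp_apply_of_le (hθ : 0 < θ) (k : ℕ) (q : Marks N) (x : Pos N)
    {i : Fin N} (hi : (q i).1 ≤ t) :
    regDisp θ k q x t i = ∫ s in ((q i).1 : ℝ)..t, regVel θ k q x s i := by
  have ht : 0 ≤ t := (q i).1.coe_nonneg.trans hi
  rw [regDisp_apply hθ k q x ht, ← integral_add_adjacent_intervals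
    (intervalIntegrable_regVel_apply hθ k q x i 0 (q i).1)
    (intervalIntegrable_regVel_apply hθ k q x i (q i).1 t),
    integral_eq_zero_of_lt (q i).1.coe_nonneg le_rfl fun s hs => regVel_apply_eq_zero hs, zero_add]

/-- A good regularized flow, completed by motionless vortices. -/
def extendFlow (V : VortexData) (Y : ℝ → Fin N → Torus) (i : ℕ) (t : ℝ≥0) : Torus :=
  if h : i < N then Y t ⟨i, h⟩ else V.pos i

lemma IsGood.regVel_eq_velocity {T : ℝ≥0}
    (hN : ∀ j, V.birth j ≤ T → j < N) (hg : IsGood θ k T (V.marks N) (V.loc N))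
    {s : ℝ≥0} (hs : s ≤ T)
    (hX : ∀ i : Fin N, X i s = regFlow θ k (V.marks N) (V.loc N) s i) {i : Fin N}
    (hi : V.birth i ≤ s) :
    regVel θ k (V.marks N) (V.loc N) s i = velocity θ V X i s := by
  rw [← force_eq_velocity (k := k) (fun j hj => hN j (hj.trans hs)) hi, regVel]
  · simp only [hX]
  · intro j hji hj
    rw [hX, hX]
    exact hg s ⟨s.coe_nonneg, mod_cast hs⟩ i j hji.symm (mod_cast hi) (mod_cast hj)

lemma eq_of_uIoc_toNNReal {b t : ℝ≥0} (hbt : b ≤ t) (hs : s ∈ uIoc (b : ℝ) t) :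
    ((s.toNNReal : ℝ≥0) : ℝ) = s ∧ b ≤ s.toNNReal ∧ s.toNNReal ≤ t := by
  rw [uIoc_of_le (mod_cast hbt)] at hs
  have h0 : 0 ≤ s := b.coe_nonneg.trans hs.1.le
  refine ⟨coe_toNNReal s h0, ?_, ?_⟩
  · rw [← coe_le_coe, coe_toNNReal s h0]; exact hs.1.le
  · rw [← coe_le_coe, coe_toNNReal s h0]; exact hs.2

/-- Along a good trajectory the truncated kernel is the true one for all pairs already born, so the
integral equations coincide. Collisions are impossible because at the origin the truncated function
is at most `-k`. Vortices of index at least `N` are not born before `T`. -/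
lemma IsGood.isFlowUpTo (hθ : 0 < θ) {T : ℝ≥0}
    (hN : ∀ j, V.birth j ≤ T → j < N) (hg : IsGood θ k T (V.marks N) (V.loc N)) :
    IsFlowUpTo θ V (extendFlow V (regFlow θ k (V.marks N) (V.loc N))) T := by
  set X := extendFlow V (regFlow θ k (V.marks N) (V.loc N)) with hXdef
  have hX : ∀ (i : Fin N) (s : ℝ≥0), X i s = regFlow θ k (V.marks N) (V.loc N) s i := fun i s => by
    rw [hXdef, extendFlow, dif_pos i.2]
  have hvel : ∀ (i : Fin N) (t : ℝ≥0), t ≤ T → V.birth i ≤ t → ∀ s ∈ uIoc (V.birth i : ℝ) t,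
      regVel θ k (V.marks N) (V.loc N) s i = velocity θ V X i s.toNNReal := by
    intro i t ht hi s hs
    obtain ⟨h1, h2, h3⟩ := eq_of_uIoc_toNNReal hi hs
    rw [← hg.regVel_eq_velocity hN (h3.trans ht) (fun i => hX i _) h2, h1]
  refine ⟨fun i t ht hi => ?_, fun i t ht hi => ?_, fun i t ht hi => ?_, fun i j t ht hij hi hj => ?_⟩
  · by_cases h : i < N
    · rw [hX ⟨i, h⟩, regFlow_eq_of_le hθ _ _ _ t.coe_nonneg (mod_cast hi)]; rfl
    · rw [hXdef, extendFlow, dif_neg h]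
  · have h := hN i (hi.trans ht)
    exact (intervalIntegrable_regVel_apply hθ k (V.marks N) (V.loc N) ⟨i, h⟩ _ _).congr (hvel ⟨i, h⟩ t ht hi)
  · have h := hN i (hi.trans ht)
    rw [hX ⟨i, h⟩, regFlow, move, regDisp_apply_of_le hθ _ _ _ (mod_cast hi)]
    congr 2
    exact integral_congr_uIoc (hvel ⟨i, h⟩ t ht hi)
  · have hi' := hN i (hi.trans ht)
    have hj' := hN j (hj.trans ht)
    have := hg t ⟨t.coe_nonneg, mod_cast ht⟩ ⟨i, hi'⟩ ⟨j, hj'⟩ (by simpa using hij) (mod_cast hi) (mod_cast hj)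
    intro heq
    rw [hX ⟨i, hi'⟩, hX ⟨j, hj'⟩] at heq
    rw [heq, sub_self, greenReg, if_pos rfl] at this
    exact absurd (cutoff_le_neg (by linarith)) (not_le.mpr this)

lemma exists_lt_green_of_compact {S : Set ℝ} (hS : IsCompact S) {D : ℝ → Torus}
    (hD : ContinuousOn D S) (h0 : ∀ t ∈ S, D t ≠ 0) : ∃ k : ℕ, ∀ t ∈ S, -(k : ℝ) < green (D t) := by
  have hc : ContinuousOn (fun t => green (D t)) S := fun t ht => by
    have h1 : ContinuousAt green (D t) := by
      have := (contDiffAt_green (h0 t ht) 1).continuousAt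
      exact (continuousAt_iff_toTorus _ _).mpr this
    exact h1.comp_continuousWithinAt (hD t ht)
  obtain ⟨B, hB⟩ := hS.exists_bound_of_continuousOn hc
  obtain ⟨k, hk⟩ := exists_nat_gt B
  refine ⟨k, fun t ht => ?_⟩
  have := (abs_le.mp (hB t ht)).1
  linarith

lemma lt_greenReg_of_lt_green (hz : z ≠ 0) (h : -(k : ℝ) < green z) : -(k : ℝ) < greenReg k z := by
  rw [greenReg, if_neg hz]; exact h.trans_le (le_cutoff _ _)

/-- After both births, two trajectories are continuous and distinct on a compact interval, so the
Green function of their difference is bounded below. For large `k` the solution therefore solves the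
truncated equation, and uniqueness there identifies it. Having all `k ≥ k₀` permits comparing two
solutions at a common `k`. -/
lemma IsFlowUpTo.exists_isGood (hθ : 0 < θ) 
    {T : ℝ≥0} (h : IsFlowUpTo θ V X T) (hN : ∀ j, V.birth j ≤ T → j < N) :
    ∃ k₀, ∀ k ≥ k₀, IsGood θ k T (V.marks N) (V.loc N) ∧
      ∀ t ≤ T, ∀ i : Fin N, X i t = regFlow θ k (V.marks N) (V.loc N) t i := by
  classical
  -- Velocities are extended by zero before birth, so that all displacements solve one equation on
  -- `[0, T]` starting from `0`.
  set W : Fin N → ℝ → ℝ × ℝ := fun i s => if (V.birth i : ℝ) ≤ s then velocity θ V X i s.toNNReal else 0 with hW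
  set y : ℝ → Vel N := fun t i => ∫ s in (0 : ℝ)..t, W i s with hy
  have hW0 : ∀ i : Fin N, ∀ s < (V.birth i : ℝ), W i s = 0 := fun i s hs => by
    rw [hW]; simp only; rw [if_neg (not_le.mpr hs)]
  have hWi0 : ∀ (i : Fin N) (t : ℝ), 0 ≤ t → t ≤ V.birth i → IntervalIntegrable (W i) volume 0 t := by
    intro i t ht hti
    have : IntervalIntegrable (fun _ : ℝ => (0 : ℝ × ℝ)) volume 0 t := _root_.intervalIntegrable_const
    refine this.congr_ae ?_
    rw [uIoc_of_le ht, ← restrict_Ioo_eq_restrict_Ioc]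
    filter_upwards [ae_restrict_mem measurableSet_Ioo] with s hs
    exact (hW0 i s (hs.2.trans_le hti)).symm
  have hWi1 : ∀ (i : Fin N) (t : ℝ≥0), t ≤ T → V.birth i ≤ t → IntervalIntegrable (W i) volume (V.birth i) t := by
    intro i t ht hi
    refine (h.integrable i t ht hi).congr fun s hs => ?_
    rw [uIoc_of_le (mod_cast hi)] at hs
    simp only [hW]; rw [if_pos hs.1.le]
  have hWi : ∀ (i : Fin N) (t : ℝ≥0), t ≤ T → IntervalIntegrable (W i) volume 0 t := by
    intro i t ht
    rcases le_total t (V.birth i) with hti | hti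
    · exact hWi0 i t t.coe_nonneg (mod_cast hti)
    · exact (hWi0 i _ (V.birth i).coe_nonneg le_rfl).trans (hWi1 i t ht hti)
  have hXy : ∀ (i : Fin N) (t : ℝ≥0), t ≤ T → X i t = V.pos i + toTorus (y t i) := by
    intro i t ht
    rcases le_total t (V.birth i) with hti | hti
    · rw [h.before_birth i t ht hti, hy]
      simp only
      rw [integral_eq_zero_of_lt t.coe_nonneg (mod_cast hti) (hW0 i), toTorus_zero, add_zero]
    · rw [h.after_birth i t ht hti]
      simp only [hy]
      rw [← integral_add_adjacent_intervals (hWi0 i _ (V.birth i).coe_nonneg le_rfl)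
        (hWi1 i t ht hti), integral_eq_zero_of_lt (V.birth i).coe_nonneg le_rfl (hW0 i), zero_add]
      congr 2
      refine integral_congr_uIoc fun s hs => ?_
      rw [uIoc_of_le (mod_cast hti)] at hs
      simp only [hW]; rw [if_pos hs.1.le]
  have hyc : ∀ i, ContinuousOn (fun t => y t i) (Icc 0 T) := by
    intro i
    have := intervalIntegral.continuousOn_primitive_interval' (hWi i T le_rfl) Set.left_mem_uIcc
    rwa [uIcc_of_le T.coe_nonneg] at this
  have hcont : ∀ i : Fin N, ContinuousOn (fun t : ℝ => X i t.toNNReal) (Icc 0 T) := by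
    intro i
    have h1 : ContinuousOn (fun t => V.pos i + toTorus (y t i)) (Icc 0 T) :=
      continuousOn_const.add (continuous_toTorus.comp_continuousOn (hyc i))
    refine h1.congr fun t ht => ?_
    rw [hXy i _ (by rw [← coe_le_coe, coe_toNNReal t ht.1]; exact ht.2), coe_toNNReal t ht.1]
  have hk : ∀ i j : Fin N, ∃ k : ℕ, i ≠ j → ∀ t : ℝ≥0, t ≤ T → V.birth i ≤ t → V.birth j ≤ t →
      -(k : ℝ) < green (X i t - X j t) := by
    intro i j
    by_cases hij : i = j
    · exact ⟨0, fun hh => absurd hij hh⟩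
    have hij' : (i : ℕ) ≠ j := fun hh => hij (Fin.ext hh)
    set b : ℝ := max (V.birth i : ℝ) (V.birth j) with hb
    have hb0 : 0 ≤ b := (V.birth i).coe_nonneg.trans (le_max_left _ _)
    obtain ⟨k, hk⟩ := exists_lt_green_of_compact (S := Icc b T) isCompact_Icc
      (D := fun t => X i t.toNNReal - X j t.toNNReal)
      (((hcont i).sub (hcont j)).mono (Set.Icc_subset_Icc_left hb0)) (fun t ht => by
        have ht0 : 0 ≤ t := hb0.trans ht.1
        refine sub_ne_zero.mpr (h.no_collision i j _ ?_ hij' ?_ ?_)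
        · rw [← coe_le_coe, coe_toNNReal t ht0]; exact ht.2
        · rw [← coe_le_coe, coe_toNNReal t ht0]; exact (le_max_left _ _).trans ht.1
        · rw [← coe_le_coe, coe_toNNReal t ht0]; exact (le_max_right _ _).trans ht.1)
    refine ⟨k, fun _ t ht hi hj => ?_⟩
    have := hk t ⟨max_le (mod_cast hi) (mod_cast hj), mod_cast ht⟩
    simpa using this
  choose kk hkk using hk
  set k₀ : ℕ := ∑ i, ∑ j, kk i j with hk₀
  have hle : ∀ i j, kk i j ≤ k₀ := fun i j =>
    (Finset.single_le_sum (f := fun j => kk i j) (fun _ _ => Nat.zero_le _) (mem_univ j)).trans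
      (Finset.single_le_sum (f := fun i => ∑ j, kk i j) (fun _ _ => Nat.zero_le _) (mem_univ i))
  refine ⟨k₀, fun k hk => ?_⟩
  have hgr : ∀ (i j : Fin N), i ≠ j → ∀ t : ℝ≥0, t ≤ T → V.birth i ≤ t → V.birth j ≤ t →
      -(k : ℝ) < greenReg k (X i t - X j t) := by
    intro i j hij t ht hi hj
    refine lt_greenReg_of_lt_green (sub_ne_zero.mpr
      (h.no_collision i j t ht (fun hh => hij (Fin.ext hh)) hi hj)) ?_
    refine lt_of_le_of_lt ?_ (hkk i j hij t ht hi hj)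
    have : ((kk i j : ℕ) : ℝ) ≤ k := mod_cast (hle i j).trans hk
    linarith
  obtain ⟨B, L, hv⟩ := exists_isLipField hθ k N
  have hmove : ∀ s : ℝ≥0, s ≤ T → move (V.loc N) (y s) = fun j : Fin N => X j s := by
    intro s hs
    ext1 j
    rw [hXy j s hs]; rfl
  have hsol : ∀ t ∈ Icc (0 : ℝ) T, y t = ∫ s in (0 : ℝ)..t,
      drift (kernelReg k) (coef θ) (V.marks N, V.loc N) s (y s) := by
    intro t ht
    have ht' : t.toNNReal ≤ T := by rw [← coe_le_coe, coe_toNNReal t ht.1]; exact ht.2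
    have hInt : IntervalIntegrable (fun s => fun i => W i s) volume 0 t := by
      rw [intervalIntegrable_iff]
      refine Integrable.of_eval fun i => intervalIntegrable_iff.mp ?_
      have := hWi i _ ht'
      rwa [coe_toNNReal t ht.1] at this
    have e1 : y t = ∫ s in (0 : ℝ)..t, fun i => W i s := by
      ext1 i
      exact ((proj (R := ℝ) (φ := fun _ : Fin N => ℝ × ℝ) i).intervalIntegral_comp_comm hInt)
    rw [e1]
    refine integral_congr fun s hs => ?_
    rw [uIcc_of_le ht.1] at hs
    have hs' : s.toNNReal ≤ T := by rw [← coe_le_coe, coe_toNNReal s hs.1]; exact hs.2.trans ht.2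
    have es : ((s.toNNReal : ℝ≥0) : ℝ) = s := coe_toNNReal s hs.1
    ext1 i
    simp only [drift]
    have := hmove s.toNNReal hs'
    rw [es] at this
    rw [this]
    by_cases hi : (V.birth i : ℝ) ≤ s
    · simp only [hW]
      rw [if_pos hi]
      have hi' : V.birth i ≤ s.toNNReal := by rw [← coe_le_coe, es]; exact hi
      rw [← force_eq_velocity (k := k) (N := N) (fun j hj => hN j (hj.trans hs')) hi'
        (fun j hji hj => hgr i j hji.symm _ hs' hi' hj), es]
    · rw [hW0 i s (not_le.mp hi), force]
      symm
      refine sum_eq_zero fun j _ => ?_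
      rw [coef, if_neg fun hh => hi hh.2.1, zero_smul]
  have hym : AEStronglyMeasurable y (volume.restrict (Icc (0 : ℝ) T)) :=
    (continuousOn_pi.mpr hyc).aestronglyMeasurable measurableSet_Icc
  have heq : ∀ t ∈ Icc (0 : ℝ) T, y t = regDisp θ k (V.marks N) (V.loc N) t := fun t ht => hv.eq_flow _ hym hsol ht
  have hfl : ∀ t ≤ T, ∀ i : Fin N, X i t = regFlow θ k (V.marks N) (V.loc N) t i := by
    intro t ht i
    rw [hXy i t ht, heq t ⟨t.coe_nonneg, mod_cast ht⟩]
    rfl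
  refine ⟨fun t ht i j hij hi hj => ?_, hfl⟩
  have ht' : t.toNNReal ≤ T := by rw [← coe_le_coe, coe_toNNReal t ht.1]; exact ht.2
  have es : ((t.toNNReal : ℝ≥0) : ℝ) = t := coe_toNNReal t ht.1
  have := hgr i j hij t.toNNReal ht' (by rw [← coe_le_coe, es]; exact hi) (by rw [← coe_le_coe, es]; exact hj)
  rwa [hfl _ ht', hfl _ ht', es] at this

lemma IsFlowUpTo.eq (hθ : 0 < θ) {X X' : Paths} 
    {T : ℝ≥0} (hN : ∀ j, V.birth j ≤ T → j < N) (h : IsFlowUpTo θ V X T) (h' : IsFlowUpTo θ V X' T)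
    (i : ℕ) {t : ℝ≥0} (ht : t ≤ T) : X i t = X' i t := by
  by_cases hi : i < N
  · obtain ⟨k, hk⟩ := h.exists_isGood hθ hN
    obtain ⟨k', hk'⟩ := h'.exists_isGood hθ hN
    rw [(hk (max k k') (le_max_left _ _)).2 t ht ⟨i, hi⟩, (hk' (max k k') (le_max_right _ _)).2 t ht ⟨i, hi⟩]
  · have hb : T < V.birth i := by
      by_contra hh
      exact hi (hN i (not_lt.mp hh))
    rw [h.before_birth i t ht (ht.trans hb.le), h'.before_birth i t ht (ht.trans hb.le)]

/-- Flows up to all integer times can be patched. -/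
lemma exists_isVortexFlow (hθ : 0 < θ) (hV : ∀ T : ℝ≥0, ∃ N, ∀ j, V.birth j ≤ T → j < N)
    (h : ∀ T : ℕ, ∃ X, IsFlowUpTo θ V X T) : ∃ X, IsVortexFlow θ V X := by
  choose X hX using h
  have hcons : ∀ (S : ℕ) (i : ℕ) (t : ℝ≥0), t ≤ S → X ⌈t⌉₊ i t = X S i t := by
    intro S i t ht
    obtain ⟨N, hN⟩ := hV (⌈t⌉₊ : ℝ≥0)
    exact (hX _).eq hθ hN ((hX S).mono (mod_cast Nat.ceil_le.mpr ht)) i (Nat.le_ceil t)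
  set Y : Paths := fun i t => X ⌈t⌉₊ i t with hY
  refine ⟨Y, isVortexFlow_of_forall fun T => ?_⟩
  have hS := hX ⌈T⌉₊
  have hTS : T ≤ (⌈T⌉₊ : ℝ≥0) := Nat.le_ceil T
  have hYX : ∀ i, ∀ t ≤ T, Y i t = X ⌈T⌉₊ i t := fun i t ht => hcons _ i t (ht.trans hTS)
  have hvel : ∀ i, ∀ t ≤ T, V.birth i ≤ t → ∀ s ∈ uIoc (V.birth i : ℝ) t,
      velocity θ V (X ⌈T⌉₊) i s.toNNReal = velocity θ V Y i s.toNNReal := by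
    intro i t ht hi s hs
    obtain ⟨h1, h2, h3⟩ := eq_of_uIoc_toNNReal hi hs
    exact velocity_congr fun j => (hYX j _ (h3.trans ht)).symm
  refine ⟨fun i t ht hi => ?_, fun i t ht hi => ?_, fun i t ht hi => ?_, fun i j t ht hij hi hj => ?_⟩
  · rw [hYX i t ht, hS.before_birth i t (ht.trans hTS) hi]
  · exact (hS.integrable i t (ht.trans hTS) hi).congr (hvel i t ht hi)
  · rw [hYX i t ht, hS.after_birth i t (ht.trans hTS) hi]
    congr 2
    exact integral_congr_uIoc (hvel i t ht hi)
  · rw [hYX i t ht, hYX j t ht]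
    exact hS.no_collision i j t (ht.trans hTS) hij hi hj

/-! ### Finite sums of point masses -/

section Dirac

variable {ι : Type*}

lemma integrable_dirac {X E : Type*} [MeasurableSpace X] [MeasurableSingletonClass X]
    [NormedAddCommGroup E] (f : X → E) (a : X) (v : ℝ) : (dirac a v).Integrable f := by
  rw [VectorMeasure.Integrable, VectorMeasure.variation_dirac]
  refine Integrable.smul_measure ?_ (by simp)
  exact MeasureTheory.integrable_dirac (by simp)

lemma pairing_sum_dirac (f : Torus → ℝ) (S : Finset ι) (x : ι → Torus) (c : ι → ℝ) :
    pairing f (∑ i ∈ S, dirac (x i) (c i)) = ∑ i ∈ S, c i * f (x i) := by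
  rw [pairing, integral_finsetSum_vectorMeasure fun i _ => integrable_dirac _ _ _]
  refine sum_congr rfl fun i _ => ?_
  rw [VectorMeasure.integral_dirac]
  simp [mul_comm]

lemma fourierCoeffSM_sum_dirac (k : ℤ × ℤ) (S : Finset ι) (x : ι → Torus) (c : ι → ℝ) :
    fourierCoeffSM (∑ i ∈ S, dirac (x i) (c i)) k = ∑ i ∈ S, (c i : ℂ) * mode (-k) (x i) := by
  rw [fourierCoeffSM, integral_finsetSum_vectorMeasure fun i _ => integrable_dirac _ _ _]
  refine sum_congr rfl fun i _ => ?_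
  rw [VectorMeasure.integral_dirac]
  simp

lemma dirac_apply_eq {X : Type*} [MeasurableSpace X] (a : X) (v : ℝ) {A : Set X} (hA : MeasurableSet A) :
    dirac a v A = A.indicator (fun _ => v) a := by
  by_cases h : a ∈ A <;> simp [h, hA]

lemma sum_dirac_apply {X : Type*} [MeasurableSpace X] (S : Finset ι) (x : ι → X) (c : ι → ℝ) {A : Set X}
    (hA : MeasurableSet A) : (∑ i ∈ S, dirac (x i) (c i)) A = ∑ i ∈ S, A.indicator (fun _ => c i) (x i) := by
  rw [FunLike.coe_sum, Finset.sum_apply]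
  exact sum_congr rfl fun i _ => dirac_apply_eq _ _ hA

lemma sum_dirac_pair (S : Finset ι) (x : ι → Torus) (c : ι → ℝ) :
    prod (∑ i ∈ S, dirac (x i) (c i)) (∑ i ∈ S, dirac (x i) (c i)) (lsmul ℝ ℝ)
      = ∑ p ∈ S ×ˢ S, dirac (x p.1, x p.2) (c p.1 * c p.2) := by
  refine VectorMeasure.prod_eq_of_forall_apply_prod fun s t hs ht => ?_
  rw [sum_dirac_apply _ _ _ (hs.prod ht), sum_dirac_apply _ _ _ hs, sum_dirac_apply _ _ _ ht]
  simp only [ContinuousLinearMap.lsmul_apply, smul_eq_mul]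
  rw [Finset.sum_mul_sum, Finset.sum_product]
  refine sum_congr rfl fun i _ => sum_congr rfl fun j _ => ?_
  by_cases hi : x i ∈ s <;> by_cases hj : x j ∈ t <;> simp [hi, hj]

-- The diagonal is removed through the positions and not through the indices, so the atoms need not
-- be distinct.
open Classical in
lemma offDiagonal_sum_dirac (h : Torus → Torus → ℝ) (S : Finset ι) (x : ι → Torus) (c : ι → ℝ) :
    offDiagonal h (∑ i ∈ S, dirac (x i) (c i))
      = ∑ i ∈ S, ∑ j ∈ S, if x i = x j then 0 else c i * c j * h (x i) (x j) := by
  have : MeasurableSingletonClass (Torus × Torus) := Prod.instMeasurableSingletonClass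
  have hd : MeasurableSet (Set.diagonal Torus)ᶜ := measurableSet_diagonal.compl
  have hr : (∑ p ∈ S ×ˢ S, dirac (x p.1, x p.2) (c p.1 * c p.2)).restrict
      (Set.diagonal Torus)ᶜ = ∑ p ∈ S ×ˢ S, dirac (x p.1, x p.2) (if x p.1 = x p.2 then 0 else c p.1 * c p.2) := by
    ext A hA
    rw [VectorMeasure.restrict_apply _ hd hA, sum_dirac_apply _ _ _ (hA.inter hd), sum_dirac_apply _ _ _ hA]
    refine sum_congr rfl fun p _ => ?_
    by_cases h1 : (x p.1, x p.2) ∈ A <;> by_cases h2 : x p.1 = x p.2 <;> simp [h1, h2]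
  rw [offDiagonal, sum_dirac_pair, hr,
    integral_finsetSum_vectorMeasure fun i _ => integrable_dirac _ _ _, Finset.sum_product]
  refine sum_congr rfl fun i _ => sum_congr rfl fun j _ => ?_
  rw [VectorMeasure.integral_dirac]
  split_ifs <;> simp [mul_comm]

/-! ### Sobolev spaces and point masses -/

/-- The weights of the Sobolev norm. -/
def weight (s : ℝ) (k : ℤ × ℤ) : ℝ := (1 + (k.1 : ℝ) ^ 2 + (k.2 : ℝ) ^ 2) ^ (s / 2)

lemma weight_nonneg (s : ℝ) (k : ℤ × ℤ) : 0 ≤ weight s k := by unfold weight; positivity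

/-- The inequality `(1 + a² + b²)² ≥ (1 + a²)(1 + b²)` dominates the double series by a product of
two simple ones, each convergent exactly because `s < -1`. -/
lemma summable_weight_sq (hs : s < -1) : Summable fun k : ℤ × ℤ => weight s k ^ 2 := by
  have h1 : Summable fun a : ℤ => (1 + (a : ℝ) ^ 2) ^ (s / 2) := by
    have h0 := Real.summable_abs_int_rpow (b := -s) (by linarith)
    refine Summable.of_norm_bounded_eventually h0 ?_
    have : ({0} : Set ℤ)ᶜ ∈ cofinite := (Set.finite_singleton 0).compl_mem_cofinite
    filter_upwards [this] with a ha
    have ha' : (0 : ℝ) < |(a : ℝ)| := by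
      have : (a : ℝ) ≠ 0 := mod_cast ha
      positivity
    rw [Real.norm_of_nonneg (by positivity), neg_neg]
    have : |(a : ℝ)| ^ s = ((a : ℝ) ^ 2) ^ (s / 2) := by
      rw [← sq_abs, ← rpow_natCast, ← rpow_mul ha'.le]; congr 1; push_cast; ring
    rw [this]
    refine Real.rpow_le_rpow_of_nonpos ?_ (by linarith) (by linarith)
    rw [← sq_abs]; positivity
  have h2 := h1.mul_of_nonneg h1 (fun a => by positivity) (fun a => by positivity)
  refine Summable.of_nonneg_of_le (fun k => sq_nonneg _) (fun k => ?_) h2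
  have e : weight s k ^ 2 = ((1 + (k.1 : ℝ) ^ 2 + (k.2 : ℝ) ^ 2) ^ 2) ^ (s / 2) := by
    have hb : (0 : ℝ) ≤ 1 + (k.1 : ℝ) ^ 2 + (k.2 : ℝ) ^ 2 := by positivity
    rw [weight]
    generalize 1 + (k.1 : ℝ) ^ 2 + (k.2 : ℝ) ^ 2 = b at hb
    rw [← rpow_natCast, ← rpow_natCast, ← rpow_mul hb, ← rpow_mul hb, mul_comm]
  rw [e, ← Real.mul_rpow (by positivity) (by positivity)]
  refine Real.rpow_le_rpow_of_nonpos (by positivity) ?_ (by linarith)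
  nlinarith [sq_nonneg (k.1 : ℝ), sq_nonneg (k.2 : ℝ), mul_nonneg (sq_nonneg (k.1 : ℝ)) (sq_nonneg (k.2 : ℝ))]

lemma norm_mode (k : ℤ × ℤ) (x : Torus) : ‖mode k x‖ = 1 := by
  simp only [mode, fourier_apply, norm_mul, Circle.norm_coe, mul_one]

lemma mode_neg (k : ℤ × ℤ) (x : Torus) : mode (-k) x = (starRingEnd ℂ) (mode k x) := by simp [mode]

lemma continuous_mode (k : ℤ × ℤ) : Continuous (mode k) :=
  ((fourier k.1).continuous.comp continuous_fst).mul ((fourier k.2).continuous.comp continuous_snd)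

lemma toSobolev_apply {μ : SMeas}
    (h : ∃ a : Sobolev s, ∀ k, (a : lp (fun _ : ℤ × ℤ => ℂ) 2) k = sobolevCoeff s μ k) (k : ℤ × ℤ) :
    (toSobolev s μ : lp (fun _ : ℤ × ℤ => ℂ) 2) k = sobolevCoeff s μ k := by
  rw [toSobolev, dif_pos h]; exact h.choose_spec k

/-- The point mass at `x`, as an element of `H^s`. -/
def diracSob (s : ℝ) (x : Torus) : Sobolev s := toSobolev s (dirac x 1)

lemma diracSob_apply (hs : s < -1) (x : Torus) (k : ℤ × ℤ) :
    (diracSob s x : lp (fun _ : ℤ × ℤ => ℂ) 2) k = weight s k * mode (-k) x := by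
  have hmem : Memℓp (fun k : ℤ × ℤ => (weight s k : ℂ) * mode (-k) x) 2 := by
    refine memℓp_gen ?_
    simpa [norm_mode, weight_nonneg, abs_of_nonneg] using summable_weight_sq hs
  have hcoef : ∀ k, sobolevCoeff s (dirac x 1) k = weight s k * mode (-k) x := fun k => by
    have := fourierCoeffSM_sum_dirac k (Finset.univ : Finset (Fin 1)) (fun _ => x) (fun _ => 1)
    simp only [Finset.univ_unique, Finset.sum_singleton, Complex.ofReal_one, one_mul] at this
    rw [sobolevCoeff, this]; rfl
  have hex : ∃ a : Sobolev s, ∀ k, (a : lp (fun _ : ℤ × ℤ => ℂ) 2) k = sobolevCoeff s (dirac x 1) k := by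
    refine ⟨⟨⟨_, hmem⟩, fun k => ?_⟩, fun k => (hcoef k).symm⟩
    change (weight s (-k) : ℂ) * mode (- -k) x = (starRingEnd ℂ) (weight s k * mode (-k) x)
    rw [map_mul, mode_neg (-k), Complex.conj_ofReal]
    simp [weight]
  rw [diracSob, toSobolev_apply hex, hcoef]

lemma sobolev_ext {a b : Sobolev s} (h : ∀ k, (a : lp (fun _ : ℤ × ℤ => ℂ) 2) k
    = (b : lp (fun _ : ℤ × ℤ => ℂ) 2) k) : a = b :=
  Subtype.ext (lp.ext (funext h))

lemma sum_smul_diracSob_apply (hs : s < -1) (S : Finset ι) (x : ι → Torus) (c : ι → ℝ) (k : ℤ × ℤ) :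
    ((∑ i ∈ S, c i • diracSob s (x i) : Sobolev s) : lp (fun _ : ℤ × ℤ => ℂ) 2) k
      = sobolevCoeff s (∑ i ∈ S, dirac (x i) (c i)) k := by
  rw [sobolevCoeff, fourierCoeffSM_sum_dirac, mul_sum, Submodule.coe_sum, lp.coeFn_sum, Finset.sum_apply]
  refine sum_congr rfl fun i _ => ?_
  rw [Submodule.coe_smul, lp.coeFn_smul, Pi.smul_apply, diracSob_apply hs, Complex.real_smul, weight]
  ring

lemma toSobolev_sum_dirac (hs : s < -1) (S : Finset ι) (x : ι → Torus) (c : ι → ℝ) :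
    toSobolev s (∑ i ∈ S, dirac (x i) (c i)) = ∑ i ∈ S, c i • diracSob s (x i) := by
  refine sobolev_ext fun k => ?_
  rw [toSobolev_apply ⟨_, sum_smul_diracSob_apply hs S x c⟩, sum_smul_diracSob_apply hs]

lemma continuous_diracSob (hs : s < -1) : Continuous (diracSob s) := by
  rw [continuous_iff_continuousAt]
  intro x
  rw [ContinuousAt, tendsto_iff_norm_sub_tendsto_zero]
  have hn : ∀ y, ‖diracSob s y - diracSob s x‖ ^ 2
      = ∑' k : ℤ × ℤ, weight s k ^ 2 * ‖mode (-k) y - mode (-k) x‖ ^ 2 := by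
    intro y
    have := lp.norm_rpow_eq_tsum (p := 2) (by simp)
      ((diracSob s y - diracSob s x : Sobolev s) : lp (fun _ : ℤ × ℤ => ℂ) 2)
    simp only [ENNReal.toReal_ofNat, Real.rpow_ofNat] at this
    rw [← Submodule.coe_norm] at this
    rw [this]
    refine tsum_congr fun k => ?_
    rw [Submodule.coe_sub, lp.coeFn_sub, Pi.sub_apply, diracSob_apply hs, diracSob_apply hs, ← mul_sub,
      norm_mul, mul_pow, Complex.norm_real, norm_eq_abs, sq_abs]
  have hlim : Tendsto (fun y => ∑' k : ℤ × ℤ, weight s k ^ 2 * ‖mode (-k) y - mode (-k) x‖ ^ 2) (𝓝 x)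
      (𝓝 (∑' _ : ℤ × ℤ, (0 : ℝ))) := by
    refine tendsto_tsum_of_dominated_convergence (bound := fun k => weight s k ^ 2 * 4)
      ((summable_weight_sq hs).mul_right 4) (fun k => ?_) (.of_forall fun y k => ?_)
    · have : Continuous fun y => weight s k ^ 2 * ‖mode (-k) y - mode (-k) x‖ ^ 2 := by
        have := continuous_mode (-k)
        fun_prop
      simpa using this.tendsto x
    · rw [Real.norm_of_nonneg (by positivity)]
      gcongr
      have := norm_sub_le (mode (-k) y) (mode (-k) x)
      rw [norm_mode, norm_mode] at this
      nlinarith [norm_nonneg (mode (-k) y - mode (-k) x)]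
  rw [tsum_zero] at hlim
  have h2 := hlim.sqrt
  rw [Real.sqrt_zero] at h2
  refine h2.congr fun y => ?_
  rw [← hn, Real.sqrt_sq (norm_nonneg _)]

end Dirac

/-! ### Integration against step functions -/

lemma boundedVariationOn_of_edist_le {α : Type*} [LinearOrder α] {f G : α → ℝ} {s : Set α}
    (hG : BoundedVariationOn G s) (h : ∀ x y, x ≤ y → edist (f y) (f x) ≤ edist (G y) (G x)) :
    BoundedVariationOn f s := by
  refine ne_top_of_le_ne_top hG (iSup_mono fun p => sum_le_sum fun i _ => ?_)
  exact h _ _ (p.2.2.1 (Nat.le_succ i))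

lemma boundedVariationOn_step {K : ℕ} (τ : Fin K → ℝ≥0) (a : Fin K → ℝ) (t : ℝ≥0) :
    BoundedVariationOn (fun s => ∑ m, if τ m ≤ min s t then a m else 0) univ := by
  have hmono : Monotone fun s : ℝ≥0 => ∑ m, if τ m ≤ min s t then |a m| else 0 := by
    intro x y hxy
    refine sum_le_sum fun m _ => ?_
    by_cases h : τ m ≤ min x t
    · rw [if_pos h, if_pos (h.trans (min_le_min_right t hxy))]
    · rw [if_neg h]; split_ifs <;> positivity
  refine boundedVariationOn_of_edist_le (G := fun s : ℝ≥0 => ∑ m, if τ m ≤ min s t then |a m| else 0)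
    ((hmono.monotoneOn _).boundedVariationOn (C := ∑ m, |a m|) fun x _ => ?_) fun x y hxy => ?_
  · rw [abs_of_nonneg (sum_nonneg fun m _ => by split_ifs <;> positivity)]
    exact sum_le_sum fun m _ => by split_ifs <;> simp
  · rw [edist_dist, edist_dist, Real.dist_eq, Real.dist_eq, abs_of_nonneg (sub_nonneg.mpr (hmono hxy)),
      ← sum_sub_distrib, ← sum_sub_distrib]
    refine ENNReal.ofReal_le_ofReal ((abs_sum_le_sum_abs _ _).trans (sum_le_sum fun m _ => ?_))
    by_cases h : τ m ≤ min x t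
    · have h' := h.trans (min_le_min_right t hxy)
      simp only [if_pos h, if_pos h', sub_self, abs_zero, le_refl]
    · rw [if_neg h, if_neg h, sub_zero, sub_zero]; split_ifs <;> simp

lemma continuousWithinAt_step {K : ℕ} (τ : Fin K → ℝ≥0) (a : Fin K → ℝ) (t s : ℝ≥0) :
    ContinuousWithinAt (fun s => ∑ m, if τ m ≤ min s t then a m else 0) (Ici s) s := by
  refine tendsto_finsetSum _ fun m _ => ?_
  refine (tendsto_const_nhds (x := if τ m ≤ min s t then a m else 0)).congr' ?_
  by_cases h : τ m ≤ s
  · filter_upwards [self_mem_nhdsWithin] with r hr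
    simp [h, h.trans hr]
  · filter_upwards [mem_nhdsWithin_of_mem_nhds (gt_mem_nhds (not_le.mp h))] with r hr
    simp [h, not_le.mpr hr]

/-- The measure of the stopped step function agrees with a sum of point masses on all half-lines
`Iic s`, a π-system generating the Borel sets. Positivity of the jump times excludes a mass at `0`.
-/
lemma stieltjesIntegral_step {K : ℕ} {τ : Fin K → ℝ≥0} (hτ : ∀ m, 0 < τ m) (a : Fin K → ℝ) {t : ℝ≥0}
    {g : ℝ≥0 → ℝ} (hg : ∀ s ≤ t, g s = ∑ m, if τ m ≤ s then a m else 0) (φ : ℝ≥0 → ℝ) :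
    BoundedVariationOn (fun s => g (min s t)) univ ∧
    stieltjesIntegral φ g t = ∑ m, if τ m ≤ t then φ (τ m) * a m else 0 := by
  classical
  have e : (fun s => g (min s t)) = fun s => ∑ m, if τ m ≤ min s t then a m else 0 :=
    funext fun s => hg _ (min_le_right _ _)
  have hbv : BoundedVariationOn (fun s => g (min s t)) univ := e ▸ boundedVariationOn_step τ a t
  refine ⟨hbv, ?_⟩
  have hright : ∀ s, Function.rightLim (fun s => g (min s t)) s = ∑ m, if τ m ≤ min s t then a m else 0 := by
    intro s
    rw [e]
    exact (continuousWithinAt_step τ a t s).rightLim_eq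
  -- In `ℝ≥0` the filter `atBot` is the pure filter at `0`, where the step function vanishes since
  -- no jump occurs at time `0`.
  have hbot : limUnder atBot (fun s => g (min s t)) = 0 := by
    refine Tendsto.limUnder_eq ?_
    rw [OrderBot.atBot_eq, tendsto_pure_left, hg _ (min_le_right _ _)]
    intro s hs
    have h0 : (∑ m, if τ m ≤ min (⊥ : ℝ≥0) t then a m else 0) = 0 :=
      sum_eq_zero fun m _ => if_neg fun h => absurd (hτ m) (not_lt.mpr (h.trans (min_le_left _ _)))
    simp only [h0]
    exact mem_of_mem_nhds hs
  have htop : limUnder atTop (fun s => g (min s t)) = ∑ m, if τ m ≤ t then a m else 0 := by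
    refine Tendsto.limUnder_eq (tendsto_const_nhds.congr' ?_)
    filter_upwards [eventually_ge_atTop t] with s hs
    rw [min_eq_right hs, hg t le_rfl]
  have hvm : hbv.vectorMeasure = ∑ m, dirac (τ m) (if τ m ≤ t then a m else 0) := by
    refine VectorMeasure.ext_of_generateFrom (Set.range Set.Iic) ?_ ?_ isPiSystem_Iic ?_
    · rintro _ ⟨s, rfl⟩
      rw [hbv.vectorMeasure_Iic, hright, hbot, sum_dirac_apply _ _ _ measurableSet_Iic, sub_zero]
      refine sum_congr rfl fun m _ => ?_
      by_cases h1 : τ m ≤ s <;> by_cases h2 : τ m ≤ t <;> simp [h1, h2]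
    · rw [BorelSpace.measurable_eq (α := ℝ≥0), borel_eq_generateFrom_Iic]
    · rw [hbv.vectorMeasure_univ, htop, hbot, sum_dirac_apply _ _ _ MeasurableSet.univ, sub_zero]
      simp
  rw [stieltjesIntegral, dif_pos hbv, hvm, integral_finsetSum_vectorMeasure fun i _ => integrable_dirac _ _ _]
  refine sum_congr rfl fun m _ => ?_
  rw [VectorMeasure.integral_dirac]
  split_ifs <;> simp

/-! ### The vorticity along a flow -/

section Paths

/-- The intensity at time `t`, zero before birth. -/
def curInt (θ : ℝ) (q : Marks N) (t : ℝ) (i : Fin N) : ℝ :=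
  if ((q i).1 : ℝ) ≤ t then exp (-θ * (t - (q i).1)) * (q i).2 else 0

lemma vorticity_eq_sum {t : ℝ≥0} (hN : ∀ j, V.birth j ≤ t → j < N) :
    vorticity θ V X t = ∑ i : Fin N, dirac (X i t) (curInt θ (V.marks N) t i) := by
  classical
  rw [vorticity, finsum_cond_eq_sum_fin hN]
  refine sum_congr rfl fun i _ => ?_
  by_cases h : V.birth i ≤ t
  · rw [if_pos h, intensity, if_neg (not_lt.mpr h), curInt, if_pos (mod_cast h)]; rfl
  · rw [if_neg h, curInt, if_neg (fun h' => h (by exact_mod_cast h')), dirac_zero]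

lemma continuousWithinAt_curInt (θ : ℝ) (q : Marks N) (i : Fin N) (t : ℝ) :
    ContinuousWithinAt (fun s => curInt θ q s i) (Ici t) t := by
  have hc : Continuous fun s : ℝ => exp (-θ * (s - (q i).1)) * (q i).2 := by fun_prop
  by_cases h : ((q i).1 : ℝ) ≤ t
  · refine hc.continuousWithinAt.congr (fun s hs => ?_) ?_
    · rw [curInt, if_pos (h.trans hs)]
    · rw [curInt, if_pos h]
  · refine (continuousAt_const (y := (0 : ℝ))).congr ?_ |>.continuousWithinAt
    filter_upwards [gt_mem_nhds (not_le.mp h)] with s hs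
    rw [curInt, if_neg (not_le.mpr hs)]

lemma tendsto_curInt_left (θ : ℝ) (q : Marks N) (i : Fin N) (t : ℝ) :
    Tendsto (fun s => curInt θ q s i) (𝓝[<] t)
      (𝓝 (if ((q i).1 : ℝ) < t then exp (-θ * (t - (q i).1)) * (q i).2 else 0)) := by
  have hc : Continuous fun s : ℝ => exp (-θ * (s - (q i).1)) * (q i).2 := by fun_prop
  split_ifs with h
  · refine ((hc.tendsto t).mono_left nhdsWithin_le_nhds).congr' ?_
    filter_upwards [mem_nhdsWithin_of_mem_nhds (lt_mem_nhds h)] with s hs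
    rw [curInt, if_pos (le_of_lt hs)]
  · refine tendsto_const_nhds.congr' ?_
    filter_upwards [self_mem_nhdsWithin] with s hs
    rw [curInt, if_neg (not_le.mpr (lt_of_lt_of_le hs (not_lt.mp h)))]

lemma tendsto_coe_Iio (t : ℝ≥0) : Tendsto (fun s : ℝ≥0 => (s : ℝ)) (𝓝[<] t) (𝓝[<] (t : ℝ)) :=
  tendsto_nhdsWithin_iff.mpr ⟨(NNReal.continuous_coe.tendsto t).mono_left nhdsWithin_le_nhds,
    eventually_nhdsWithin_of_forall fun s hs => mod_cast hs⟩

lemma tendsto_coe_Ici (t : ℝ≥0) : Tendsto (fun s : ℝ≥0 => (s : ℝ)) (𝓝[≥] t) (𝓝[≥] (t : ℝ)) :=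
  tendsto_nhdsWithin_iff.mpr ⟨(NNReal.continuous_coe.tendsto t).mono_left nhdsWithin_le_nhds,
    eventually_nhdsWithin_of_forall fun s hs => mod_cast hs⟩

lemma continuous_regFlow_nnreal (hθ : 0 < θ) (k : ℕ) (q : Marks N)
    (x : Pos N) (i : Fin N) : Continuous fun t : ℝ≥0 => regFlow θ k q x t i :=
  continuousOn_univ.mp (((continuous_apply i).comp_continuousOn (continuousOn_regFlow hθ k q x)).comp
    NNReal.continuous_coe.continuousOn fun t _ => t.coe_nonneg)

/-- One-sided limits of `∑ ξᵢ F(xᵢ)` along a flow. -/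
lemma tendsto_sum_curInt {E : Type*} [NormedAddCommGroup E] [NormedSpace ℝ E] (hθ : 0 < θ) (k : ℕ)
    (q : Marks N) (x : Pos N) {F : Torus → E} (hF : Continuous F) (t : ℝ≥0) :
    Tendsto (fun s : ℝ≥0 => ∑ i, curInt θ q s i • F (regFlow θ k q x s i)) (𝓝[≥] t)
      (𝓝 (∑ i, curInt θ q t i • F (regFlow θ k q x t i))) ∧
    Tendsto (fun s : ℝ≥0 => ∑ i, curInt θ q s i • F (regFlow θ k q x s i)) (𝓝[<] t)
      (𝓝 (∑ i, (if ((q i).1 : ℝ) < t then exp (-θ * (t - (q i).1)) * (q i).2 else 0) •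
        F (regFlow θ k q x t i))) := by
  have hX : ∀ i, Tendsto (fun s : ℝ≥0 => F (regFlow θ k q x s i)) (𝓝 t) (𝓝 (F (regFlow θ k q x t i))) :=
    fun i => (hF.comp (continuous_regFlow_nnreal hθ k q x i)).tendsto t
  refine ⟨tendsto_finsetSum _ fun i _ => Tendsto.smul ?_ ((hX i).mono_left nhdsWithin_le_nhds),
    tendsto_finsetSum _ fun i _ => Tendsto.smul ?_ ((hX i).mono_left nhdsWithin_le_nhds)⟩
  · exact (continuousWithinAt_curInt θ q i t).tendsto.comp (tendsto_coe_Ici t)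
  · exact (tendsto_curInt_left θ q i t).comp (tendsto_coe_Iio t)

/-- The left limit of the vorticity. -/
def leftVorticity (θ : ℝ) (V : VortexData) (X : Paths) (t : ℝ≥0) : SMeas :=
  ∑ᶠ (i : ℕ) (_ : V.birth i < t), dirac (X i t) (intensity θ V i t)

lemma leftVorticity_eq_sum {t : ℝ≥0} (hN : ∀ j, V.birth j ≤ t → j < N) :
    leftVorticity θ V X t = ∑ i : Fin N, dirac (X i t)
      (if ((V.marks N i).1 : ℝ) < t then exp (-θ * (t - (V.marks N i).1)) * (V.marks N i).2 else 0) := by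
  classical
  rw [leftVorticity, finsum_cond_eq_sum_fin fun j hj => hN j hj.le]
  refine sum_congr rfl fun i _ => ?_
  by_cases h : V.birth i < t
  · rw [if_pos h, intensity, if_neg (not_lt.mpr h.le), if_pos (mod_cast h)]; rfl
  · rw [if_neg h, if_neg (fun h' => h (by exact_mod_cast h')), dirac_zero]

/-- A functional of finite sums of point masses, linear in the intensities, has one-sided limits
along the vorticity of a flow. -/
lemma tendsto_functional_vorticity {E : Type*} [NormedAddCommGroup E] [NormedSpace ℝ E] (hθ : 0 < θ)
    (hV : ∀ T : ℝ≥0, ∃ N, ∀ j, V.birth j ≤ T → j < N) (hX : IsVortexFlow θ V X)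
    {F : Torus → E} (hF : Continuous F) {L : SMeas → E}
    (hL : ∀ (N : ℕ) (x : Pos N) (c : Fin N → ℝ), L (∑ i, dirac (x i) (c i)) = ∑ i, c i • F (x i)) (t : ℝ≥0) :
    Tendsto (fun s => L (vorticity θ V X s)) (𝓝[≥] t) (𝓝 (L (vorticity θ V X t))) ∧
    Tendsto (fun s => L (vorticity θ V X s)) (𝓝[<] t) (𝓝 (L (leftVorticity θ V X t))) := by
  obtain ⟨N, hN⟩ := hV (t + 1)
  obtain ⟨k, hk⟩ := (hX.isFlowUpTo (t + 1)).exists_isGood hθ hN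
  have hfl := (hk k le_rfl).2
  have ht1 : t < t + 1 := lt_add_of_pos_right t one_pos
  have he : ∀ s ≤ t + 1, L (vorticity θ V X s) = ∑ i : Fin N, curInt θ (V.marks N) s i •
      F (regFlow θ k (V.marks N) (V.loc N) s i) := fun s hs => by
    rw [vorticity_eq_sum fun j hj => hN j (hj.trans hs), hL]
    exact sum_congr rfl fun i _ => by rw [hfl s hs]
  have hev : ∀ᶠ s in 𝓝 t, s ≤ t + 1 := (gt_mem_nhds ht1).mono fun s hs => le_of_lt hs
  obtain ⟨h1, h2⟩ := tendsto_sum_curInt hθ k (V.marks N) (V.loc N) hF t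
  constructor
  · rw [he t ht1.le]
    refine h1.congr' ?_
    filter_upwards [mem_nhdsWithin_of_mem_nhds hev] with s hs using (he s hs).symm
  · rw [leftVorticity_eq_sum fun j hj => hN j (hj.trans ht1.le), hL]
    have e : ∀ i : Fin N, F (X i t) = F (regFlow θ k (V.marks N) (V.loc N) t i) := fun i => by rw [hfl t ht1.le]
    simp only [e]
    refine h2.congr' ?_
    filter_upwards [mem_nhdsWithin_of_mem_nhds hev] with s hs using (he s hs).symm

lemma toSobolev_functional (hs : s < -1) (N : ℕ) (x : Pos N) (c : Fin N → ℝ) :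
    toSobolev s (∑ i, dirac (x i) (c i)) = ∑ i, c i • diracSob s (x i) :=
  toSobolev_sum_dirac hs _ _ _

lemma isCadlagOn_vorticity (hθ : 0 < θ) (hV : ∀ T : ℝ≥0, ∃ N, ∀ j, V.birth j ≤ T → j < N)
    (hX : IsVortexFlow θ V X) : IsCadlagOn (vorticity θ V X) univ := by
  intro t _
  have h := fun f : C(Torus, ℝ) => tendsto_functional_vorticity hθ hV hX f.continuous
    (L := fun μ => pairing f μ) (fun N x c => by simp [pairing_sum_dirac]) t
  rw [Set.univ_inter, Set.univ_inter]
  refine ⟨?_, leftVorticity θ V X t, ?_⟩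
  · rw [ContinuousWithinAt, nhds_induced, tendsto_comap_iff, tendsto_pi_nhds]
    exact fun f => (h f).1
  · rw [nhds_induced, tendsto_comap_iff, tendsto_pi_nhds]
    exact fun f => (h f).2

lemma isCadlagOn_toSobolev_vorticity (hθ : 0 < θ) (hV : ∀ T : ℝ≥0, ∃ N, ∀ j, V.birth j ≤ T → j < N)
    (hX : IsVortexFlow θ V X) (hs : s < -1) (I : Set ℝ≥0) :
    IsCadlagOn (fun t => toSobolev s (vorticity θ V X t)) I := by
  intro t _
  obtain ⟨h1, h2⟩ := tendsto_functional_vorticity hθ hV hX (continuous_diracSob hs) (toSobolev_functional hs) t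
  exact ⟨h1.mono_left (nhdsWithin_mono _ Set.inter_subset_right), _,
    h2.mono_left (nhdsWithin_mono _ Set.inter_subset_right)⟩

end Paths

/-! ### The weak form of the equation -/

section Weak

/-- The derivative of `f` along the trajectory of a vortex of the regularized flow. -/
def transport (θ : ℝ) (k : ℕ) (q : Marks N) (x : Pos N) (f : Torus → ℝ) (i : Fin N) (s : ℝ) : ℝ :=
  partial₁ f (regFlow θ k q x s i) * (regVel θ k q x s i).1 +
    partial₂ f (regFlow θ k q x s i) * (regVel θ k q x s i).2

lemma measurable_regFlow_time (hθ : 0 < θ) (k : ℕ) (q : Marks N) (x : Pos N) (i : Fin N) :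
    Measurable fun s => regFlow θ k q x s i := by
  have hx : Measurable (fun s : ℝ => (((q, x), s) : (Marks N × Pos N) × ℝ)) :=
    measurable_const.prodMk measurable_id
  have h := (measurable_pi_apply i).comp ((measurable_regFlow (N := N) hθ k).comp hx)
  simpa only [comp_def] using h

lemma intervalIntegrable_transport (hθ : 0 < θ) (k : ℕ) (q : Marks N) (x : Pos N)
    {f : Torus → ℝ} (hf : SmoothOnTorus f) (i : Fin N) (a b : ℝ) :
    IntervalIntegrable (transport θ k q x f i) volume a b := by
  obtain ⟨B, hB⟩ := exists_norm_regVel_le hθ k q x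
  obtain ⟨C1, h1, hC1⟩ := hf.partial₁.exists_bound
  obtain ⟨C2, h2, hC2⟩ := hf.partial₂.exists_bound
  have hv : Measurable fun s => regVel θ k q x s i := (measurable_pi_apply i).comp (measurable_regVel hθ k q x)
  have hX := measurable_regFlow_time hθ k q x i
  have hm : Measurable (transport θ k q x f i) :=
    ((hf.partial₁.continuous.measurable.comp hX).mul (measurable_fst.comp hv)).add
      ((hf.partial₂.continuous.measurable.comp hX).mul (measurable_snd.comp hv))
  rw [intervalIntegrable_iff]
  refine Integrable.mono' (g := fun _ => C1 * B + C2 * B) (integrableOn_const (by simp))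
    hm.aestronglyMeasurable (.of_forall fun s => ?_)
  have hvi : ‖regVel θ k q x s i‖ ≤ B := (norm_le_pi_norm _ i).trans (hB s)
  refine (norm_add_le _ _).trans (add_le_add ?_ ?_)
  · rw [norm_mul]
    exact mul_le_mul (hC1 _) ((norm_fst_le _).trans hvi) (norm_nonneg _) h1
  · rw [norm_mul]
    exact mul_le_mul (hC2 _) ((norm_snd_le _).trans hvi) (norm_nonneg _) h2

lemma integral_transport (hθ : 0 < θ) (k : ℕ) (q : Marks N) (x : Pos N)
    {f : Torus → ℝ} (hf : SmoothOnTorus f) (i : Fin N) (ht : 0 ≤ t) :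
    ∫ s in (0 : ℝ)..t, transport θ k q x f i s = f (regFlow θ k q x t i) - f (x i) := by
  have hG : ∀ y : Vel N, HasFDerivAt (fun y : Vel N => f (x i + toTorus (y i)))
      ((partial₁ f (x i + toTorus (y i)) • fst ℝ ℝ ℝ +
        partial₂ f (x i + toTorus (y i)) • snd ℝ ℝ ℝ).comp
          (proj (R := ℝ) (φ := fun _ : Fin N => ℝ × ℝ) i)) y := fun y =>
    HasFDerivAt.comp (f := fun y : Vel N => y i) y (hf.hasFDerivAt_add (x i) (y i)) (hasFDerivAt_apply i y)
  have h := sub_eq_integral_of_right_continuous (w := regVel θ k q x) (y := regDisp θ k q x)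
    (fun s _ => intervalIntegrable_regVel hθ k q x 0 s)
    (fun s hs => continuousWithinAt_regVel hθ k q x hs) (fun s hs => regDisp_eq hθ k q x hs)
    hG le_rfl ht ((intervalIntegrable_transport hθ k q x hf i 0 t).congr fun s _ => by
      simp [transport, regFlow, move])
  have e0 : x i + toTorus (regDisp θ k q x 0 i) = x i := by rw [regDisp_zero hθ]; simp [toTorus_zero]
  rw [e0] at h
  change _ = f (x i + toTorus (regDisp θ k q x t i)) - f (x i)
  rw [h]
  refine integral_congr fun s _ => ?_
  simp [transport, regFlow, move]

/-- After birth, damping from `s` to `t` turns the intensity at `s` into the one at `t`; before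
birth the vortex is at rest and both sides vanish. This makes the weight constant in time, so the
transport term can be integrated vortex by vortex. -/
lemma curInt_mul_transport (k : ℕ) (q : Marks N) (x : Pos N) (f : Torus → ℝ) (i : Fin N) (hst : s ≤ t) :
    exp (-θ * (t - s)) * (curInt θ q s i * transport θ k q x f i s)
      = curInt θ q t i * transport θ k q x f i s := by
  by_cases h : ((q i).1 : ℝ) ≤ s
  · rw [curInt, if_pos h, curInt, if_pos (h.trans hst), ← mul_assoc, ← mul_assoc, ← exp_add]
    congr 3; ring
  · have : transport θ k q x f i s = 0 := by rw [transport, regVel_apply_eq_zero (not_le.mp h)]; simp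
    rw [this]; simp

/-- Exchanging `i` and `j` and using that the kernel is odd replaces `∇f(x_i) · K` by half of
`(∇f(x_i) - ∇f(x_j)) · K`, which is `H_f`. Vortices not yet born have weight zero, so only pairs
covered by goodness matter. -/
lemma sum_curInt_mul_transport {q : Marks N} {x : Pos N} {T : ℝ}
    (hg : IsGood θ k T q x) (f : Torus → ℝ) (hs : s ∈ Icc 0 T) :
    ∑ i, curInt θ q s i * transport θ k q x f i s
      = offDiagonal (symKernel f) (∑ i, dirac (regFlow θ k q x s i) (curInt θ q s i)) := by
  classical
  rw [offDiagonal_sum_dirac]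
  set Y := regFlow θ k q x s
  set c := curInt θ q s with hc
  set a : Fin N → Fin N → ℝ := fun i j => if i = j then 0 else c i * c j *
    (partial₁ f (Y i) * (kernelReg k (Y i - Y j)).1 + partial₂ f (Y i) * (kernelReg k (Y i - Y j)).2) with ha
  have h1 : ∑ i, c i * transport θ k q x f i s = ∑ i, ∑ j, a i j := by
    refine sum_congr rfl fun i _ => ?_
    have hcoef : ∀ j, c i * coef θ q s i j = if i = j then 0 else c i * c j := by
      intro j
      by_cases hij : i = j
      · subst hij; simp [coef_self]
      · rw [if_neg hij, coef, hc, curInt, curInt]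
        by_cases hi : ((q i).1 : ℝ) ≤ s <;> by_cases hj : ((q j).1 : ℝ) ≤ s <;> simp [hi, hj, hij]
    have e : transport θ k q x f i s = ∑ j, coef θ q s i j *
        (partial₁ f (Y i) * (kernelReg k (Y i - Y j)).1 + partial₂ f (Y i) * (kernelReg k (Y i - Y j)).2) := by
      rw [transport, regVel, force, Prod.fst_sum, Prod.snd_sum, mul_sum, mul_sum, ← Finset.sum_add_distrib]
      refine sum_congr rfl fun j _ => ?_
      simp only [Prod.smul_fst, Prod.smul_snd, smul_eq_mul]; ring
    rw [e, mul_sum]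
    refine sum_congr rfl fun j _ => ?_
    rw [← mul_assoc, hcoef, ha]
    simp only [ite_mul, zero_mul]
  -- The symmetrization: the double sum is averaged with its transpose.
  have h2 : ∑ i, ∑ j, a i j = ∑ i, ∑ j, (1 / 2) * (a i j + a j i) := by
    have : ∑ i, ∑ j, a j i = ∑ i, ∑ j, a i j := Finset.sum_comm
    simp only [← mul_sum, Finset.sum_add_distrib]
    rw [this]; ring
  rw [h1, h2]
  refine sum_congr rfl fun i _ => sum_congr rfl fun j _ => ?_
  by_cases hij : i = j
  · subst hij; simp [ha]
  by_cases hi : ((q i).1 : ℝ) ≤ s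
  · by_cases hj : ((q j).1 : ℝ) ≤ s
    · have hgr := hg s hs i j hij hi hj
      have hne : Y i ≠ Y j := by
        intro h
        have h' : greenReg k (Y i - Y j) ≤ -(k : ℝ) := by
          rw [h, sub_self, greenReg, if_pos rfl]; exact cutoff_le_neg (by linarith)
        exact absurd hgr (not_lt.mpr h')
      have hK : kernelReg k (Y j - Y i) = -kernelReg k (Y i - Y j) := by rw [← kernelReg_neg, neg_sub]
      have hB : kernelReg k (Y i - Y j) = biotSavart (Y i) (Y j) := kernelReg_eq_biotSavart hgr
      rw [if_neg hne, ha]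
      simp only [if_neg hij, if_neg (Ne.symm hij), hK, hB, symKernel, Prod.fst_neg, Prod.snd_neg]
      ring
    · have : c j = 0 := by rw [hc, curInt, if_neg hj]
      simp [ha, this]
  · have : c i = 0 := by rw [hc, curInt, if_neg hi]
    simp [ha, this]

/-- The increment of `f` along each trajectory, multiplied by the final intensity, is summed over
the vortices. The boundary term `∑ ξ_{i,t} f(x_{i,0})` contains both the damped initial vorticity
and the stochastic integral, which are separated later. -/
lemma IsVortexFlow.weak_equation (hθ : 0 < θ)
    (hX : IsVortexFlow θ V X) {f : Torus → ℝ} (hf : SmoothOnTorus f) {t : ℝ≥0}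
    (hN : ∀ j, V.birth j ≤ t → j < N) :
    IntervalIntegrable (fun s : ℝ => exp (-θ * ((t : ℝ) - s)) *
      offDiagonal (symKernel f) (vorticity θ V X s.toNNReal)) volume 0 t ∧
    pairing f (vorticity θ V X t) = ∑ i : Fin N, curInt θ (V.marks N) t i * f (V.pos i) +
      ∫ s in (0 : ℝ)..t, exp (-θ * ((t : ℝ) - s)) * offDiagonal (symKernel f) (vorticity θ V X s.toNNReal) := by
  obtain ⟨k, hk⟩ := (hX.isFlowUpTo t).exists_isGood hθ hN
  obtain ⟨hg, hfl⟩ := hk k le_rfl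
  set q := V.marks N
  set x := V.loc N with hx
  have he : ∀ s ∈ uIoc (0 : ℝ) t, ∑ i, curInt θ q t i * transport θ k q x f i s
      = exp (-θ * ((t : ℝ) - s)) * offDiagonal (symKernel f) (vorticity θ V X s.toNNReal) := by
    intro s hs
    rw [uIoc_of_le t.coe_nonneg] at hs
    have es : ((s.toNNReal : ℝ≥0) : ℝ) = s := coe_toNNReal s hs.1.le
    have hst : s.toNNReal ≤ t := by rw [← coe_le_coe, es]; exact hs.2
    rw [vorticity_eq_sum fun j hj => hN j (hj.trans hst), es]
    have e2 : ∀ i : Fin N, X i s.toNNReal = regFlow θ k q x s i := fun i => by rw [hfl _ hst, es]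
    simp only [e2]
    rw [← sum_curInt_mul_transport hg f ⟨hs.1.le, hs.2⟩, mul_sum]
    exact sum_congr rfl fun i _ => (curInt_mul_transport k q x f i hs.2).symm
  have hInt : ∀ i, IntervalIntegrable (fun s => curInt θ q t i * transport θ k q x f i s) volume 0 t :=
    fun i => (intervalIntegrable_transport hθ k q x hf i 0 t).const_mul _
  have hsum : IntervalIntegrable (fun s => ∑ i, curInt θ q t i * transport θ k q x f i s) volume 0 t := by
    simpa only [Finset.sum_fn] using IntervalIntegrable.sum Finset.univ fun i _ => hInt i
  refine ⟨hsum.congr he, ?_⟩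
  rw [← integral_congr_uIoc he, intervalIntegral.integral_finsetSum fun i _ => hInt i,
    vorticity_eq_sum hN, pairing_sum_dirac, ← Finset.sum_add_distrib]
  refine sum_congr rfl fun i _ => ?_
  rw [intervalIntegral.integral_const_mul, integral_transport hθ k q x hf i t.coe_nonneg, hfl t le_rfl]
  change _ = curInt θ q t i * f (V.loc N i) + _
  rw [← hx]; ring

lemma measurable_curInt (θ : ℝ) (q : Marks N) (i : Fin N) : Measurable fun s => curInt θ q s i :=
  Measurable.ite measurableSet_Ici (by fun_prop) measurable_const

lemma abs_curInt_le (hθ : 0 < θ) (q : Marks N) (s : ℝ) (i : Fin N) :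
    |curInt θ q s i| ≤ |(q i).2| := by
  unfold curInt
  split_ifs with h
  · rw [abs_mul, Real.abs_exp]
    refine mul_le_of_le_one_left (abs_nonneg _) (exp_le_one_iff.mpr ?_)
    nlinarith
  · simp

lemma exists_norm_diracSob_le (hs : s < -1) : ∃ C, ∀ x, ‖diracSob s x‖ ≤ C := by
  obtain ⟨C, hC⟩ := isCompact_univ.exists_bound_of_continuousOn (continuous_diracSob hs).continuousOn
  exact ⟨C, fun x => hC x trivial⟩

lemma IsVortexFlow.memLp (hθ : 0 < θ) (hV : ∀ T : ℝ≥0, ∃ N, ∀ j, V.birth j ≤ T → j < N)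
    (hX : IsVortexFlow θ V X) (T : ℝ≥0) (hs : s < -1) :
    MemLp (fun r : ℝ => toSobolev s (vorticity θ V X r.toNNReal)) 2 (volume.restrict (Icc (0 : ℝ) T)) := by
  obtain ⟨N, hN⟩ := hV T
  obtain ⟨k, hk⟩ := (hX.isFlowUpTo T).exists_isGood hθ hN
  obtain ⟨hg, hfl⟩ := hk k le_rfl
  obtain ⟨C, hC⟩ := exists_norm_diracSob_le hs
  have hm : MemLp (fun r : ℝ => ∑ i : Fin N, curInt θ (V.marks N) r i •
      diracSob s (regFlow θ k (V.marks N) (V.loc N) r i)) 2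
      (volume.restrict (Icc (0 : ℝ) T)) := by
    refine memLp_finsetSum _ fun i _ => ?_
    refine MemLp.of_bound (C := |(V.marks N i).2| * C) ?_ (.of_forall fun r => ?_)
    · exact (measurable_curInt θ _ i).stronglyMeasurable.aestronglyMeasurable.smul
        ((continuous_diracSob hs).comp_aestronglyMeasurable
          (measurable_regFlow_time hθ k _ _ i).stronglyMeasurable.aestronglyMeasurable)
    · rw [norm_smul]
      exact mul_le_mul (abs_curInt_le hθ _ _ _) (hC _) (norm_nonneg _) (abs_nonneg _)
  refine hm.ae_eq ?_
  filter_upwards [ae_restrict_mem measurableSet_Icc] with r hr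
  have es : ((r.toNNReal : ℝ≥0) : ℝ) = r := coe_toNNReal r hr.1
  have hrt : r.toNNReal ≤ T := by rw [← coe_le_coe, es]; exact hr.2
  rw [vorticity_eq_sum fun j hj => hN j (hj.trans hrt), toSobolev_sum_dirac hs, es]
  exact sum_congr rfl fun i _ => by rw [hfl _ hrt, es]

end Weak

/-! ### Sequences of points -/

/-- Sequences of (time, sign, position). -/
abbrev Points : Type := ℕ → Mark

/-- The times are positive and increase to infinity, and the signs do not vanish. -/
structure IsNondeg (p : Points) : Prop where
  pos : 0 < (p 0).1
  lt_succ : ∀ m, (p m).1 < (p (m + 1)).1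
  unbounded : ∀ T : ℕ, ∃ m, (T : ℝ≥0) < (p m).1
  sign_ne_zero : ∀ m, (p m).2.1 ≠ 0

/-- The number of points up to time `T`. -/
def count (p : Points) (T : ℝ≥0) : ℕ := sInf {m | T < (p m).1}

namespace IsNondeg

variable {p p' : Points}

lemma strictMono (h : IsNondeg p) : StrictMono fun m => (p m).1 := strictMono_nat_of_lt_succ h.lt_succ

lemma time_pos (h : IsNondeg p) (m : ℕ) : 0 < (p m).1 := h.pos.trans_le (h.strictMono.monotone (Nat.zero_le m))

lemma exists_lt (h : IsNondeg p) (T : ℝ≥0) : ∃ m, T < (p m).1 := by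
  obtain ⟨m, hm⟩ := h.unbounded ⌈T⌉₊
  exact ⟨m, (Nat.le_ceil T).trans_lt hm⟩

lemma le_iff (h : IsNondeg p) (T : ℝ≥0) (m : ℕ) : (p m).1 ≤ T ↔ m < count p T := by
  have hs : T < (p (count p T)).1 := sInf_mem (s := {m | T < (p m).1}) (h.exists_lt T)
  constructor
  · intro hm
    exact h.strictMono.lt_iff_lt.mp (hm.trans_lt hs)
  · intro hm
    exact not_lt.mp fun hc => Nat.notMem_of_lt_sInf hm hc

lemma compoundPoisson_eq (h : IsNondeg p) {s T : ℝ≥0} (hs : s ≤ T) :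
    compoundPoisson p s = ∑ m : Fin (count p T), dirac (p m).2.2 (if (p m).1 ≤ s then (p m).2.1 else 0) := by
  classical
  rw [compoundPoisson, finsum_cond_eq_sum_fin fun j hj => (h.le_iff T j).mp (hj.trans hs)]
  refine sum_congr rfl fun m _ => ?_
  split_ifs <;> simp

lemma exists_eq_right (h : IsNondeg p) (s : ℝ≥0) :
    ∃ u > s, ∀ r, s ≤ r → r < u → compoundPoisson p r = compoundPoisson p s := by
  obtain hs : s < (p (count p s)).1 := sInf_mem (s := {m | s < (p m).1}) (h.exists_lt s)
  refine ⟨_, hs, fun r hsr hr => ?_⟩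
  have he : ∀ m, (p m).1 ≤ r ↔ (p m).1 ≤ s := fun m => by
    refine ⟨fun hm => (h.le_iff s m).mpr ?_, fun hm => hm.trans hsr⟩
    exact h.strictMono.lt_iff_lt.mp (hm.trans_lt hr)
  simp only [compoundPoisson, he]

lemma eq_of_dirac_eq {x x' : Torus} {a a' : ℝ} (ha : a ≠ 0) (h : dirac x a = dirac x' a') : a = a' ∧ x = x' := by
  have h1 : dirac x a {x} = dirac x' a' {x} := by rw [h]
  rw [dirac_apply_eq _ _ (measurableSet_singleton x), dirac_apply_eq _ _ (measurableSet_singleton x)] at h1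
  by_cases hx : x' = x
  · subst hx; simp at h1; exact ⟨h1, rfl⟩
  · simp [hx] at h1; exact absurd h1 ha

/-- The noise is constant on a right neighbourhood of every time, so countably many times determine
it. Stopping at `T` makes the time `T` itself one of those observed. -/
lemma eq_of_forall_rat (h : IsNondeg p) (h' : IsNondeg p') {T : ℝ≥0}
    (he : ∀ r : ℚ≥0, compoundPoisson p (min r T) = compoundPoisson p' (min r T)) :
    ∀ s ≤ T, compoundPoisson p s = compoundPoisson p' s := by
  intro s hs
  rcases hs.eq_or_lt with rfl | hs
  · obtain ⟨n, hn⟩ := exists_nat_ge s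
    have := he n
    rwa [show (((n : ℚ≥0) : ℝ≥0)) = (n : ℝ≥0) by simp, min_eq_right hn] at this
  · obtain ⟨u, hu, hu2⟩ := h.exists_eq_right s
    obtain ⟨u', hu', hu2'⟩ := h'.exists_eq_right s
    have hlt : s < min (min u u') T := lt_min (lt_min hu hu') hs
    obtain ⟨r, hr1, hr2⟩ := exists_rat_btwn (NNReal.coe_lt_coe.mpr hlt)
    have hr0 : (0 : ℚ) ≤ r := by
      have : (0 : ℝ) ≤ r := s.coe_nonneg.trans hr1.le
      exact_mod_cast this
    lift r to ℚ≥0 using hr0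
    have e : (((r : ℚ)) : ℝ) = (((r : ℝ≥0)) : ℝ) := by rfl
    rw [e, NNReal.coe_lt_coe] at hr1 hr2
    have h1 := he r
    rw [min_eq_left (hr2.le.trans (min_le_right _ _))] at h1
    rwa [hu2 r hr1.le (hr2.trans_le ((min_le_left _ _).trans (min_le_left _ _))),
      hu2' r hr1.le (hr2.trans_le ((min_le_left _ _).trans (min_le_right _ _)))] at h1

/-- Induction over the points: when all earlier ones agree, at the smaller of the two `m`-th times
the noises differ by at most these two atoms. Their masses are non-zero, so both must be present and
equal. -/
lemma eq_of_compoundPoisson (h : IsNondeg p) (h' : IsNondeg p') {T : ℝ≥0}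
    (he : ∀ s ≤ T, compoundPoisson p s = compoundPoisson p' s) (m : ℕ)
    (hm : (p m).1 ≤ T ∨ (p' m).1 ≤ T) : p m = p' m := by
  classical
  induction m using Nat.strong_induction_on with
  | _ m ih =>
    have hl : ∀ l < m, p l = p' l := fun l hlm => ih l hlm <| hm.imp
      (fun hh => (h.strictMono hlm).le.trans hh) (fun hh => (h'.strictMono hlm).le.trans hh)
    set s := min (p m).1 (p' m).1 with hs
    have hsT : s ≤ T := hm.elim (fun hh => (min_le_left _ _).trans hh) fun hh => (min_le_right _ _).trans hh
    have key : ∀ {p : Points}, IsNondeg p → s ≤ (p m).1 → compoundPoisson p s =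
        (∑ l : Fin m, if (p l).1 ≤ s then dirac (p l).2.2 (p l).2.1 else 0) +
          if (p m).1 ≤ s then dirac (p m).2.2 (p m).2.1 else 0 := by
      intro p hp hsp
      rw [compoundPoisson, finsum_cond_eq_sum_fin (N := m + 1) fun j hj =>
        Nat.lt_succ_of_le (hp.strictMono.le_iff_le.mp (hj.trans hsp)), Fin.sum_univ_castSucc]
      simp
    have h1 := he s hsT
    rw [key h (min_le_left _ _), key h' (min_le_right _ _)] at h1
    have h2 : (∑ l : Fin m, if (p l).1 ≤ s then dirac (p l).2.2 (p l).2.1 else 0) =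
        ∑ l : Fin m, if (p' l).1 ≤ s then dirac (p' l).2.2 (p' l).2.1 else 0 :=
      sum_congr rfl fun l _ => by rw [hl l l.2]
    rw [h2] at h1
    have h3 := add_left_cancel h1
    rcases lt_trichotomy (p m).1 (p' m).1 with hlt | heq | hlt
    · rw [hs, min_eq_left hlt.le, if_pos le_rfl, if_neg (not_le.mpr hlt), ← dirac_zero (x := (p m).2.2)] at h3
      exact absurd (eq_of_dirac_eq (h.sign_ne_zero m) h3).1 (h.sign_ne_zero m)
    · rw [hs, ← heq, min_self, if_pos le_rfl, if_pos le_rfl] at h3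
      obtain ⟨e1, e2⟩ := eq_of_dirac_eq (h.sign_ne_zero m) h3
      exact Prod.ext heq (Prod.ext e1 e2)
    · rw [hs, min_eq_right hlt.le, if_pos le_rfl, if_neg (not_le.mpr hlt), ← dirac_zero (x := (p' m).2.2)] at h3
      exact absurd (eq_of_dirac_eq (h'.sign_ne_zero m) h3.symm).1 (h'.sign_ne_zero m)

lemma count_eq (h : IsNondeg p) (h' : IsNondeg p') {T : ℝ≥0}
    (he : ∀ m, (p m).1 ≤ T ∨ (p' m).1 ≤ T → p m = p' m) : count p T = count p' T := by
  have : ∀ m, m < count p T ↔ m < count p' T := fun m => by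
    rw [← h.le_iff, ← h'.le_iff]
    constructor
    · intro hm; rw [← he m (Or.inl hm)]; exact hm
    · intro hm; rw [he m (Or.inr hm)]; exact hm
  exact le_antisymm (not_lt.mp fun hc => absurd ((this _).mp hc) (lt_irrefl _))
    (not_lt.mp fun hc => absurd ((this _).mpr hc) (lt_irrefl _))

end IsNondeg

/-! ### Configurations -/

/-- Initial vortices and subsequent births. -/
abbrev Config : Type := ℕ × (ℕ → ℝ × Torus) × Points

/-- The vortices of a configuration. -/
abbrev Config.data (c : Config) : VortexData := vortexData c.1 c.2.1 c.2.2

/-- Non-zero intensities, distinct initial loc, regular sequence of births. -/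
structure Config.IsNondeg (c : Config) : Prop where
  int_ne_zero : ∀ i < c.1, (c.2.1 i).1 ≠ 0
  pos_ne : ∀ i < c.1, ∀ j < c.1, i ≠ j → (c.2.1 i).2 ≠ (c.2.1 j).2
  points : PointVortex.IsNondeg c.2.2

/-- The number of vortices at time `T`. -/
def Config.num (c : Config) (T : ℝ≥0) : ℕ := c.1 + count c.2.2 T

/-- The initial vorticity and the noise up to time `T`, at rational times. -/
def observe (T : ℝ≥0) (c : Config) : SMeas × (ℚ≥0 → SMeas) :=
  (initialVorticity c.1 c.2.1, fun r => compoundPoisson c.2.2 (min r T))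

namespace Config

variable {c c' : Config}

lemma data_birth_le_iff (h : c.IsNondeg) (T : ℝ≥0) (j : ℕ) : c.data.birth j ≤ T ↔ j < c.num T := by
  simp only [data, vortexData, num]
  split_ifs with hj
  · simp [Nat.lt_add_right _ hj]
  · rw [h.points.le_iff]; omega

lemma exists_num (h : c.IsNondeg) (T : ℝ≥0) : ∃ N, ∀ j, c.data.birth j ≤ T → j < N :=
  ⟨_, fun j => (data_birth_le_iff h T j).mp⟩

lemma initialVorticity_apply (h : c.IsNondeg) {i : ℕ} (hi : i < c.1) :
    initialVorticity c.1 c.2.1 {(c.2.1 i).2} = (c.2.1 i).1 := by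
  rw [initialVorticity, sum_dirac_apply _ _ _ (measurableSet_singleton _), Finset.sum_eq_single i]
  · simp
  · intro j hj hji
    have := h.pos_ne j (by simpa using hj) i hi hji
    simp [this]
  · simp [hi]

lemma exists_of_initialVorticity_ne_zero {x : Torus} (hx : initialVorticity c.1 c.2.1 {x} ≠ 0) :
    ∃ i < c.1, (c.2.1 i).2 = x := by
  by_contra hc
  push Not at hc
  apply hx
  rw [initialVorticity, sum_dirac_apply _ _ _ (measurableSet_singleton _)]
  exact sum_eq_zero fun i hi => by simp [hc i (by simpa using hi)]

lemma exists_perm_of_range_eq {α : Type*} {f f' : Fin N → α} (hf : Injective f)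
    (hf' : Injective f') (h : Set.range f' = Set.range f) :
    ∃ σ : Equiv.Perm (Fin N), ∀ i, f' i = f (σ i) := by
  refine ⟨(Equiv.ofInjective f' hf').trans ((Equiv.setCongr h).trans (Equiv.ofInjective f hf).symm), fun i => ?_⟩
  simp only [Equiv.trans_apply]
  rw [Equiv.apply_ofInjective_symm hf]
  rfl

/-- All data of the vortex `i`. -/
def tuple (c : Config) (i : ℕ) : Mark := (c.data.birth i, c.data.int i, c.data.pos i)

lemma tuple_of_lt {i : ℕ} (hi : i < c.1) : c.tuple i = (0, c.2.1 i) := by simp [tuple, vortexData, hi]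

lemma tuple_of_le {i : ℕ} (hi : c.1 ≤ i) : c.tuple i = c.2.2 (i - c.1) := by
  simp [tuple, vortexData, not_lt.mpr hi]

lemma tuple_injective (h : c.IsNondeg) : Injective c.tuple := by
  have key : ∀ i j, i < c.1 → c.1 ≤ j → c.tuple i ≠ c.tuple j := fun i j hi hj he => by
    rw [tuple_of_lt hi, tuple_of_le hj] at he
    have := h.points.time_pos (j - c.1)
    rw [← he] at this
    exact lt_irrefl _ this
  intro i j he
  rcases lt_or_ge i c.1 with hi | hi <;> rcases lt_or_ge j c.1 with hj | hj
  · rw [tuple_of_lt hi, tuple_of_lt hj] at he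
    by_contra hij
    have h2 : c.2.1 i = c.2.1 j := (Prod.ext_iff.mp he).2
    exact h.pos_ne i hi j hj hij (by rw [h2])
  · exact absurd he (key i j hi hj)
  · exact absurd he.symm (key j i hj hi)
  · rw [tuple_of_le hi, tuple_of_le hj] at he
    have := h.points.strictMono.injective (congrArg Prod.fst he)
    omega

/-- Distinct positions make the mass at a singleton equal to the intensity of the vortex there, and
a non-zero mass betrays the presence of a vortex. Only the order of the initial vortices is lost. -/
lemma exists_initial_eq (h : c.IsNondeg)
    (he : initialVorticity c.1 c.2.1 = initialVorticity c'.1 c'.2.1) (h' : c'.IsNondeg) {i : ℕ}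
    (hi : i < c.1) : ∃ j < c'.1, c'.2.1 j = c.2.1 i := by
  have h1 : initialVorticity c'.1 c'.2.1 {(c.2.1 i).2} = (c.2.1 i).1 := by rw [← he, initialVorticity_apply h hi]
  obtain ⟨j, hj, hji⟩ := exists_of_initialVorticity_ne_zero (h1.symm ▸ h.int_ne_zero i hi :
    initialVorticity c'.1 c'.2.1 {(c.2.1 i).2} ≠ 0)
  refine ⟨j, hj, Prod.ext ?_ hji⟩
  rw [← h1, ← hji, initialVorticity_apply h' hj]

lemma initial_le (h : c.IsNondeg) (he : initialVorticity c.1 c.2.1 = initialVorticity c'.1 c'.2.1)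
    (h' : c'.IsNondeg) : c.1 ≤ c'.1 := by
  have hex : ∀ i : Fin c.1, ∃ j : Fin c'.1, c'.2.1 j = c.2.1 i := fun i => by
    obtain ⟨j, hj, hji⟩ := exists_initial_eq h he h' i.2
    exact ⟨⟨j, hj⟩, hji⟩
  choose g hg using hex
  have hinj : Injective g := by
    intro i j hij
    by_contra hne
    refine h.pos_ne i i.2 j j.2 (fun hh => hne (Fin.ext hh)) ?_
    rw [← hg i, ← hg j, hij]
  simpa using Fintype.card_le_of_injective g hinj

/-- Observations up to time `T` determine the vortices born up to time `T`, up to the order of the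
initial ones. -/
lemma exists_perm (h : c.IsNondeg) (h' : c'.IsNondeg) {T : ℝ≥0} (he : observe T c = observe T c') :
    c'.num T = c.num T ∧ ∃ σ : Equiv.Perm (Fin (c.num T)), ∀ i : Fin (c.num T), c'.tuple i = c.tuple (σ i) := by
  have e0 : initialVorticity c.1 c.2.1 = initialVorticity c'.1 c'.2.1 := congrArg Prod.fst he
  have e1 := h.points.eq_of_compoundPoisson h'.points (T := T)
    (h.points.eq_of_forall_rat h'.points fun r => congrFun (congrArg Prod.snd he) r)
  have hn : c.1 = c'.1 := le_antisymm (initial_le h e0 h') (initial_le h' e0.symm h)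
  have hcount : count c.2.2 T = count c'.2.2 T := h.points.count_eq h'.points e1
  have hN : c'.num T = c.num T := by rw [num, num, hn, hcount]
  refine ⟨hN, ?_⟩
  have key : ∀ {c c' : Config}, c.IsNondeg → c'.IsNondeg →
      initialVorticity c.1 c.2.1 = initialVorticity c'.1 c'.2.1 → c.1 = c'.1 →
      (∀ m, (c.2.2 m).1 ≤ T → c.2.2 m = c'.2.2 m) → c'.num T = c.num T →
      ∀ i < c.num T, ∃ j < c.num T, c'.tuple j = c.tuple i := by
    intro c c' h h' e0 hn e1 hN i hi
    rcases lt_or_ge i c.1 with hic | hic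
    · obtain ⟨j, hj, hji⟩ := exists_initial_eq h e0 h' hic
      exact ⟨j, by rw [← hN, num]; omega, by rw [tuple_of_lt hj, tuple_of_lt hic, hji]⟩
    · refine ⟨i, hi, ?_⟩
      rw [tuple_of_le hic, tuple_of_le (hn ▸ hic), ← hn, e1]
      exact (h.points.le_iff T _).mpr (by rw [num] at hi; omega)
  refine exists_perm_of_range_eq (f := fun i : Fin (c.num T) => c.tuple i)
    (f' := fun i : Fin (c.num T) => c'.tuple i)
    (fun i j hij => Fin.ext (tuple_injective h hij)) (fun i j hij => Fin.ext (tuple_injective h' hij)) ?_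
  refine Set.Subset.antisymm ?_ ?_
  · rintro _ ⟨i, rfl⟩
    obtain ⟨j, hj, hji⟩ := key h' h e0.symm hn.symm (fun m hm => (e1 m (Or.inr hm)).symm) hN.symm i
      (by rw [hN]; exact i.2)
    exact ⟨⟨j, by rw [← hN]; exact hj⟩, hji⟩
  · rintro _ ⟨i, rfl⟩
    obtain ⟨j, hj, hji⟩ := key h h' e0 hn (fun m hm => e1 m (Or.inl hm)) hN i i.2
    exact ⟨⟨j, hj⟩, hji⟩

end Config

variable {p : Points} {lam : ℝ} [hlam : Fact (0 < lam)] {M : ℝ≥0}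

/-! ### Measurability of signed measures -/

lemma measurable_apply_set (A : Set Torus) : Measurable fun μ : SMeas => μ A :=
  (comap_measurable (fun μ : SMeas => μ A)).mono
    (le_iSup (fun A : Set Torus => MeasurableSpace.comap (fun μ : SMeas => μ A) inferInstance) A) le_rfl

lemma measurable_sMeas {α : Type*} {mα : MeasurableSpace α} {f : α → SMeas}
    (h : ∀ A, MeasurableSet A → Measurable fun a => f a A) : Measurable f := by
  refine Measurable.of_le_map (iSup_le fun A => ?_)
  rw [MeasurableSpace.comap_le_iff_le_map, MeasurableSpace.map_comp, ← measurable_iff_le_map]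
  by_cases hA : MeasurableSet A
  · exact h A hA
  · have : (fun μ : SMeas => μ A) ∘ f = fun _ => 0 := funext fun a => (f a).not_measurable hA
    rw [this]; exact measurable_const

lemma measurable_sum_dirac (N : ℕ) : Measurable fun v : Fin N → ℝ × Torus =>
    (∑ i, dirac (v i).2 (v i).1 : SMeas) := by
  refine measurable_sMeas fun A hA => ?_
  simp only [sum_dirac_apply _ _ _ hA]
  refine measurable_sum _ fun i _ => ?_
  have : (fun v : Fin N → ℝ × Torus => A.indicator (fun _ => (v i).1) (v i).2) =
      ({v | (v i).2 ∈ A} : Set (Fin N → ℝ × Torus)).indicator fun v => (v i).1 := by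
    ext v; simp [indicator]
  rw [this]
  exact (by fun_prop : Measurable fun v : Fin N → ℝ × Torus => (v i).1).indicator
    ((by fun_prop : Measurable fun v : Fin N → ℝ × Torus => (v i).2) hA)

lemma measurable_add_sMeas : Measurable fun v : SMeas × SMeas => v.1 + v.2 :=
  measurable_sMeas fun A _ => ((measurable_apply_set A).comp measurable_fst).add
    ((measurable_apply_set A).comp measurable_snd)

/-- A countable algebra of sets generating the Borel sets of the torus. -/
def setAlg : Set (Set Torus) := generateSetAlgebra (MeasurableSpace.countableGeneratingSet Torus)

instance instCountableSetAlg : Countable setAlg :=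
  (countable_generateSetAlgebra (MeasurableSpace.countable_countableGeneratingSet)).to_subtype

/-- Countably many evaluations separate signed measures, because the Borel sets of the torus are
generated by a countable algebra. The values on it form a countably separated target for maps on
configurations. -/
lemma sMeas_ext {μ ν : SMeas} (h : ∀ A : setAlg, μ A = ν A) : μ = ν := by
  have halg : IsSetAlgebra setAlg := isSetAlgebra_generateSetAlgebra
  refine VectorMeasure.ext_of_generateFrom setAlg (fun A hA => h ⟨A, hA⟩) ?_
    (fun _ hs _ ht _ => halg.inter_mem hs ht) (h ⟨_, halg.univ_mem⟩)
  rw [setAlg, generateFrom_generateSetAlgebra_eq, MeasurableSpace.generateFrom_countableGeneratingSet]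

/-- The values of a signed measure on a countable algebra of sets. -/
def evalAlg (μ : SMeas) (A : setAlg) : ℝ := μ A

lemma measurable_evalAlg : Measurable evalAlg := measurable_pi_lambda _ fun A => measurable_apply_set A

lemma evalAlg_injective : Injective evalAlg := fun _ _ h => sMeas_ext fun A => congrFun h A

/-- Measurability in terms of the atoms, for sets of finite sums of point masses. -/
def IsAtomicSet (B : Set SMeas) : Prop :=
  ∀ N : ℕ, MeasurableSet {v : Fin N → ℝ × Torus | ∑ i, dirac (v i).2 (v i).1 ∈ B}

lemma isAtomicSet_of_measurableSet (hB : MeasurableSet B) : IsAtomicSet B := fun N => measurable_sum_dirac N hB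

lemma continuous_toSobolev_sum_dirac (hs : s < -1) (N : ℕ) :
    Continuous fun v : Fin N → ℝ × Torus => toSobolev s (∑ i, dirac (v i).2 (v i).1) := by
  simp only [toSobolev_sum_dirac hs]
  refine continuous_finsetSum _ fun i _ => ?_
  exact (by fun_prop : Continuous fun v : Fin N → ℝ × Torus => (v i).1).smul
    ((continuous_diracSob hs).comp (by fun_prop : Continuous fun v : Fin N → ℝ × Torus => (v i).2))

/-- A set measurable with respect to a map from a standard Borel space, if it is saturated. -/
lemma exists_measurableSet_iff_of_saturated {X Y : Type*} [MeasurableSpace X] [StandardBorelSpace X]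
    [MeasurableSpace Y] [CountablySeparated Y] {D A : Set X} (hD : MeasurableSet D)
    (hA : MeasurableSet A) {f : X → Y} (hf : ∀ S, MeasurableSet S → MeasurableSet (D ∩ f ⁻¹' S))
    (h : ∀ c ∈ D, ∀ c' ∈ D, f c = f c' → c ∈ A → c' ∈ A) :
    ∃ C, MeasurableSet C ∧ ∀ c ∈ D, (c ∈ A ↔ f c ∈ C) := by
  have : StandardBorelSpace D := hD.standardBorel
  set g : D → Y := fun c => f c with hg
  have hgm : Measurable g := fun S hS => by
    have := measurable_subtype_coe (p := (· ∈ D)) (hf S hS)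
    convert this using 1
    ext c; simp [hg]
  set S : Set Y := g '' (Subtype.val ⁻¹' A) with hS
  have hpre : g ⁻¹' S = Subtype.val ⁻¹' A := by
    ext c
    constructor
    · rintro ⟨c', hc', he⟩
      exact h c' c'.2 c c.2 he hc'
    · exact fun hc => ⟨c, hc, rfl⟩
  have h1 : MeasurableSet (g ⁻¹' S) := by rw [hpre]; exact measurable_subtype_coe hA
  have : CountablySeparated (Set.range g) :=
    CountablySeparated.subtype_iff.mpr
      ((CountablySeparated.countably_separated (α := Y)).mono (fun _ => id) (Set.subset_univ _))
  -- As an image, `S` is a priori only analytic. By saturation its preimage is Borel, so `S` and its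
  -- complement in the range are disjoint analytic sets, and Lusin separation makes `S` Borel within
  -- the range.
  obtain ⟨C, hC, hCS⟩ := hgm.measurableSet_preimage_iff_preimage_val.mp h1
  refine ⟨C, hC, fun c hc => ?_⟩
  have e : c ∈ A ↔ (⟨c, hc⟩ : D) ∈ g ⁻¹' S := by rw [hpre]; rfl
  have e2 := Set.ext_iff.mp hCS ⟨g ⟨c, hc⟩, Set.mem_range_self _⟩
  rw [e]
  exact e2.symm

/-! ### Measurability of configurations -/

lemma measurable_count (T : ℝ≥0) : Measurable fun p : Points => count p T := by
  have hm : ∀ m, MeasurableSet {p : Points | T < (p m).1} := fun m =>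
    measurableSet_lt measurable_const (by fun_prop)
  refine measurable_to_countable' fun n => ?_
  -- The last set accounts for the value `0` of the infimum of the empty set, when no point lies
  -- after `T`.
  have : (fun p : Points => count p T) ⁻¹' {n} = ({p | T < (p n).1} ∩ ⋂ m < n, {p | T < (p m).1}ᶜ) ∪
      (if n = 0 then ⋂ m, {p | T < (p m).1}ᶜ else ∅) := by
    ext p
    have key : count p T = n ↔ (T < (p n).1 ∧ ∀ m < n, ¬ T < (p m).1) ∨ (n = 0 ∧ ∀ m, ¬ T < (p m).1) := by
      constructor
      · rintro rfl
        by_cases he : ∃ m, T < (p m).1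
        · exact Or.inl ⟨sInf_mem (s := {m | T < (p m).1}) he, fun m hm => Nat.notMem_of_lt_sInf hm⟩
        · push Not at he
          refine Or.inr ⟨?_, fun m => not_lt.mpr (he m)⟩
          rw [count, Nat.sInf_eq_zero]
          exact Or.inr (Set.eq_empty_iff_forall_notMem.mpr fun m => not_lt.mpr (he m))
      · rintro (⟨h1, h2⟩ | ⟨rfl, h⟩)
        · exact le_antisymm (Nat.sInf_le h1) (not_lt.mp fun hc => h2 _ hc
            (sInf_mem (s := {m | T < (p m).1}) ⟨n, h1⟩))
        · rw [count, Nat.sInf_eq_zero]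
          exact Or.inr (Set.eq_empty_iff_forall_notMem.mpr h)
    simp only [mem_preimage, Set.mem_singleton_iff, key]
    split_ifs with h <;> simp [h]
  rw [this]
  refine MeasurableSet.union ((hm n).inter (.iInter fun m => .iInter fun _ => (hm m).compl)) ?_
  split_ifs
  · exact .iInter fun m => (hm m).compl
  · exact MeasurableSet.empty

lemma measurableSet_isNondeg : MeasurableSet {p : Points | IsNondeg p} := by
  have : {p : Points | IsNondeg p} = {p | 0 < (p 0).1} ∩ (⋂ m, {p | (p m).1 < (p (m + 1)).1}) ∩
      (⋂ T : ℕ, ⋃ m, {p | (T : ℝ≥0) < (p m).1}) ∩ ⋂ m, {p | (p m).2.1 ≠ 0} := by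
    ext p
    simp only [mem_inter_iff, Set.mem_iInter, mem_iUnion, mem_ofPred_eq]
    exact ⟨fun h => ⟨⟨⟨h.1, h.2⟩, h.3⟩, h.4⟩, fun h => ⟨h.1.1.1, h.1.1.2, h.1.2, h.2⟩⟩
  rw [this]
  refine ((MeasurableSet.inter ?_ ?_).inter ?_).inter ?_
  · exact measurableSet_lt measurable_const (by fun_prop)
  · exact .iInter fun m => measurableSet_lt (by fun_prop) (by fun_prop)
  · exact .iInter fun T => MeasurableSet.iUnion fun m => measurableSet_lt measurable_const (by fun_prop)
  · exact .iInter fun m => (measurableSet_eq_fun (by fun_prop) measurable_const).compl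

namespace Config

lemma measurableSet_isNondeg : MeasurableSet {c : Config | c.IsNondeg} := by
  have hlt : ∀ i : ℕ, MeasurableSet {c : Config | i < c.1} := fun i =>
    measurableSet_lt measurable_const measurable_fst
  have : {c : Config | c.IsNondeg} = (⋂ i, ({c | i < c.1}ᶜ ∪ {c | (c.2.1 i).1 ≠ 0})) ∩
      (⋂ i, ⋂ j, ({c | i < c.1}ᶜ ∪ ({c | j < c.1}ᶜ ∪ ({_c | i = j} ∪ {c | (c.2.1 i).2 ≠ (c.2.1 j).2})))) ∩
      {c | PointVortex.IsNondeg c.2.2} := by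
    ext c
    simp only [mem_inter_iff, Set.mem_iInter, Set.mem_union, Set.mem_compl_iff, mem_ofPred_eq]
    constructor
    · exact fun h => ⟨⟨fun i => imp_iff_not_or.mp (h.1 i), fun i j => by
        have := h.2 i; have h3 := fun hi => this hi j; tauto⟩, h.3⟩
    · rintro ⟨⟨h1, h2⟩, h3⟩
      exact ⟨fun i => imp_iff_not_or.mpr (h1 i), fun i hi j hj hij => by have := h2 i j; tauto, h3⟩
  rw [this]
  refine (MeasurableSet.inter ?_ ?_).inter ((by fun_prop : Measurable fun c : Config => c.2.2)
    PointVortex.measurableSet_isNondeg)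
  · exact .iInter fun i => (hlt i).compl.union (measurableSet_eq_fun (by fun_prop) measurable_const).compl
  · exact .iInter fun i => .iInter fun j => (hlt i).compl.union
      ((hlt j).compl.union ((MeasurableSet.const _).union
        (measurableSet_eq_fun (by fun_prop) (by fun_prop)).compl))

lemma measurable_of_fixed {β : Type*} [MeasurableSpace β] {f : Config → β}
    (h : ∀ n, Measurable fun v : (ℕ → ℝ × Torus) × Points => f (n, v)) : Measurable f :=
  measurable_from_prod_countable_right h

lemma measurable_marks (N : ℕ) : Measurable fun c : Config => c.data.marks N := by
  refine measurable_of_fixed fun n => measurable_pi_lambda _ fun i => ?_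
  simp only [VortexData.marks, data, vortexData]
  split_ifs <;> fun_prop

lemma measurable_loc (N : ℕ) : Measurable fun c : Config => c.data.loc N := by
  refine measurable_of_fixed fun n => measurable_pi_lambda _ fun i => ?_
  simp only [VortexData.loc, data, vortexData]
  split_ifs <;> fun_prop

lemma measurable_num (T : ℝ≥0) : Measurable fun c : Config => c.num T :=
  measurable_fst.add ((measurable_count T).comp (measurable_snd.comp measurable_snd))

end Config

lemma measurable_initialVorticity : Measurable fun c : ℕ × (ℕ → ℝ × Torus) => initialVorticity c.1 c.2 := by
  refine measurable_from_prod_countable_right fun n => ?_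
  simp only [initialVorticity, sum_range]
  exact (measurable_sum_dirac n).comp (measurable_pi_lambda _ fun i => measurable_pi_apply _)

/-- The noise of a nondegenerate sequence of points is a measurable function of it. -/
lemma measurableSet_compoundPoisson (t : ℝ≥0) {S : Set SMeas} (hS : IsAtomicSet S) :
    MeasurableSet ({p | IsNondeg p} ∩ {p | compoundPoisson p t ∈ S}) := by
  have : {p | IsNondeg p} ∩ {p | compoundPoisson p t ∈ S} = {p | IsNondeg p} ∩ ⋃ N : ℕ, {p | count p t = N} ∩
      {p | (∑ m : Fin N, dirac (p m).2.2 (p m).2.1) ∈ S} := by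
    ext p
    simp only [mem_inter_iff, mem_ofPred_eq, mem_iUnion]
    refine and_congr_right fun hp => ?_
    have e : compoundPoisson p t = ∑ m : Fin (count p t), dirac (p m).2.2 (p m).2.1 := by
      rw [hp.compoundPoisson_eq le_rfl]
      exact sum_congr rfl fun m _ => by rw [if_pos ((hp.le_iff t m).mpr m.2)]
    rw [e]
    constructor
    · exact fun h => ⟨_, rfl, h⟩
    · rintro ⟨N, rfl, h⟩; exact h
  rw [this]
  refine measurableSet_isNondeg.inter (MeasurableSet.iUnion fun N => ?_)
  refine (measurable_count t (measurableSet_singleton N)).inter ?_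
  exact (measurable_pi_lambda _ fun m => by fun_prop :
    Measurable fun (p : Points) (m : Fin N) => ((p m).2.1, (p m).2.2)) (hS N)

/-! ### The vorticity as a measurable function of the initial vorticity and the noise -/

section Good

/-- A continuous function on a compact interval that exceeds `-k` does so by a margin `1/(m+1)`, and
this closed condition can be tested at rational times. Clamping to the interval between the later
birth and `T` makes the test times admissible and continuous in the rational. -/
lemma isGood_iff (hθ : 0 < θ) (k : ℕ) (T : ℝ≥0) (q : Marks N) (x : Pos N) :
    IsGood θ k T q x ↔ ∀ i j, i ≠ j → (q i).1 ≤ T → (q j).1 ≤ T → ∃ m : ℕ, ∀ r : ℚ,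
      -(k : ℝ) + 1 / (m + 1) ≤
        greenReg k (regFlow θ k q x (max (min (r : ℝ) T) (max (q i).1 (q j).1)) i
          - regFlow θ k q x (max (min (r : ℝ) T) (max (q i).1 (q j).1)) j) := by
  have hcont : ∀ i j, Continuous fun s : ℝ =>
      greenReg k (regFlow θ k q x (max (min s T) (max (q i).1 (q j).1)) i
          - regFlow θ k q x (max (min s T) (max (q i).1 (q j).1)) j) := fun i j => by
    have h1 : Continuous fun s : ℝ => regFlow θ k q x (max (min s T) (max (q i).1 (q j).1)) :=
      (continuousOn_regFlow hθ k q x).comp_continuous (by fun_prop)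
        fun s => le_max_of_le_right (le_max_of_le_left (q i).1.coe_nonneg)
    exact (smoothOnTorus_greenReg k).continuous.comp
      (((continuous_apply i).comp h1).sub ((continuous_apply j).comp h1))
  constructor
  · intro h i j hij hi hj
    have hi' : ((q i).1 : ℝ) ≤ T := hi
    have hj' : ((q j).1 : ℝ) ≤ T := hj
    obtain ⟨s, hs, hmin⟩ := isCompact_Icc.exists_isMinOn (Set.nonempty_Icc.mpr T.coe_nonneg)
      (hcont i j).continuousOn
    have hpos : ∀ s : ℝ, -(k : ℝ) < greenReg k (regFlow θ k q x (max (min s T) (max (q i).1 (q j).1)) i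
          - regFlow θ k q x (max (min s T) (max (q i).1 (q j).1)) j) := fun s =>
      h _ ⟨le_max_of_le_right (le_max_of_le_left (q i).1.coe_nonneg),
        max_le (min_le_right _ _) (max_le hi' hj')⟩ i j hij
        (le_max_of_le_right (le_max_left _ _)) (le_max_of_le_right (le_max_right _ _))
    obtain ⟨m, hm⟩ := exists_nat_one_div_lt (sub_pos.mpr (hpos s))
    refine ⟨m, fun r => ?_⟩
    have h1 := hmin (show max (min (r : ℝ) T) 0 ∈ Icc (0 : ℝ) T from
      ⟨le_max_right _ _, max_le (min_le_right _ _) T.coe_nonneg⟩)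
    have e : max (min (max (min (r : ℝ) T) 0) (T : ℝ)) (max ((q i).1 : ℝ) (q j).1) =
        max (min (r : ℝ) T) (max (q i).1 (q j).1) := by
      rw [min_eq_left (max_le (min_le_right _ _) T.coe_nonneg), max_assoc,
        max_eq_right (le_max_of_le_left (q i).1.coe_nonneg)]
    simp only [mem_ofPred_eq, e] at h1
    linarith
  · intro h t ht i j hij hi hj
    have hi' : (q i).1 ≤ T := coe_le_coe.mp (hi.trans ht.2)
    have hj' : (q j).1 ≤ T := coe_le_coe.mp (hj.trans ht.2)
    obtain ⟨m, hm⟩ := h i j hij hi' hj'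
    have hcl : IsClosed {s : ℝ | -(k : ℝ) + 1 / (m + 1) ≤
        greenReg k (regFlow θ k q x (max (min s T) (max (q i).1 (q j).1)) i
          - regFlow θ k q x (max (min s T) (max (q i).1 (q j).1)) j)} :=
      isClosed_le continuous_const (hcont i j)
    have hall := (Rat.denseRange_cast (𝕜 := ℝ)).induction_on
      (p := fun s => -(k : ℝ) + 1 / (m + 1) ≤
        greenReg k (regFlow θ k q x (max (min s T) (max (q i).1 (q j).1)) i
          - regFlow θ k q x (max (min s T) (max (q i).1 (q j).1)) j)) t hcl hm
    rw [min_eq_left ht.2, max_eq_left (max_le hi hj)] at hall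
    have : (0 : ℝ) < 1 / (m + 1) := by positivity
    linarith

lemma measurableSet_isGood (hθ : 0 < θ) (k : ℕ) (T : ℝ≥0) :
    MeasurableSet {v : Marks N × Pos N | IsGood θ k T v.1 v.2} := by
  simp only [isGood_iff hθ, Set.ofPred_forall]
  refine .iInter fun i => .iInter fun j => .iInter fun _ => ?_
  have e : ∀ l : Fin N, MeasurableSet {v : Marks N × Pos N | (v.1 l).1 ≤ T} := fun l =>
    measurableSet_le (by fun_prop) measurable_const
  have hS : MeasurableSet (⋃ m : ℕ, ⋂ r : ℚ, {v : Marks N × Pos N | -(k : ℝ) + 1 / (m + 1) ≤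
        greenReg k (regFlow θ k v.1 v.2 (max (min (r : ℝ) T) (max (v.1 i).1 (v.1 j).1)) i
          - regFlow θ k v.1 v.2 (max (min (r : ℝ) T) (max (v.1 i).1 (v.1 j).1)) j)}) := by
    refine MeasurableSet.iUnion fun m => .iInter fun r => measurableSet_le measurable_const ?_
    have hx : Measurable fun v : Marks N × Pos N =>
        (((v.1, v.2), max (min (r : ℝ) T) (max (v.1 i).1 (v.1 j).1)) : (Marks N × Pos N) × ℝ) := by fun_prop
    have h := (measurable_regFlow (N := N) hθ k).comp hx
    have hi := (measurable_pi_apply i).comp h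
    have hj := (measurable_pi_apply j).comp h
    exact (smoothOnTorus_greenReg k).continuous.measurable.comp (hi.sub hj)
  convert ((e i).inter (e j)).compl.union hS using 1
  ext v
  simp only [mem_ofPred_eq, Set.mem_iInter, mem_iUnion, Set.mem_union, Set.mem_compl_iff, mem_inter_iff]
  tauto

end Good

/-! ### Events of existence of a flow with prescribed final vorticity -/

/-- A flow exists up to time `T`, and the vorticity at this time belongs to `B`. -/
def Reaches (θ : ℝ) (T : ℝ≥0) (c : Config) (B : Set SMeas) : Prop :=
  ∃ X, IsFlowUpTo θ c.data X T ∧ vorticity θ c.data X T ∈ B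

/-- The regularized vorticity of `N` vortices. -/
def regVort (θ : ℝ) (k : ℕ) (q : Marks N) (x : Pos N) (T : ℝ≥0) : SMeas :=
  ∑ i, dirac (regFlow θ k q x T i) (curInt θ q T i)

lemma IsGood.vorticity_eq {T : ℝ≥0} (hN : ∀ j, V.birth j ≤ T → j < N) :
    vorticity θ V (extendFlow V (regFlow θ k (V.marks N) (V.loc N))) T = regVort θ k (V.marks N) (V.loc N) T := by
  rw [vorticity_eq_sum hN, regVort]
  exact sum_congr rfl fun i _ => by rw [extendFlow, dif_pos i.2]

/-- An existential statement over all trajectories becomes a countable union over the truncation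
level, hence a measurable event. -/
lemma reaches_iff (hθ : 0 < θ) {c : Config} {T : ℝ≥0} (hN : ∀ j, c.data.birth j ≤ T → j < N) :
    Reaches θ T c B ↔ ∃ k, IsGood θ k T (c.data.marks N) (c.data.loc N) ∧
      regVort θ k (c.data.marks N) (c.data.loc N) T ∈ B := by
  constructor
  · rintro ⟨X, hX, hB⟩
    obtain ⟨k, hk⟩ := hX.exists_isGood hθ hN
    refine ⟨k, (hk k le_rfl).1, ?_⟩
    rw [vorticity_eq_sum hN] at hB
    rw [regVort]
    convert hB using 3 with i
    rw [(hk k le_rfl).2 T le_rfl i]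
  · rintro ⟨k, hk, hB⟩
    exact ⟨_, hk.isFlowUpTo hθ hN, by rwa [IsGood.vorticity_eq hN]⟩

/-- By uniqueness the existential quantifier over flows can be evaluated on any one of them; thus no
measurable selection of `X` is ever needed. -/
lemma IsFlowUpTo.reaches_iff (hθ : 0 < θ) {c : Config} {T : ℝ≥0}
    (hN : ∀ j, c.data.birth j ≤ T → j < N) (hX : IsFlowUpTo θ c.data X T)
    : Reaches θ T c B ↔ vorticity θ c.data X T ∈ B := by
  refine ⟨?_, fun h => ⟨X, hX, h⟩⟩
  rintro ⟨X', hX', hB⟩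
  rw [vorticity_eq_sum hN] at hB ⊢
  simpa only [fun i : Fin N => hX'.eq hθ hN hX i (le_refl T)] using hB

lemma measurable_regVort_data (hθ : 0 < θ) (k N : ℕ) (T : ℝ≥0) :
    Measurable fun (v : Marks N × Pos N) (i : Fin N) => (curInt θ v.1 T i, regFlow θ k v.1 v.2 T i) := by
  have hx : Measurable fun v : Marks N × Pos N => (((v.1, v.2), (T : ℝ)) : (Marks N × Pos N) × ℝ) := by fun_prop
  have h := (measurable_regFlow (N := N) hθ k).comp hx
  refine measurable_pi_lambda _ fun i => Measurable.prodMk ?_ ((measurable_pi_apply i).comp h)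
  unfold curInt
  exact Measurable.ite (measurableSet_le (by fun_prop) measurable_const) (by fun_prop) measurable_const

lemma measurableSet_reaches (hθ : 0 < θ) (T : ℝ≥0) (hB : IsAtomicSet B) :
    MeasurableSet {c : Config | c.IsNondeg ∧ Reaches θ T c B} := by
  have : {c : Config | c.IsNondeg ∧ Reaches θ T c B} = {c | c.IsNondeg} ∩ ⋃ N : ℕ, {c | c.num T = N} ∩
      ⋃ k : ℕ, (fun c : Config => (c.data.marks N, c.data.loc N)) ⁻¹'
        ({v | IsGood θ k T v.1 v.2} ∩ {v | regVort θ k v.1 v.2 T ∈ B}) := by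
    ext c
    simp only [mem_inter_iff, mem_ofPred_eq, mem_iUnion, mem_preimage]
    refine and_congr_right fun hc => ?_
    rw [reaches_iff hθ fun j => (Config.data_birth_le_iff hc T j).mp]
    constructor
    · exact fun h => ⟨_, rfl, h⟩
    · rintro ⟨N, rfl, h⟩; exact h
  rw [this]
  refine Config.measurableSet_isNondeg.inter (MeasurableSet.iUnion fun N => ?_)
  refine (Config.measurable_num T (measurableSet_singleton N)).inter (MeasurableSet.iUnion fun k => ?_)
  exact ((Config.measurable_marks N).prodMk (Config.measurable_loc N))
    ((measurableSet_isGood hθ k T).inter (measurable_regVort_data hθ k N T (hB N)))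

/-! ### Relabelling -/

section Relabel

/-- The permuted displacements solve the equation with permuted data, and solutions are unique. -/
lemma regDisp_comp_perm (hθ : 0 < θ) (k : ℕ) (q : Marks N) (x : Pos N) (σ : Equiv.Perm (Fin N)) (ht : 0 ≤ t) :
    regDisp θ k (q ∘ σ) (x ∘ σ) t = regDisp θ k q x t ∘ σ := by
  obtain ⟨B, L, hv⟩ := exists_isLipField hθ k N
  symm
  refine hv.eq_flow (q ∘ σ, x ∘ σ) (y := fun t => regDisp θ k q x t ∘ σ) (T := t) ?_ ?_ ⟨ht, le_rfl⟩
  · refine ContinuousOn.aestronglyMeasurable ?_ measurableSet_Icc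
    exact (Continuous.comp_continuousOn (by fun_prop : Continuous fun y : Vel N => y ∘ σ)
      (continuousOn_regDisp hθ k q x)).mono Set.Icc_subset_Ici_self
  · intro s hs
    have hv' : ∀ s : ℝ, drift (kernelReg k) (coef θ) (q ∘ σ, x ∘ σ) s (regDisp θ k q x s ∘ σ)
        = drift (kernelReg k) (coef θ) (q, x) s (regDisp θ k q x s) ∘ σ := fun s => by
      ext1 i
      simp only [drift, force, comp_apply, move]
      refine Fintype.sum_equiv σ _ _ fun j => ?_
      simp only [coef, comp_apply, ne_eq, EmbeddingLike.apply_eq_iff_eq]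
    simp only [hv']
    rw [regDisp_eq hθ k q x hs.1]
    have hL := (LinearMap.funLeft ℝ (ℝ × ℝ) σ).toContinuousLinearMap.intervalIntegral_comp_comm
      (intervalIntegrable_regVel hθ k q x 0 s)
    exact hL.symm

lemma regFlow_comp_perm (hθ : 0 < θ) (k : ℕ) (q : Marks N) (x : Pos N)
    (σ : Equiv.Perm (Fin N)) (ht : 0 ≤ t) (i : Fin N) :
    regFlow θ k (q ∘ σ) (x ∘ σ) t i = regFlow θ k q x t (σ i) := by
  simp only [regFlow, regDisp_comp_perm hθ k q x σ ht, move, comp_apply]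

end Relabel

/-- Equal observations mean equal vortices up to a permutation; the flow is equivariant and the
vorticity, being a sum, does not see the labels. This is the saturation needed to express the event
through the observation. -/
lemma Reaches.of_observe_eq (hθ : 0 < θ) {T : ℝ≥0} {c c' : Config}
    (hc : c.IsNondeg) (hc' : c'.IsNondeg) (h : Reaches θ T c B) (he : observe T c = observe T c') :
    Reaches θ T c' B := by
  obtain ⟨hnum, σ, hσ⟩ := Config.exists_perm hc hc' he
  have hN : ∀ j, c.data.birth j ≤ T → j < c.num T := fun j => (Config.data_birth_le_iff hc T j).mp
  have hN' : ∀ j, c'.data.birth j ≤ T → j < c.num T := fun j hj => hnum ▸ (Config.data_birth_le_iff hc' T j).mp hj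
  rw [reaches_iff hθ hN] at h
  rw [reaches_iff hθ hN']
  have hm : c'.data.marks (c.num T) = c.data.marks (c.num T) ∘ σ := funext fun i =>
    Prod.ext (congrArg (fun v => v.1) (hσ i)) (congrArg (fun v => v.2.1) (hσ i))
  have hp : c'.data.loc (c.num T) = c.data.loc (c.num T) ∘ σ := funext fun i => congrArg (fun v => v.2.2) (hσ i)
  obtain ⟨k, hk, hB⟩ := h
  refine ⟨k, fun t ht i j hij hi hj => ?_, ?_⟩
  · rw [hm] at hi hj
    rw [hm, hp, regFlow_comp_perm hθ k _ _ σ ht.1, regFlow_comp_perm hθ k _ _ σ ht.1]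
    exact hk t ht _ _ (fun hh => hij (σ.injective hh)) hi hj
  · convert hB using 1
    rw [regVort, regVort, hm, hp]
    exact Fintype.sum_equiv σ _ _ fun i => by rw [regFlow_comp_perm hθ k _ _ σ T.coe_nonneg]; rfl

/-- The signed measures of an observation, evaluated on a countable algebra of sets. -/
def evalObs (v : SMeas × (ℚ≥0 → SMeas)) : (setAlg → ℝ) × (ℚ≥0 → setAlg → ℝ) :=
  (evalAlg v.1, fun r => evalAlg (v.2 r))

lemma measurable_evalObs : Measurable evalObs :=
  (measurable_evalAlg.comp measurable_fst).prodMk (measurable_pi_lambda _ fun r =>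
    measurable_evalAlg.comp ((measurable_pi_apply r).comp measurable_snd))

lemma evalObs_injective : Injective evalObs := fun _ _ h =>
  Prod.ext (evalAlg_injective (congrArg Prod.fst h))
    (funext fun r => evalAlg_injective (congrFun (congrArg Prod.snd h) r))

/-- A measurable version of the noise. -/
def noiseVersion (t : ℝ≥0) (p : Points) : SMeas := by classical exact if IsNondeg p then compoundPoisson p t else 0

lemma measurable_noiseVersion (t : ℝ≥0) : Measurable (noiseVersion t) := by
  classical
  intro S hS
  have : noiseVersion t ⁻¹' S = ({p | IsNondeg p} ∩ {p | compoundPoisson p t ∈ S}) ∪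
      ({p | IsNondeg p}ᶜ ∩ {_p | (0 : SMeas) ∈ S}) := by
    ext p
    by_cases hp : IsNondeg p <;> simp [noiseVersion, hp]
  rw [this]
  exact (measurableSet_compoundPoisson t (isAtomicSet_of_measurableSet hS)).union
    (measurableSet_isNondeg.compl.inter (MeasurableSet.const _))

lemma noiseVersion_eq (hp : IsNondeg p) (t : ℝ≥0) : noiseVersion t p = compoundPoisson p t := by
  simp [noiseVersion, hp]

/-- A measurable version of the observation. -/
def observeVersion (T : ℝ≥0) (c : Config) : SMeas × (ℚ≥0 → SMeas) :=
  (initialVorticity c.1 c.2.1, fun r => noiseVersion (min r T) c.2.2)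

lemma measurable_observeVersion (T : ℝ≥0) : Measurable (observeVersion T) :=
  (measurable_initialVorticity.comp (by fun_prop : Measurable fun c : Config => (c.1, c.2.1))).prodMk
    (measurable_pi_lambda _ fun r => (measurable_noiseVersion _).comp (by fun_prop))

lemma observeVersion_eq {c : Config} (hc : c.IsNondeg) (T : ℝ≥0) : observeVersion T c = observe T c := by
  simp only [observeVersion, observe, noiseVersion_eq hc.points]

instance instStandardBorelSpaceInitial : StandardBorelSpace (ℕ → ℝ × Torus) :=
  have h : StandardBorelSpace (ℝ × Torus) := inferInstance
  @StandardBorelSpace.pi_countable ℕ _ _ _ fun _ => h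

instance instStandardBorelSpacePoints : StandardBorelSpace Points :=
  have h : StandardBorelSpace (Mark) := inferInstance
  @StandardBorelSpace.pi_countable ℕ _ _ _ fun _ => h

/-- The vorticity at time `T` is a function of the initial vorticity and the noise up to time `T`. -/
lemma exists_measurableSet_reaches_iff (hθ : 0 < θ) (T : ℝ≥0) (hB : IsAtomicSet B) :
    ∃ C : Set (SMeas × (ℚ≥0 → SMeas)), MeasurableSet C ∧
      ∀ c : Config, c.IsNondeg → (Reaches θ T c B ↔ observe T c ∈ C) := by
  -- Observations are passed through `evalObs`, whose target is a countable product of real lines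
  -- and hence countably separated.
  obtain ⟨C, hC, h⟩ := exists_measurableSet_iff_of_saturated (D := {c : Config | c.IsNondeg})
    (A := {c : Config | c.IsNondeg ∧ Reaches θ T c B}) Config.measurableSet_isNondeg
    (measurableSet_reaches hθ T hB) (f := fun c => evalObs (observeVersion T c))
    (fun S hS => Config.measurableSet_isNondeg.inter ((measurable_evalObs.comp (measurable_observeVersion T)) hS))
    (fun c hc c' hc' he h => ⟨hc', h.2.of_observe_eq hθ hc hc' (by
      have := evalObs_injective he
      rwa [observeVersion_eq hc, observeVersion_eq hc'] at this)⟩)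
  refine ⟨evalObs ⁻¹' C, measurable_evalObs hC, fun c hc => ?_⟩
  have := h c hc
  rw [observeVersion_eq hc] at this
  rw [mem_preimage, ← this]
  exact ⟨fun hr => ⟨hc, hr⟩, fun hr => hr.2⟩

/-! ### The Poisson point process -/

/-- The law of the waiting times. -/
def gapLaw (lam : ℝ) : Measure ℝ≥0 := (expMeasure lam).map Real.toNNReal

instance instIsProbabilityMeasureSignLaw : IsProbabilityMeasure signLaw := by
  constructor
  simp only [signLaw, Measure.smul_apply, Measure.add_apply, measure_univ, smul_eq_mul]
  rw [one_add_one_eq_two, ENNReal.inv_mul_cancel (by norm_num) (by norm_num)]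

lemma lintegral_gapLaw {F : ℝ≥0 → ℝ≥0∞} (hF : Measurable F) :
    ∫⁻ g, F g ∂gapLaw lam = ∫⁻ x in Ioi (0 : ℝ), ofReal (lam * exp (-(lam * x))) * F x.toNNReal := by
  rw [gapLaw, lintegral_map hF (by fun_prop), expMeasure, gammaMeasure,
    lintegral_withDensity_eq_lintegral_mul _ (f := gammaPDF 1 lam)
      (measurable_gammaPDFReal 1 lam).ennreal_ofReal (by fun_prop),
    ← lintegral_indicator measurableSet_Ioi]
  refine lintegral_congr_ae ?_
  filter_upwards [compl_mem_ae_iff.mpr (measure_singleton (μ := volume) (0 : ℝ))] with x hx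
  have e : gammaPDF 1 lam x = ofReal (if 0 ≤ x then lam * exp (-(lam * x)) else 0) := exponentialPDF_eq lam x
  rw [Pi.mul_apply, e]
  rcases lt_or_gt_of_ne (hx : x ≠ 0) with h | h
  · simp [not_le.mpr h, h.le]
  · simp [h.le, h]

lemma gapLaw_singleton (t : ℝ≥0) : gapLaw lam {t} = 0 := by
  rw [← lintegral_indicator_one (measurableSet_singleton t),
    lintegral_gapLaw (measurable_one.indicator (measurableSet_singleton t))]
  refine (lintegral_congr_ae (g := 0) ?_).trans (by simp)
  filter_upwards [ae_restrict_mem measurableSet_Ioi,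
    ae_restrict_of_ae (compl_mem_ae_iff.mpr (measure_singleton (μ := volume) (t : ℝ)))] with x hx hxt
  have : x.toNNReal ∉ ({t} : Set ℝ≥0) := fun h => hxt <| by
    rw [Set.mem_singleton_iff] at h ⊢
    rw [← h, coe_toNNReal _ (le_of_lt hx)]
  rw [indicator_of_notMem this, mul_zero, Pi.zero_apply]

/-- Lack of memory of the exponential law: the excess over `s` is again exponential, on an event of
probability `e^{-λs}`. -/
lemma lintegral_gapLaw_shift (s : ℝ≥0) {G : ℝ≥0 → ℝ≥0∞} (hG : Measurable G) :
    ∫⁻ g, (if s < g then G (g - s) else 0) ∂gapLaw lam = ofReal (exp (-(lam * s))) * ∫⁻ g, G g ∂gapLaw lam := by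
  have hm : Measurable fun g : ℝ≥0 => if s < g then G (g - s) else 0 :=
    Measurable.ite (measurableSet_lt measurable_const measurable_id) (by fun_prop) measurable_const
  rw [lintegral_gapLaw hm, lintegral_gapLaw hG, ← lintegral_const_mul _ (by fun_prop)]
  rw [← lintegral_indicator measurableSet_Ioi, ← lintegral_indicator measurableSet_Ioi,
    ← lintegral_add_right_eq_self _ (s : ℝ)]
  refine lintegral_congr fun x => ?_
  by_cases hx : 0 < x
  · have h1 : s < (x + s).toNNReal := by rw [Real.lt_toNNReal_iff_coe_lt]; linarith
    have h2 : (x + s).toNNReal - s = x.toNNReal := by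
      rw [Real.toNNReal_add hx.le s.coe_nonneg, Real.toNNReal_coe, add_tsub_cancel_right]
    rw [indicator_of_mem (by simp; positivity), indicator_of_mem (by simpa), if_pos h1, h2, ← mul_assoc,
      ← ofReal_mul (by positivity)]
    congr 2
    rw [mul_left_comm, ← exp_add]; congr 2; ring
  · have h1 : ¬ s < (x + s).toNNReal := by rw [Real.lt_toNNReal_iff_coe_lt]; linarith
    rw [indicator_of_notMem (s := Ioi (0 : ℝ)) (a := x) hx]
    simp only [indicator, if_neg h1, mul_zero, ite_self]

section

instance instIsProbabilityMeasureGapLaw : IsProbabilityMeasure (gapLaw lam) :=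
  have := isProbabilityMeasure_expMeasure hlam.out
  isProbabilityMeasure_map (by fun_prop)

instance instIsProbabilityMeasureMarkLaw : IsProbabilityMeasure (markLaw lam) :=
  inferInstanceAs (IsProbabilityMeasure ((gapLaw lam).prod _))

lemma measurable_accumulate : Measurable fun (g : Points) (m : ℕ) => (∑ i ∈ range (m + 1), (g i).1, (g m).2) :=
  measurable_pi_lambda _ fun m => by fun_prop

instance instIsProbabilityMeasurePoissonLaw : IsProbabilityMeasure (Poi lam) :=
  isProbabilityMeasure_map measurable_accumulate.aemeasurable

/-- A first point `a`, followed by the points `p`, with time counted from that of `a`. -/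
def join (a : Mark) (p : Points) : Points
  | 0 => a
  | m + 1 => (a.1 + (p m).1, (p m).2)

lemma measurable_join : Measurable fun v : (Mark) × Points => join v.1 v.2 := by
  refine measurable_pi_lambda _ fun m => ?_
  cases m with
  | zero => exact measurable_fst
  | succ m => simp only [join]; fun_prop

/-- A sequence extended by a first term. -/
def consSeq {α : Type*} (a : α) (g : ℕ → α) : ℕ → α
  | 0 => a
  | m + 1 => g m

lemma infinitePi_eq_map_consSeq {α : Type*} [MeasurableSpace α] (μ : Measure α) [IsProbabilityMeasure μ] :
    infinitePi (fun _ : ℕ => μ) = (μ.prod (infinitePi fun _ : ℕ => μ)).map fun v => consSeq v.1 v.2 := by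
  have hm : Measurable fun v : α × (ℕ → α) => consSeq v.1 v.2 := by
    refine measurable_pi_lambda _ fun m => ?_
    cases m with
    | zero => exact measurable_fst
    | succ m => simp only [consSeq]; fun_prop
  symm
  refine Measure.eq_infinitePi _ fun s t ht => ?_
  classical
  rw [map_apply hm (MeasurableSet.pi s.countable_toSet fun i _ => ht i)]
  set s' : Finset ℕ := s.preimage Nat.succ Nat.succ_injective.injOn with hs'
  have hpre : (fun v : α × (ℕ → α) => consSeq v.1 v.2) ⁻¹' (Set.pi s t) =
      (if 0 ∈ s then t 0 else univ) ×ˢ Set.pi s' fun m => t (m + 1) := by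
    ext v
    simp only [mem_preimage, Set.mem_pi, Finset.mem_coe, Set.mem_prod, hs', Finset.mem_preimage]
    constructor
    · intro h
      refine ⟨?_, fun m hm => h (m + 1) hm⟩
      split_ifs with h0
      · exact h 0 h0
      · trivial
    · rintro ⟨h0, h1⟩ m hm
      cases m with
      | zero => rwa [if_pos hm] at h0
      | succ m => exact h1 m hm
  rw [hpre, prod_prod, Measure.infinitePi_pi _ (fun i _ => ht _)]
  have himg : s = (if 0 ∈ s then {0} else ∅) ∪ s'.image Nat.succ := by
    ext m
    cases m with
    | zero => by_cases h : 0 ∈ s <;> simp [h]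
    | succ m => by_cases h : 0 ∈ s <;> simp [h, hs']
  conv_rhs => rw [himg]
  rw [Finset.prod_union (by split_ifs <;> simp), Finset.prod_image (Nat.succ_injective.injOn)]
  split_ifs <;> simp

/-- Renewal: counted from the first point, the following points form an independent copy of the
whole process. The computations with the Poisson law below are recursions on this identity. -/
lemma poissonLaw_eq_map_join : Poi lam = ((markLaw lam).prod (Poi lam)).map fun v => join v.1 v.2 := by
  have hp : (markLaw lam).prod (Poi lam) =
      ((markLaw lam).prod (infinitePi fun _ : ℕ => markLaw lam)).map
        (Prod.map id fun (g : Points) (m : ℕ) => (∑ i ∈ range (m + 1), (g i).1, (g m).2)) := by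
    rw [← map_prod_map _ _ measurable_id measurable_accumulate, Measure.map_id, poissonLaw]
  have hc : Measurable fun v : (Mark) × Points => consSeq v.1 v.2 := by
    refine measurable_pi_lambda _ fun m => ?_
    cases m with
    | zero => exact measurable_fst
    | succ m => simp only [consSeq]; fun_prop
  rw [hp, Measure.map_map measurable_join (measurable_id.prodMap measurable_accumulate)]
  conv_lhs => rw [poissonLaw, infinitePi_eq_map_consSeq, Measure.map_map measurable_accumulate hc]
  congr 1
  ext1 v
  funext m
  cases m with
  | zero => simp [join, consSeq]
  | succ m =>
    simp only [comp_apply, join, Prod.map, consSeq, id]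
    rw [Finset.sum_range_succ']
    simp [add_comm]

lemma lintegral_poissonLaw {F : Points → ℝ≥0∞} (hF : Measurable F) :
    ∫⁻ p, F p ∂Poi lam = ∫⁻ a, ∫⁻ p, F (join a p) ∂Poi lam ∂markLaw lam := by
  conv_lhs => rw [poissonLaw_eq_map_join, lintegral_map hF measurable_join]
  exact lintegral_prod _ (hF.comp measurable_join).aemeasurable

lemma lintegral_markLaw {F : Mark → ℝ≥0∞} (hF : Measurable F) :
    ∫⁻ a, F a ∂markLaw lam = ∫⁻ b, ∫⁻ g, F (g, b) ∂gapLaw lam ∂(signLaw.prod volume) :=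
  lintegral_prod_symm (μ := gapLaw lam) _ hF.aemeasurable

/-! ### Moments and nondegeneracy -/

/-- With everything except the first waiting time fixed, `t_m` is a translate of that waiting time,
which has no atoms. -/
lemma ae_time_ne (m : ℕ) (t : ℝ≥0) : ∀ᵐ p ∂Poi lam, (p m).1 ≠ t := by
  have hS : MeasurableSet {p : Points | (p m).1 = t} := measurableSet_eq_fun (by fun_prop) measurable_const
  rw [ae_iff]
  simp only [ne_eq, not_not]
  have hi : Measurable ({p : Points | (p m).1 = t}.indicator (1 : Points → ℝ≥0∞)) := measurable_one.indicator hS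
  rw [← lintegral_indicator_one hS, poissonLaw_eq_map_join, lintegral_map hi measurable_join,
    lintegral_prod_symm (fun v : (Mark) × Points =>
      {p : Points | (p m).1 = t}.indicator (1 : Points → ℝ≥0∞) (join v.1 v.2))
      (hi.comp measurable_join).aemeasurable]
  refine (lintegral_congr fun p => ?_).trans lintegral_zero
  have hmeas : Measurable fun a : Mark =>
      {p : Points | (p m).1 = t}.indicator (1 : Points → ℝ≥0∞) (join a p) :=
    hi.comp (measurable_join.comp (measurable_id.prodMk measurable_const))
  refine (lintegral_markLaw hmeas).trans ?_
  refine (lintegral_congr fun b => ?_).trans lintegral_zero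
  refine le_antisymm ?_ zero_le
  -- Only an inclusion of events is needed, so truncation of the subtraction to `0` does no harm.
  have hle : ∀ g : ℝ≥0, {p : Points | (p m).1 = t}.indicator (1 : Points → ℝ≥0∞) (join (g, b) p) ≤
      ({t - (if m = 0 then 0 else (p (m - 1)).1)} : Set ℝ≥0).indicator 1 g := fun g => by
    by_cases hg : join (g, b) p ∈ {p : Points | (p m).1 = t}
    · have : g ∈ ({t - (if m = 0 then 0 else (p (m - 1)).1)} : Set ℝ≥0) := by
        rw [Set.mem_singleton_iff]
        cases m with
        | zero => simpa [join] using hg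
        | succ m => simp only [join, mem_ofPred_eq] at hg; simp [← hg]
      rw [indicator_of_mem hg, indicator_of_mem this]; simp
    · rw [indicator_of_notMem hg]; exact zero_le
  refine (lintegral_mono hle).trans ?_
  rw [lintegral_indicator_one (measurableSet_singleton _), gapLaw_singleton]

/-- The Laplace transform of the waiting times. -/
def gapLaplace (lam : ℝ) : ℝ≥0∞ := ∫⁻ g, ofReal (exp (-(g : ℝ))) ∂gapLaw lam

lemma gapLaplace_lt_one : gapLaplace lam < 1 := by
  have h1 : ∫⁻ _g, 1 ∂gapLaw lam = 1 := by simp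
  rw [← h1, gapLaplace]
  refine lintegral_strict_mono (by simp [NeZero.ne]) (by fun_prop) ?_ ?_
  · refine ne_top_of_le_ne_top (by simp : (1 : ℝ≥0∞) ≠ ∞) ?_
    rw [← h1]
    exact lintegral_mono fun g => by simp
  · filter_upwards [compl_mem_ae_iff.mpr (gapLaw_singleton (lam := lam) 0)] with g hg
    have : 0 < g := pos_iff_ne_zero.mpr hg
    simpa using this

lemma lintegral_exp_neg_time (m : ℕ) :
    ∫⁻ p, ofReal (exp (-((p m).1 : ℝ))) ∂Poi lam = gapLaplace lam ^ (m + 1) := by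
  have hmark : ∫⁻ a, ofReal (exp (-(a.1 : ℝ))) ∂markLaw lam = gapLaplace lam := by
    rw [lintegral_markLaw (by fun_prop)]; simp [gapLaplace]
  induction m with
  | zero => rw [lintegral_poissonLaw (by fun_prop)]; simp [join, hmark]
  | succ m ih =>
    rw [lintegral_poissonLaw (by fun_prop)]
    simp only [join, coe_add, neg_add, exp_add]
    simp only [ofReal_mul (exp_pos _).le]
    rw [lintegral_congr fun a => lintegral_const_mul _ (by fun_prop)]
    rw [lintegral_mul_const _ (by fun_prop), ih, hmark, pow_succ' _ (m + 1)]

/-- The means of `e^{-t_m}` form a convergent geometric series. Finiteness of the sum forces the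
times to be unbounded, and since each point up to `T` contributes at least `e^{-T}`, it also bounds
the mean number of points. -/
lemma lintegral_tsum_exp_neg_time_lt_top : ∫⁻ p, ∑' m, ofReal (exp (-((p m).1 : ℝ))) ∂Poi lam < ∞ := by
  rw [lintegral_tsum fun m => (by fun_prop : Measurable fun p : Points =>
    ofReal (exp (-((p m).1 : ℝ)))).aemeasurable]
  simp only [lintegral_exp_neg_time]
  rw [ENNReal.tsum_geometric_add_one]
  exact mul_lt_top (gapLaplace_lt_one.trans ENNReal.one_lt_top)
    (ENNReal.inv_lt_top.mpr (tsub_pos_of_lt gapLaplace_lt_one))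

lemma ae_isNondeg : ∀ᵐ p ∂Poi lam, IsNondeg p := by
  have hunb : ∀ᵐ p ∂Poi lam, ∀ T : ℕ, ∃ m, (T : ℝ≥0) < (p m).1 := by
    filter_upwards [ae_lt_top (by fun_prop) (lintegral_tsum_exp_neg_time_lt_top (lam := lam)).ne] with p hp T
    by_contra hc
    push Not at hc
    refine hp.ne (top_le_iff.mp ?_)
    rw [← ENNReal.tsum_const_eq_top_of_ne_zero (α := ℕ) (ENNReal.ofReal_pos.mpr (exp_pos (-(T : ℝ)))).ne']
    refine ENNReal.tsum_le_tsum fun m => ENNReal.ofReal_le_ofReal (Real.exp_le_exp.mpr (neg_le_neg ?_))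
    exact_mod_cast hc m
  have hmarks : ∀ᵐ g ∂(infinitePi fun _ : ℕ => markLaw lam), ∀ m, (g m).1 ≠ 0 ∧ (g m).2.1 ≠ 0 := by
    rw [ae_all_iff]
    intro m
    refine (measurePreserving_eval_infinitePi (fun _ : ℕ => markLaw lam) m).quasiMeasurePreserving.ae
      (p := fun a => a.1 ≠ 0 ∧ a.2.1 ≠ 0) ?_
    have h1 : ∀ᵐ a ∂markLaw lam, a.1 ≠ 0 :=
      quasiMeasurePreserving_fst.ae (p := fun g => g ≠ 0) (compl_mem_ae_iff.mpr (gapLaw_singleton (lam := lam) 0))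
    have h2 : ∀ᵐ a ∂markLaw lam, a.2.1 ≠ 0 := by
      have h3 : ∀ᵐ σ ∂signLaw, σ ≠ 0 := by simp [signLaw, ae_iff]
      exact quasiMeasurePreserving_snd.ae
        ((quasiMeasurePreserving_fst (μ := signLaw) (ν := (volume : Measure Torus))).ae (p := fun g => g ≠ 0) h3)
    exact h1.and h2
  have hrest : ∀ᵐ p ∂Poi lam, 0 < (p 0).1 ∧ (∀ m, (p m).1 < (p (m + 1)).1) ∧ ∀ m, (p m).2.1 ≠ 0 := by
    rw [poissonLaw, ae_map_iff measurable_accumulate.aemeasurable]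
    · filter_upwards [hmarks] with g hg
      refine ⟨by simpa using pos_iff_ne_zero.mpr (hg 0).1, fun m => ?_, fun m => (hg m).2⟩
      simp only [Finset.sum_range_succ _ (m + 1)]
      exact lt_add_of_pos_right _ (pos_iff_ne_zero.mpr (hg (m + 1)).1)
    · simp only [Set.ofPred_and, Set.ofPred_forall]
      refine MeasurableSet.inter (measurableSet_lt measurable_const (by fun_prop)) (MeasurableSet.inter ?_ ?_)
      · exact .iInter fun m => measurableSet_lt (by fun_prop) (by fun_prop)
      · exact .iInter fun m => (measurableSet_eq_fun (by fun_prop) measurable_const).compl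
  filter_upwards [hunb, hrest] with p h1 h2
  exact ⟨h2.1, h2.2.1, h1, h2.2.2⟩

lemma lintegral_count_lt_top (T : ℝ≥0) : ∫⁻ p, (count p T : ℝ≥0∞) ∂Poi lam < ∞ := by
  have hle : ∀ᵐ p ∂Poi lam, (count p T : ℝ≥0∞) ≤ ofReal (exp T) * ∑' m, ofReal (exp (-((p m).1 : ℝ))) := by
    filter_upwards [ae_isNondeg] with p hp
    rw [← ENNReal.tsum_mul_left]
    calc (count p T : ℝ≥0∞) = ∑ m ∈ range (count p T), (1 : ℝ≥0∞) := by simp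
      _ ≤ ∑ m ∈ range (count p T), ofReal (exp T) * ofReal (exp (-((p m).1 : ℝ))) := by
        refine sum_le_sum fun m hm => ?_
        have : ((p m).1 : ℝ) ≤ T := (hp.le_iff T m).mpr (by simpa using hm)
        rw [← ofReal_mul (exp_pos _).le, ← exp_add, ENNReal.one_le_ofReal, Real.one_le_exp_iff]
        linarith
      _ ≤ _ := ENNReal.sum_le_tsum _
  refine (lintegral_mono_ae hle).trans_lt ?_
  rw [lintegral_const_mul _ (by fun_prop)]
  exact mul_lt_top ofReal_lt_top lintegral_tsum_exp_neg_time_lt_top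

/-! ### Invariance -/

/-- Signs and positions are independent of the waiting times and of each other for different points.
This is applied to translations of the positions and to the change of all signs. -/
lemma poissonLaw_map_marks {φ : ℕ → ℝ × Torus → ℝ × Torus}
    (hφ : ∀ m, MeasurePreserving (φ m) (signLaw.prod volume) (signLaw.prod volume)) :
    (Poi lam).map (fun p m => ((p m).1, φ m (p m).2)) = Poi lam := by
  have hm : Measurable fun (p : Points) (m : ℕ) => ((p m).1, φ m (p m).2) :=
    measurable_pi_lambda _ fun m => Measurable.prodMk (by fun_prop) ((hφ m).measurable.comp (by fun_prop))
  have h1 := Measure.infinitePi_map_pi (fun _ : ℕ => markLaw lam) (f := fun m => Prod.map id (φ m))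
    fun m => measurable_id.prodMap (hφ m).measurable
  have h2 : ∀ m, (markLaw lam).map (Prod.map id (φ m)) = markLaw lam := fun m =>
    ((MeasurePreserving.id (gapLaw lam)).prod (hφ m)).map_eq
  simp only [h2] at h1
  have h3 : Measurable fun (x : Points) (m : ℕ) => Prod.map id (φ m) (x m) :=
    measurable_pi_lambda _ fun m => (measurable_id.prodMap (hφ m).measurable).comp (measurable_pi_apply m)
  conv_rhs => rw [poissonLaw, ← h1, Measure.map_map measurable_accumulate h3]
  rw [poissonLaw, Measure.map_map hm measurable_accumulate]
  rfl

end

/-! ### Independence of past and future -/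

/-- The points up to time `s`. -/
def past (s : ℝ≥0) (p : Points) : Points := fun m => if (p m).1 ≤ s then p m else (s + 1, 1, 0)

/-- The points after time `s`, with time counted from `s`. -/
def shift (s : ℝ≥0) (p : Points) : Points := fun m => ((p (count p s + m)).1 - s, (p (count p s + m)).2)

lemma measurable_past (s : ℝ≥0) : Measurable (past s) := by
  refine measurable_pi_lambda _ fun m => ?_
  exact Measurable.ite (measurableSet_le (by fun_prop) measurable_const) (by fun_prop) measurable_const

lemma measurable_shift (s : ℝ≥0) : Measurable (shift s) := by
  refine measurable_pi_lambda _ fun m => ?_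
  have h : Measurable fun v : ℕ × Points => v.2 (v.1 + m) :=
    measurable_from_prod_countable_right fun n => measurable_pi_apply (n + m)
  have h2 := h.comp ((measurable_count s).prodMk measurable_id)
  exact (h2.fst.sub_const s).prodMk h2.snd

lemma count_eq_zero {s : ℝ≥0} (h : s < (p 0).1) : count p s = 0 := Nat.sInf_eq_zero.mpr (Or.inl h)

lemma count_join {a : Mark} (hp : IsNondeg p) {s : ℝ≥0} (ha : a.1 ≤ s) :
    count (join a p) s = count p (s - a.1) + 1 := by
  have hmem : ∀ m, s < (join a p (m + 1)).1 ↔ s - a.1 < (p m).1 := fun m => by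
    change s < a.1 + (p m).1 ↔ _
    rw [tsub_lt_iff_left ha]
  have h1 : s - a.1 < (p (count p (s - a.1))).1 := sInf_mem (s := {m | s - a.1 < (p m).1}) (hp.exists_lt _)
  refine le_antisymm (Nat.sInf_le ((hmem _).mpr h1)) ?_
  have h2 : s < (join a p (count (join a p) s)).1 := sInf_mem (s := {m | s < (join a p m).1}) ⟨_, (hmem _).mpr h1⟩
  rcases hc : count (join a p) s with _ | n
  · rw [hc] at h2; exact absurd h2 (not_lt.mpr ha)
  · rw [hc, hmem] at h2
    exact Nat.succ_le_succ (Nat.sInf_le h2)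

lemma past_join_of_lt {a : Mark} {s : ℝ≥0} (ha : s < a.1) : past s (join a p) = fun _ => (s + 1, 1, 0) := by
  funext m
  rw [past, if_neg]
  cases m with
  | zero => exact not_le.mpr ha
  | succ m => exact not_le.mpr (ha.trans_le le_self_add)

lemma shift_join_of_lt {a : Mark} {s : ℝ≥0} (ha : s < a.1) : shift s (join a p) = join (a.1 - s, a.2) p := by
  funext m
  rw [shift, count_eq_zero (show s < (join a p 0).1 from ha), Nat.zero_add]
  cases m with
  | zero => rfl
  | succ m => exact Prod.ext (tsub_add_eq_add_tsub ha.le).symm rfl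

/-- The past of `join a p` up to time `s` in terms of the past of `p`. -/
def joinPast (s : ℝ≥0) (a : Mark) (r : Points) : Points
  | 0 => a
  | m + 1 => if (r m).1 ≤ s - a.1 then (a.1 + (r m).1, (r m).2) else (s + 1, 1, 0)

lemma measurable_joinPast (s : ℝ≥0) (a : Mark) : Measurable (joinPast s a) := by
  refine measurable_pi_lambda _ fun m => ?_
  cases m with
  | zero => exact measurable_const
  | succ m => exact Measurable.ite (measurableSet_le (by fun_prop) measurable_const) (by fun_prop) measurable_const

lemma past_join_of_le {a : Mark} {s : ℝ≥0} (ha : a.1 ≤ s) :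
    past s (join a p) = joinPast s a (past (s - a.1) p) := by
  funext m
  cases m with
  | zero => simp [past, join, joinPast, ha]
  | succ m =>
    by_cases h : (p m).1 ≤ s - a.1
    · have h1 : (join a p (m + 1)).1 ≤ s := (le_tsub_iff_left ha).mp h
      have h2 : past (s - a.1) p m = p m := if_pos h
      rw [past, if_pos h1, joinPast, h2, if_pos h]
      rfl
    · have h1 : ¬ (join a p (m + 1)).1 ≤ s := fun hc => h ((le_tsub_iff_left ha).mpr hc)
      have h2 : past (s - a.1) p m = (s - a.1 + 1, 1, 0) := if_neg h
      rw [past, if_neg h1, joinPast, h2, if_neg (by simp)]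

lemma shift_join_of_le {a : Mark} (hp : IsNondeg p) {s : ℝ≥0} (ha : a.1 ≤ s) :
    shift s (join a p) = shift (s - a.1) p := by
  funext m
  rw [shift, shift, count_join hp ha, Nat.add_right_comm]
  refine Prod.ext ?_ rfl
  change a.1 + _ - s = _ - (s - a.1)
  rw [tsub_tsub_eq_add_tsub_of_le ha, add_comm]

section

/-- If the first point comes after `s`, lack of memory makes the process counted from `s` a fresh
Poisson process; the factor is the probability of that event. -/
lemma lintegral_poissonLaw_of_time_gt (s : ℝ≥0) {G : Points → ℝ≥0∞} (hG : Measurable G) :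
    ∫⁻ a, ∫⁻ p, (if s < a.1 then G (join (a.1 - s, a.2) p) else 0) ∂Poi lam ∂markLaw lam
      = ofReal (exp (-(lam * s))) * ∫⁻ p, G p ∂Poi lam := by
  have hJ : Measurable fun a => ∫⁻ p, G (join a p) ∂Poi lam := (hG.comp measurable_join).lintegral_prod_right'
  have h1 : ∀ a : Mark, ∫⁻ p, (if s < a.1 then G (join (a.1 - s, a.2) p) else 0) ∂Poi lam
      = if s < a.1 then ∫⁻ p, G (join (a.1 - s, a.2) p) ∂Poi lam else 0 := fun a => by
    split_ifs <;> simp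
  simp only [h1]
  have hm : Measurable fun a : Mark => if s < a.1 then ∫⁻ p, G (join (a.1 - s, a.2) p) ∂Poi lam else 0 :=
    Measurable.ite (measurableSet_lt measurable_const (by fun_prop))
      (hJ.comp (by fun_prop : Measurable fun a : Mark => (a.1 - s, a.2))) measurable_const
  have h2 : ∀ b : ℝ × Torus, Measurable fun g : ℝ≥0 => ∫⁻ p, G (join (g, b) p) ∂Poi lam := fun b =>
    hJ.comp (by fun_prop : Measurable fun g : ℝ≥0 => (g, b))
  rw [lintegral_markLaw hm, lintegral_poissonLaw hG, lintegral_markLaw hJ,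
    ← lintegral_const_mul' _ _ ofReal_ne_top]
  exact lintegral_congr fun b => lintegral_gapLaw_shift s (h2 b)

/-- Past and future on the event that there are `n` points in the past. -/
lemma lintegral_past_mul_shift_count (n : ℕ) (s : ℝ≥0) {F G : Points → ℝ≥0∞} (hF : Measurable F)
    (hG : Measurable G) (hG' : ∫⁻ p, G p ∂Poi lam ≠ ∞) :
    ∫⁻ p, (if count p s = n then F (past s p) * G (shift s p) else 0) ∂Poi lam
      = (∫⁻ p, (if count p s = n then F (past s p) else 0) ∂Poi lam) * ∫⁻ p, G p ∂Poi lam := by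
  have hmeas : ∀ (n : ℕ) (s : ℝ≥0) {F G : Points → ℝ≥0∞}, Measurable F → Measurable G →
      Measurable fun p => if count p s = n then F (past s p) * G (shift s p) else 0 := fun n s F G hF hG =>
    Measurable.ite (measurable_count s (measurableSet_singleton n))
      ((hF.comp (measurable_past s)).mul (hG.comp (measurable_shift s))) measurable_const
  -- Having `n + 1` points up to `s` means that the first one falls at `a ≤ s` and `n` further ones
  -- within `s - a`. Both past and future at `s` are then read off from the process after the first
  -- point.
  have key : ∀ (n : ℕ) (s : ℝ≥0) {F G : Points → ℝ≥0∞}, Measurable F → Measurable G →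
      ∫⁻ p, (if count p s = n + 1 then F (past s p) * G (shift s p) else 0) ∂Poi lam =
        ∫⁻ a, (if a.1 ≤ s then ∫⁻ p, (if count p (s - a.1) = n then F (joinPast s a (past (s - a.1) p)) *
          G (shift (s - a.1) p) else 0) ∂Poi lam else 0) ∂markLaw lam := by
    intro n s F G hF hG
    rw [lintegral_poissonLaw (hmeas (n + 1) s hF hG)]
    refine lintegral_congr fun a => ?_
    by_cases ha : a.1 ≤ s
    · rw [if_pos ha]
      refine lintegral_congr_ae ?_
      filter_upwards [ae_isNondeg] with p hp
      simp only [count_join hp ha, past_join_of_le ha, shift_join_of_le hp ha, Nat.add_right_cancel_iff]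
    · rw [if_neg ha]
      refine (lintegral_congr fun p => ?_).trans lintegral_zero
      rw [count_eq_zero (show s < (join a p 0).1 from not_le.mp ha), if_neg (succ_ne_zero n).symm]
  -- Without points in the past, `past` is a constant sequence and the future is governed by lack of
  -- memory.
  have key0 : ∀ (s : ℝ≥0) {F G : Points → ℝ≥0∞}, Measurable F → Measurable G →
      ∫⁻ p, (if count p s = 0 then F (past s p) * G (shift s p) else 0) ∂Poi lam =
        F (fun _ => (s + 1, 1, 0)) * (ofReal (exp (-(lam * s))) * ∫⁻ p, G p ∂Poi lam) := by
    intro s F G hF hG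
    have hG2 : Measurable fun p => F (fun _ => (s + 1, 1, 0)) * G p := hG.const_mul _
    rw [lintegral_poissonLaw (hmeas 0 s hF hG), mul_left_comm, ← lintegral_const_mul _ hG,
      ← lintegral_poissonLaw_of_time_gt s hG2]
    refine lintegral_congr fun a => lintegral_congr_ae ?_
    filter_upwards [ae_isNondeg] with p hp
    by_cases ha : a.1 ≤ s
    · rw [count_join hp ha, if_neg (succ_ne_zero _), if_neg (not_lt.mpr ha)]
    · have ha' := not_le.mp ha
      rw [count_eq_zero (show s < (join a p 0).1 from ha'), if_pos rfl, if_pos ha', past_join_of_lt ha',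
        shift_join_of_lt ha']
  induction n generalizing s F with
  | zero =>
    have h1 := key0 s hF (measurable_const (a := (1 : ℝ≥0∞)))
    simp only [mul_one, lintegral_one, measure_univ] at h1
    rw [key0 s hF hG, h1, mul_assoc]
  | succ n ih =>
    have h1 := key n s hF (measurable_const (a := (1 : ℝ≥0∞)))
    simp only [mul_one] at h1
    rw [key n s hF hG, h1, ← lintegral_mul_const' _ _ hG']
    refine lintegral_congr fun a => ?_
    split_ifs with ha
    · exact ih (s - a.1) (hF.comp (measurable_joinPast s a))
    · simp

lemma lintegral_past_mul_shift (s : ℝ≥0) {F G : Points → ℝ≥0∞} (hF : Measurable F)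
    (hG : Measurable G) (hG' : ∫⁻ p, G p ∂Poi lam ≠ ∞) :
    ∫⁻ p, F (past s p) * G (shift s p) ∂Poi lam = (∫⁻ p, F (past s p) ∂Poi lam) * ∫⁻ p, G p ∂Poi lam := by
  have key : ∀ H : Points → ℝ≥0∞, Measurable H → ∫⁻ p, H p ∂Poi lam =
      ∑' n : ℕ, ∫⁻ p, (if count p s = n then H p else 0) ∂Poi lam := fun H hH => by
    have hm : ∀ n : ℕ, Measurable fun p => if count p s = n then H p else 0 := fun n =>
      Measurable.ite (measurable_count s (measurableSet_singleton n)) hH measurable_const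
    rw [← lintegral_tsum fun n => (hm n).aemeasurable]
    refine lintegral_congr fun p => ?_
    rw [tsum_eq_single (count p s) fun n hn => if_neg hn.symm, if_pos rfl]
  rw [key (fun p => F (past s p) * G (shift s p)) ((hF.comp (measurable_past s)).mul
    (hG.comp (measurable_shift s))), key (fun p => F (past s p)) (hF.comp (measurable_past s)),
    ← ENNReal.tsum_mul_right]
  exact tsum_congr fun n => lintegral_past_mul_shift_count n s hF hG hG'

lemma poissonLaw_map_past_shift (s : ℝ≥0) :
    (Poi lam).map (fun p => (past s p, shift s p)) = ((Poi lam).map (past s)).prod (Poi lam) := by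
  have := isProbabilityMeasure_map (μ := Poi lam) (measurable_past s).aemeasurable
  symm
  refine Measure.prod_eq fun A B hA hB => ?_
  have h := lintegral_past_mul_shift (lam := lam) s (measurable_one.indicator hA) (measurable_one.indicator hB)
    (by rw [lintegral_indicator_one hB]; exact measure_ne_top _ _)
  rw [lintegral_indicator_one hB, ← lintegral_map (measurable_one.indicator hA) (measurable_past s),
    lintegral_indicator_one hA] at h
  rw [← h, map_apply ((measurable_past s).prodMk (measurable_shift s)) (hA.prod hB),
    ← lintegral_indicator_one (((measurable_past s).prodMk (measurable_shift s)) (hA.prod hB))]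
  refine lintegral_congr fun p => ?_
  by_cases h1 : past s p ∈ A <;> by_cases h2 : shift s p ∈ B <;> simp [indicator, h1, h2]

lemma poissonLaw_map_shift (s : ℝ≥0) : (Poi lam).map (shift s) = Poi lam := by
  have := isProbabilityMeasure_map (μ := Poi lam) (measurable_past s).aemeasurable
  have h := congrArg (Measure.map Prod.snd) (poissonLaw_map_past_shift (lam := lam) s)
  rwa [Measure.map_map measurable_snd ((measurable_past s).prodMk (measurable_shift s)), Measure.map_snd_prod,
    measure_univ, one_smul] at h

end

/-! ### The noise in terms of past and future -/

lemma IsNondeg.shift (hp : IsNondeg p) (s : ℝ≥0) : IsNondeg (shift s p) := by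
  have hgt : ∀ m, s < (p (count p s + m)).1 := fun m => not_le.mp fun hc => by have := (hp.le_iff s _).mp hc; omega
  refine ⟨tsub_pos_of_lt (hgt 0), fun m => tsub_lt_tsub_right_of_le (hgt m).le (hp.lt_succ _), fun T => ?_,
    fun m => hp.sign_ne_zero _⟩
  obtain ⟨m, hm⟩ := hp.exists_lt (T + s)
  refine ⟨m, lt_tsub_iff_right.mpr (hm.trans_le (hp.strictMono.monotone (Nat.le_add_left _ _)))⟩

lemma shift_time_le_iff (p : Points) (s u : ℝ≥0) (m : ℕ) :
    (shift s p m).1 ≤ u ↔ (p (count p s + m)).1 ≤ s + u := tsub_le_iff_left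

lemma IsNondeg.count_shift (hp : IsNondeg p) (s u : ℝ≥0) :
    count p (s + u) = count p s + count (PointVortex.shift s p) u := by
  have h : ∀ m, m < count p (s + u) ↔ m < count p s + count (PointVortex.shift s p) u := fun m => by
    rw [← hp.le_iff]
    rcases lt_or_ge m (count p s) with hm | hm
    · exact iff_of_true (((hp.le_iff s m).mpr hm).trans le_self_add) (by omega)
    · obtain ⟨l, rfl⟩ := Nat.exists_eq_add_of_le hm
      rw [← shift_time_le_iff p s u l, (hp.shift s).le_iff]; omega
  exact le_antisymm (not_lt.mp fun hc => absurd ((h _).mp hc) (lt_irrefl _))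
    (not_lt.mp fun hc => absurd ((h _).mpr hc) (lt_irrefl _))

lemma IsNondeg.compoundPoisson_eq_sum (hp : IsNondeg p) (t : ℝ≥0) :
    compoundPoisson p t = ∑ m ∈ range (count p t), dirac (p m).2.2 (p m).2.1 := by
  rw [hp.compoundPoisson_eq le_rfl, sum_range]
  exact sum_congr rfl fun m _ => by rw [if_pos ((hp.le_iff t m).mpr m.2)]

/-! ### Multiplicative functionals of the Poisson point process -/

lemma integral_gapLaw (hlam : 0 < lam) {F : ℝ≥0 → ℂ} (hF : Measurable F) (h : ℝ≥0) :
    ∫ g, (if g ≤ h then F g else 0) ∂gapLaw lam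
      = ∫ x in (0 : ℝ)..h, ((lam * exp (-(lam * x)) : ℝ) : ℂ) * F x.toNNReal := by
  have hm : Measurable fun g : ℝ≥0 => if g ≤ h then F g else 0 :=
    Measurable.ite (measurableSet_le measurable_id measurable_const) hF measurable_const
  rw [gapLaw, integral_map (by fun_prop) hm.aestronglyMeasurable, expMeasure, gammaMeasure,
    integral_withDensity_eq_integral_toReal_smul (f := gammaPDF 1 lam)
      (measurable_gammaPDFReal 1 lam).ennreal_ofReal (ae_of_all _ fun x => ofReal_lt_top),
    integral_of_le h.coe_nonneg, ← integral_indicator measurableSet_Ioc]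
  refine integral_congr_ae ?_
  filter_upwards [compl_mem_ae_iff.mpr (measure_singleton (μ := volume) (0 : ℝ))] with x hx
  have e : (gammaPDF 1 lam x).toReal = (ofReal (if 0 ≤ x then lam * exp (-(lam * x)) else 0)).toReal :=
    congrArg _ (exponentialPDF_eq lam x)
  rw [e]
  rcases lt_or_gt_of_ne (hx : x ≠ 0) with h0 | h0
  · simp [not_le.mpr h0, indicator, not_lt.mpr h0.le]
  · by_cases hxh : x ≤ h
    · rw [if_pos (Real.toNNReal_le_iff_le_coe.mpr hxh), indicator_of_mem (show x ∈ Ioc (0 : ℝ) h from ⟨h0, hxh⟩), if_pos h0.le,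
        ENNReal.toReal_ofReal (by positivity), Complex.real_smul]
    · rw [if_neg (fun hc => hxh (Real.toNNReal_le_iff_le_coe.mp hc)), indicator_of_notMem fun hc => hxh hc.2, smul_zero]

section

lemma integral_poissonLaw {F : Points → ℂ} (hF : Measurable F) {C : ℝ} (hC : ∀ p, ‖F p‖ ≤ C) :
    ∫ p, F p ∂Poi lam = ∫ a, ∫ p, F (join a p) ∂Poi lam ∂markLaw lam := by
  conv_lhs => rw [poissonLaw_eq_map_join, integral_map measurable_join.aemeasurable hF.aestronglyMeasurable]
  exact integral_prod _ (Integrable.of_bound (hF.comp measurable_join).aestronglyMeasurable C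
    (ae_of_all _ fun v => hC _))

lemma integral_markLaw {F : Mark → ℂ} (hF : Measurable F) {C : ℝ} (hC : ∀ p, ‖F p‖ ≤ C) :
    ∫ a, F a ∂markLaw lam = ∫ g, ∫ b, F (g, b) ∂(signLaw.prod volume) ∂gapLaw lam :=
  integral_prod (μ := gapLaw lam) _ (Integrable.of_bound hF.aestronglyMeasurable C (ae_of_all _ hC))

lemma gapLaw_Ioi (h : ℝ≥0) : (gapLaw lam).real (Ioi h) = exp (-(lam * h)) := by
  have := lintegral_gapLaw_shift (lam := lam) h (measurable_const (a := (1 : ℝ≥0∞)))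
  rw [lintegral_one, measure_univ, mul_one] at this
  rw [measureReal_def, ← lintegral_indicator_one measurableSet_Ioi,
    show (Ioi h).indicator (1 : ℝ≥0 → ℝ≥0∞) = fun g => if h < g then 1 else 0 from rfl, this,
    ENNReal.toReal_ofReal (exp_pos _).le]

variable {Φ : Mark → ℂ}

lemma measurable_prod_count (hΦ : Measurable Φ) (n : ℕ) (a h : ℝ≥0) : Measurable fun p : Points =>
    if count p h = n then ∏ m ∈ range n, Φ (a + (p m).1, (p m).2) else 0 :=
  Measurable.ite (measurable_count h (measurableSet_singleton n))
    (Finset.measurable_prod _ fun m _ => hΦ.comp (by fun_prop)) measurable_const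

lemma norm_prod_count_le (hb : ∀ v, ‖Φ v‖ ≤ 1) (n : ℕ) (a h : ℝ≥0) (p : Points) :
    ‖if count p h = n then ∏ m ∈ range n, Φ (a + (p m).1, (p m).2) else 0‖ ≤ 1 := by
  split_ifs
  · rw [norm_prod]; exact Finset.prod_le_one (fun _ _ => norm_nonneg _) fun _ _ => hb _
  · simp

/-- With `Ψ(r) = ∫_r^H φ`, the integrand is the derivative of `-Ψ^{n+1} / (n+1)`. It is the
recursion behind the factor `1/n!` of an integral over ordered times. -/
lemma integral_pow_primitive {φ : ℝ → ℂ} (hφ : Continuous φ) (n : ℕ) (a H : ℝ) :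
    ∫ r in a..H, φ r * (∫ s in r..H, φ s) ^ n = (∫ s in a..H, φ s) ^ (n + 1) / (n + 1) := by
  have hd : ∀ r, HasDerivAt (fun r => ∫ s in r..H, φ s) (-φ r) r := fun r =>
    intervalIntegral.integral_hasDerivAt_left (hφ.intervalIntegrable _ _)
      (hφ.stronglyMeasurableAtFilter _ _) hφ.continuousAt
  have hd2 : ∀ r, HasDerivAt (fun r => -(∫ s in r..H, φ s) ^ (n + 1) / (n + 1))
      (φ r * (∫ s in r..H, φ s) ^ n) r := fun r => by
    refine (((hd r).pow (n + 1)).neg.div_const _).congr_deriv ?_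
    have : (n + 1 : ℂ) ≠ 0 := mod_cast succ_ne_zero n
    field_simp
    push_cast
    ring
  have hc : Continuous fun r => ∫ s in r..H, φ s := continuous_iff_continuousAt.mpr fun r => (hd r).continuousAt
  rw [intervalIntegral.integral_eq_sub_of_hasDerivAt (fun r _ => hd2 r)
    ((hφ.mul (hc.pow n)).intervalIntegrable _ _)]
  simp
  ring

/-- The mean of a product over the points, on the event that their number is `n`. -/
lemma integral_prod_count (hΦ : Measurable Φ) (hb : ∀ v, ‖Φ v‖ ≤ 1) {φ : ℝ → ℂ} (hφ : Continuous φ)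
    (hφΦ : ∀ r : ℝ≥0, φ r = ∫ b, Φ (r, b) ∂(signLaw.prod volume)) (n : ℕ) {a H : ℝ≥0} (ha : a ≤ H) :
    ∫ p, (if count p (H - a) = n then ∏ m ∈ range n, Φ (a + (p m).1, (p m).2) else 0) ∂Poi lam
      = Complex.exp (-(lam * (H - a))) * (lam ^ n * (∫ r in (a : ℝ)..H, φ r) ^ n / n.factorial) := by
  -- The starting time `a` is arbitrary: after the first point the process restarts later, with the
  -- same horizon `H`.
  induction n generalizing a with
  | zero =>
    rw [integral_poissonLaw (measurable_prod_count hΦ 0 a _) (norm_prod_count_le hb 0 a _)]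
    have h2 : ∀ x : Mark, ∫ p, (if count (join x p) (H - a) = 0 then
        ∏ m ∈ range 0, Φ (a + (join x p m).1, (join x p m).2) else 0) ∂Poi lam
        = (Ioi (H - a)).indicator (fun _ => (1 : ℂ)) x.1 := fun x => by
      by_cases hx : H - a < x.1
      · rw [indicator_of_mem (show x.1 ∈ Ioi (H - a) from hx)]
        simp only [count_eq_zero (show H - a < (join x _ 0).1 from hx), if_true, Finset.range_zero,
          Finset.prod_empty]
        simp
      · rw [indicator_of_notMem (show x.1 ∉ Ioi (H - a) from hx)]
        refine integral_eq_zero_of_ae ?_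
        filter_upwards [ae_isNondeg] with p hp
        rw [count_join hp (not_lt.mp hx), if_neg (succ_ne_zero _)]; rfl
    simp only [h2]
    have hm : Measurable fun x : Mark => (Ioi (H - a)).indicator (fun _ => (1 : ℂ)) x.1 :=
      (measurable_const.indicator measurableSet_Ioi).comp measurable_fst
    rw [integral_markLaw hm (C := 1) fun v => by by_cases h : v.1 ∈ Ioi (H - a) <;> simp [h]]
    simp only [integral_const, probReal_univ, one_smul]
    rw [integral_indicator_const _ measurableSet_Ioi, gapLaw_Ioi, coe_sub ha]
    simp
  | succ n ih =>
    rw [integral_poissonLaw (measurable_prod_count hΦ (n + 1) a _) (norm_prod_count_le hb (n + 1) a _)]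
    set V : ℝ → ℂ := fun r => Complex.exp (-(lam * (H - r))) *
      (lam ^ n * (∫ r in r..(H : ℝ), φ r) ^ n / n.factorial) with hV
    have hVc : Continuous V := by
      have : Continuous fun r : ℝ => ∫ s in r..(H : ℝ), φ s := by
        simp_rw [intervalIntegral.integral_symm (H : ℝ)]
        exact (intervalIntegral.continuous_primitive (fun a b => hφ.intervalIntegrable a b) H).neg
      fun_prop
    have h2 : ∀ x : Mark, ∫ p, (if count (join x p) (H - a) = n + 1 then
        ∏ m ∈ range (n + 1), Φ (a + (join x p m).1, (join x p m).2) else 0) ∂Poi lam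
        = if x.1 ≤ H - a then Φ (a + x.1, x.2) * V ((a + x.1 : ℝ≥0) : ℝ) else 0 := fun x => by
      by_cases hx : x.1 ≤ H - a
      · have hx' : a + x.1 ≤ H := (le_tsub_iff_left ha).mp hx
        rw [if_pos hx, hV]
        simp only
        rw [← ih hx', ← integral_const_mul]
        refine integral_congr_ae ?_
        filter_upwards [ae_isNondeg] with p hp
        rw [count_join hp hx, tsub_tsub]
        simp only [Nat.add_right_cancel_iff, Finset.prod_range_succ', mul_ite, mul_zero]
        refine if_congr Iff.rfl ?_ rfl
        rw [mul_comm]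
        simp only [join, add_assoc]
      · rw [if_neg hx]
        refine integral_eq_zero_of_ae (ae_of_all _ fun p => if_neg ?_)
        rw [count_eq_zero (show H - a < (join x p 0).1 from not_le.mp hx)]
        exact (succ_ne_zero n).symm
    simp only [h2]
    have hm : Measurable fun x : Mark => if x.1 ≤ H - a then Φ (a + x.1, x.2) * V ((a + x.1 : ℝ≥0) : ℝ) else 0 :=
      Measurable.ite (measurableSet_le (by fun_prop) measurable_const)
        ((hΦ.comp (by fun_prop)).mul (hVc.measurable.comp (by fun_prop))) measurable_const
    obtain ⟨C, hC⟩ := isCompact_Icc.exists_bound_of_continuousOn (hVc.continuousOn (s := Icc (0 : ℝ) H))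
    have hbd : ∀ x : Mark,
        ‖if x.1 ≤ H - a then Φ (a + x.1, x.2) * V ((a + x.1 : ℝ≥0) : ℝ) else 0‖ ≤ max C 0 := fun x => by
      split_ifs with hx
      · rw [norm_mul]
        have := hC ((a + x.1 : ℝ≥0) : ℝ) ⟨NNReal.coe_nonneg _, mod_cast (le_tsub_iff_left ha).mp hx⟩
        exact (mul_le_of_le_one_left (norm_nonneg _) (hb _)).trans (this.trans (le_max_left _ _))
      · simp
    rw [integral_markLaw hm hbd]
    have h3 : ∀ g : ℝ≥0, ∫ b, (if g ≤ H - a then Φ (a + g, b) * V ((a + g : ℝ≥0) : ℝ) else 0) ∂(signLaw.prod volume)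
        = if g ≤ H - a then φ ((a + g : ℝ≥0) : ℝ) * V ((a + g : ℝ≥0) : ℝ) else 0 := fun g => by
      split_ifs
      · rw [integral_mul_const, hφΦ]
      · simp
    simp only [h3]
    have hφV : Measurable fun g : ℝ≥0 => φ ((a + g : ℝ≥0) : ℝ) * V ((a + g : ℝ≥0) : ℝ) :=
      (hφ.mul hVc).measurable.comp (by fun_prop : Measurable fun g : ℝ≥0 => ((a + g : ℝ≥0) : ℝ))
    rw [integral_gapLaw hlam.out hφV]
    have h4 : ∫ x in (0 : ℝ)..(H - a : ℝ≥0), ((lam * exp (-(lam * x)) : ℝ) : ℂ) *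
          (φ ((a + x.toNNReal : ℝ≥0) : ℝ) * V ((a + x.toNNReal : ℝ≥0) : ℝ))
        = ∫ x in (0 : ℝ)..(H - a : ℝ), (Complex.exp (-(lam * (H - a))) * (lam ^ (n + 1) / n.factorial)) *
          (φ (a + x) * (∫ r in (a + x)..(H : ℝ), φ r) ^ n) := by
      rw [coe_sub ha]
      refine integral_congr fun x hx => ?_
      rw [uIcc_of_le (by simpa using ha)] at hx
      simp only [coe_add, coe_toNNReal _ hx.1, hV]
      push_cast
      have e : Complex.exp (-(lam * (H - a))) = Complex.exp (-(lam * x)) * Complex.exp (-(lam * (H - (a + x)))) := by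
        rw [← Complex.exp_add]; congr 1; ring
      rw [e]
      ring
    have h5 := integral_comp_add_left (a := 0) (b := (H - a : ℝ)) (fun r => φ r * (∫ s in r..(H : ℝ), φ s) ^ n) a
    simp only [add_zero, add_sub_cancel] at h5
    rw [h4, intervalIntegral.integral_const_mul, h5, integral_pow_primitive hφ, Nat.factorial_succ]
    have : (n + 1 : ℂ) ≠ 0 := mod_cast succ_ne_zero n
    have : (n.factorial : ℂ) ≠ 0 := mod_cast n.factorial_ne_zero
    push_cast
    field_simp

end

/-! ### Laws on the space of signed measures -/

/-- The σ-algebra is pulled back from a product of real lines, where finite-dimensional marginals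
determine a finite measure and are in turn determined by their characteristic functions. -/
lemma sMeas_measure_ext {ν ν' : Measure SMeas} [IsFiniteMeasure ν] [IsFiniteMeasure ν']
    (h : ∀ (J : Finset (Set Torus)) (c : J → ℝ), (∀ A ∈ J, MeasurableSet A) →
      ∫ μ, Complex.exp (((∑ A, c A * μ A : ℝ) : ℂ) * I) ∂ν
        = ∫ μ, Complex.exp (((∑ A, c A * μ A : ℝ) : ℂ) * I) ∂ν') : ν = ν' := by
  classical
  have h' : ∀ (J : Finset (Set Torus)) (c : J → ℝ),
      ∫ μ, Complex.exp (((∑ A, c A * μ A : ℝ) : ℂ) * I) ∂ν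
        = ∫ μ, Complex.exp (((∑ A, c A * μ A : ℝ) : ℂ) * I) ∂ν' := by
    intro J c
    -- A signed measure takes the value `0` on non-measurable sets, so these coordinates can be
    -- dropped.
    have e : ∀ μ : SMeas, ∑ A : J, c A * μ A = ∑ A : (J.filter MeasurableSet : Finset (Set Torus)),
        (if hA : (A : Set Torus) ∈ J then c ⟨A, hA⟩ else 0) * μ A := fun μ => by
      rw [Finset.sum_coe_sort (J.filter MeasurableSet) (fun A => (if hA : A ∈ J then c ⟨A, hA⟩ else 0) * μ A),
        Finset.sum_filter, ← Finset.sum_coe_sort J]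
      refine sum_congr rfl fun A _ => ?_
      split_ifs with hA hA2
      · rfl
      · exact absurd A.2 hA2
      · rw [VectorMeasure.not_measurable μ hA, mul_zero]
    simp only [e]
    exact h _ _ fun A hA => (Finset.mem_filter.mp hA).2
  let ev : SMeas → Set Torus → ℝ := fun μ A => μ A
  have hev : Measurable ev := measurable_pi_lambda _ fun A => measurable_apply_set A
  have hmap : ν.map ev = ν'.map ev := by
    have := Measure.isFiniteMeasure_map ν ev
    refine IsProjectiveLimit.unique (P := fun J => (ν.map ev).map J.restrict) (fun J => rfl) fun J => ?_
    have hr : Measurable (J.restrict : (Set Torus → ℝ) → _) := Finset.measurable_restrict J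
    refine Measure.ext_of_charFunDual (E := J → ℝ) (funext fun L => ?_)
    have hL : ∀ v : J → ℝ, L v = ∑ A, L (Pi.single A 1) * v A := fun v => by
      conv_lhs => rw [pi_eq_sum_univ' v, map_sum]
      refine sum_congr rfl fun A _ => ?_
      rw [map_smul, smul_eq_mul, mul_comm]
    rw [charFunDual_apply, charFunDual_apply]
    simp only
    rw [Measure.map_map hr hev, Measure.map_map hr hev,
      integral_map (hr.comp hev).aemeasurable (by fun_prop), integral_map (hr.comp hev).aemeasurable (by fun_prop)]
    have hL' : ∀ μ : SMeas, L (J.restrict (ev μ)) = ∑ A : J, L (Pi.single A 1) * μ A := fun μ => hL _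
    simp only [comp_apply, hL']
    exact (h' J fun A => L (Pi.single A 1)).symm
  ext S hS
  have hc : (instMeasurableSpaceSMeas : MeasurableSpace SMeas) = MeasurableSpace.comap ev inferInstance := by
    simp only [instMeasurableSpaceSMeas, MeasurableSpace.pi, MeasurableSpace.comap_iSup, MeasurableSpace.comap_comp]
    rfl
  rw [hc] at hS
  obtain ⟨S', hS', rfl⟩ := hS
  rw [← map_apply hev hS', hmap, map_apply hev hS']

/-! ### Weighted sums over the points of the Poisson process -/

/-- The sum of `σ_m w(t_m) δ_{x_m}` over the points up to time `T`. -/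
def weighted (w : ℝ → ℝ) (T : ℝ≥0) (p : Points) : SMeas :=
  ∑ m ∈ range (count p T), dirac (p m).2.2 ((p m).2.1 * w (p m).1)

lemma measurable_weighted {w : ℝ → ℝ} (hw : Measurable w) (T : ℝ≥0) : Measurable (weighted w T) := by
  have h : Measurable fun v : ℕ × Points =>
      (∑ m ∈ range v.1, dirac (v.2 m).2.2 ((v.2 m).2.1 * w (v.2 m).1) : SMeas) := by
    refine measurable_from_prod_countable_right fun n => ?_
    simp only [sum_range]
    exact (measurable_sum_dirac n).comp (measurable_pi_lambda (fun (p : Points) (i : Fin n) =>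
      ((p i).2.1 * w (p i).1, (p i).2.2)) fun i => by fun_prop)
  exact h.comp ((measurable_count T).prodMk measurable_id)

lemma IsNondeg.finsum_eq_weighted (hp : IsNondeg p) (w : ℝ → ℝ) (T : ℝ≥0) :
    ∑ᶠ (m : ℕ) (_ : (p m).1 ≤ T), dirac (p m).2.2 ((p m).2.1 * w (p m).1) = weighted w T p := by
  classical
  rw [finsum_cond_eq_sum_fin fun j hj => (hp.le_iff T j).mp hj, weighted, sum_range]
  exact sum_congr rfl fun m _ => by rw [if_pos ((hp.le_iff T m).mpr m.2)]

lemma IsNondeg.xiSum_eq (hp : IsNondeg p) (θ : ℝ) (T : ℝ≥0) : xiSum θ T p = weighted (fun t => exp (-θ * t)) T p :=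
  hp.finsum_eq_weighted (fun t => exp (-θ * t)) T

/-- The placeholders in `past` carry the time `s + 1 > r`, so they are never counted up to `r`. -/
lemma weighted_past (w : ℝ → ℝ) {r s : ℝ≥0} (hr : r ≤ s) (p : Points) : weighted w r (past s p) = weighted w r p := by
  have hc : count (past s p) r = count p r := by
    have : {m | r < (past s p m).1} = {m | r < (p m).1} := by
      ext m
      simp only [mem_ofPred_eq, past]
      split_ifs with h
      · rfl
      · exact iff_of_true (hr.trans_lt (by simp)) (hr.trans_lt (not_le.mp h))
    rw [count, count, this]
  rw [weighted, weighted, hc]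
  refine sum_congr rfl fun m hm => ?_
  have : (p m).1 ≤ r := not_lt.mp (Nat.notMem_of_lt_sInf (mem_range.mp hm))
  rw [past, if_pos (this.trans hr)]

lemma IsNondeg.weighted_add (hp : IsNondeg p) (w : ℝ → ℝ) (s u : ℝ≥0) :
    weighted w (s + u) p = weighted w s p + weighted (fun t => w (s + t)) u (PointVortex.shift s p) := by
  rw [weighted, weighted, weighted, hp.count_shift, sum_range_add]
  congr 1
  refine sum_congr rfl fun m _ => ?_
  have h : s ≤ (p (count p s + m)).1 := not_lt.mp fun hc => by have := (hp.le_iff s _).mp hc.le; omega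
  simp only [PointVortex.shift, coe_sub h]
  congr 3
  ring

section

lemma integral_eq_tsum_count {F : Points → ℂ} (hF : Measurable F) {C : ℝ} (hC : ∀ p, ‖F p‖ ≤ C) (T : ℝ≥0) :
    ∫ p, F p ∂Poi lam = ∑' n : ℕ, ∫ p, (if count p T = n then F p else 0) ∂Poi lam := by
  have hms : ∀ n : ℕ, MeasurableSet {p : Points | count p T = n} := fun n =>
    measurable_count T (measurableSet_singleton n)
  have hU : (⋃ n, {p : Points | count p T = n}) = univ := Set.eq_univ_of_forall fun p => mem_iUnion.mpr ⟨_, rfl⟩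
  have h := hasSum_integral_iUnion (μ := Poi lam) (f := F) hms
    (fun i j hij => Set.disjoint_left.mpr fun p hi hj => hij (Eq.trans (Eq.symm hi) hj))
    (Integrable.of_bound hF.aestronglyMeasurable C (ae_of_all _ hC)).integrableOn
  rw [hU, setIntegral_univ] at h
  rw [← h.tsum_eq]
  refine tsum_congr fun n => ?_
  rw [← integral_indicator (hms n)]
  refine integral_congr_ae (ae_of_all _ fun p => ?_)
  by_cases h : count p T = n <;> simp [h]

/-- A weighted sum over the points up to time `T` has the law of the time-reversed one. -/
lemma map_weighted_reverse {w : ℝ → ℝ} (hw : Continuous w) (T : ℝ≥0) :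
    (Poi lam).map (weighted (fun t => w (T - t)) T) = (Poi lam).map (weighted w T) := by
  have hw' : Continuous fun t => w (T - t) := by fun_prop
  have hmw := measurable_weighted hw.measurable T
  have hmw' := measurable_weighted hw'.measurable T
  have := isProbabilityMeasure_map (μ := Poi lam) hmw.aemeasurable
  have := isProbabilityMeasure_map (μ := Poi lam) hmw'.aemeasurable
  refine sMeas_measure_ext fun J c hJ => ?_
  set f : Torus → ℝ := fun x => ∑ A : J, c A * (A : Set Torus).indicator 1 x with hf
  have hfm : Measurable f := measurable_sum _ fun A _ => measurable_const.mul (measurable_one.indicator (hJ A A.2))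
  set Φ : (ℝ → ℝ) → Mark → ℂ := fun w v => Complex.exp (((v.2.1 * w v.1 * f v.2.2 : ℝ) : ℂ) * I) with hΦ
  have hΦm : ∀ {w : ℝ → ℝ}, Continuous w → Measurable (Φ w) := fun hw => by
    have := hw.measurable
    fun_prop
  have hΦb : ∀ (w : ℝ → ℝ) v, ‖Φ w v‖ ≤ 1 := fun w v => (Complex.norm_exp_ofReal_mul_I _).le
  have hprod : ∀ (w : ℝ → ℝ) (p : Points),
      Complex.exp (((∑ A : J, c A * weighted w T p A : ℝ) : ℂ) * I)
        = ∏ m ∈ range (count p T), Φ w (p m) := fun w p => by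
    rw [← Complex.exp_sum, ← Finset.sum_mul, ← Complex.ofReal_sum]
    congr 3
    simp only [weighted, hf, mul_sum]
    rw [Finset.sum_comm]
    refine sum_congr rfl fun A _ => ?_
    rw [sum_dirac_apply _ _ _ (hJ A A.2), mul_sum]
    refine sum_congr rfl fun m _ => ?_
    by_cases h : (p m).2.2 ∈ (A : Set Torus) <;> simp [h, mul_comm]
  -- The characteristic functional depends on `w` only through an integral over `[0, T]` of a
  -- function of `w(r)`, which is unchanged by `r ↦ T - r`.
  have key : ∀ {w : ℝ → ℝ}, Continuous w →
      ∫ μ, Complex.exp (((∑ A : J, c A * μ A : ℝ) : ℂ) * I) ∂(Poi lam).map (weighted w T)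
        = ∑' n : ℕ, Complex.exp (-(lam * T)) * (lam ^ n * (∫ r in (0 : ℝ)..T,
          ∫ b : ℝ × Torus, Complex.exp (((b.1 * w r * f b.2 : ℝ) : ℂ) * I) ∂(signLaw.prod volume)) ^ n
            / n.factorial) := by
    intro w hw
    have hE : Measurable fun μ : SMeas => Complex.exp (((∑ A : J, c A * μ A : ℝ) : ℂ) * I) := by
      have : Measurable fun μ : SMeas => ∑ A : J, c A * μ (A : Set Torus) :=
        measurable_sum _ fun A _ => (measurable_apply_set A).const_mul _
      fun_prop
    have hmw := measurable_weighted hw.measurable T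
    rw [integral_map hmw.aemeasurable hE.aestronglyMeasurable,
      integral_eq_tsum_count (F := fun p => Complex.exp (((∑ A : J, c A * weighted w T p A : ℝ) : ℂ) * I))
        (hE.comp hmw) (C := 1) (fun p => (Complex.norm_exp_ofReal_mul_I _).le) T]
    refine tsum_congr fun n => ?_
    have hφ : Continuous fun r : ℝ => ∫ b : ℝ × Torus, Complex.exp (((b.1 * w r * f b.2 : ℝ) : ℂ) * I)
        ∂(signLaw.prod volume) := by
      refine continuous_of_dominated (bound := fun _ => 1) (fun r => ?_)
        (fun r => ae_of_all _ fun b => (Complex.norm_exp_ofReal_mul_I _).le) (integrable_const _)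
        (ae_of_all _ fun b => by fun_prop)
      exact Measurable.aestronglyMeasurable (by fun_prop)
    have h := integral_prod_count (lam := lam) (hΦm hw) (hΦb w) hφ (fun r => rfl) n (zero_le (a := T))
    simp only [tsub_zero, zero_add, coe_zero, Complex.ofReal_zero, sub_zero] at h
    rw [← h]
    refine integral_congr_ae (ae_of_all _ fun p => ?_)
    simp only [hprod]
    split_ifs with hn
    · rw [hn]
    · rfl
  rw [key hw', key hw]
  refine tsum_congr fun n => ?_
  have h := intervalIntegral.integral_comp_sub_left (a := 0) (b := (T : ℝ)) (fun r => ∫ b : ℝ × Torus,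
    Complex.exp (((b.1 * w r * f b.2 : ℝ) : ℂ) * I) ∂(signLaw.prod volume)) T
  simp only [sub_self, sub_zero] at h
  rw [h]

/-- The damped initial vorticity plus the damped noise has the law `Ξ_{M+T}`. -/
lemma map_static_eq_xiLaw (θ : ℝ) (M T : ℝ≥0) :
    ((Poi lam).prod (Poi lam)).map (fun v => weighted (fun t => exp (-θ * (T + t))) M v.1 +
      weighted (fun t => exp (-θ * (T - t))) T v.2) = xiLaw θ lam (M + T) := by
  have h0 : Measurable (weighted (fun t => exp (-θ * t)) T) := measurable_weighted (by fun_prop) T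
  have h1 : Measurable (weighted (fun t => exp (-θ * (T + t))) M) := measurable_weighted (by fun_prop) M
  have h2 : Measurable (weighted (fun t => exp (-θ * (T - t))) T) := measurable_weighted (by fun_prop) T
  have hps : Measurable fun p => (past T p, shift T p) := (measurable_past T).prodMk (measurable_shift T)
  have hrev := map_weighted_reverse (lam := lam) (w := fun t => exp (-θ * t)) (by fun_prop) T
  have := isProbabilityMeasure_map (μ := Poi lam) (measurable_past T).aemeasurable
  have := isProbabilityMeasure_map (μ := Poi lam) h1.aemeasurable
  have := isProbabilityMeasure_map (μ := Poi lam) h0.aemeasurable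
  have e1 : xiLaw θ lam (M + T) = (((Poi lam).map (weighted (fun t => exp (-θ * t)) T)).prod
      ((Poi lam).map (weighted (fun t => exp (-θ * (T + t))) M))).map (fun v => v.1 + v.2) := by
    -- In `Ξ_{M+T}` the points up to `T` play the part of the time-reversed births. Those in `(T,
    -- T+M]`, counted from `T`, form an independent process with the weight `e^{-θ(T+t)}` of the
    -- damped initial vorticity.
    have e3 : (Poi lam).map (weighted (fun t => exp (-θ * t)) T)
        = ((Poi lam).map (past T)).map (weighted (fun t => exp (-θ * t)) T) := by
      rw [Measure.map_map h0 (measurable_past T)]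
      congr 1
      exact (funext fun p => weighted_past _ le_rfl p).symm
    rw [e3, map_prod_map _ _ h0 h1, ← poissonLaw_map_past_shift,
      Measure.map_map measurable_add_sMeas (h0.prodMap h1),
      Measure.map_map (measurable_add_sMeas.comp (h0.prodMap h1)) hps, xiLaw]
    refine Measure.map_congr ?_
    filter_upwards [ae_isNondeg] with p hp
    rw [hp.xiSum_eq, add_comm M T, hp.weighted_add]
    simp [weighted_past _ le_rfl]
  have e2 : ((Poi lam).prod (Poi lam)).map (fun v => weighted (fun t => exp (-θ * (T + t))) M v.1 +
      weighted (fun t => exp (-θ * (T - t))) T v.2) =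
      (((Poi lam).map (weighted (fun t => exp (-θ * (T + t))) M)).prod
        ((Poi lam).map (weighted (fun t => exp (-θ * (T - t))) T))).map (fun v => v.1 + v.2) := by
    rw [map_prod_map _ _ h1 h2, Measure.map_map measurable_add_sMeas (h1.prodMap h2)]
    rfl
  rw [e1, e2, hrev, ← Measure.prod_swap, Measure.map_map measurable_add_sMeas measurable_swap]
  congr 1
  ext1 v
  exact add_comm _ _

end

/-! ### The canonical configuration -/

/-- The configuration with initial vortices given by the points `v.1` up to time `M`, and births by `v.2`. -/
def canon (θ : ℝ) (M : ℝ≥0) (v : Points × Points) : Config :=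
  (count v.1 M, fun i => ((v.1 i).2.1 * exp (-θ * (v.1 i).1), (v.1 i).2.2), v.2)

lemma measurable_canon (θ : ℝ) (M : ℝ≥0) : Measurable (canon θ M) :=
  ((measurable_count M).comp measurable_fst).prodMk
    ((measurable_pi_lambda _ fun i => by fun_prop).prodMk measurable_snd)

/-- Translation of the loc. -/
def translate (y : ℕ → Torus) (p : Points) : Points := fun m => ((p m).1, (p m).2.1, (p m).2.2 + y m)

lemma count_translate (y : ℕ → Torus) (p : Points) (T : ℝ≥0) : count (translate y p) T = count p T := rfl

/-- Extension of a finite sequence by zero. -/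
def extendZero (y : Pos N) (i : ℕ) : Torus := if h : i < N then y ⟨i, h⟩ else 0

lemma measurable_extendZero (N i : ℕ) : Measurable fun y : Pos N => extendZero y i := by
  unfold extendZero
  split_ifs <;> fun_prop

section

lemma measurePreserving_translate (y : ℕ → Torus) : MeasurePreserving (translate y) (Poi lam) (Poi lam) := by
  refine ⟨measurable_pi_lambda _ fun m => by unfold translate; fun_prop, ?_⟩
  exact poissonLaw_map_marks (φ := fun m => Prod.map id (· + y m)) fun m =>
    (MeasurePreserving.id signLaw).prod (measurePreserving_add_right volume (y m))

variable (lam) in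
/-- Two independent Poisson point processes. -/
abbrev canonLaw : Measure (Points × Points) := (Poi lam).prod (Poi lam)

/-- The law is invariant under each fixed translation of the positions, hence under averaging over
`N` of them. The first `m` coordinates of `y` move the initial vortices, the others the births. -/
lemma lintegral_canonLaw_translate {Ψ : Points × Points → ℝ≥0∞} (hΨ : Measurable Ψ) (m N : ℕ) :
    ∫⁻ v, Ψ v ∂canonLaw lam = ∫⁻ v, ∫⁻ y : Pos N,
      Ψ (translate (extendZero y) v.1, translate (fun j => extendZero y (m + j)) v.2) ∂volume ∂canonLaw lam := by
  have hm : Measurable fun u : (Points × Points) × (Pos N) =>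
      Ψ (translate (extendZero u.2) u.1.1, translate (fun j => extendZero u.2 (m + j)) u.1.2) := by
    have h1 : ∀ i, Measurable fun u : (Points × Points) × (Pos N) => extendZero u.2 i := fun i =>
      (measurable_extendZero N i).comp measurable_snd
    refine hΨ.comp (Measurable.prodMk ?_ ?_)
    · exact measurable_pi_lambda _ fun i => by have := h1 i; unfold translate; fun_prop
    · exact measurable_pi_lambda _ fun i => by have := h1 (m + i); unfold translate; fun_prop
  rw [lintegral_lintegral_swap hm.aemeasurable]
  have : ∀ y : Pos N, ∫⁻ v, Ψ (translate (extendZero y) v.1, translate (fun j => extendZero y (m + j)) v.2)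
      ∂canonLaw lam = ∫⁻ v, Ψ v ∂canonLaw lam := fun y =>
    ((measurePreserving_translate (extendZero y)).prod
      (measurePreserving_translate fun j => extendZero y (m + j))).lintegral_comp hΨ
  simp [this]

variable {M T : ℝ≥0}

lemma canon_translate {m N : ℕ} {v : Points × Points} (hv : count v.1 M = m) (y : Pos N) :
    (canon θ M (translate (extendZero y) v.1, translate (fun j => extendZero y (m + j)) v.2)).data.marks N
      = (canon θ M v).data.marks N ∧
    (canon θ M (translate (extendZero y) v.1, translate (fun j => extendZero y (m + j)) v.2)).data.loc N
      = (canon θ M v).data.loc N + y := by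
  subst hv
  constructor
  · rfl
  · funext i
    simp only [VortexData.loc, vortexData, canon, Pi.add_apply]
    change (if (i : ℕ) < count v.1 M then _ else _) = (if (i : ℕ) < count v.1 M then _ else _) + _
    split_ifs with hi
    · simp [translate, extendZero]
    · simp only [count_translate]
      simp only [translate]
      rw [Nat.add_sub_cancel' (not_lt.mp hi)]
      simp [extendZero]

/-- Given their number, intensities and birth times, the loc of the vortices are independent and uniform. -/
lemma lintegral_canonLaw_loc (m n N : ℕ) {Θ : Marks N × Pos N → ℝ≥0∞} (hΘ : Measurable Θ) :
    ∫⁻ v, (if count v.1 M = m ∧ count v.2 T = n then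
        Θ ((canon θ M v).data.marks N, (canon θ M v).data.loc N) else 0) ∂canonLaw lam
      = ∫⁻ v, (if count v.1 M = m ∧ count v.2 T = n then
        ∫⁻ x, Θ ((canon θ M v).data.marks N, x) else 0) ∂canonLaw lam := by
  have hS : MeasurableSet {v : Points × Points | count v.1 M = m ∧ count v.2 T = n} :=
    (((measurable_count M).comp measurable_fst) (measurableSet_singleton m)).inter
      (((measurable_count T).comp measurable_snd) (measurableSet_singleton n))
  have hm : Measurable fun v : Points × Points => if count v.1 M = m ∧ count v.2 T = n then
      Θ ((canon θ M v).data.marks N, (canon θ M v).data.loc N) else 0 :=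
    Measurable.ite hS (hΘ.comp (((Config.measurable_marks N).prodMk (Config.measurable_loc N)).comp
      (measurable_canon θ M))) measurable_const
  rw [lintegral_canonLaw_translate hm m N]
  refine lintegral_congr fun v => ?_
  by_cases hv : count v.1 M = m ∧ count v.2 T = n
  · rw [if_pos hv, ← lintegral_add_left_eq_self (fun x => Θ ((canon θ M v).data.marks N, x))
      ((canon θ M v).data.loc N)]
    refine lintegral_congr fun y => ?_
    obtain ⟨h1, h2⟩ := canon_translate (θ := θ) hv.1 y
    rw [h1, h2]
    exact if_pos hv
  · rw [if_neg hv]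
    refine (lintegral_congr fun y => ?_).trans lintegral_zero
    exact if_neg hv

/-- On each of the countably many events fixing the two counts the positions are uniform given the
marks, so an exceptional set that is null for every choice of marks is null. -/
lemma ae_canonLaw_of_ae (θ : ℝ) (M T : ℝ≥0) {R : ∀ N : ℕ, Marks N × Pos N → Prop}
    (hR : ∀ N, MeasurableSet {u | R N u}) (h : ∀ N q, ∀ᵐ x : Pos N, R N (q, x)) :
    ∀ᵐ v ∂canonLaw lam, R ((canon θ M v).num T) ((canon θ M v).data.marks _, (canon θ M v).data.loc _) := by
  have key : ∀ m n : ℕ, ∀ᵐ v ∂canonLaw lam, count v.1 M = m ∧ count v.2 T = n →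
      R (m + n) ((canon θ M v).data.marks _, (canon θ M v).data.loc _) := by
    intro m n
    have h1 := lintegral_canonLaw_loc (lam := lam) (θ := θ) (M := M) (T := T) m n (m + n)
      (Θ := {u | R (m + n) u}ᶜ.indicator 1) (measurable_one.indicator (hR _).compl)
    have h2 : ∀ q : Fin (m + n) → ℝ≥0 × ℝ, ∫⁻ x, ({u | R (m + n) u}ᶜ.indicator 1 (q, x) : ℝ≥0∞) = 0 := fun q => by
      refine (lintegral_congr_ae ?_).trans lintegral_zero
      filter_upwards [h (m + n) q] with x hx
      exact indicator_of_notMem (Set.notMem_compl_iff.mpr hx) _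
    simp only [h2, ite_self, lintegral_zero] at h1
    have hS : MeasurableSet {v : Points × Points | count v.1 M = m ∧ count v.2 T = n} :=
      (((measurable_count M).comp measurable_fst) (measurableSet_singleton m)).inter
        (((measurable_count T).comp measurable_snd) (measurableSet_singleton n))
    have hm : Measurable fun v : Points × Points => if count v.1 M = m ∧ count v.2 T = n then
        ({u | R (m + n) u}ᶜ.indicator 1 ((canon θ M v).data.marks (m + n),
          (canon θ M v).data.loc (m + n)) : ℝ≥0∞) else 0 :=
      Measurable.ite hS ((measurable_one.indicator (hR _).compl).comp (((Config.measurable_marks _).prodMk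
        (Config.measurable_loc _)).comp (measurable_canon θ M))) measurable_const
    rw [lintegral_eq_zero_iff hm] at h1
    filter_upwards [h1] with v hv hmn
    simp only [if_pos hmn, Pi.zero_apply] at hv
    by_contra hc
    rw [indicator_of_mem (show _ ∈ {u | R (m + n) u}ᶜ from hc)] at hv
    exact one_ne_zero hv
  filter_upwards [ae_all_iff.mpr fun m => ae_all_iff.mpr fun n => key m n] with v hv
  exact hv _ _ ⟨rfl, rfl⟩

lemma ae_canon_isNondeg (θ : ℝ) (M : ℝ≥0) : ∀ᵐ v ∂canonLaw lam, (canon θ M v).IsNondeg := by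
  have h1 : ∀ᵐ v ∂canonLaw lam, IsNondeg v.1 := quasiMeasurePreserving_fst.ae ae_isNondeg
  have h2 : ∀ᵐ v ∂canonLaw lam, IsNondeg v.2 := quasiMeasurePreserving_snd.ae ae_isNondeg
  have h3 := ae_canonLaw_of_ae (lam := lam) θ M 0 (R := fun N u => ∀ i j : Fin N, i ≠ j → u.2 i ≠ u.2 j)
    (fun N => by
      simp only [Set.ofPred_forall]
      exact .iInter fun i => .iInter fun j => .iInter fun _ =>
        (measurableSet_eq_fun (by fun_prop) (by fun_prop)).compl)
    fun N q => ae_all_iff.mpr fun i => ae_all_iff.mpr fun j => ae_all_iff.mpr fun hij => ae_ne_pi hij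
  filter_upwards [h1, h2, h3] with v hv1 hv2 hv3
  refine ⟨fun i _ => mul_ne_zero (hv1.sign_ne_zero i) (exp_pos _).ne', fun i hi j hj hij => ?_, hv2⟩
  have hlt : ∀ {i}, i < (canon θ M v).1 → i < (canon θ M v).num 0 := fun h => h.trans_le (Nat.le_add_right _ _)
  have := hv3 ⟨i, hlt hi⟩ ⟨j, hlt hj⟩ (fun hc => hij (congrArg Fin.val hc))
  simpa [VortexData.loc, vortexData, hi, hj] using this

lemma ae_canon_isGood (hθ : 0 < θ) (M T : ℝ≥0) : ∀ᵐ v ∂canonLaw lam, ∃ k, IsGood θ k T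
    ((canon θ M v).data.marks ((canon θ M v).num T))
    ((canon θ M v).data.loc ((canon θ M v).num T)) := by
  refine ae_canonLaw_of_ae (lam := lam) θ M T (R := fun N u => ∃ k, IsGood θ k T u.1 u.2)
    (fun N => ?_) fun N q => ?_
  · simp only [Set.ofPred_exists]
    exact MeasurableSet.iUnion fun k => measurableSet_isGood hθ k T
  · filter_upwards [ae_exists_lt_greenReg hθ q T] with x hx
    obtain ⟨k, hk⟩ := hx
    exact ⟨k, fun t ht i j hij _ _ => hk t ht i j hij⟩

lemma static_canon {v : Points × Points} (hv : IsNondeg v.2) :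
    ∑ i : Fin ((canon θ M v).num T), dirac ((canon θ M v).data.loc _ i) (curInt θ ((canon θ M v).data.marks _) T i)
      = weighted (fun t => exp (-θ * (T + t))) M v.1 + weighted (fun t => exp (-θ * (T - t))) T v.2 := by
  have e := Fin.sum_univ_eq_sum_range (fun i => (dirac ((canon θ M v).data.pos i)
    (if ((canon θ M v).data.birth i : ℝ) ≤ T then
      exp (-θ * (T - (canon θ M v).data.birth i)) * (canon θ M v).data.int i else 0) : SMeas))
    ((canon θ M v).num T)
  refine e.trans ?_
  rw [Config.num, sum_range_add, weighted, weighted]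
  congr 1
  · refine sum_congr rfl fun i hi => ?_
    have hi' : i < (canon θ M v).1 := mem_range.mp hi
    simp only [vortexData, if_pos hi']
    rw [if_pos (by simp)]
    simp only [canon, coe_zero, sub_zero]
    rw [mul_add, exp_add, mul_left_comm]
  · refine sum_congr rfl fun j hj => ?_
    have hj' : ((v.2 j).1 : ℝ) ≤ T := (hv.le_iff T j).mpr (mem_range.mp hj)
    have h1 : ¬ (canon θ M v).1 + j < (canon θ M v).1 := by omega
    simp only [vortexData, if_neg h1, Nat.add_sub_cancel_left]
    refine Eq.trans (congrArg _ (if_pos hj')) ?_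
    rw [mul_comm]
    rfl

/-- The law of the vorticity at time `T` in the canonical configuration. -/
lemma canonLaw_reaches (hθ : 0 < θ) (M T : ℝ≥0) (hB : MeasurableSet B) :
    canonLaw lam {v | (canon θ M v).IsNondeg ∧ Reaches θ T (canon θ M v) B} = xiLaw θ lam (M + T) B := by
  set c := canon θ M with hc
  have hcm := measurable_canon θ M
  let Q : ∀ (N : ℕ) (f : Marks N × Pos N → SMeas) (v : Points × Points), Prop :=
    fun N f v => f ((c v).data.marks N, (c v).data.loc N) ∈ B
  have hsum : ∀ f : ∀ N : ℕ, Marks N × Pos N → SMeas, (∀ N, Measurable (f N)) →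
      MeasurableSet {v | Q ((c v).num T) (f _) v} ∧ canonLaw lam {v | Q ((c v).num T) (f _) v} =
        ∑' m : ℕ × ℕ, ∫⁻ v, (if count v.1 M = m.1 ∧ count v.2 T = m.2 then
          ∫⁻ x, B.indicator 1 (f (m.1 + m.2) ((c v).data.marks _, x)) else 0) ∂canonLaw lam := by
    intro f hf
    have hmk : ∀ N, Measurable fun v => f N ((c v).data.marks N, (c v).data.loc N) := fun N =>
      (hf N).comp (((Config.measurable_marks N).prodMk (Config.measurable_loc N)).comp hcm)
    have hms : MeasurableSet {v | Q ((c v).num T) (f _) v} := by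
      have : {v | Q ((c v).num T) (f _) v} = ⋃ N, {v | (c v).num T = N} ∩ {v | Q N (f N) v} := by
        ext v
        simp only [mem_ofPred_eq, mem_iUnion, mem_inter_iff]
        exact ⟨fun h => ⟨_, rfl, h⟩, fun ⟨N, h1, h2⟩ => by subst h1; exact h2⟩
      rw [this]
      exact MeasurableSet.iUnion fun N => (((Config.measurable_num T).comp hcm) (measurableSet_singleton N)).inter
        (hmk N hB)
    refine ⟨hms, ?_⟩
    rw [← lintegral_indicator_one hms]
    refine Eq.trans ?_ (tsum_congr fun m : ℕ × ℕ => lintegral_canonLaw_loc (lam := lam) (θ := θ) (M := M) (T := T)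
      m.1 m.2 (m.1 + m.2) (Θ := fun u => B.indicator 1 (f (m.1 + m.2) u)) ((measurable_one.indicator hB).comp (hf _)))
    rw [← lintegral_tsum fun m => ?_]
    · refine lintegral_congr fun v => ?_
      rw [tsum_eq_single (count v.1 M, count v.2 T) fun m hm => if_neg fun h => hm (Prod.ext h.1.symm h.2.symm),
        if_pos ⟨rfl, rfl⟩]
      rfl
    · exact (Measurable.ite ((((measurable_count M).comp measurable_fst) (measurableSet_singleton m.1)).inter
        (((measurable_count T).comp measurable_snd) (measurableSet_singleton m.2)))
        ((measurable_one.indicator hB).comp (hmk _)) measurable_const).aemeasurable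
  have hreg : ∀ k N, Measurable fun u : Marks N × Pos N => regVort θ k u.1 u.2 T := fun k N =>
    (measurable_sum_dirac N).comp (measurable_regVort_data hθ k N T)
  have hst : ∀ N, Measurable fun u : Marks N × Pos N => (∑ i, dirac (u.2 i) (curInt θ u.1 T i) : SMeas) := fun N =>
    (measurable_sum_dirac N).comp (measurable_pi_lambda (fun (u : Marks N × Pos N) i =>
      (curInt θ u.1 T i, u.2 i)) fun i => by
      have := (measurable_pi_apply i).comp (measurable_regVort_data hθ 0 N T)
      exact this.fst.prodMk (by fun_prop))
  -- Given the marks, the truncated flow preserves the uniform law of the positions. Hence the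
  -- vorticity it produces at time `T` has the law of the one with motionless vortices, for every
  -- `k`.
  have heq : ∀ k, canonLaw lam {v | Q ((c v).num T) (fun u => regVort θ k u.1 u.2 T) v} =
      canonLaw lam {v | Q ((c v).num T) (fun u => ∑ i, dirac (u.2 i) (curInt θ u.1 T i)) v} := by
    intro k
    rw [(hsum _ (hreg k)).2, (hsum _ hst).2]
    refine tsum_congr fun m => lintegral_congr fun v => if_congr Iff.rfl ?_ rfl
    exact (measurePreserving_regFlow hθ k ((c v).data.marks _) T.coe_nonneg).lintegral_comp
      (f := fun x => B.indicator (1 : SMeas → ℝ≥0∞) (∑ i, dirac (x i) (curInt θ ((c v).data.marks _) T i)))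
      ((measurable_one.indicator hB).comp ((hst _).comp measurable_prodMk_left))
  -- Almost surely the truncated vorticity equals the true one for all large `k`, so the indicators
  -- converge; the probabilities are constant in `k` and thus equal to the limit.
  have hlim := tendsto_measure_of_ae_tendsto_indicator_of_isFiniteMeasure (μ := canonLaw lam) atTop
    (A := {v | (c v).IsNondeg ∧ Reaches θ T (c v) B}) (hcm (measurableSet_reaches hθ T (isAtomicSet_of_measurableSet hB)))
    (As := fun k : ℕ => {v | Q ((c v).num T) (fun u => regVort θ k u.1 u.2 T) v}) (fun k => (hsum _ (hreg k)).1) (by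
      filter_upwards [ae_canon_isNondeg θ M, ae_canon_isGood hθ M T] with v hv hg
      obtain ⟨k', hk'⟩ := hg
      have hN : ∀ j, (c v).data.birth j ≤ T → j < (c v).num T := fun j => (Config.data_birth_le_iff hv T j).mp
      have hX := hk'.isFlowUpTo hθ hN
      obtain ⟨k₀, hk₀⟩ := hX.exists_isGood hθ hN
      filter_upwards [eventually_ge_atTop k₀] with k hk
      have h1 := ((hk₀ k hk).1.isFlowUpTo hθ hN).reaches_iff hθ hN (B := B)
      rw [IsGood.vorticity_eq hN] at h1
      exact h1.symm.trans ⟨fun h => ⟨hv, h⟩, fun h => h.2⟩)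
  simp only [heq] at hlim
  have hms : Measurable fun v : Points × Points => weighted (fun t => exp (-θ * (T + t))) M v.1 +
      weighted (fun t => exp (-θ * (T - t))) T v.2 :=
    measurable_add_sMeas.comp (((measurable_weighted (w := fun t => exp (-θ * (T + t))) (by fun_prop) M).comp
      measurable_fst).prodMk ((measurable_weighted (w := fun t => exp (-θ * (T - t))) (by fun_prop) T).comp
      measurable_snd))
  rw [tendsto_nhds_unique hlim tendsto_const_nhds, ← map_static_eq_xiLaw, map_apply hms hB]
  refine measure_congr ?_
  have h2 : ∀ᵐ v ∂canonLaw lam, IsNondeg v.2 := quasiMeasurePreserving_snd.ae ae_isNondeg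
  filter_upwards [h2] with v hv
  have := static_canon (θ := θ) (M := M) (T := T) hv
  refine propext ?_
  exact iff_of_eq (congrArg (· ∈ B) this)

end

/-! ### Random configurations -/

/-- The initial vorticity of a configuration. -/
abbrev Config.initial (c : Config) : SMeas := initialVorticity c.1 c.2.1

/-- A random configuration with initial vorticity of law `Ξ_M`, independent of the births, which form a
Poisson point process. -/
structure IsSample {Ω : Type*} {m : MeasurableSpace Ω} (P : Measure Ω) (θ lam : ℝ) (M : ℝ≥0)
    (c : Ω → Config) : Prop where
  measurable : Measurable c
  nondeg : ∀ᵐ w ∂P, (∀ i < (c w).1, ((c w).2.1 i).1 ≠ 0) ∧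
    ∀ i < (c w).1, ∀ j < (c w).1, i ≠ j → ((c w).2.1 i).2 ≠ ((c w).2.1 j).2
  law : P.map (fun w => (c w).initial) = xiLaw θ lam M
  births : P.map (fun w => (c w).2.2) = Poi lam
  indep : IndepFun (fun w => (c w).initial) (fun w => (c w).2.2) P

/-- The observation as a function of the initial vorticity and the births. -/
def observeFun (T : ℝ≥0) (u : SMeas × Points) : SMeas × (ℚ≥0 → SMeas) := (u.1, fun r => noiseVersion (min r T) u.2)

lemma measurable_observeFun (T : ℝ≥0) : Measurable (observeFun T) :=
  measurable_fst.prodMk (measurable_pi_lambda _ fun _ => (measurable_noiseVersion _).comp measurable_snd)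

lemma Config.measurable_initial : Measurable Config.initial :=
  measurable_initialVorticity.comp (by fun_prop : Measurable fun c : Config => (c.1, c.2.1))

section

lemma canonLaw_map_initial : (canonLaw lam).map (fun v => ((canon θ M v).initial, v.2)) =
    (xiLaw θ lam M).prod (Poi lam) := by
  have hw : Measurable (weighted (fun t => exp (-θ * t)) M) := measurable_weighted (by fun_prop) M
  have h1 : xiLaw θ lam M = (Poi lam).map (weighted (fun t => exp (-θ * t)) M) :=
    Measure.map_congr (by filter_upwards [ae_isNondeg] with p hp using hp.xiSum_eq θ M)
  have h2 := map_prod_map (Poi lam) (Poi lam) hw measurable_id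
  rw [Measure.map_id] at h2
  rw [h1, h2]
  rfl

variable {Ω : Type*} {m : MeasurableSpace Ω} {P : Measure Ω} [IsProbabilityMeasure P] {c : Ω → Config}

namespace IsSample

lemma measurable_initial (hc : IsSample P θ lam M c) : Measurable fun w => (c w).initial :=
  Config.measurable_initial.comp hc.measurable

lemma measurable_births (hc : IsSample P θ lam M c) : Measurable fun w => (c w).2.2 := hc.measurable.snd.snd

lemma ae_births (hc : IsSample P θ lam M c) {R : Points → Prop} (h : ∀ᵐ p ∂Poi lam, R p) :
    ∀ᵐ w ∂P, R (c w).2.2 := by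
  rw [← hc.births] at h
  exact ae_of_ae_map hc.measurable_births.aemeasurable h

lemma isNondeg (hc : IsSample P θ lam M c) : ∀ᵐ w ∂P, (c w).IsNondeg := by
  filter_upwards [hc.nondeg, hc.ae_births ae_isNondeg] with w h1 h2 using ⟨h1.1, h1.2, h2⟩

/-- The joint law of the labelled initial vortices is unknown, but the law of the initial measure
and its independence of the births fix the law of the observation, which therefore agrees with the
canonical one. -/
lemma map_observe (hc : IsSample P θ lam M c) (T : ℝ≥0) {C : Set (SMeas × (ℚ≥0 → SMeas))}
    (hC : MeasurableSet C) : P {w | observe T (c w) ∈ C} = canonLaw lam {v | observe T (canon θ M v) ∈ C} := by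
  have h := (indepFun_iff_map_prod_eq_prod_map_map hc.measurable_initial.aemeasurable
    hc.measurable_births.aemeasurable).mp hc.indep
  have hm : Measurable fun v => ((canon θ M v).initial, v.2) :=
    (Config.measurable_initial.comp (measurable_canon θ M)).prodMk measurable_snd
  rw [hc.law, hc.births, ← canonLaw_map_initial] at h
  have h2 := DFunLike.congr_fun h (observeFun T ⁻¹' C)
  rw [map_apply (hc.measurable_initial.prodMk hc.measurable_births) (measurable_observeFun T hC),
    map_apply hm (measurable_observeFun T hC)] at h2
  have e1 : ∀ᵐ w ∂P, observeFun T ((c w).initial, (c w).2.2) = observe T (c w) := by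
    filter_upwards [hc.isNondeg] with w hw using observeVersion_eq hw T
  have e2 : ∀ᵐ v ∂canonLaw lam, observeFun T ((canon θ M v).initial, v.2) = observe T (canon θ M v) := by
    filter_upwards [ae_canon_isNondeg θ M] with v hv using observeVersion_eq hv T
  refine Eq.trans (measure_congr ?_) (h2.trans (measure_congr ?_))
  · filter_upwards [e1] with w hw using propext (iff_of_eq (congrArg (· ∈ C) hw.symm))
  · filter_upwards [e2] with w hw using propext (iff_of_eq (congrArg (· ∈ C) hw))

/-- Up to null sets the event is expressed by the observation, so its probability can be computed in
the canonical configuration. -/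
lemma measure_reaches (hc : IsSample P θ lam M c) (hθ : 0 < θ) (T : ℝ≥0) 
    (hB : MeasurableSet B) : P {w | Reaches θ T (c w) B} = xiLaw θ lam (M + T) B := by
  obtain ⟨C, hC, h⟩ := exists_measurableSet_reaches_iff hθ T (isAtomicSet_of_measurableSet hB)
  rw [← canonLaw_reaches hθ M T hB]
  refine Eq.trans (measure_congr ?_) ((hc.map_observe T hC).trans (measure_congr ?_))
  · filter_upwards [hc.isNondeg] with w hw using propext (h _ hw)
  · filter_upwards [ae_canon_isNondeg θ M] with v hv
    exact propext (((h _ hv).symm).trans ⟨fun h => ⟨hv, h⟩, fun h => h.2⟩)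

lemma exists_flow (hc : IsSample P θ lam M c) (hθ : 0 < θ) : ∀ᵐ w ∂P, ∃ X, IsVortexFlow θ (c w).data X := by
  have h1 : ∀ T : ℕ, ∀ᵐ w ∂P, Reaches θ T (c w) univ := fun T => by
    have hx : IsProbabilityMeasure (xiLaw θ lam (M + T)) := by
      rw [← map_static_eq_xiLaw]
      exact isProbabilityMeasure_map (measurable_add_sMeas.comp
        (((measurable_weighted (w := fun t => exp (-θ * ((T : ℝ≥0) + t))) (by fun_prop) M).comp
          measurable_fst).prodMk ((measurable_weighted
          (w := fun t => exp (-θ * ((T : ℝ≥0) - t))) (by fun_prop) T).comp measurable_snd))).aemeasurable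
    -- With the full set of vorticities, the event is mere existence of a flow up to `T`, and its
    -- probability is the total mass of `Ξ_{M+T}`.
    have := (hc.measure_reaches hθ T MeasurableSet.univ).trans measure_univ
    obtain ⟨C, hC, h⟩ := exists_measurableSet_reaches_iff hθ T (isAtomicSet_of_measurableSet MeasurableSet.univ)
    refine (mem_ae_iff_prob_eq_one₀ ?_).mpr this
    refine ((measurable_observeVersion T).comp hc.measurable hC).nullMeasurableSet.congr ?_
    filter_upwards [hc.isNondeg] with w hw
    exact propext ((iff_of_eq (congrArg (· ∈ C) (observeVersion_eq hw T))).trans (h _ hw).symm)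
  filter_upwards [hc.isNondeg, ae_all_iff.mpr h1] with w hw h
  exact exists_isVortexFlow hθ (Config.exists_num hw) fun T => (h T).imp fun X hX => hX.1

/-- The vorticity at time `t` is a function of the initial vorticity and the noise up to time `t`. -/
lemma exists_ae_mem_iff (hc : IsSample P θ lam M c) (hθ : 0 < θ) {X : Ω → Paths}
    (hX : ∀ᵐ w ∂P, IsVortexFlow θ (c w).data (X w)) (t : ℝ≥0) (hB : IsAtomicSet B) :
    ∃ C : Set (SMeas × (ℚ≥0 → SMeas)), MeasurableSet C ∧
      ∀ᵐ w ∂P, (vorticity θ (c w).data (X w) t ∈ B ↔ observe t (c w) ∈ C) := by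
  obtain ⟨C, hC, h⟩ := exists_measurableSet_reaches_iff hθ t hB
  refine ⟨C, hC, ?_⟩
  filter_upwards [hc.isNondeg, hX] with w hw hx
  obtain ⟨N, hN⟩ := Config.exists_num hw t
  rw [← h _ hw, (hx.isFlowUpTo t).reaches_iff hθ hN]

lemma map_vorticity (hc : IsSample P θ lam M c) (hθ : 0 < θ) {X : Ω → Paths}
    (hX : ∀ᵐ w ∂P, IsVortexFlow θ (c w).data (X w)) (t : ℝ≥0)
    (hm : Measurable fun w => vorticity θ (c w).data (X w) t) :
    P.map (fun w => vorticity θ (c w).data (X w) t) = xiLaw θ lam (M + t) := by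
  ext B hB
  rw [map_apply hm hB, ← hc.measure_reaches hθ t hB]
  refine measure_congr ?_
  filter_upwards [hc.isNondeg, hX] with w hw hx
  obtain ⟨N, hN⟩ := Config.exists_num hw t
  exact propext ((hx.isFlowUpTo t).reaches_iff hθ hN).symm

end IsSample

end

/-! ### Sigma-algebras containing the null sets -/

section

variable {Ω : Type*} {m : MeasurableSpace Ω} {P : Measure Ω}

lemma measurableSet_of_ae_iff {𝓐 : MeasurableSpace Ω} (h0 : ∀ A : Set Ω, P A = 0 → MeasurableSet[𝓐] A) {A A' : Set Ω}
    (hA : MeasurableSet[𝓐] A') (h : ∀ᵐ w ∂P, (w ∈ A ↔ w ∈ A')) : MeasurableSet[𝓐] A := by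
  have e : A = (A' \ {w | ¬(w ∈ A ↔ w ∈ A')}) ∪ (A ∩ {w | ¬(w ∈ A ↔ w ∈ A')}) := by
    ext w
    by_cases hw : w ∈ A <;> by_cases hw' : w ∈ A' <;> simp [hw, hw']
  rw [e]
  exact (MeasurableSet.diff hA (h0 _ h)).union (h0 _ (measure_mono_null Set.inter_subset_right h))

lemma measurable_of_ae_eq {𝓐 : MeasurableSpace Ω} {S : Type*} [MeasurableSpace S]
    (h0 : ∀ A : Set Ω, P A = 0 → MeasurableSet[𝓐] A) {f g : Ω → S}
    (hg : Measurable[𝓐] g) (h : f =ᵐ[P] g) : Measurable[𝓐] f := fun B hB =>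
  measurableSet_of_ae_iff h0 (hg hB) (by filter_upwards [h] with w hw; simp [hw])

variable [IsProbabilityMeasure P] {c : Ω → Config}

lemma IsSample.measurable_noise (hc : IsSample P θ lam M c) [P.IsComplete] (t : ℝ≥0) :
    Measurable fun w => compoundPoisson (c w).2.2 t := by
  refine measurable_of_ae_eq (P := P) (fun A hA => Measure.IsComplete.out' A hA)
    ((measurable_noiseVersion t).comp hc.measurable_births) ?_
  filter_upwards [hc.isNondeg] with w hw using (noiseVersion_eq hw.points t).symm

lemma IsSample.measurableSet_vorticity (hc : IsSample P θ lam M c) (hθ : 0 < θ) {X : Ω → Paths}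
    (hX : ∀ᵐ w ∂P, IsVortexFlow θ (c w).data (X w)) {t : ℝ≥0}
    {𝓐 : MeasurableSpace Ω} (h0 : ∀ A : Set Ω, P A = 0 → MeasurableSet[𝓐] A) (h1 : Measurable[𝓐] fun w => (c w).initial)
    (h2 : ∀ r ≤ t, Measurable[𝓐] fun w => compoundPoisson (c w).2.2 r) (hB : IsAtomicSet B) :
    MeasurableSet[𝓐] {w | vorticity θ (c w).data (X w) t ∈ B} := by
  obtain ⟨C, hC, h⟩ := hc.exists_ae_mem_iff hθ hX t hB
  exact measurableSet_of_ae_iff h0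
    ((h1.prodMk (measurable_pi_lambda _ fun r => h2 _ (min_le_right _ _)) : Measurable[𝓐] fun w => observe t (c w)) hC) h

end

/-! ### Restarting the vortices at a positive time -/

section

variable {V V' : VortexData} {s : ℝ≥0}

/-- `V'` describes the vortices `V` seen from time `s` on. -/
structure IsRestart (θ : ℝ) (V : VortexData) (X : Paths) (s : ℝ≥0) (V' : VortexData) : Prop where
  birth : ∀ i, V'.birth i = V.birth i - s
  pos : ∀ i, V'.pos i = X i s
  int : ∀ i, V'.int i = intensity θ V i s

namespace IsRestart

lemma birth_le_iff (h : IsRestart θ V X s V') (i : ℕ) (t : ℝ≥0) : V'.birth i ≤ t ↔ V.birth i ≤ s + t := by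
  rw [h.birth, tsub_le_iff_left]

lemma intensity_eq (h : IsRestart θ V X s V') (i : ℕ) (t : ℝ≥0) :
    intensity θ V' i t = intensity θ V i (s + t) := by
  have hlt : t < V'.birth i ↔ s + t < V.birth i := by rw [h.birth, lt_tsub_iff_left]
  unfold intensity
  simp only [hlt]
  split_ifs with h1
  · rw [h.int, intensity, if_pos (lt_of_le_of_lt le_self_add h1)]
  · rw [h.int, intensity, h.birth]
    split_ifs with h2
    · rw [coe_sub h2.le]; push_cast; congr 2; ring
    · rw [tsub_eq_zero_of_le (not_lt.mp h2), ← mul_assoc, ← exp_add]; push_cast; congr 2; ring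

lemma velocity_eq (h : IsRestart θ V X s V') (i : ℕ) (t : ℝ≥0) :
    velocity θ V' (fun i t => X i (s + t)) i t = velocity θ V X i (s + t) := by
  simp only [velocity, h.birth_le_iff, h.intensity_eq]

lemma vorticity_eq (h : IsRestart θ V X s V') (t : ℝ≥0) :
    vorticity θ V' (fun i t => X i (s + t)) t = vorticity θ V X (s + t) := by
  simp only [vorticity, h.birth_le_iff, h.intensity_eq]

/-- Truncated subtraction sends births before `s` to `0`, so a vortex already present restarts from
its current position and its integral is split at `s`; for later births the time is merely
translated. -/
lemma isVortexFlow (h : IsRestart θ V X s V') (hX : IsVortexFlow θ V X) :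
    IsVortexFlow θ V' fun i t => X i (s + t) := by
  have hv : ∀ i, ∀ r : ℝ, 0 ≤ r → velocity θ V' (fun i t => X i (s + t)) i r.toNNReal =
      velocity θ V X i (s + r).toNNReal := fun i r hr => by
    rw [h.velocity_eq, Real.toNNReal_add s.coe_nonneg hr, Real.toNNReal_coe]
  have hb : ∀ i, ∀ t : ℝ≥0, V'.birth i ≤ t → ∀ r ∈ uIoc (V'.birth i : ℝ) t, 0 ≤ r := fun i t ht r hr =>
    (V'.birth i).2.trans (uIoc_of_le (coe_le_coe.mpr ht) ▸ hr).1.le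
  have hi : ∀ i, ∀ t : ℝ≥0, V.birth i ≤ s + t → IntervalIntegrable (fun r : ℝ => velocity θ V X i r.toNNReal)
      volume (s + V'.birth i) (s + t) := fun i t ht => by
    refine (hX.integrable i _ ht).mono_set ?_
    have h1 : V.birth i ≤ s + V'.birth i := by rw [h.birth]; exact le_add_tsub
    have h2 := add_le_add_right ((h.birth_le_iff i t).mpr ht) s
    rw [← coe_add, ← coe_add, uIcc_of_le (mod_cast h2), uIcc_of_le (mod_cast ht)]
    exact Set.Icc_subset_Icc_left (mod_cast h1)
  refine ⟨fun i t ht => ?_, fun i t ht => ?_, fun i t ht => ?_, fun i j t hij hi hj =>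
    hX.no_collision i j _ hij ((h.birth_le_iff i t).mp hi) ((h.birth_le_iff j t).mp hj)⟩
  · rcases le_or_gt (V.birth i) s with hs | hs
    · rw [h.birth, tsub_eq_zero_of_le hs, nonpos_iff_eq_zero] at ht
      simp [h.pos, ht]
    · rw [h.pos, hX.before_birth i s hs.le]
      refine hX.before_birth i _ ?_
      rw [h.birth] at ht
      exact (le_tsub_iff_left hs.le).mp ht
  · refine ((hi i t ((h.birth_le_iff i t).mp ht)).comp_add_left s).congr ?_ |>.mono_set ?_
    all_goals simp only [add_sub_cancel_left]
    · exact fun r hr => (hv i r (hb i t ht r hr)).symm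
    · rfl
  · have ht' := (h.birth_le_iff i t).mp ht
    rw [h.pos, intervalIntegral.integral_congr_ae (ae_of_all _ fun r hr => hv i r (hb i t ht r hr)),
      integral_comp_add_left (fun r => velocity θ V X i r.toNNReal)]
    rw [hX.after_birth i _ ht']
    rcases le_or_gt (V.birth i) s with hs | hs
    · rw [hX.after_birth i s hs, add_assoc, ← toTorus_add, h.birth, tsub_eq_zero_of_le hs, coe_zero, add_zero,
        ← coe_add, integral_add_adjacent_intervals (hX.integrable i s hs)]
      have := hi i t ht'
      rwa [h.birth, tsub_eq_zero_of_le hs, coe_zero, add_zero, ← coe_add] at this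
    · rw [hX.before_birth i s hs.le, h.birth, ← coe_add, ← coe_add, add_tsub_cancel_of_le hs.le]

end IsRestart

/-- The configuration at time `s`. -/
def Config.restart (θ : ℝ) (c : Config) (X : Paths) (s : ℝ≥0) : Config :=
  (c.num s, fun i => (intensity θ c.data i s, X i s), shift s c.2.2)

variable {c : Config}

lemma Config.IsNondeg.isRestart (hc : c.IsNondeg) (hX : IsVortexFlow θ c.data X) (s : ℝ≥0) :
    IsRestart θ c.data X s (c.restart θ X s).data := by
  have hn : ∀ i, ¬ i < c.num s → ¬ i < c.1 ∧ i - c.1 = count c.2.2 s + (i - c.num s) := fun i hi => by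
    rw [Config.num] at *; omega
  refine ⟨fun i => ?_, fun i => ?_, fun i => ?_⟩
  all_goals
    have hb := Config.data_birth_le_iff hc s i
    by_cases hi : i < c.num s
  · rw [tsub_eq_zero_of_le (hb.mpr hi)]
    simp [vortexData, restart, hi]
  · simp [vortexData, restart, hi, shift, hn i hi, -not_lt]
  · simp [vortexData, restart, hi]
  · rw [hX.before_birth i s (not_le.mp (hb.not.mpr hi)).le]
    simp [vortexData, restart, hi, shift, hn i hi, -not_lt]
  · simp [vortexData, restart, hi]
  · rw [intensity, if_pos (not_le.mp (hb.not.mpr hi))]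
    simp [vortexData, restart, hi, shift, hn i hi, -not_lt]

/-- Distinctness of the new initial positions is exactly the absence of collisions at time `s`. -/
lemma Config.IsNondeg.restart (hc : c.IsNondeg) (hX : IsVortexFlow θ c.data X) (s : ℝ≥0) :
    (c.restart θ X s).IsNondeg where
  int_ne_zero i hi := by
    have hb := (Config.data_birth_le_iff hc s i).mpr hi
    have h0 : c.data.int i ≠ 0 := by
      simp only [vortexData]
      split_ifs with h
      · exact hc.int_ne_zero i h
      · exact hc.points.sign_ne_zero _
    simp [Config.restart, intensity, not_lt.mpr hb, h0, Real.exp_ne_zero]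
  pos_ne i hi j hj hij := hX.no_collision i j s hij ((Config.data_birth_le_iff hc s i).mpr hi)
    ((Config.data_birth_le_iff hc s j).mpr hj)
  points := hc.points.shift s

lemma Config.IsNondeg.initial_restart (hc : c.IsNondeg) (s : ℝ≥0) :
    (c.restart θ X s).initial = vorticity θ c.data X s := by
  classical
  rw [vorticity, finsum_cond_eq_sum_fin fun j hj => (Config.data_birth_le_iff hc s j).mp hj, Config.initial,
    initialVorticity, sum_range]
  exact sum_congr rfl fun i _ => (if_pos ((Config.data_birth_le_iff hc s i).mpr i.2)).symm

/-- The vorticity at time `s + u` is a function of the one at time `s` and of the births in between. -/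
lemma exists_observeFun_mem_iff (hθ : 0 < θ) (u : ℝ≥0) (hB : IsAtomicSet B) :
    ∃ D : Set (SMeas × Points), MeasurableSet D ∧ ∀ c : Config, c.IsNondeg → ∀ X, IsVortexFlow θ c.data X → ∀ s,
      (vorticity θ c.data X (s + u) ∈ B ↔ (vorticity θ c.data X s, shift s c.2.2) ∈ D) := by
  obtain ⟨C, hC, h⟩ := exists_measurableSet_reaches_iff hθ u hB
  refine ⟨observeFun u ⁻¹' C, measurable_observeFun u hC, fun c hc X hX s => ?_⟩
  have hr := hc.restart hX s
  obtain ⟨N, hN⟩ := Config.exists_num hr u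
  have hR := hc.isRestart hX s
  rw [← hR.vorticity_eq, ← ((hR.isVortexFlow hX).isFlowUpTo u).reaches_iff hθ hN, h _ hr, ← observeVersion_eq hr,
    ← hc.initial_restart]
  rfl

end

/-! ### Independence of past and future -/

/-- A function of a variable known in `𝓐` and a variable independent of `𝓐` is conditioned by freezing the
former. -/
lemma condExp_indicator_of_indep {Ω S E : Type*} {𝓐 m : MeasurableSpace Ω} [MeasurableSpace S] [MeasurableSpace E]
    {P : Measure Ω} [IsProbabilityMeasure P] (h𝓐 : 𝓐 ≤ m) {Y : Ω → S}
    (hY : Measurable[𝓐] Y) {Z : Ω → E} (hZ : Measurable[m] Z) {ν : Measure E} [IsProbabilityMeasure ν]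
    (h : ∀ A, MeasurableSet[𝓐] A → ∀ F, MeasurableSet F → P (A ∩ Z ⁻¹' F) = P A * ν F) {D : Set (S × E)}
    (hD : MeasurableSet D) : P[{w | (Y w, Z w) ∈ D}.indicator (fun _ => (1 : ℝ)) | 𝓐] =ᵐ[P]
      fun w => ν.real (Prod.mk (Y w) ⁻¹' D) := by
  have hYm : Measurable[m] Y := hY.mono h𝓐 le_rfl
  have hDm : MeasurableSet[m] {w | (Y w, Z w) ∈ D} := (hYm.prodMk hZ) hD
  have hκ : Measurable fun y => ν (Prod.mk y ⁻¹' D) := measurable_measure_prodMk_left hD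
  have hκY : Measurable[𝓐] fun w => ν.real (Prod.mk (Y w) ⁻¹' D) := hκ.ennreal_toReal.comp hY
  refine (ae_eq_condExp_of_forall_setIntegral_eq h𝓐 ((integrable_const 1).indicator hDm) (fun A _ _ => ?_)
    (fun A hA _ => ?_) hκY.stronglyMeasurable.aestronglyMeasurable).symm
  · exact Integrable.of_bound (hκY.mono h𝓐 le_rfl).aestronglyMeasurable 1
      (ae_of_all _ fun w => by rw [Real.norm_of_nonneg measureReal_nonneg]; exact measureReal_le_one)
  · have hA' := h𝓐 A hA
    have e : (P.restrict A).map (fun w => (Y w, Z w)) = ((P.restrict A).map Y).prod ν := by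
      symm
      refine Measure.prod_eq fun S F hS hF => ?_
      rw [map_apply (hYm.prodMk hZ) (hS.prod hF), map_apply hYm hS, restrict_apply (hYm hS),
        restrict_apply ((hYm.prodMk hZ) (hS.prod hF)), ← h _ (MeasurableSet.inter (hY hS) hA) F hF]
      congr 1
      ext w; simp; tauto
    have h1 := DFunLike.congr_fun e D
    rw [map_apply (hYm.prodMk hZ) hD, Measure.prod_apply hD, lintegral_map hκ hYm] at h1
    rw [integral_indicator_const _ hDm, smul_eq_mul, mul_one, Measure.real]
    refine Eq.trans ?_ (congrArg ENNReal.toReal h1).symm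
    exact integral_toReal (hκ.comp hYm).aemeasurable (ae_of_all _ fun w => measure_lt_top _ _)

instance instBorelSpacePoints : BorelSpace Points := have h : BorelSpace (Mark) := inferInstance
  @Pi.borelSpace ℕ _ _ _ _ _ fun _ => h

/-- There are no points in `(s, u]` for `u` close to `s`, so the shift only subtracts `u` from the
same times. This right-continuity compensates for the right-continuous completion of the filtration.
-/
lemma IsNondeg.tendsto_shift (hp : IsNondeg p) (s : ℝ≥0) :
    Tendsto (fun u => PointVortex.shift u p) (𝓝[>] s) (𝓝 (PointVortex.shift s p)) := by
  have hs : s < (p (count p s)).1 := not_le.mp fun h => absurd ((hp.le_iff s _).mp h) (lt_irrefl _)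
  refine tendsto_pi_nhds.mpr fun m => ?_
  have h1 : Tendsto (fun u => ((p (count p s + m)).1 - u, (p (count p s + m)).2)) (𝓝[>] s)
      (𝓝 (PointVortex.shift s p m)) :=
    ((continuous_const.sub continuous_id).prodMk continuous_const).continuousWithinAt
  refine h1.congr' ?_
  filter_upwards [Ioo_mem_nhdsGT hs] with u hu
  have : count p u = count p s := by
    refine le_antisymm (not_lt.mp fun h => ?_) (not_lt.mp fun h => ?_)
    · exact absurd ((hp.le_iff u _).mpr h) (not_le.mpr hu.2)
    · exact lt_irrefl _ ((hp.le_iff u _).mp (((hp.le_iff s _).mpr h).trans hu.1.le))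
  rw [PointVortex.shift, this]

section

variable {Ω : Type*} {m : MeasurableSpace Ω} {P : Measure Ω} [IsProbabilityMeasure P] {c : Ω → Config}
  

/-- The filtration of the initial vorticity and the noise. -/
abbrev sampleFiltration (P : Measure Ω) (c : Ω → Config) : Filtration ℝ≥0 m :=
  generatedFiltration P (fun w => (c w).initial) (fun t w => compoundPoisson (c w).2.2 t)

namespace IsSample

lemma map_past_shift (hc : IsSample P θ lam M c) (u : ℝ≥0) :
    P.map (fun w => (((c w).initial, past u (c w).2.2), shift u (c w).2.2)) =
      (P.map fun w => ((c w).initial, past u (c w).2.2)).prod (Poi lam) := by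
  have := isProbabilityMeasure_map (μ := Poi lam) (measurable_past u).aemeasurable
  have := isProbabilityMeasure_map (μ := P) hc.measurable_initial.aemeasurable
  have hps : Measurable fun p => (past u p, shift u p) := (measurable_past u).prodMk (measurable_shift u)
  have h := (indepFun_iff_map_prod_eq_prod_map_map hc.measurable_initial.aemeasurable
    hc.measurable_births.aemeasurable).mp hc.indep
  rw [hc.births] at h
  have hJ := hc.measurable_initial.prodMk hc.measurable_births
  have e : P.map (fun w => ((c w).initial, past u (c w).2.2)) =
      (P.map fun w => (c w).initial).prod ((Poi lam).map (past u)) := by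
    have h2 := map_prod_map (P.map fun w => (c w).initial) (Poi lam) measurable_id (measurable_past u)
    rw [Measure.map_id, ← h, Measure.map_map (measurable_id.prodMap (measurable_past u)) hJ] at h2
    exact h2.symm
  have h3 := map_prod_map (P.map fun w => (c w).initial) (Poi lam) measurable_id hps
  rw [Measure.map_id, ← h, Measure.map_map (measurable_id.prodMap hps) hJ, poissonLaw_map_past_shift,
    ← Measure.prodAssoc_prod, ← e] at h3
  have h4 := congrArg (Measure.map MeasurableEquiv.prodAssoc.symm) h3
  rw [Measure.map_map (MeasurableEquiv.measurable _) (MeasurableEquiv.measurable _), MeasurableEquiv.symm_comp_self,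
    Measure.map_id, Measure.map_map (MeasurableEquiv.measurable _) ((measurable_id.prodMap hps).comp hJ)] at h4
  exact h4.symm

/-- The births after time `s` are independent of the filtration at time `s`. -/
lemma measure_inter_shift (hc : IsSample P θ lam M c) {s : ℝ≥0} {A : Set Ω}
    (hA : MeasurableSet[sampleFiltration P c s] A) {F : Set Points} (hF : MeasurableSet F) :
    P (A ∩ (fun w => shift s (c w).2.2) ⁻¹' F) = P A * Poi lam F := by
  have hAm := (sampleFiltration P c).le s A hA
  have hZ : ∀ u, Measurable fun w => shift u (c w).2.2 := fun u => (measurable_shift u).comp hc.measurable_births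
  have hpast : ∀ u, Measurable fun w => ((c w).initial, past u (c w).2.2) := fun u =>
    hc.measurable_initial.prodMk ((measurable_past u).comp hc.measurable_births)
  -- For `u > s` every set of the filtration at `s` agrees, up to a null set, with one determined by
  -- the initial vorticity and the points up to `u`; the points after `u` are independent of both.
  have hu : ∀ u > s, (P.restrict A).map (fun w => shift u (c w).2.2) = P A • Poi lam := by
    intro u hu
    obtain ⟨A', ⟨S, hS, rfl⟩, hAA'⟩ : ∃ A', MeasurableSet[MeasurableSpace.comap
        (fun w => ((c w).initial, past u (c w).2.2)) inferInstance] A' ∧ A =ᵐ[P] A' := by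
      let 𝓑 := MeasurableSpace.comap (fun w => ((c w).initial, past u (c w).2.2)) inferInstance
      have hB : Measurable[𝓑] fun w => ((c w).initial, past u (c w).2.2) := comap_measurable _
      have hle : sampleFiltration P c s ≤ eventuallyMeasurableSpace 𝓑 (ae P) := by
        rw [sampleFiltration, generatedFiltration, Filtration.rightCont_eq]
        refine (iInf₂_le u hu).trans (inf_le_left.trans (sup_le (sup_le ?_ (iSup₂_le fun r hr => ?_)) ?_))
        · exact (Measurable.comap_le (measurable_fst.comp hB)).trans (le_eventuallyMeasurableSpace (l := ae P))
        · refine Measurable.comap_le (Measurable.eventuallyMeasurable_of_eventuallyEq (m := 𝓑)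
            ((measurable_weighted (w := fun _ => 1) measurable_const r).comp (measurable_snd.comp hB)) ?_)
          filter_upwards [hc.isNondeg] with w hw
          simp [weighted_past _ hr, ← hw.points.finsum_eq_weighted, compoundPoisson]
        · refine MeasurableSpace.generateFrom_le fun N hN => ⟨∅, MeasurableSet.empty, ?_⟩
          exact ae_eq_empty.mpr hN
      exact hle A hA
    ext F hF
    have h1 := DFunLike.congr_fun (hc.map_past_shift u) (S ×ˢ F)
    rw [map_apply ((hpast u).prodMk (hZ u)) (hS.prod hF), prod_prod, map_apply (hpast u) hS] at h1
    rw [map_apply (hZ u) hF, restrict_apply (hZ u hF), Measure.smul_apply, smul_eq_mul, measure_congr hAA', ← h1]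
    refine measure_congr ?_
    filter_upwards [hAA'] with w hw
    exact propext (and_comm.trans (and_congr_left' (iff_of_eq hw)))
  -- Letting `u` decrease to `s` against bounded continuous functions transfers the identity to `s`
  -- itself.
  have hs : (P.restrict A).map (fun w => shift s (c w).2.2) = P A • Poi lam := by
    have : IsFiniteMeasure (P A • Poi lam) := Measure.smul_finite _ (measure_ne_top _ _)
    refine ext_of_forall_integral_eq_of_IsFiniteMeasure fun f => ?_
    have hf : Measurable f := f.continuous.measurable
    rw [integral_map (hZ s).aemeasurable hf.aestronglyMeasurable]
    refine tendsto_nhds_unique (tendsto_integral_filter_of_dominated_convergence (l := 𝓝[>] s)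
      (F := fun u w => f (shift u (c w).2.2)) (fun _ => ‖f‖) ?_ ?_ (integrable_const _) ?_)
      (tendsto_const_nhds.congr' ?_)
    · exact .of_forall fun u => (hf.comp (hZ u)).aestronglyMeasurable
    · exact .of_forall fun u => ae_of_all _ fun w => f.norm_coe_le_norm _
    · filter_upwards [ae_restrict_of_ae hc.isNondeg] with w hw
      exact (f.continuous.tendsto _).comp (hw.points.tendsto_shift s)
    · filter_upwards [self_mem_nhdsWithin] with u hus
      rw [← hu u hus, integral_map (hZ u).aemeasurable hf.aestronglyMeasurable]
  have := DFunLike.congr_fun hs F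
  rw [map_apply (hZ s) hF, restrict_apply (hZ s hF), Set.inter_comm] at this
  exact this

lemma isMarkov (hc : IsSample P θ lam M c) (hθ : 0 < θ) {X : Ω → Paths}
    (hX : ∀ᵐ w ∂P, IsVortexFlow θ (c w).data (X w))
    (had : ∀ t, Measurable[sampleFiltration P c t] fun w => vorticity θ (c w).data (X w) t) :
    IsMarkov (fun t w => vorticity θ (c w).data (X w) t) (sampleFiltration P c) P := by
  refine ⟨had, fun s t hst B hB => ?_⟩
  obtain ⟨u, rfl⟩ := exists_add_of_le hst
  obtain ⟨D, hD, h⟩ := exists_observeFun_mem_iff hθ u (isAtomicSet_of_measurableSet hB)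
  have hZ : Measurable fun w => shift s (c w).2.2 := (measurable_shift s).comp hc.measurable_births
  have he : (((fun w => vorticity θ (c w).data (X w) (s + u)) ⁻¹' B).indicator fun _ => (1 : ℝ)) =ᵐ[P]
      {w | (vorticity θ (c w).data (X w) s, shift s (c w).2.2) ∈ D}.indicator fun _ => (1 : ℝ) := by
    classical
    filter_upwards [hc.isNondeg, hX] with w hw hx
    simp only [indicator, mem_preimage, mem_ofPred_eq, h _ hw _ hx s]
  -- The births after `s` are independent of every smaller σ-algebra too. The same formula for the
  -- conditional probability thus holds given `𝓖_s` and given the vorticity at time `s` alone.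
  have key : ∀ 𝓐 ≤ sampleFiltration P c s, Measurable[𝓐] (fun w => vorticity θ (c w).data (X w) s) →
      P[((fun w => vorticity θ (c w).data (X w) (s + u)) ⁻¹' B).indicator fun _ => (1 : ℝ) | 𝓐] =ᵐ[P]
        fun w => (Poi lam).real (Prod.mk (vorticity θ (c w).data (X w) s) ⁻¹' D) := fun 𝓐 h𝓐 hY =>
    (condExp_congr_ae he).trans (condExp_indicator_of_indep (h𝓐.trans ((sampleFiltration P c).le s)) hY hZ
      (fun A hA F hF => hc.measure_inter_shift (h𝓐 A hA) hF) hD)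
  exact (key _ le_rfl (had s)).trans (key _ (had s).comap_le (comap_measurable _)).symm

end IsSample

end

/-! ### Measurability in Sobolev spaces -/

/-- Finite sums of point masses. -/
def IsAtomic (μ : SMeas) : Prop := ∃ (N : ℕ) (v : Fin N → ℝ × Torus), μ = ∑ i, dirac (v i).2 (v i).1

lemma isAtomic_finsum (q : ℕ → Prop) (x : ℕ → Torus) (a : ℕ → ℝ) :
    IsAtomic (∑ᶠ (i : ℕ) (_ : q i), dirac (x i) (a i)) := by
  classical
  have e : ∀ i, (∑ᶠ (_ : q i), dirac (x i) (a i) : SMeas) = dirac (x i) (if q i then a i else 0) := fun i => by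
    rw [finsum_eq_if]; split_ifs <;> simp
  simp only [e]
  by_cases h : (Function.support fun i => (dirac (x i) (if q i then a i else 0) : SMeas)).Finite
  · obtain ⟨N, hN⟩ := h.bddAbove
    refine ⟨N + 1, fun i => (if q i then a i else 0, x i), ?_⟩
    rw [finsum_eq_sum_of_support_subset (s := range (N + 1)) _ fun i hi => by simpa using Nat.lt_succ_of_le (hN hi),
      sum_range]
  · exact ⟨0, finZeroElim, by simp [finsum_of_infinite_support h]⟩

lemma isAtomicSet_toSobolev (hs : s < -1) {Y : Type*} [MeasurableSpace Y] {F : Sobolev s → Y}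
    (hF : Measurable[borel _] F) {S : Set Y} (hS : MeasurableSet S) : IsAtomicSet {μ | F (toSobolev s μ) ∈ S} := fun N => by
  borelize ↥(Sobolev s)
  have hb : BorelSpace (ℝ × Torus) := inferInstance
  have : BorelSpace (Fin N → ℝ × Torus) := @Pi.borelSpace _ _ _ _ _ _ fun _ => hb
  exact (hF.comp (continuous_toSobolev_sum_dirac hs N).measurable) hS

/-- On finite sums of point masses the Sobolev embedding is continuous in the atoms, although no
measurability on all signed measures is claimed. Separability holds since the values lie in
countably many continuous images of separable spaces. -/
lemma stronglyMeasurable_toSobolev {Ω : Type*} {𝓐 : MeasurableSpace Ω} (hs : s < -1) {Y : Ω → SMeas}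
    (hY : ∀ w, IsAtomic (Y w)) (h : ∀ B, IsAtomicSet B → MeasurableSet {w | Y w ∈ B}) :
    StronglyMeasurable fun w => toSobolev s (Y w) := by
  borelize ↥(Sobolev s)
  refine stronglyMeasurable_iff_measurable_separable.mpr
    ⟨fun S hS => h _ (isAtomicSet_toSobolev hs (F := id) measurable_id hS), ?_⟩
  refine (TopologicalSpace.IsSeparable.iUnion fun N : ℕ =>
    TopologicalSpace.isSeparable_range (continuous_toSobolev_sum_dirac hs N)).mono ?_
  rintro _ ⟨w, rfl⟩
  obtain ⟨N, v, hv⟩ := hY w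
  exact mem_iUnion.mpr ⟨N, v, congrArg (toSobolev s) hv.symm⟩

/-- Finite sums of point masses are determined by their Fourier coefficients. -/
lemma sum_dirac_eq_zero (x : Pos N) (a : Fin N → ℝ)
    (h : ∀ k, ∑ i, (a i : ℂ) * mode k (x i) = 0) : (∑ i, dirac (x i) (a i) : SMeas) = 0 := by
  classical
  -- Each point of the torus is a character of `ℤ²`, and distinct points give distinct characters;
  -- by Dedekind's theorem these are linearly independent.
  let χ : Torus → (Multiplicative (ℤ × ℤ) →* ℂ) := fun y =>
    { toFun := fun k => mode k.toAdd y
      map_one' := by simp [mode]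
      map_mul' := fun k l => by simp only [mode, toAdd_mul, Prod.fst_add, Prod.snd_add, fourier_add]; ring }
  have hχ : Injective χ := fun y y' he => by
    have h1 := DFunLike.congr_fun he (Multiplicative.ofAdd (1, 0))
    have h2 := DFunLike.congr_fun he (Multiplicative.ofAdd (0, 1))
    simp only [χ, MonoidHom.coe_mk, OneHom.coe_mk, toAdd_ofAdd, mode, fourier_zero, mul_one, one_mul, fourier_one]
      at h1 h2
    exact Prod.ext (AddCircle.injective_toCircle one_ne_zero (Circle.ext h1))
      (AddCircle.injective_toCircle one_ne_zero (Circle.ext h2))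
  have hli := (linearIndependent_monoidHom (Multiplicative (ℤ × ℤ)) ℂ).comp χ hχ
  have hz := linearIndependent_iff.mp hli (∑ i, Finsupp.single (x i) (a i : ℂ)) (by
    simp only [map_sum, Finsupp.linearCombination_single]
    funext k
    simpa [χ, Finset.sum_apply] using h k.toAdd)
  ext A hA
  have h3 := congrArg (Finsupp.linearCombination ℂ (A.indicator (1 : Torus → ℂ))) hz
  simp only [map_sum, Finsupp.linearCombination_single, map_zero, smul_eq_mul] at h3
  rw [sum_dirac_apply _ _ _ hA]
  refine Complex.ofReal_injective ((Complex.ofReal_sum _ _).trans ((sum_congr rfl fun i _ => ?_).trans h3))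
  by_cases hi : x i ∈ A <;> simp [hi]

lemma eq_of_toSobolev_eq (hs : s < -1) {μ ν : SMeas} (hμ : IsAtomic μ) (hν : IsAtomic ν)
    (h : toSobolev s μ = toSobolev s ν) : μ = ν := by
  obtain ⟨N, v, rfl⟩ := hμ
  obtain ⟨N', v', rfl⟩ := hν
  have e : (∑ i, dirac (Fin.append (fun i => (v i).2) (fun i => (v' i).2) i)
      (Fin.append (fun i => (v i).1) (fun i => -(v' i).1) i) : SMeas) = 0 := by
    refine sum_dirac_eq_zero _ _ fun k => ?_
    have h1 := congrArg (fun u : Sobolev s => (u : lp (fun _ : ℤ × ℤ => ℂ) 2) (-k)) h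
    simp only [toSobolev_sum_dirac hs, sum_smul_diracSob_apply hs, sobolevCoeff, fourierCoeffSM_sum_dirac] at h1
    have h2 := mul_left_cancel₀ (mod_cast (Real.rpow_pos_of_pos (by positivity) _).ne') h1
    simp only [neg_neg] at h2
    simp [Fin.sum_univ_add, h2]
  have hneg : ∀ (x : Torus) (b : ℝ), (dirac x (-b) : SMeas) = -dirac x b := fun x b => by
    ext A hA
    rw [neg_apply, dirac_apply_eq _ _ hA, dirac_apply_eq _ _ hA]
    by_cases hx : x ∈ A <;> simp [hx]
  rw [Fin.sum_univ_add] at e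
  simp only [Fin.append_left, Fin.append_right, hneg, Finset.sum_neg_distrib] at e
  exact add_neg_eq_zero.mp e

/-! ### The noise -/

/-- Any observable that is injective on finite sums of point masses and measurable in terms of the
atoms recovers the noise. It serves both for evaluations on a countable algebra and for Fourier
coefficients. -/
lemma exists_noise_mem_iff {Y : Type*} [MeasurableSpace Y] [CountablySeparated Y] {Φ : SMeas → Y}
    (hΦ : ∀ S, MeasurableSet S → IsAtomicSet (Φ ⁻¹' S))
    (hinj : ∀ μ ν, IsAtomic μ → IsAtomic ν → Φ μ = Φ ν → μ = ν) (t : ℝ≥0) (hB : IsAtomicSet B) :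
    ∃ C, MeasurableSet C ∧ ∀ p, IsNondeg p → (compoundPoisson p t ∈ B ↔ Φ (compoundPoisson p t) ∈ C) := by
  obtain ⟨C, hC, h⟩ := exists_measurableSet_iff_of_saturated measurableSet_isNondeg
    (measurableSet_compoundPoisson t hB) (f := fun p => Φ (compoundPoisson p t))
    (fun S hS => measurableSet_compoundPoisson t (hΦ S hS)) (fun p hp p' hp' he h => ⟨hp', by
      have : compoundPoisson p t = compoundPoisson p' t := hinj _ _ (isAtomic_finsum _ _ _) (isAtomic_finsum _ _ _) he
      rw [mem_ofPred_eq, ← this]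
      exact h.2⟩)
  exact ⟨C, hC, fun p hp => ⟨fun hb => (h p hp).mp ⟨hp, hb⟩, fun hb => ((h p hp).mpr hb).2⟩⟩

section

variable {Ω : Type*} {𝓐 m : MeasurableSpace Ω} {P : Measure Ω} [IsProbabilityMeasure P] {c : Ω → Config}
  

lemma IsSample.stronglyMeasurable_noise (hc : IsSample P θ lam M c) (hs : s < -1) {t : ℝ≥0}
    (h0 : ∀ A : Set Ω, P A = 0 → MeasurableSet[𝓐] A) (h : Measurable[𝓐] fun w => compoundPoisson (c w).2.2 t) :
    StronglyMeasurable[𝓐] fun w => toSobolev s (compoundPoisson (c w).2.2 t) := by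
  refine stronglyMeasurable_toSobolev (𝓐 := 𝓐) hs (fun w => isAtomic_finsum _ _ _) fun B hB => ?_
  obtain ⟨C, hC, hB⟩ := exists_noise_mem_iff (Φ := evalAlg)
    (fun S hS => isAtomicSet_of_measurableSet (measurable_evalAlg hS)) (fun _ _ _ _ h => evalAlg_injective h) t hB
  exact measurableSet_of_ae_iff h0 ((measurable_evalAlg.comp h) hC)
    (by filter_upwards [hc.isNondeg] with w hw using hB _ hw.points)

/-- A general filtration is assumed to know the noise only as a Sobolev-valued process. Its Fourier
coefficients determine the atoms, so the noise is adapted as a measure as well. -/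
lemma IsSample.measurable_noise_of_toSobolev (hc : IsSample P θ lam M c) (hs : s < -1) {t : ℝ≥0}
    (h0 : ∀ A : Set Ω, P A = 0 → MeasurableSet[𝓐] A)
    (h : StronglyMeasurable[𝓐] fun w => toSobolev s (compoundPoisson (c w).2.2 t)) :
    Measurable[𝓐] fun w => compoundPoisson (c w).2.2 t := by
  borelize ↥(Sobolev s)
  intro B hB
  have hF : Measurable fun (u : Sobolev s) (k : ℤ × ℤ) => (u : lp (fun _ : ℤ × ℤ => ℂ) 2) k :=
    measurable_pi_lambda _ fun k => ((continuous_apply k).comp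
      ((lp.uniformContinuous_coe (p := 2)).continuous.comp continuous_subtype_val)).measurable
  obtain ⟨C, hC, hB⟩ := exists_noise_mem_iff (fun S hS => isAtomicSet_toSobolev hs hF hS)
    (fun μ ν hμ hν he => eq_of_toSobolev_eq hs hμ hν (sobolev_ext fun k => congrFun he k)) t
    (isAtomicSet_of_measurableSet hB)
  exact measurableSet_of_ae_iff h0 ((hF.comp h.measurable) hC)
    (by filter_upwards [hc.isNondeg] with w hw using hB _ hw.points)

/-! ### The martingale property -/

lemma ae_abs_sign : ∀ᵐ p ∂Poi lam, ∀ m, |(p m).2.1| = 1 := by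
  refine ae_all_iff.mpr fun m => ?_
  rw [poissonLaw, ae_map_iff measurable_accumulate.aemeasurable (measurableSet_eq_fun (by fun_prop) measurable_const)]
  refine (measurePreserving_eval_infinitePi (fun _ : ℕ => markLaw lam) m).quasiMeasurePreserving.ae
    (p := fun a => |a.2.1| = 1) ?_
  have h : ∀ᵐ σ ∂signLaw, |σ| = 1 := by simp [signLaw, ae_iff]
  exact quasiMeasurePreserving_snd.ae ((quasiMeasurePreserving_fst (μ := signLaw)
    (ν := (volume : Measure Torus))).ae (p := fun σ => |σ| = 1) h)

lemma IsNondeg.toSobolev_compoundPoisson (hs : s < -1) (hp : IsNondeg p) (t : ℝ≥0) :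
    toSobolev s (compoundPoisson p t) = ∑ m ∈ range (count p t), (p m).2.1 • diracSob s (p m).2.2 := by
  rw [hp.compoundPoisson_eq_sum, toSobolev_sum_dirac hs]

lemma stronglyMeasurable_noiseVersion (hs : s < -1) (t : ℝ≥0) :
    StronglyMeasurable fun p => toSobolev s (noiseVersion t p) := by
  classical
  refine stronglyMeasurable_toSobolev hs (fun p => ?_) fun B hB => ?_
  · rw [noiseVersion]
    split_ifs
    exacts [isAtomic_finsum _ _ _, ⟨0, finZeroElim, by simp⟩]
  · have : {p | noiseVersion t p ∈ B} = ({p | IsNondeg p} ∩ {p | compoundPoisson p t ∈ B}) ∪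
        ({p | IsNondeg p}ᶜ ∩ {_p | (0 : SMeas) ∈ B}) := by
      ext p
      by_cases hp : IsNondeg p <;> simp [noiseVersion, hp]
    rw [this]
    exact (measurableSet_compoundPoisson t hB).union (measurableSet_isNondeg.compl.inter (MeasurableSet.const _))

lemma integrable_noiseVersion (hs : s < -1) (t : ℝ≥0) :
    Integrable (fun p => toSobolev s (noiseVersion t p)) (Poi lam) := by
  obtain ⟨C, hC⟩ := exists_norm_diracSob_le hs
  refine Integrable.mono' (g := fun p => count p t * C) ?_ (stronglyMeasurable_noiseVersion hs t).aestronglyMeasurable ?_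
  · refine Integrable.mul_const ⟨((measurable_from_top (f := fun n : ℕ => (n : ℝ))).comp
      (measurable_count t)).aestronglyMeasurable, ?_⟩ C
    simpa [HasFiniteIntegral] using lintegral_count_lt_top (lam := lam) t
  · filter_upwards [ae_isNondeg, ae_abs_sign] with p hp hσ
    rw [noiseVersion_eq hp, hp.toSobolev_compoundPoisson hs]
    refine (norm_sum_le_of_le _ (fun m _ => ?_)).trans_eq (b := ∑ _m ∈ range (count p t), C) (by simp)
    rw [norm_smul, norm_eq_abs, hσ, one_mul]
    exact hC _

/-- Changing all signs preserves the law and negates the noise, so the mean equals its own opposite.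
-/
lemma integral_noiseVersion (hs : s < -1) (t : ℝ≥0) : ∫ p, toSobolev s (noiseVersion t p) ∂Poi lam = 0 := by
  have hneg : MeasurePreserving (fun σ : ℝ => -σ) signLaw signLaw := ⟨measurable_neg, by
    rw [signLaw, Measure.map_smul, Measure.map_add _ _ measurable_neg, Measure.map_dirac' measurable_neg,
      Measure.map_dirac' measurable_neg, neg_neg, add_comm]⟩
  have h1 := poissonLaw_map_marks (lam := lam) (φ := fun _ => Prod.map (fun σ => -σ) id) fun _ =>
    hneg.prod (MeasurePreserving.id volume)
  have h2 := integral_map (μ := Poi lam) (φ := fun p m => ((p m).1, Prod.map (fun σ => -σ) id (p m).2))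
    (measurable_pi_lambda _ fun m => by simp only [Prod.map]; fun_prop).aemeasurable
    (stronglyMeasurable_noiseVersion hs t).aestronglyMeasurable
  have h3 : ∫ p, toSobolev s (noiseVersion t p) ∂Poi lam = -∫ p, toSobolev s (noiseVersion t p) ∂Poi lam := by
    rw [← integral_neg]
    refine ((congrArg (fun μ => ∫ p, toSobolev s (noiseVersion t p) ∂μ) h1).symm.trans h2).trans (integral_congr_ae ?_)
    filter_upwards [ae_isNondeg] with p hp
    have hp' : IsNondeg fun m => ((p m).1, Prod.map (fun σ => -σ) id (p m).2) :=
      ⟨hp.pos, hp.lt_succ, hp.unbounded, fun m => neg_ne_zero.mpr (hp.sign_ne_zero m)⟩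
    rw [noiseVersion_eq hp, noiseVersion_eq hp', hp.toSobolev_compoundPoisson hs, hp'.toSobolev_compoundPoisson hs,
      ← Finset.sum_neg_distrib]
    exact sum_congr rfl fun m _ => neg_smul _ _
  have h4 : (2 : ℝ) • ∫ p, toSobolev s (noiseVersion t p) ∂Poi lam = 0 := by
    rw [two_smul]; exact eq_neg_iff_add_eq_zero.mp h3
  exact (smul_eq_zero.mp h4).resolve_left two_ne_zero

/-- The increment after `r` is the noise of the shifted births, which are independent of the
filtration at `r` and again Poisson; its mean vanishes. -/
lemma IsSample.martingale (hc : IsSample P θ lam M c) (hs : s < -1)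
    (had : ∀ t, StronglyMeasurable[sampleFiltration P c t] fun w => toSobolev s (compoundPoisson (c w).2.2 t)) :
    Martingale (fun t w => toSobolev s (compoundPoisson (c w).2.2 t)) (sampleFiltration P c) P := by
  have hi : ∀ t {Z : Ω → Points}, Measurable Z → P.map Z = Poi lam →
      Integrable (fun w => toSobolev s (noiseVersion t (Z w))) P := fun t Z hZ he => by
    have := integrable_noiseVersion (lam := lam) hs t
    rw [← he] at this
    exact this.comp_measurable hZ
  have hN : ∀ t, (fun w => toSobolev s (noiseVersion t (c w).2.2)) =ᵐ[P]
      fun w => toSobolev s (compoundPoisson (c w).2.2 t) := fun t => by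
    filter_upwards [hc.isNondeg] with w hw
    rw [noiseVersion_eq hw.points]
  have hNi := fun t => (hi t hc.measurable_births hc.births).congr (hN t)
  refine ⟨had, fun r t hrt => ?_⟩
  obtain ⟨u, rfl⟩ := exists_add_of_le hrt
  have hZ : Measurable fun w => shift r (c w).2.2 := (measurable_shift r).comp hc.measurable_births
  have hZl : P.map (fun w => shift r (c w).2.2) = Poi lam := by
    rw [← poissonLaw_map_shift r, ← hc.births, Measure.map_map (measurable_shift r) hc.measurable_births]; rfl
  have hind : Indep (MeasurableSpace.comap (fun w => shift r (c w).2.2) inferInstance) (sampleFiltration P c r) P := by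
    refine (Indep_iff _ _ P).mpr ?_
    rintro _ A ⟨F, hF, rfl⟩ hA
    rw [Set.inter_comm, hc.measure_inter_shift hA hF, ← map_apply hZ hF, hZl, mul_comm]
  have e : (fun w => toSobolev s (compoundPoisson (c w).2.2 (r + u))) =ᵐ[P] (fun w => toSobolev s
      (compoundPoisson (c w).2.2 r)) + fun w => toSobolev s (noiseVersion u (shift r (c w).2.2)) := by
    filter_upwards [hc.isNondeg] with w hw
    rw [Pi.add_apply, noiseVersion_eq (hw.points.shift r), (hw.points.shift r).toSobolev_compoundPoisson hs,
      hw.points.toSobolev_compoundPoisson hs, hw.points.toSobolev_compoundPoisson hs, hw.points.count_shift,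
      sum_range_add]
    rfl
  refine (condExp_congr_ae e).trans ((condExp_add (hNi r) (hi u hZ hZl) _).trans ?_)
  rw [condExp_of_stronglyMeasurable ((sampleFiltration P c).le r) (had r) (hNi r)]
  filter_upwards [condExp_indep_eq (f := fun w => toSobolev s (noiseVersion u (shift r (c w).2.2))) hZ.comap_le ((sampleFiltration P c).le r)
    ((stronglyMeasurable_noiseVersion hs u).comp_measurable (comap_measurable _)) hind] with w hw
  rw [Pi.add_apply, hw, ← integral_map (φ := fun w => shift r (c w).2.2) hZ.aemeasurable
    (stronglyMeasurable_noiseVersion hs u).aestronglyMeasurable, hZl, integral_noiseVersion hs, add_zero]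

end

/-! ### Predictable modifications -/

/-- An adapted process has a predictable companion, which coincides with its left limits. -/
lemma exists_isStronglyPredictable {Ω E : Type*} {m : MeasurableSpace Ω} [NormedAddCommGroup E] [CompleteSpace E]
    {𝓕 : Filtration ℝ≥0 m} {Y : ℝ≥0 → Ω → E} (hY : ∀ t, StronglyMeasurable[𝓕 t] (Y t)) :
    ∃ Y' : ℝ≥0 → Ω → E, IsStronglyPredictable 𝓕 Y' ∧ Y' 0 = Y 0 ∧
      ∀ t w l, 0 < t → Tendsto (fun r => Y r w) (𝓝[<] t) (𝓝 l) → Y' t w = l := by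
  borelize E
  let _ : MeasurableSpace (ℝ≥0 × Ω) := 𝓕.predictable
  -- For `t > 0` this is the largest multiple of `1/(n+1)` strictly below `t`, and it is `0` at `t =
  -- 0`. The process sampled at it is constant in time on the intervals `(k/(n+1), (k+1)/(n+1)]`,
  -- with a value known at their left ends, hence predictable.
  let d : ℕ → ℝ≥0 → ℝ≥0 := fun n t => ((⌈t * (n + 1)⌉₊ - 1 : ℕ) : ℝ≥0) / (n + 1)
  have hd0 : ∀ n, d n 0 = 0 := fun n => by simp [d]
  have hN : ∀ n : ℕ, (0 : ℝ≥0) < n + 1 := fun n => by positivity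
  have hceil : ∀ (n : ℕ) {t : ℝ≥0}, 0 < t → ((⌈t * (n + 1)⌉₊ - 1 : ℕ) : ℝ≥0) + 1 = ⌈t * (n + 1)⌉₊ := fun n t ht => by
    have : 0 < ⌈t * (n + 1)⌉₊ := Nat.ceil_pos.mpr (mul_pos ht (hN n))
    exact_mod_cast Nat.sub_add_cancel this
  have hlt : ∀ n {t : ℝ≥0}, 0 < t → d n t < t := fun n t ht => by
    rw [div_lt_iff₀ (hN n), ← add_lt_add_iff_right 1, hceil n ht]
    exact Nat.ceil_lt_add_one (by positivity)
  have hle : ∀ n {t : ℝ≥0}, 0 < t → t ≤ d n t + 1 / (n + 1) := fun n t ht => by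
    rw [← add_div, hceil n ht, le_div_iff₀ (hN n)]
    exact Nat.le_ceil _
  have hmeas : ∀ n, StronglyMeasurable fun u : ℝ≥0 × Ω => Y (d n u.1) u.2 := fun n => by
    refine stronglyMeasurable_iff_measurable_separable.mpr ⟨fun S hS => ?_, ?_⟩
    · have : (fun u : ℝ≥0 × Ω => Y (d n u.1) u.2) ⁻¹' S = ({⊥} ×ˢ (Y ⊥ ⁻¹' S)) ∪
          ⋃ k : ℕ, Ioc ((k : ℝ≥0) / (n + 1)) ((k + 1) / (n + 1)) ×ˢ (Y (k / (n + 1)) ⁻¹' S) := by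
        ext ⟨t, w⟩
        simp only [mem_preimage, Set.mem_union, Set.mem_prod, Set.mem_singleton_iff, mem_iUnion, Set.mem_Ioc]
        constructor
        · intro h
          rcases eq_or_ne t 0 with rfl | ht
          · exact Or.inl ⟨rfl, by rwa [hd0] at h⟩
          · have ht := pos_iff_ne_zero.mpr ht
            exact Or.inr ⟨_, ⟨hlt n ht, by rw [add_div]; exact hle n ht⟩, h⟩
        · rintro (⟨rfl, h⟩ | ⟨k, ⟨h1, h2⟩, h⟩)
          · change Y (d n 0) w ∈ S
            rwa [hd0]
          · rw [div_lt_iff₀ (hN n)] at h1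
            rw [le_div_iff₀ (hN n)] at h2
            have : ⌈t * (n + 1)⌉₊ = k + 1 := (Nat.ceil_eq_iff k.succ_ne_zero).mpr ⟨by simpa using h1, mod_cast h2⟩
            simpa [d, this] using h
      rw [this]
      exact MeasurableSet.union (measurableSet_predictable_singleton_bot_prod ((hY ⊥).measurable hS))
        (MeasurableSet.iUnion fun k => measurableSet_predictable_Ioc_prod _ _ ((hY _).measurable hS))
    · refine (TopologicalSpace.IsSeparable.iUnion fun k : ℕ => (hY (k / (n + 1))).isSeparable_range).mono ?_
      rintro _ ⟨⟨t, w⟩, rfl⟩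
      exact mem_iUnion.mpr ⟨_, w, rfl⟩
  refine ⟨fun t w => limUnder atTop fun n => Y (d n t) w,
    StronglyMeasurable.limUnder (l := atTop) hmeas, ?_, fun t w l ht hl => ?_⟩
  · funext w
    simp only [hd0]
    exact tendsto_const_nhds.limUnder_eq
  · refine (hl.comp (tendsto_nhdsWithin_iff.mpr ⟨?_, .of_forall fun n => hlt n ht⟩)).limUnder_eq
    refine tendsto_of_tendsto_of_tendsto_of_le_of_le ?_ tendsto_const_nhds
      (fun n => tsub_le_iff_right.mpr (hle n ht)) fun n => (hlt n ht).le
    simpa using tendsto_const_nhds.sub (tendsto_one_div_add_atTop_nhds_zero_nat (𝕜 := ℝ≥0))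

/-! ### The equation -/

section

variable {c : Config}

lemma Config.IsNondeg.vorticity_zero (hc : c.IsNondeg) (hX : IsVortexFlow θ c.data X) :
    vorticity θ c.data X 0 = c.initial := by
  classical
  have hb : ∀ j, c.data.birth j ≤ 0 → j < c.1 := fun j hj => by
    by_contra h
    simp only [vortexData, h, if_false] at hj
    exact absurd hj (not_le.mpr (hc.points.time_pos _))
  rw [vorticity, finsum_cond_eq_sum_fin hb, Config.initial, initialVorticity, sum_range]
  refine sum_congr rfl fun i _ => ?_
  rw [hX.before_birth i 0 zero_le, intensity]
  simp [vortexData]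

/-- In the boundary term of the weak equation, the initial vortices give `e^{-θt}⟨f, ω₀⟩`. Those
born later give the Stieltjes integral, whose integrand at a jump time is precisely the damping
since birth. -/
lemma Config.IsNondeg.equation (hθ : 0 < θ) (hc : c.IsNondeg) (hX : IsVortexFlow θ c.data X) {f : Torus → ℝ}
    (hf : SmoothOnTorus f) (t : ℝ≥0) :
    IntervalIntegrable (fun s : ℝ => exp (-θ * ((t : ℝ) - s)) *
      offDiagonal (symKernel f) (vorticity θ c.data X s.toNNReal)) volume 0 t ∧
    BoundedVariationOn (fun s => pairing f (compoundPoisson c.2.2 (min s t))) univ ∧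
    pairing f (vorticity θ c.data X t) = exp (-θ * t) * pairing f (vorticity θ c.data X 0)
      + (∫ s in (0 : ℝ)..t, exp (-θ * ((t : ℝ) - s)) * offDiagonal (symKernel f) (vorticity θ c.data X s.toNNReal))
      + stieltjesIntegral (fun s => exp (-θ * ((t : ℝ) - s))) (fun s => pairing f (compoundPoisson c.2.2 s)) t := by
  classical
  have hN := fun j => (Config.data_birth_le_iff hc t j).mp
  obtain ⟨h1, h2⟩ := hX.weak_equation hθ hf hN
  obtain ⟨h3, h4⟩ := stieltjesIntegral_step (K := count c.2.2 t) (τ := fun m => (c.2.2 m).1)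
    (fun m => hc.points.time_pos m) (fun m => (c.2.2 m).2.1 * f (c.2.2 m).2.2) (t := t)
    (g := fun s => pairing f (compoundPoisson c.2.2 s)) (fun s hs => by
      simp only [hc.points.compoundPoisson_eq hs, pairing_sum_dirac, ite_mul, zero_mul])
    (fun s => exp (-θ * ((t : ℝ) - s)))
  refine ⟨h1, h3, ?_⟩
  rw [h2, h4, hc.vorticity_zero hX, Config.initial, initialVorticity, pairing_sum_dirac, add_right_comm]
  congr 1
  have e : ∀ i : Fin (c.num t), curInt θ (c.data.marks _) t i * f (c.data.pos i) =
      exp (-θ * (t - c.data.birth i)) * c.data.int i * f (c.data.pos i) := fun i => by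
    rw [curInt, if_pos (show ((c.data.marks _ i).1 : ℝ) ≤ t from
      coe_le_coe.mpr ((Config.data_birth_le_iff hc t i).mpr i.2))]; rfl
  rw [sum_congr rfl fun i _ => e i, Fin.sum_univ_eq_sum_range (fun i => exp (-θ * (t - c.data.birth i)) *
    c.data.int i * f (c.data.pos i)), Config.num, sum_range_add, mul_sum]
  congr 1
  · refine sum_congr rfl fun i hi => ?_
    simp [vortexData, mem_range.mp hi, mul_assoc]
  · rw [sum_range]
    refine sum_congr rfl fun i _ => ?_
    rw [if_pos ((hc.points.le_iff t i).mpr i.2)]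
    simp [vortexData, mul_assoc]

/-- If `t > 0` is not a birth time, the left limit includes the same vortices as the value. At a
deterministic time this holds almost surely, so the predictable process of left limits is a
modification. -/
lemma IsVortexFlow.tendsto_left (hθ : 0 < θ) (hc : c.IsNondeg) (hX : IsVortexFlow θ c.data X) (hs : s < -1)
    {t : ℝ≥0} (ht : 0 < t) (hne : ∀ m, (c.2.2 m).1 ≠ t) :
    Tendsto (fun r => toSobolev s (vorticity θ c.data X r)) (𝓝[<] t) (𝓝 (toSobolev s (vorticity θ c.data X t))) := by
  have h := (tendsto_functional_vorticity hθ (Config.exists_num hc) hX (continuous_diracSob hs)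
    (toSobolev_functional hs) t).2
  have hb : ∀ i, c.data.birth i < t ↔ c.data.birth i ≤ t := fun i => by
    refine ⟨le_of_lt, fun h => h.lt_of_ne ?_⟩
    simp only [vortexData]
    split_ifs
    exacts [ht.ne, hne _]
  have e : leftVorticity θ c.data X t = vorticity θ c.data X t := by simp only [leftVorticity, vorticity, hb]
  rwa [e] at h

end

/-! ### The solution of the driven equation -/

section

variable {Ω : Type*} {m : MeasurableSpace Ω} {P : Measure Ω} [IsProbabilityMeasure P] [P.IsComplete]
  {c : Ω → Config} {X : Ω → Paths}

lemma le_generatedFiltration {S : Type*} [MeasurableSpace S] (X₀ : Ω → S) (N : ℝ≥0 → Ω → S) (t : ℝ≥0) :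
    (MeasurableSpace.comap X₀ inferInstance ⊔ (⨆ r : ℝ≥0, ⨆ _ : r ≤ t, MeasurableSpace.comap (N r) inferInstance) ⊔
      generateFrom {A | P A = 0}) ⊓ m ≤ generatedFiltration P X₀ N t := by
  rw [generatedFiltration]
  refine le_trans ?_ (Filtration.le_rightCont _ t)
  exact le_rfl

lemma usualHypotheses_generatedFiltration {S : Type*} [MeasurableSpace S] (X₀ : Ω → S) (N : ℝ≥0 → Ω → S) :
    UsualHypotheses (generatedFiltration P X₀ N) P := by
  refine ⟨fun A hA => ?_, fun t => ?_⟩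
  · refine le_generatedFiltration X₀ N 0 A (MeasurableSpace.measurableSet_inf.mpr ⟨?_, Measure.IsComplete.out' A hA⟩)
    exact (le_sup_right : generateFrom {A | P A = 0} ≤ _) A (MeasurableSpace.measurableSet_generateFrom hA)
  · conv_rhs => rw [generatedFiltration, ← Filtration.rightCont_self, Filtration.rightCont_eq]
    rfl

namespace IsSample

lemma measurable_initial_sampleFiltration (hc : IsSample P θ lam M c) (t : ℝ≥0) :
    Measurable[sampleFiltration P c t] fun w => (c w).initial :=
  measurable_iff_comap_le.mpr ((le_inf (le_sup_of_le_left le_sup_left) hc.measurable_initial.comap_le).trans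
    (le_generatedFiltration _ _ t))

lemma measurable_noise_sampleFiltration (hc : IsSample P θ lam M c) {r t : ℝ≥0} (hr : r ≤ t) :
    Measurable[sampleFiltration P c t] fun w => compoundPoisson (c w).2.2 r :=
  measurable_iff_comap_le.mpr ((le_inf (le_sup_of_le_left (le_sup_of_le_right (le_iSup₂
    (f := fun r (_ : r ≤ t) => MeasurableSpace.comap (fun w => compoundPoisson (c w).2.2 r) inferInstance) r hr)))
    (hc.measurable_noise r).comap_le).trans (le_generatedFiltration _ _ t))

lemma isSolution (hc : IsSample P θ lam M c) (hθ : 0 < θ) (hX : ∀ᵐ w ∂P, IsVortexFlow θ (c w).data (X w))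
    (hmarg : ∀ t, P.map (fun w => vorticity θ (c w).data (X w) t) = xiLaw θ lam (M + t)) (T : ℝ≥0) {δ : ℝ}
    (hδ : 0 < δ) {𝓕 : Filtration ℝ≥0 m} (hu : UsualHypotheses 𝓕 P) (h0 : Measurable[𝓕 0] fun w => (c w).initial)
    (hm : Martingale (fun t w => toSobolev (-1 - δ) (compoundPoisson (c w).2.2 t)) 𝓕 P) :
    IsSolution P 𝓕 θ lam M T δ (fun t w => compoundPoisson (c w).2.2 t)
      fun t w => vorticity θ (c w).data (X w) t := by
  have hs : -1 - δ < -1 := by linarith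
  have hnull : ∀ t, ∀ A : Set Ω, P A = 0 → MeasurableSet[𝓕 t] A := fun t A hA => 𝓕.mono zero_le A (hu.1 A hA)
  have had : ∀ t, StronglyMeasurable[𝓕 t] fun w => toSobolev (-1 - δ) (vorticity θ (c w).data (X w) t) := fun t =>
    stronglyMeasurable_toSobolev (𝓐 := 𝓕 t) hs (fun w => isAtomic_finsum _ _ _) fun B hB =>
      hc.measurableSet_vorticity hθ hX (hnull t) (h0.mono (𝓕.mono zero_le) le_rfl)
        (fun r hr => (hc.measurable_noise_of_toSobolev hs (hnull r) (hm.1 r)).mono (𝓕.mono hr) le_rfl) hB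
  refine ⟨hu, hm, ?_, fun t _ => had t, ?_, ?_, ?_, fun t _ => hmarg t, fun f hf => ?_⟩
  · have h1 : compoundPoisson =ᵐ[P.map fun w => (c w).2.2] fun p t => noiseVersion t p := by
      rw [hc.births]
      filter_upwards [ae_isNondeg] with p hp
      funext t
      rw [noiseVersion_eq hp]
    rw [← hc.births, AEMeasurable.map_map_of_aemeasurable
      ⟨_, measurable_pi_lambda _ fun t => measurable_noiseVersion t, h1⟩ hc.measurable_births.aemeasurable]
    rfl
  · obtain ⟨Y, hY, hY0, hYl⟩ := exists_isStronglyPredictable had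
    refine ⟨Y, hY, fun t _ => ?_⟩
    rcases eq_or_ne t 0 with rfl | ht
    · exact ae_of_all _ fun w => congrFun hY0 w
    · filter_upwards [hc.isNondeg, hX, ae_all_iff.mpr fun m => hc.ae_births (ae_time_ne m t)] with w hw hx hne
      exact hYl t w _ (pos_iff_ne_zero.mpr ht) (hx.tendsto_left hθ hw hs (pos_iff_ne_zero.mpr ht) hne)
  · filter_upwards [hc.isNondeg, hX] with w hw hx
    exact hx.memLp hθ (Config.exists_num hw) T hs
  · filter_upwards [hc.isNondeg, hX] with w hw hx
    exact isCadlagOn_toSobolev_vorticity hθ (Config.exists_num hw) hx (by linarith) _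
  · filter_upwards [hc.isNondeg, hX] with w hw hx
    exact fun t _ => hw.equation hθ hx hf t

end IsSample

end

end PointVortex

end

open MeasureTheory ProbabilityTheory Filter Topology PointVortex in
/-- `p` (birth times, intensities, positions) is sampled under `π^λ`, and the random vector
`z 0, …, z (n - 1)` (intensities, positions) under `Ξ_M^{θ,λ}`, independently of `p`. -/
theorem corollary1 {Ω : Type*} [m : MeasurableSpace Ω] (P : Measure Ω) [IsProbabilityMeasure P]
    [P.IsComplete] (θ lam : ℝ) (hθ : 0 < θ) (hlam : 0 < lam) (M : NNReal)
    (n : Ω → ℕ) (hn : Measurable n)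
    (z : Ω → ℕ → ℝ × Torus) (hz : Measurable z)
    (hz_nondeg : ∀ᵐ w ∂P, (∀ i < n w, (z w i).1 ≠ 0) ∧
      ∀ i < n w, ∀ j < n w, i ≠ j → (z w i).2 ≠ (z w j).2)
    (hz_law : P.map (fun w => initialVorticity (n w) (z w)) = xiLaw θ lam M)
    (p : Ω → ℕ → NNReal × ℝ × Torus) (hp : Measurable p)
    (hp_law : P.map p = poissonLaw lam)
    (h_indep : IndepFun (fun w => initialVorticity (n w) (z w)) p P) :
    (∃ X : Ω → ℕ → NNReal → Torus,
      ∀ᵐ w ∂P, IsVortexFlow θ (vortexData (n w) (z w) (p w)) (X w)) ∧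
    ∀ X : Ω → ℕ → NNReal → Torus,
      (∀ᵐ w ∂P, IsVortexFlow θ (vortexData (n w) (z w) (p w)) (X w)) →
      let ω : NNReal → Ω → SMeas := fun t w => vorticity θ (vortexData (n w) (z w) (p w)) (X w) t
      let noise : NNReal → Ω → SMeas := fun t w => compoundPoisson (p w) t
      let ω₀ : Ω → SMeas := fun w => initialVorticity (n w) (z w)
      let 𝓖 : Filtration NNReal m := generatedFiltration P ω₀ noise
      (∀ᵐ w ∂P, ω 0 w = ω₀ w) ∧
      (∀ᵐ w ∂P, IsCadlagOn (fun t => ω t w) Set.univ) ∧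
      IsMarkov ω 𝓖 P ∧
      (∀ t : NNReal, P.map (ω t) = xiLaw θ lam (M + t)) ∧
      ∀ (T : NNReal) (δ : ℝ), 0 < T → 0 < δ →
        IsSolution P 𝓖 θ lam M T δ noise ω ∧
        ∀ 𝓕 : Filtration NNReal m, UsualHypotheses 𝓕 P → Measurable[𝓕 0] ω₀ →
          Martingale (fun t w => toSobolev (-1 - δ) (noise t w)) 𝓕 P →
          IsSolution P 𝓕 θ lam M T δ noise ω := by
  have : Fact (0 < lam) := ⟨hlam⟩
  have hc : IsSample P θ lam M fun w => (n w, z w, p w) :=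
    ⟨hn.prodMk (hz.prodMk hp), hz_nondeg, hz_law, hp_law, h_indep⟩
  refine ⟨?_, fun X hX => ?_⟩
  · classical
    obtain hex := hc.exists_flow hθ
    refine ⟨fun w => if h : ∃ X, IsVortexFlow θ (vortexData (n w) (z w) (p w)) X then h.choose else fun _ _ => 0, ?_⟩
    filter_upwards [hex] with w hw
    rw [dif_pos hw]
    exact hw.choose_spec
  intro ω noise ω₀ 𝓖
  have hu : UsualHypotheses 𝓖 P := usualHypotheses_generatedFiltration ω₀ noise
  have hnull : ∀ t, ∀ A : Set Ω, P A = 0 → MeasurableSet[𝓖 t] A := fun t A hA => 𝓖.mono zero_le A (hu.1 A hA)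
  have had : ∀ t, Measurable[𝓖 t] (ω t) := fun t B hB =>
    hc.measurableSet_vorticity hθ hX (hnull t) (hc.measurable_initial_sampleFiltration t)
      (fun r hr => hc.measurable_noise_sampleFiltration hr) (isAtomicSet_of_measurableSet hB)
  have hmarg : ∀ t, P.map (ω t) = xiLaw θ lam (M + t) := fun t =>
    hc.map_vorticity hθ hX t ((had t).mono (𝓖.le t) le_rfl)
  refine ⟨?_, ?_, hc.isMarkov hθ hX had, hmarg, fun T δ _ hδ => ⟨?_, fun 𝓕 h𝓕 h0 hm =>
    hc.isSolution hθ hX hmarg T hδ h𝓕 h0 hm⟩⟩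
  · filter_upwards [hc.isNondeg, hX] with w hw hx using hw.vorticity_zero hx
  · filter_upwards [hc.isNondeg, hX] with w hw hx using isCadlagOn_vorticity hθ (Config.exists_num hw) hx
  · refine hc.isSolution hθ hX hmarg T hδ hu (hc.measurable_initial_sampleFiltration 0) ?_
    exact hc.martingale (by linarith) fun t => hc.stronglyMeasurable_noise (by linarith) (hnull t)
      (hc.measurable_noise_sampleFiltration le_rfl)
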